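/- Let $\mu>1/2$, $\alpha\in(0,1)$, $\mathbb R_+=(0,\infty)$ and $\langle\theta\rangle=(1+\theta^2)^{1/2}$. For $k\ge 0$ and $f:\mathbb R_+\to\mathbb R$ put $$\|f\|_k=\sup_{\theta>0}\langle\theta\rangle^\alpha|f(\theta)|+\sup_{0<\theta_2<\theta_1<\theta_2+1}\langle\theta_1\rangle^{k+\alpha}\frac{|f(\theta_1)-f(\theta_2)|}{|\theta_1-\theta_2|^\alpha},$$ let $\mathcal G^k$ be the space of continuous $f:\mathbb R_+\to\mathbb R$ with $\|f\|_k<\infty$, and $\mathcal G^k_0=\{f\in\mathcal G^k:\lim_{\theta\to0+}f(\theta)=0\}$. Let $X$ be the space of pairs $(r,\gamma)$ of differentiable functions $\mathbb R_+\to\mathbb R$ with $\theta^\mu r\in\mathcal G^1$, $\theta^{\mu+1}r'\in\mathcal G^0$, $\theta^{2\mu-1}\gamma\in\mathcal G^1$, $\theta^{2\mu}\gamma'\in\mathcal G^1$, with norm $$\|(r,\gamma)\|_X=\|\theta^\mu r\|_1+\|\theta^{\mu+1}r'\|_0+\|\theta^{2\mu-1}\gamma\|_1+\|\theta^{2\mu}\gamma'\|_1,$$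 and let $B_X(\varepsilon)$ be its open ball of radius $\varepsilon$ centred at $0$. Let $Y$ be the space of functions $f+\mathrm i g:\mathbb R_+\to\mathbb C$ ($f,g$ real) with $\theta^{2\mu}f\in\mathcal G^0_0$ and $\theta^{2\mu-1}g\in\mathcal G^1$, with norm $\|f+\mathrm i g\|_Y=\|\theta^{2\mu}f\|_0+\|\theta^{2\mu-1}g\|_1$. Let $r_0(\theta)=\theta^{-\mu}$ and $\gamma_0(\theta)=-2\pi\theta^{1-2\mu}$. For a positive integer $m$, a pair $(r,\gamma)$ of functions on $\mathbb R_+$ and $\theta>0$ put $$\mathcal I_m[r,\gamma](\theta)=\frac1{2\pi\mathrm i}\left[\operatorname{p.v.}\int_0^\infty\frac{\gamma'(t)+\gamma_0'(t)}{1-\left(\frac{r(t)+r_0(t)}{r(\theta)+r_0(\theta)}\right)^m\mathrm e^{\mathrm i m(t-\theta)}}\,\mathrm dt-\int_\theta^\infty\bigl(\gamma'(t)+\gamma_0'(t)\bigr)\,\mathrm dt\right],$$ where $\operatorname{p.v.}\int_0^\infty$ is the limit as $\varepsilon\to0+$ of the integrals over $\{t>0:|t-\theta|>\varepsilon\}$.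 Then there exist $\varepsilon_1\in(0,1)$, a positive integer $m_1$ and a constant $C_*>1$ (depending only on $\mu$ and $\alpha$) such that for all integers $m>m_1$: for every $(r,\gamma)\in B_X(\varepsilon_1)$ the integrals defining $\mathcal I_m[r,\gamma](\theta)$ exist for all $\theta>0$ and $\mathcal I_m[r,\gamma]\in Y$; moreover $$\|\mathcal I_m[0,0]\|_Y\le\frac{C_*}{m^2},$$ and $$\|\mathcal I_m[r_1,\gamma_1]-\mathcal I_m[r_2,\gamma_2]\|_Y\le\frac{C_*}{m}\,\|(r_1,\gamma_1)-(r_2,\gamma_2)\|_X\qquad\text{for all }(r_1,\gamma_1),(r_2,\gamma_2)\in B_X(\varepsilon_1).$$ -/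

import Mathlib

open Set Filter Topology MeasureTheory
open scoped ENNReal

noncomputable section

namespace KadenSpiral

/-! Functions on `(0, ∞)` are represented by functions `ℝ → ℝ`; every notion below only looks at
their values on `Ioi 0`. Norms take values in `ℝ≥0∞`, so that a norm is `∞` exactly when the
defining supremum is infinite. -/

/-- The bracket `⟨θ⟩ = (1 + θ²)^{1/2}`. -/
def bracket (θ : ℝ) : ℝ := Real.sqrt (1 + θ ^ 2)

/-- Supremum of `|f|` over `(0, ∞)`; it is the `L^∞` norm for continuous `f`. -/
def supNorm (f : ℝ → ℝ) : ℝ≥0∞ := ⨆ θ ∈ Ioi (0 : ℝ), ENNReal.ofReal |f θ|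

/-- The weighted Hölder seminorm `[f]_k`, the supremum being over `0 < θ₂ < θ₁ < θ₂ + 1`. -/
def holderSeminorm (α k : ℝ) (f : ℝ → ℝ) : ℝ≥0∞ :=
  ⨆ p ∈ {p : ℝ × ℝ | 0 < p.2 ∧ p.2 < p.1 ∧ p.1 < p.2 + 1},
    ENNReal.ofReal (bracket p.1 ^ (k + α) * (|f p.1 - f p.2| / |p.1 - p.2| ^ α))

/-- The norm `‖f‖_k = ‖⟨θ⟩^α f‖_{L^∞} + [f]_k`. -/
def normG (α k : ℝ) (f : ℝ → ℝ) : ℝ≥0∞ :=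
  supNorm (fun θ => bracket θ ^ α * f θ) + holderSeminorm α k f

/-- The real weighted Hölder space `𝒢^k`. -/
def MemG (α k : ℝ) (f : ℝ → ℝ) : Prop :=
  ContinuousOn f (Ioi 0) ∧ normG α k f < ∞

/-- The subspace `𝒢^k_0` of functions with `f(0+) = 0`. -/
def MemG0 (α k : ℝ) (f : ℝ → ℝ) : Prop :=
  MemG α k f ∧ Tendsto f (𝓝[>] 0) (𝓝 0)

/-- Membership of a pair `(r, γ)` in the space `X`. -/
structure MemX (μ α : ℝ) (r γ : ℝ → ℝ) : Prop where
  diff_r : DifferentiableOn ℝ r (Ioi 0)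
  diff_γ : DifferentiableOn ℝ γ (Ioi 0)
  mem_r : MemG α 1 (fun θ => θ ^ μ * r θ)
  mem_deriv_r : MemG α 0 (fun θ => θ ^ (μ + 1) * deriv r θ)
  mem_γ : MemG α 1 (fun θ => θ ^ (2 * μ - 1) * γ θ)
  mem_deriv_γ : MemG α 1 (fun θ => θ ^ (2 * μ) * deriv γ θ)

/-- The norm of `X`. -/
def normX (μ α : ℝ) (r γ : ℝ → ℝ) : ℝ≥0∞ :=
  (normG α 1 (fun θ => θ ^ μ * r θ) + normG α 0 (fun θ => θ ^ (μ + 1) * deriv r θ)) +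
  (normG α 1 (fun θ => θ ^ (2 * μ - 1) * γ θ) + normG α 1 (fun θ => θ ^ (2 * μ) * deriv γ θ))

/-- Membership in the open ball `B_X(ε)` about the origin. -/
def MemBallX (μ α ε : ℝ) (r γ : ℝ → ℝ) : Prop :=
  MemX μ α r γ ∧ normX μ α r γ < ENNReal.ofReal ε

/-- Membership of a complex function `F = f + i g`, identified with `(f, g)`, in the space `Y`. -/
def MemY (μ α : ℝ) (F : ℝ → ℂ) : Prop :=
  MemG0 α 0 (fun θ => θ ^ (2 * μ) * (F θ).re) ∧ MemG α 1 (fun θ => θ ^ (2 * μ - 1) * (F θ).im)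

/-- The norm of `Y`. -/
def normY (μ α : ℝ) (F : ℝ → ℂ) : ℝ≥0∞ :=
  normG α 0 (fun θ => θ ^ (2 * μ) * (F θ).re) + normG α 1 (fun θ => θ ^ (2 * μ - 1) * (F θ).im)

/-- Kaden's spiral: the radius `r₀(θ) = θ^{-μ}`. -/
def r₀ (μ θ : ℝ) : ℝ := θ ^ (-μ)

/-- Kaden's spiral: the circulation `γ₀(θ) = -2π θ^{1-2μ}`. -/
def γ₀ (μ θ : ℝ) : ℝ := -2 * Real.pi * θ ^ (1 - 2 * μ)

/-- The integral of `f` over `{t > 0 : |t - θ| > ε}`. -/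
def truncIntegral (f : ℝ → ℂ) (θ ε : ℝ) : ℂ := ∫ t in {t : ℝ | 0 < t ∧ ε < |t - θ|}, f t

/-- The principal value integral `p.v. ∫₀^∞ f` with singularity at `θ` exists. -/
def HasPV (f : ℝ → ℂ) (θ : ℝ) : Prop :=
  (∀ ε > 0, IntegrableOn f {t : ℝ | 0 < t ∧ ε < |t - θ|}) ∧
    ∃ L : ℂ, Tendsto (truncIntegral f θ) (𝓝[>] 0) (𝓝 L)

/-- The principal value integral `p.v. ∫₀^∞ f` with singularity at `θ` (meaningful under
`HasPV f θ`). -/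
def pvIntegral (f : ℝ → ℂ) (θ : ℝ) : ℂ := limUnder (𝓝[>] 0) (truncIntegral f θ)

/-- The integrand `t ↦ (γ'(t) + γ₀'(t)) / (1 - ((r(t)+r₀(t))/(r(θ)+r₀(θ)))^m e^{im(t-θ)})`. -/
def cauchyIntegrand (μ : ℝ) (m : ℕ) (r γ : ℝ → ℝ) (θ t : ℝ) : ℂ :=
  ((deriv γ t + deriv (γ₀ μ) t : ℝ) : ℂ) /
    (1 - (((r t + r₀ μ t) / (r θ + r₀ μ θ) : ℝ) : ℂ) ^ m *
      Complex.exp (Complex.I * (m : ℂ) * ((t - θ : ℝ) : ℂ)))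

/-- Both integrals in the definition of `ℐ_m[r, γ](θ)` make sense. -/
def IDefinedAt (μ : ℝ) (m : ℕ) (r γ : ℝ → ℝ) (θ : ℝ) : Prop :=
  HasPV (cauchyIntegrand μ m r γ θ) θ ∧
    IntegrableOn (fun t => deriv γ t + deriv (γ₀ μ) t) (Ioi θ)

/-- The operator `ℐ_m[r, γ]`. -/
def I (μ : ℝ) (m : ℕ) (r γ : ℝ → ℝ) (θ : ℝ) : ℂ :=
  1 / (2 * (Real.pi : ℂ) * Complex.I) *
    (pvIntegral (cauchyIntegrand μ m r γ θ) θ -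
      ((∫ t in Ioi θ, (deriv γ t + deriv (γ₀ μ) t) : ℝ) : ℂ))

end KadenSpiral

end

/-! Substitute `t = θ e^u` and put `ρ = t^μ r`, `τ = t ρ'`, `h = t^{2μ} γ'`, `c = 2π(2μ-1)`. The
quotient of radii times `e^{i(t-θ)}` is `e^P` with `P = iθ(e^u-1) - μu + log(1+ρ(θe^u)) -
log(1+ρ(θ))`, and `∂_u P = it - p(t)` with `p = μ - τ/(1+ρ)` close to `μ`. The real part of `∂_u P`
is at most `-μ/2`, which localises everything at `|u| ~ 1/m`; its imaginary part grows like `t`,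
which makes the kernel oscillate fast for large `θ`. Since `1/(1-e^{mP})` is a kernel `ker` decaying
on both sides plus the indicator of `u > 0`, the indicator cancels `∫_θ^∞`. Moreover `∂_u P · ker`
is the derivative of `-(1/m) log(1-q)`, `q = e^{± mP}`, and has principal value zero. Hence, with `f
= (h+c)/(it-p)`, the operator is `θ^{1-2μ}/(2πi)` times the absolutely convergent integral `opJ f =
∫ (e^{(1-2μ)u} f(θe^u) - f(θ)) ∂_u P ker du`. The `Y`-norm is controlled by a sup and a Hölder bound
of this integral, both with weight `(1+θ)^{-(1+α)}` (`EB`).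

The main estimate, `Cls.opJ_bound`, is `O(1/m)` for `f` decaying like `t^{-(1+α)}` with Hölder
weight `t^{-(2+α)}`. Split `f` into its average over unit intervals and the rest. The average is
differentiable, and one integration by parts (`opJ_eq_opN`) replaces the singular kernel by the
logarithmic one. The rest decays like `t^{-(2+α)}`, which pays for the growth of `∂_u P`. For it, on
`|u| ≲ 1/(m(1+θ))` the kernel is `-1/(mu)` plus an integrable error, so a Hilbert transform bound
applies (`hilbert_hoelder`). Farther out, absolute values alone would lose `log θ`; the loss
disappears because `|1-q|` also dominates `|sin(m Im P)|` and `|sin|^{-1/2}` averages to a constant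
along the fast phase (`Sym.lintegral_farG_le`).

The density is `f = dens + c/(it-μ)`, where `dens` is small and in the good class but `1/(it-μ)`
decays only like `1/t`. All quantities are holomorphic along complex lines of perturbations. The
`dens` part is Lipschitz by the Schwarz lemma. The other part becomes a logarithmic integral, whose
derivative along the line is again a combination of operators `opJ` on good densities
(`Line.integral_eq`), so the mean value inequality applies. At the unperturbed spiral a second
integration by parts, with the dilogarithm as antiderivative of the logarithm, yields `1/m²`
(`exists_opJ_resMu_bound`). -/

noncomputable section
-- Weighted Hölder classes on the half-line.
namespace KadenSpiral

/-- Weighted Hölder class on `(0, ∞)` with sup weight `(1+t)^s` and Hölder weight `(1+t)^e`. -/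
structure Cls (α s e A : ℝ) (f : ℝ → ℂ) : Prop where
  cont : ContinuousOn f (Ioi 0)
  bd : ∀ t, 0 < t → ‖f t‖ ≤ A * (1 + t) ^ (-s)
  hol : ∀ t' t, 0 < t' → t' < t →
    ‖f t - f t'‖ ≤ A * (1 + t') ^ (-e) * ((t - t') ^ α + (t - t'))

theorem weight_anti {s t t' : ℝ} (hs : 0 ≤ s) (ht' : 0 < t') (h : t' ≤ t) :
    (1 + t) ^ (-s) ≤ (1 + t') ^ (-s) :=
  Real.rpow_le_rpow_of_nonpos (by linarith) (by linarith) (by linarith)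

theorem weight_mono {s s' t : ℝ} (hs : s' ≤ s) (ht : 0 < t) :
    (1 + t) ^ (-s) ≤ (1 + t) ^ (-s') :=
  Real.rpow_le_rpow_of_exponent_le (by linarith) (by linarith)

theorem weight_pos {s t : ℝ} (ht : 0 < t) : 0 < (1 + t) ^ s :=
  Real.rpow_pos_of_pos (by linarith) _

theorem weight_mul {s e t : ℝ} (ht : 0 < t) :
    (1 + t) ^ (-s) * (1 + t) ^ (-e) = (1 + t) ^ (-(s + e)) := by
  rw [← Real.rpow_add (by linarith)]; ring_nf

theorem modulus_nonneg {α t t' : ℝ} (h : t' < t) : 0 ≤ (t - t') ^ α + (t - t') :=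
  add_nonneg (Real.rpow_nonneg (by linarith) _) (by linarith)

namespace Cls

variable {α s e A s' e' A' : ℝ} {f g : ℝ → ℂ}

theorem nonneg (h : Cls α s e A f) : 0 ≤ A := by
  by_contra hA
  have h1 := h.bd 1 one_pos
  have := mul_neg_of_neg_of_pos (not_le.1 hA) (weight_pos (s := -s) one_pos)
  linarith [norm_nonneg (f 1)]

theorem mono (h : Cls α s e A f) (hs : s' ≤ s) (he : e' ≤ e) (hA : A ≤ A') :
    Cls α s' e' A' f where
  cont := h.cont
  bd t ht := (h.bd t ht).trans
    (mul_le_mul hA (weight_mono hs ht) (weight_pos ht).le (h.nonneg.trans hA))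
  hol t' t ht' hlt := (h.hol t' t ht' hlt).trans
    (mul_le_mul_of_nonneg_right
      (mul_le_mul hA (weight_mono he ht') (weight_pos ht').le (h.nonneg.trans hA))
      (modulus_nonneg hlt))

theorem congr (h : Cls α s e A f) (hfg : ∀ t, 0 < t → g t = f t) : Cls α s e A g where
  cont := h.cont.congr hfg
  bd t ht := by rw [hfg t ht]; exact h.bd t ht
  hol t' t ht' hlt := by
    rw [hfg t (ht'.trans hlt), hfg t' ht']; exact h.hol t' t ht' hlt

theorem add (h : Cls α s e A f) (h' : Cls α s e A' g) :
    Cls α s e (A + A') (fun t => f t + g t) where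
  cont := h.cont.add h'.cont
  bd t ht := by
    have := norm_add_le (f t) (g t)
    have := h.bd t ht
    have := h'.bd t ht
    rw [add_mul]; linarith
  hol t' t ht' hlt := by
    have h1 := norm_add_le (f t - f t') (g t - g t')
    have h2 := h.hol t' t ht' hlt
    have h3 := h'.hol t' t ht' hlt
    have h4 : f t + g t - (f t' + g t') = f t - f t' + (g t - g t') := by ring
    rw [h4, add_mul, add_mul]; linarith

theorem const_mul (h : Cls α s e A f) (a : ℂ) : Cls α s e (‖a‖ * A) (fun t => a * f t) where
  cont := continuousOn_const.mul h.cont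
  bd t ht := by
    rw [norm_mul, mul_assoc]; exact mul_le_mul_of_nonneg_left (h.bd t ht) (norm_nonneg _)
  hol t' t ht' hlt := by
    rw [← mul_sub, norm_mul, mul_assoc, mul_assoc, ← mul_assoc A]
    exact mul_le_mul_of_nonneg_left (h.hol t' t ht' hlt) (norm_nonneg _)

theorem neg (h : Cls α s e A f) : Cls α s e A (fun t => -f t) where
  cont := h.cont.neg
  bd t ht := by rw [norm_neg]; exact h.bd t ht
  hol t' t ht' hlt := by
    rw [neg_sub_neg, norm_sub_rev]; exact h.hol t' t ht' hlt

theorem sub (h : Cls α s e A f) (h' : Cls α s e A' g) :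
    Cls α s e (A + A') (fun t => f t - g t) := by
  simpa [sub_eq_add_neg] using h.add h'.neg

theorem const (a : ℂ) : Cls α 0 e ‖a‖ (fun _ => a) where
  cont := continuousOn_const
  bd t ht := by simp
  hol t' t ht' hlt := by
    simpa using mul_nonneg (mul_nonneg (norm_nonneg a) (weight_pos ht').le) (modulus_nonneg hlt)

/-- Product rule: each Hölder weight is improved by the decay of the other factor. Decay is needed
at the larger point `t` while weights sit at the smaller point `t'`, hence `0 ≤ s'`. -/
theorem mul (h : Cls α s e A f) (h' : Cls α s' e' A' g) (hs' : 0 ≤ s') {e₁ : ℝ}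
    (h1 : e₁ ≤ e + s') (h2 : e₁ ≤ e' + s) :
    Cls α (s + s') e₁ (2 * (A * A')) (fun t => f t * g t) where
  cont := h.cont.mul h'.cont
  bd t ht := by
    rw [norm_mul]
    have := mul_le_mul (h.bd t ht) (h'.bd t ht) (norm_nonneg _)
      (mul_nonneg h.nonneg (weight_pos ht).le)
    have h3 : A * (1 + t) ^ (-s) * (A' * (1 + t) ^ (-s')) = A * A' * (1 + t) ^ (-(s + s')) := by
      rw [← weight_mul ht]; ring
    rw [h3] at this
    have := mul_nonneg (mul_nonneg h.nonneg h'.nonneg) (weight_pos (s := -(s + s')) ht).le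
    linarith
  hol t' t ht' hlt := by
    have ht := ht'.trans hlt
    have e1 : f t * g t - f t' * g t' = (f t - f t') * g t + f t' * (g t - g t') := by ring
    have hM := modulus_nonneg (α := α) hlt
    set M := (t - t') ^ α + (t - t')
    have hw : A' * (1 + t) ^ (-s') ≤ A' * (1 + t') ^ (-s') :=
      mul_le_mul_of_nonneg_left (weight_anti hs' ht' hlt.le) h'.nonneg
    have b1 : ‖(f t - f t') * g t‖ ≤ A * A' * (1 + t') ^ (-e₁) * M := by
      rw [norm_mul]
      have := mul_le_mul (h.hol t' t ht' hlt) ((h'.bd t ht).trans hw) (norm_nonneg _)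
        (mul_nonneg (mul_nonneg h.nonneg (weight_pos ht').le) hM)
      refine this.trans ?_
      have e2 : A * (1 + t') ^ (-e) * M * (A' * (1 + t') ^ (-s'))
          = A * A' * (1 + t') ^ (-(e + s')) * M := by rw [← weight_mul ht']; ring
      rw [e2]
      exact mul_le_mul_of_nonneg_right (mul_le_mul_of_nonneg_left (weight_mono h1 ht')
        (mul_nonneg h.nonneg h'.nonneg)) hM
    have b2 : ‖f t' * (g t - g t')‖ ≤ A * A' * (1 + t') ^ (-e₁) * M := by
      rw [norm_mul]
      have := mul_le_mul (h.bd t' ht') (h'.hol t' t ht' hlt) (norm_nonneg _)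
        (mul_nonneg h.nonneg (weight_pos ht').le)
      refine this.trans ?_
      have e2 : A * (1 + t') ^ (-s) * (A' * (1 + t') ^ (-e') * M)
          = A * A' * (1 + t') ^ (-(e' + s)) * M := by
        rw [add_comm e' s, ← weight_mul ht']; ring
      rw [e2]
      exact mul_le_mul_of_nonneg_right (mul_le_mul_of_nonneg_left (weight_mono h2 ht')
        (mul_nonneg h.nonneg h'.nonneg)) hM
    rw [e1]
    linarith [norm_add_le ((f t - f t') * g t) (f t' * (g t - g t'))]

end Cls

/-- Dilation by `e^u` changes a weight by at most `e^{s|u|}`, because `1 + θ ≤ e^{|u|}(1 + θe^u)`.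
Such exponential losses are later absorbed by the decay of the kernel. -/
theorem weight_exp {s θ : ℝ} (hs : 0 ≤ s) (hθ : 0 < θ) (u : ℝ) :
    (1 + θ * Real.exp u) ^ (-s) ≤ Real.exp (s * |u|) * (1 + θ) ^ (-s) := by
  have h0 : 1 + θ ≤ Real.exp |u| * (1 + θ * Real.exp u) := by
    have h1 : 1 ≤ Real.exp |u| := Real.one_le_exp (abs_nonneg u)
    have h2 : 1 ≤ Real.exp |u| * Real.exp u := by
      rw [← Real.exp_add]; exact Real.one_le_exp (by linarith [neg_abs_le u])
    nlinarith
  have h1 : 0 < 1 + θ * Real.exp u := by positivity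
  have h2 : Real.exp (s * |u|) * (1 + θ) ^ (-s) = (Real.exp (-|u|) * (1 + θ)) ^ (-s) := by
    rw [Real.mul_rpow (Real.exp_pos _).le (by linarith), ← Real.exp_mul]; ring_nf
  rw [h2]
  refine Real.rpow_le_rpow_of_nonpos (by positivity) ?_ (by linarith)
  rw [Real.exp_neg, inv_mul_le_iff₀ (Real.exp_pos _)]; exact h0

theorem rpow_mul_exp_le {α x u : ℝ} (hα1 : α ≤ 1) (hx : 0 ≤ x) :
    (x * Real.exp |u|) ^ α ≤ x ^ α * Real.exp |u| := by
  rw [Real.mul_rpow hx (Real.exp_pos _).le, ← Real.exp_mul]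
  refine mul_le_mul_of_nonneg_left (Real.exp_le_exp.2 ?_) (Real.rpow_nonneg hx _)
  nlinarith [abs_nonneg u]

theorem self_le_rpow {α x : ℝ} (hα1 : α ≤ 1) (hx : 0 ≤ x) (hx1 : x ≤ 1) (hα0 : 0 < α) :
    x ≤ x ^ α := by
  rcases hx.eq_or_lt with rfl | h
  · rw [Real.zero_rpow hα0.ne']
  · simpa using Real.rpow_le_rpow_of_exponent_ge h hx1 hα1

theorem abs_exp_sub_one_le (u : ℝ) : |Real.exp u - 1| ≤ |u| * Real.exp |u| := by
  rcases le_total 0 u with h | h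
  · rw [abs_of_nonneg h, abs_of_nonneg (by linarith [Real.one_le_exp h])]
    have h1 := Real.add_one_le_exp (-u)
    have h2 : Real.exp u * Real.exp (-u) = 1 := by rw [← Real.exp_add]; simp
    nlinarith [Real.exp_pos u]
  · rw [abs_of_nonpos h, abs_of_nonpos (by linarith [Real.exp_le_one_iff.2 h])]
    have h1 := Real.add_one_le_exp u
    have h2 := Real.one_le_exp (neg_nonneg.2 h)
    nlinarith

namespace Cls

variable {α s e A : ℝ} {f : ℝ → ℂ}

theorem bd_exp (h : Cls α s e A f) (hs : 0 ≤ s) {θ : ℝ} (hθ : 0 < θ) (u : ℝ) :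
    ‖f (θ * Real.exp u)‖ ≤ A * (1 + θ) ^ (-s) * Real.exp (s * |u|) := by
  refine (h.bd _ (by positivity)).trans ?_
  rw [mul_assoc, mul_comm ((1 + θ) ^ (-s))]
  exact mul_le_mul_of_nonneg_left (weight_exp hs hθ u) h.nonneg

/-- Dilation stretches increments, so `θ₁e^u - θ₂e^u` need not be below one even if `θ₁ - θ₂` is.
This is why the class is defined with the modulus `δ^α + δ` for all pairs instead of `δ^α` at unit
scale. -/
theorem shift (h : Cls α s e A f) (he : 0 ≤ e) (hα0 : 0 < α) (hα1 : α ≤ 1) {θ₁ θ₂ : ℝ}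
    (h2 : 0 < θ₂) (h12 : θ₂ < θ₁) (h1 : θ₁ ≤ θ₂ + 1) (u : ℝ) :
    ‖f (θ₁ * Real.exp u) - f (θ₂ * Real.exp u)‖ ≤
      2 * A * (1 + θ₂) ^ (-e) * (θ₁ - θ₂) ^ α * Real.exp ((e + 1) * |u|) := by
  have hE := Real.exp_pos u
  refine (h.hol (θ₂ * Real.exp u) (θ₁ * Real.exp u) (by positivity)
    (mul_lt_mul_of_pos_right h12 hE)).trans ?_
  rw [← sub_mul]
  have hd : 0 ≤ θ₁ - θ₂ := by linarith
  have b1 : ((θ₁ - θ₂) * Real.exp u) ^ α ≤ (θ₁ - θ₂) ^ α * Real.exp |u| :=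
    (Real.rpow_le_rpow (by positivity) (mul_le_mul_of_nonneg_left
      (Real.exp_le_exp.2 (le_abs_self u)) hd) hα0.le).trans (rpow_mul_exp_le hα1 hd)
  have b2 : (θ₁ - θ₂) * Real.exp u ≤ (θ₁ - θ₂) ^ α * Real.exp |u| :=
    mul_le_mul (self_le_rpow hα1 hd (by linarith) hα0) (Real.exp_le_exp.2 (le_abs_self u))
      hE.le (Real.rpow_nonneg hd _)
  have b3 := mul_le_mul_of_nonneg_left (weight_exp he h2 u) h.nonneg
  refine (mul_le_mul b3 (add_le_add b1 b2) (by positivity) ?_).trans (le_of_eq ?_)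
  · exact mul_nonneg h.nonneg (mul_nonneg (Real.exp_pos _).le (weight_pos h2).le)
  · rw [add_mul, one_mul, Real.exp_add]; ring

/-- The increment in the logarithmic variable has length `θ|e^u - 1| ≤ θ|u|e^{|u|}`. The two signs
of `u` differ in which of the points carries the weight. -/
theorem scale (h : Cls α s e A f) (he : 0 ≤ e) (hα0 : 0 < α) (hα1 : α ≤ 1) {θ : ℝ}
    (hθ : 0 < θ) (u : ℝ) :
    ‖f (θ * Real.exp u) - f θ‖ ≤
      A * (1 + θ) ^ (-e) * ((θ * |u|) ^ α + θ * |u|) * Real.exp ((e + 1) * |u|) := by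
  have key : ∀ x : ℝ, 0 ≤ x → x ≤ θ * |u| * Real.exp |u| →
      x ^ α + x ≤ ((θ * |u|) ^ α + θ * |u|) * Real.exp |u| := by
    intro x hx hxl
    rw [add_mul]
    exact add_le_add ((Real.rpow_le_rpow hx hxl hα0.le).trans
      (rpow_mul_exp_le hα1 (by positivity))) hxl
  have hE := abs_exp_sub_one_le u
  have hx : θ * |Real.exp u - 1| ≤ θ * |u| * Real.exp |u| := by
    rw [mul_assoc]; exact mul_le_mul_of_nonneg_left hE hθ.le
  have hk := key _ (by positivity) hx
  have e1 : A * (1 + θ) ^ (-e) * ((θ * |u|) ^ α + θ * |u|) * Real.exp ((e + 1) * |u|)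
      = A * (Real.exp (e * |u|) * (1 + θ) ^ (-e)) *
        (((θ * |u|) ^ α + θ * |u|) * Real.exp |u|) := by
    rw [add_mul e, one_mul, Real.exp_add]; ring
  have hA := h.nonneg
  have hw : 0 ≤ (1 + θ) ^ (-e) := (weight_pos hθ).le
  rw [e1]
  rcases lt_trichotomy u 0 with hu | rfl | hu
  · have hlt : θ * Real.exp u < θ := by nlinarith [Real.exp_lt_exp.2 hu, Real.exp_zero]
    rw [norm_sub_rev]
    refine (h.hol _ _ (by positivity) hlt).trans ?_
    have e2 : θ - θ * Real.exp u = θ * |Real.exp u - 1| := by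
      rw [abs_of_nonpos (by linarith [Real.exp_lt_exp.2 hu, Real.exp_zero])]; ring
    rw [e2]
    exact mul_le_mul (mul_le_mul_of_nonneg_left (weight_exp he hθ u) hA) hk (by positivity)
      (by positivity)
  · simp only [Real.exp_zero, mul_one, sub_self, norm_zero]; positivity
  · have hlt : θ < θ * Real.exp u := by nlinarith [Real.one_lt_exp_iff.2 hu]
    refine (h.hol _ _ hθ hlt).trans ?_
    have e2 : θ * Real.exp u - θ = θ * |Real.exp u - 1| := by
      rw [abs_of_nonneg (by linarith [Real.one_lt_exp_iff.2 hu])]; ring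
    rw [e2]
    refine mul_le_mul (mul_le_mul_of_nonneg_left ?_ hA) hk (by positivity) (by positivity)
    exact le_mul_of_one_le_left hw (Real.one_le_exp (by positivity))

theorem cont_exp (h : Cls α s e A f) {θ : ℝ} (hθ : 0 < θ) :
    Continuous (fun u => f (θ * Real.exp u)) :=
  h.cont.comp_continuous (by fun_prop) (fun u => by simp only [mem_Ioi]; positivity)

end Cls

/-! ### Symbols close to the constant `μ`. -/

/-- The admissible distance of the symbol `p` from `μ`. -/
def symTol (μ : ℝ) : ℝ := min (μ / 2) (1 / 8)

theorem symTol_le (μ : ℝ) : symTol μ ≤ μ / 2 ∧ symTol μ ≤ 1 / 8 :=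
  ⟨min_le_left _ _, min_le_right _ _⟩

theorem symTol_pos {μ : ℝ} (hμ : 0 < μ) : 0 < symTol μ := lt_min (by linarith) (by norm_num)

/-- Admissible symbols. -/
def Sym (μ α : ℝ) (p : ℝ → ℂ) : Prop := Cls α 0 0 (symTol μ) (fun t => p t - μ)

variable {μ α : ℝ} {p : ℝ → ℂ}

theorem sym_const (hμ : 0 < μ) : Sym μ α (fun _ => (μ : ℂ)) := by
  have h : Cls α 0 0 0 (fun _ : ℝ => (μ : ℂ) - μ) := by simpa using Cls.const (α := α) (e := 0) (0 : ℂ)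
  exact h.mono le_rfl le_rfl (symTol_pos hμ).le

namespace Sym

theorem norm_sub_le (hp : Sym μ α p) {t : ℝ} (ht : 0 < t) : ‖p t - μ‖ ≤ symTol μ := by
  simpa using hp.bd t ht

theorem re_ge (hp : Sym μ α p) {t : ℝ} (ht : 0 < t) : μ / 2 ≤ (p t).re := by
  have h1 := (Complex.abs_re_le_norm _).trans (hp.norm_sub_le ht)
  simp only [Complex.sub_re, Complex.ofReal_re] at h1
  linarith [(abs_le.1 h1).1, (symTol_le μ).1]

theorem abs_im_le (hp : Sym μ α p) {t : ℝ} (ht : 0 < t) : |(p t).im| ≤ 1 / 8 := by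
  have h1 := (Complex.abs_im_le_norm _).trans (hp.norm_sub_le ht)
  simp only [Complex.sub_im, Complex.ofReal_im, sub_zero] at h1
  linarith [(symTol_le μ).2]

theorem norm_le (hp : Sym μ α p) {t : ℝ} (hμ : 0 < μ) (ht : 0 < t) : ‖p t‖ ≤ 2 * μ := by
  have h1 := norm_add_le (p t - μ) μ
  simp only [sub_add_cancel, Complex.norm_real, Real.norm_eq_abs, abs_of_pos hμ] at h1
  linarith [hp.norm_sub_le ht, (symTol_le μ).1]

theorem cont (hp : Sym μ α p) : ContinuousOn p (Ioi 0) := by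
  have := Cls.cont hp
  exact (this.add (continuousOn_const (c := (μ : ℂ)))).congr fun t _ => by simp

theorem hol (hp : Sym μ α p) {t' t : ℝ} (ht' : 0 < t') (hlt : t' < t) :
    ‖p t - p t'‖ ≤ 1 / 8 * ((t - t') ^ α + (t - t')) := by
  have h := Cls.hol hp t' t ht' hlt
  simp only [sub_sub_sub_cancel_right, neg_zero, Real.rpow_zero, mul_one] at h
  exact h.trans (mul_le_mul_of_nonneg_right (symTol_le μ).2 (modulus_nonneg hlt))

end Sym

/-- Lower bound constant for `|it - p|/(1+t)`. -/
def ellC (μ : ℝ) : ℝ := min (μ / 4) (7 / 16)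

theorem ellC_pos (hμ : 0 < μ) : 0 < ellC μ := lt_min (by linarith) (by norm_num)

/-- For `t ≤ 1` the real part, of modulus at least `μ/2`, suffices; for `t ≥ 1` the imaginary part
is at least `t - 1/8`, and `7/8 = (7/16)·2` at `t = 1` fixes the second constant in `ellC`. -/
theorem Sym.norm_ge (hp : Sym μ α p) (hμ : 0 < μ) {t : ℝ} (ht : 0 < t) :
    ellC μ * (1 + t) ≤ ‖Complex.I * t - p t‖ := by
  have h1 := Complex.abs_re_le_norm (Complex.I * t - p t)
  have h2 := Complex.abs_im_le_norm (Complex.I * t - p t)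
  simp at h1 h2
  have h3 := hp.re_ge ht
  have h4 := hp.abs_im_le ht
  have h5 := le_abs_self (p t).re
  have h6 := le_abs_self (t - (p t).im)
  have h7 := le_abs_self (p t).im
  have e1 : ellC μ ≤ μ / 4 := min_le_left _ _
  have e2 : ellC μ ≤ 7 / 16 := min_le_right _ _
  rcases le_total t 1 with h | h <;> nlinarith

/-- Inversion gains one power in the decay but two in the Hölder weight, since the difference of
inverses carries both denominators. This gap of one power is the reason for the class with exponents
`1+α` and `2+α` below. -/
theorem Sym.inv_cls (hp : Sym μ α p) (hμ : 0 < μ) :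
    Cls α 1 2 (2 / ellC μ ^ 2 + 1 / ellC μ) (fun t => (Complex.I * t - p t)⁻¹) := by
  have hc := ellC_pos hμ
  have hne : ∀ t : ℝ, 0 < t → 0 < ‖Complex.I * t - p t‖ := fun t ht =>
    lt_of_lt_of_le (by positivity) (hp.norm_ge hμ ht)
  refine ⟨?_, ?_, ?_⟩
  · refine ContinuousOn.inv₀ (by have := hp.cont; fun_prop) fun t ht => norm_pos_iff.1 (hne t ht)
  · intro t ht
    rw [norm_inv, Real.rpow_neg_one]
    have h1 := inv_anti₀ (by positivity) (hp.norm_ge hμ ht)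
    rw [mul_inv] at h1
    refine h1.trans (mul_le_mul_of_nonneg_right ?_ (by positivity))
    rw [one_div]; linarith [show 0 < 2 / ellC μ ^ 2 by positivity]
  · intro t' t ht' hlt
    have ht := ht'.trans hlt
    have hM := modulus_nonneg (α := α) hlt
    rw [inv_sub_inv (norm_pos_iff.1 (hne t ht)) (norm_pos_iff.1 (hne t' ht')), norm_div, norm_mul]
    have hnum : ‖Complex.I * t' - p t' - (Complex.I * t - p t)‖ ≤
        2 * ((t - t') ^ α + (t - t')) := by
      have e1 : Complex.I * t' - p t' - (Complex.I * t - p t)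
          = (p t - p t') - Complex.I * ((t - t' : ℝ) : ℂ) := by push_cast; ring
      rw [e1]
      refine (_root_.norm_sub_le _ _).trans ?_
      have h1 := hp.hol ht' hlt
      have h2 : ‖Complex.I * ((t - t' : ℝ) : ℂ)‖ = t - t' := by
        rw [norm_mul, Complex.norm_I, one_mul, Complex.norm_real, Real.norm_of_nonneg (by linarith)]
      have h3 : 0 ≤ (t - t') ^ α := Real.rpow_nonneg (by linarith) _
      rw [h2]; linarith
    have hden : ellC μ ^ 2 * (1 + t') ^ 2 ≤
        ‖Complex.I * t - p t‖ * ‖Complex.I * t' - p t'‖ := by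
      have h1 : ellC μ * (1 + t') ≤ ‖Complex.I * t - p t‖ :=
        (mul_le_mul_of_nonneg_left (by linarith) hc.le).trans (hp.norm_ge hμ ht)
      have := mul_le_mul h1 (hp.norm_ge hμ ht') (by positivity) (norm_nonneg _)
      calc _ = _ := by ring
        _ ≤ _ := this
    refine (div_le_div₀ (by positivity) hnum (by positivity) hden).trans ?_
    have e2 : (1 + t') ^ (-2 : ℝ) = ((1 + t') ^ 2)⁻¹ := by
      rw [Real.rpow_neg (by linarith)]; norm_num
    rw [e2]
    have e3 : 2 * ((t - t') ^ α + (t - t')) / (ellC μ ^ 2 * (1 + t') ^ 2)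
        = 2 / ellC μ ^ 2 * ((1 + t') ^ 2)⁻¹ * ((t - t') ^ α + (t - t')) := by
      field_simp
    rw [e3]
    refine mul_le_mul_of_nonneg_right (mul_le_mul_of_nonneg_right ?_ (by positivity)) hM
    linarith [show 0 < 1 / ellC μ by positivity]

end KadenSpiral
end

/-! ### Integrable majorants. -/

noncomputable section
namespace KadenSpiral

/-- Integrable majorant with a singularity of order `β` at the origin. -/
def majorant (β v : ℝ) : ℝ := (1 + |v| ^ (-β)) * Real.exp (-|v| / 2)

theorem majorant_nonneg (β v : ℝ) : 0 ≤ majorant β v := by unfold majorant; positivity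

theorem exp_le_majorant (β v : ℝ) : Real.exp (-|v| / 2) ≤ majorant β v :=
  le_mul_of_one_le_left (Real.exp_pos _).le
    (by linarith [Real.rpow_nonneg (abs_nonneg v) (-β)])

theorem rpow_mul_exp_le_majorant (β v : ℝ) :
    |v| ^ (-β) * Real.exp (-|v| / 2) ≤ majorant β v :=
  mul_le_mul_of_nonneg_right (by linarith) (Real.exp_pos _).le

theorem integrable_comp_abs_of_integrableOn {f : ℝ → ℝ} (hf : IntegrableOn f (Ioi 0)) :
    Integrable (fun x => f |x|) := by
  rw [← integrableOn_univ, ← Iic_union_Ioi (a := (0 : ℝ))]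
  have h1 : IntegrableOn (fun x => f |x|) (Ioi 0) :=
    hf.congr_fun (fun x hx => by rw [abs_of_pos hx]) measurableSet_Ioi
  refine IntegrableOn.union ?_ h1
  rw [integrableOn_Iic_iff_integrableOn_Iio]
  have h2 := ((integrable_indicator_iff measurableSet_Ioi).2 h1).comp_neg
  refine (integrable_indicator_iff measurableSet_Iio).1 (h2.congr (Eventually.of_forall ?_))
  intro x
  by_cases hx : x < 0 <;> simp [indicator, hx]

theorem integrable_majorant {β : ℝ} (hβ : β < 1) : Integrable (majorant β) := by
  have h1 : ∀ s : ℝ, -1 < s → Integrable (fun v : ℝ => |v| ^ s * Real.exp (-|v| / 2)) := by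
    intro s hs
    refine integrable_comp_abs_of_integrableOn (f := fun v => v ^ s * Real.exp (-v / 2)) ?_
    have := integrableOn_rpow_mul_exp_neg_mul_rpow (p := 1) (s := s) (b := 1 / 2) hs one_pos
      (by norm_num)
    refine this.congr_fun (fun x hx => ?_) measurableSet_Ioi
    simp only [Real.rpow_one]; ring_nf
  have := (h1 0 (by norm_num)).add (h1 (-β) (by linarith))
  refine this.congr (Eventually.of_forall fun v => ?_)
  simp [majorant, add_mul]

/-- The integral of the majorant. -/
def majC (β : ℝ) : ℝ := ∫ v, majorant β v

theorem majC_nonneg (β : ℝ) : 0 ≤ majC β := integral_nonneg (majorant_nonneg β)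

theorem integrable_majorant_comp {β c : ℝ} (hβ : β < 1) (hc : 0 < c) :
    Integrable (fun u => majorant β (c * u)) :=
  (integrable_majorant hβ).comp_mul_left' hc.ne'

theorem ae_ne_zero : ∀ᵐ u : ℝ, u ≠ 0 := by
  simp [ae_iff]

theorem integrable_of_le_majorant {β c B : ℝ} (hβ : β < 1) (hc : 0 < c) {f : ℝ → ℂ}
    (hm : AEStronglyMeasurable f) (hf : ∀ u, u ≠ 0 → ‖f u‖ ≤ B * majorant β (c * u)) :
    Integrable f :=
  ((integrable_majorant_comp hβ hc).const_mul B).mono' hm (ae_ne_zero.mono hf)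

/-- The division by `c` comes from the change of variables `v = cu`. With `c = rate μ m`,
proportional to `m`, this is one source of the powers of `1/m`. -/
theorem norm_integral_le_majorant {β c B : ℝ} (hβ : β < 1) (hc : 0 < c) {f : ℝ → ℂ}
    (hf : ∀ u, u ≠ 0 → ‖f u‖ ≤ B * majorant β (c * u)) :
    ‖∫ u, f u‖ ≤ B * majC β / c := by
  refine (norm_integral_le_of_norm_le ((integrable_majorant_comp hβ hc).const_mul B)
    (ae_ne_zero.mono hf)).trans (le_of_eq ?_)
  rw [integral_const_mul, Measure.integral_comp_mul_left (majorant β), abs_of_pos (inv_pos.2 hc),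
    smul_eq_mul, majC]
  field_simp

/-- Fundamental theorem of calculus on `ℝ` with a possible jump at the origin. -/
theorem integral_eq_jump {F F' : ℝ → ℂ} {a b : ℂ} (hF : ∀ u, u ≠ 0 → HasDerivAt F (F' u) u)
    (hi : Integrable F') (ha : Tendsto F (𝓝[>] 0) (𝓝 a)) (hb : Tendsto F (𝓝[<] 0) (𝓝 b))
    (htop : Tendsto F atTop (𝓝 0)) (hbot : Tendsto F atBot (𝓝 0)) :
    ∫ u, F' u = b - a := by
  have h1 := integral_Ioi_deriv_mul_eq_sub (A := ℂ) (a := (0 : ℝ)) (u := F) (u' := F')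
    (v := fun _ => 1) (v' := fun _ => 0) (a' := a) (b' := 0) (fun x hx => hF x (ne_of_gt hx))
    (fun x _ => hasDerivAt_const x 1) (by simpa [Pi.mul_def, Pi.add_def] using hi.integrableOn)
    (by simpa [Pi.mul_def] using ha) (by simpa [Pi.mul_def] using htop)
  have h2 := integral_Iic_deriv_mul_eq_sub (A := ℂ) (a := (0 : ℝ)) (u := F) (u' := F')
    (v := fun _ => 1) (v' := fun _ => 0) (a' := b) (b' := 0) (fun x hx => hF x (ne_of_lt hx))
    (fun x _ => hasDerivAt_const x 1) (by simpa [Pi.mul_def, Pi.add_def] using hi.integrableOn)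
    (by simpa [Pi.mul_def] using hb) (by simpa [Pi.mul_def] using hbot)
  simp only [mul_one, mul_zero, add_zero] at h1 h2
  rw [← intervalIntegral.integral_Iic_add_Ioi (b := (0 : ℝ)) hi.integrableOn hi.integrableOn,
    h1, h2]
  ring

/-! ### The phase, the singular kernel and the logarithmic kernel. -/

/-- The derivative of the phase. -/
def symZ (p : ℝ → ℂ) (θ u : ℝ) : ℂ := Complex.I * ((θ * Real.exp u : ℝ) : ℂ) - p (θ * Real.exp u)

/-- The phase. -/
def symP (p : ℝ → ℂ) (θ u : ℝ) : ℂ := ∫ v in (0 : ℝ)..u, symZ p θ v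

/-- The sign with value `-1` at the origin. -/
def sg (u : ℝ) : ℝ := if 0 < u then 1 else -1

/-- The exponential of the phase, oriented so that it is at most one in modulus. -/
def kerQ (p : ℝ → ℂ) (m θ u : ℝ) : ℂ := Complex.exp ((sg u * m : ℝ) * symP p θ u)

/-- The kernel `1/(1-q) - 1_{u>0}`. -/
def ker (p : ℝ → ℂ) (m θ u : ℝ) : ℂ := sg u * (kerQ p m θ u / (1 - kerQ p m θ u))

/-- Logarithmic antiderivative of the kernel. -/
def kerL (p : ℝ → ℂ) (m θ u : ℝ) : ℂ := Complex.log (1 - kerQ p m θ u)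

/-- The exponential rate of decay of the kernel. -/
def rate (μ m : ℝ) : ℝ := μ / 4 * m

theorem sg_of_pos {u : ℝ} (h : 0 < u) : sg u = 1 := if_pos h
theorem sg_of_neg {u : ℝ} (h : u < 0) : sg u = -1 := if_neg (not_lt.2 h.le)
theorem sg_mul_self (u : ℝ) : sg u * sg u = 1 := by unfold sg; split_ifs <;> norm_num
theorem abs_sg (u : ℝ) : |sg u| = 1 := by unfold sg; split_ifs <;> norm_num
theorem sg_eventuallyEq {u : ℝ} (h : u ≠ 0) : ∀ᶠ v in 𝓝 u, sg v = sg u := by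
  rcases lt_or_gt_of_ne h with h | h
  · filter_upwards [Iio_mem_nhds h] with v hv
    rw [sg_of_neg hv, sg_of_neg h]
  · filter_upwards [Ioi_mem_nhds h] with v hv
    rw [sg_of_pos hv, sg_of_pos h]
theorem measurable_sg : Measurable sg :=
  Measurable.ite measurableSet_Ioi measurable_const measurable_const

variable {μ α : ℝ} {p : ℝ → ℂ} {m θ : ℝ}

theorem Sym.continuous_symZ (hp : Sym μ α p) (hθ : 0 < θ) : Continuous (symZ p θ) := by
  have h : Continuous fun u => p (θ * Real.exp u) := hp.cont.comp_continuous (by fun_prop)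
    (fun u => by simp only [mem_Ioi]; positivity)
  unfold symZ
  exact (by fun_prop : Continuous fun u : ℝ => Complex.I * ((θ * Real.exp u : ℝ) : ℂ)).sub h

theorem Sym.hasDerivAt_symP (hp : Sym μ α p) (hθ : 0 < θ) (u : ℝ) :
    HasDerivAt (symP p θ) (symZ p θ u) u :=
  ((hp.continuous_symZ hθ).integral_hasStrictDerivAt 0 u).hasDerivAt

theorem Sym.continuous_symP (hp : Sym μ α p) (hθ : 0 < θ) : Continuous (symP p θ) :=
  continuous_iff_continuousAt.2 fun u => (hp.hasDerivAt_symP hθ u).continuousAt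

theorem symP_zero : symP p θ 0 = 0 := intervalIntegral.integral_same

theorem Sym.symP_re (hp : Sym μ α p) (hθ : 0 < θ) (u : ℝ) :
    (symP p θ u).re = ∫ v in (0 : ℝ)..u, (symZ p θ v).re :=
  ((Complex.reCLM.intervalIntegral_comp_comm
    ((hp.continuous_symZ hθ).intervalIntegrable 0 u))).symm

theorem Sym.symZ_re_le (hp : Sym μ α p) (hθ : 0 < θ) (u : ℝ) : (symZ p θ u).re ≤ -(μ / 2) := by
  have h := hp.re_ge (t := θ * Real.exp u) (by positivity)
  simp only [symZ, Complex.sub_re, Complex.mul_re, Complex.I_re, Complex.I_im, Complex.ofReal_re,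
    Complex.ofReal_im]
  linarith

/-- Integration of `Re ∂_u P ≤ -μ/2` from the origin; the sign orients the phase so that both
half-lines give decay. -/
theorem Sym.sg_symP_re (hp : Sym μ α p) (hθ : 0 < θ) (u : ℝ) :
    sg u * (symP p θ u).re ≤ -(μ / 2) * |u| := by
  have hc : Continuous fun v => (symZ p θ v).re :=
    Complex.continuous_re.comp (hp.continuous_symZ hθ)
  rw [hp.symP_re hθ]
  rcases lt_trichotomy u 0 with h | rfl | h
  · rw [sg_of_neg h, abs_of_neg h, intervalIntegral.integral_symm]
    have := intervalIntegral.integral_mono_on (μ := volume) h.le (hc.intervalIntegrable _ _)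
      (continuous_const.intervalIntegrable _ _) (fun v _ => hp.symZ_re_le hθ v)
    rw [intervalIntegral.integral_const, smul_eq_mul] at this
    linarith
  · simp
  · rw [sg_of_pos h, abs_of_pos h]
    have := intervalIntegral.integral_mono_on (μ := volume) h.le (hc.intervalIntegrable _ _)
      (continuous_const.intervalIntegrable _ _) (fun v _ => hp.symZ_re_le hθ v)
    rw [intervalIntegral.integral_const, smul_eq_mul] at this
    linarith

theorem Sym.norm_kerQ_le (hp : Sym μ α p) (hθ : 0 < θ) (hm : 0 ≤ m) (u : ℝ) :
    ‖kerQ p m θ u‖ ≤ Real.exp (-(2 * (rate μ m * |u|))) := by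
  rw [kerQ, Complex.norm_exp, Complex.re_ofReal_mul]
  refine Real.exp_le_exp.2 ?_
  have := mul_le_mul_of_nonneg_left (hp.sg_symP_re hθ u) hm
  unfold rate; linarith

theorem rate_pos (hμ : 0 < μ) (hm : 0 < m) : 0 < rate μ m := by unfold rate; positivity

theorem Sym.norm_one_sub_kerQ (hp : Sym μ α p) (hθ : 0 < θ) (hm : 0 ≤ m) (u : ℝ) :
    1 - Real.exp (-(2 * (rate μ m * |u|))) ≤ ‖1 - kerQ p m θ u‖ := by
  have h := norm_sub_norm_le (1 : ℂ) (kerQ p m θ u)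
  rw [norm_one] at h
  linarith [hp.norm_kerQ_le hθ hm u]

theorem Sym.norm_kerQ_lt (hp : Sym μ α p) (hμ : 0 < μ) (hθ : 0 < θ) (hm : 0 < m) {u : ℝ}
    (hu : u ≠ 0) : ‖kerQ p m θ u‖ < 1 := by
  refine (hp.norm_kerQ_le hθ hm.le u).trans_lt (Real.exp_lt_one_iff.2 ?_)
  have := mul_pos (rate_pos hμ hm) (abs_pos.2 hu)
  linarith

theorem Sym.one_sub_kerQ_mem (hp : Sym μ α p) (hμ : 0 < μ) (hθ : 0 < θ) (hm : 0 < m) {u : ℝ}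
    (hu : u ≠ 0) : 1 - kerQ p m θ u ∈ Complex.slitPlane := by
  left
  have h := (Complex.re_le_norm _).trans_lt (hp.norm_kerQ_lt hμ hθ hm hu)
  simp only [Complex.sub_re, Complex.one_re]; linarith

theorem Sym.one_sub_kerQ_ne (hp : Sym μ α p) (hμ : 0 < μ) (hθ : 0 < θ) (hm : 0 < m) {u : ℝ}
    (hu : u ≠ 0) : 1 - kerQ p m θ u ≠ 0 :=
  Complex.slitPlane_ne_zero (hp.one_sub_kerQ_mem hμ hθ hm hu)

theorem one_sub_exp_ge {x : ℝ} (hx : 0 ≤ x) : 2 * x * Real.exp (-x) ≤ 1 - Real.exp (-(2 * x)) := by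
  have h1 : Real.exp (-(2 * x)) = Real.exp (-x) * Real.exp (-x) := by
    rw [← Real.exp_add]; ring_nf
  have h2 : Real.exp x * Real.exp (-x) = 1 := by rw [← Real.exp_add]; simp
  have h3 := Real.self_le_sinh_iff.2 hx
  rw [Real.sinh_eq] at h3
  have h4 := Real.exp_pos (-x)
  rw [h1]; nlinarith

theorem Sym.norm_ker_le (hp : Sym μ α p) (hμ : 0 < μ) (hθ : 0 < θ) (hm : 0 < m) {u : ℝ}
    (hu : u ≠ 0) :
    ‖ker p m θ u‖ ≤ Real.exp (-(rate μ m * |u|)) / (2 * (rate μ m * |u|)) := by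
  have hx : 0 < rate μ m * |u| := mul_pos (rate_pos hμ hm) (abs_pos.2 hu)
  set x := rate μ m * |u|
  rw [ker, norm_mul, Complex.norm_real, Real.norm_eq_abs, abs_sg, one_mul, norm_div]
  have h1 := one_sub_exp_ge hx.le
  have h2 := hp.norm_one_sub_kerQ hθ hm.le u
  have h3 := hp.norm_kerQ_le hθ hm.le u
  refine (div_le_div₀ (Real.exp_pos _).le h3 (by positivity) (h1.trans h2)).trans (le_of_eq ?_)
  have h4 : Real.exp (-(2 * x)) = Real.exp (-x) * Real.exp (-x) := by
    rw [← Real.exp_add]; ring_nf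
  rw [h4]; field_simp

theorem Sym.hasDerivAt_kerQ (hp : Sym μ α p) (hθ : 0 < θ) {u : ℝ} (hu : u ≠ 0) :
    HasDerivAt (kerQ p m θ) (((sg u * m : ℝ) : ℂ) * symZ p θ u * kerQ p m θ u) u := by
  have h1 := ((hp.hasDerivAt_symP hθ u).const_mul ((sg u * m : ℝ) : ℂ)).cexp
  rw [mul_comm (Complex.exp _)] at h1
  refine h1.congr_of_eventuallyEq ?_
  filter_upwards [sg_eventuallyEq hu] with v hv
  rw [kerQ, hv]

/-- The identity behind both the vanishing principal value and the integration by parts: the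
orientation sign in `q` produces exactly the sign in front of `ker`. -/
theorem Sym.hasDerivAt_kerL (hp : Sym μ α p) (hμ : 0 < μ) (hθ : 0 < θ) (hm : 0 < m) {u : ℝ}
    (hu : u ≠ 0) : HasDerivAt (kerL p m θ) (-(m * (symZ p θ u * ker p m θ u))) u := by
  have h1 := ((hp.hasDerivAt_kerQ (m := m) hθ hu).const_sub 1).clog_real
    (hp.one_sub_kerQ_mem hμ hθ hm hu)
  convert! h1 using 1
  rw [ker]; push_cast; ring

theorem Sym.measurable_kerQ (hp : Sym μ α p) (hθ : 0 < θ) : Measurable (kerQ p m θ) := by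
  have h1 := (hp.continuous_symP hθ).measurable
  have h2 := measurable_sg
  unfold kerQ; fun_prop

theorem Sym.measurable_ker (hp : Sym μ α p) (hθ : 0 < θ) : Measurable (ker p m θ) := by
  have h1 := hp.measurable_kerQ (m := m) hθ
  have h2 := measurable_sg
  unfold ker; fun_prop

theorem Sym.measurable_kerL (hp : Sym μ α p) (hθ : 0 < θ) : Measurable (kerL p m θ) := by
  have h1 := hp.measurable_kerQ (m := m) hθ
  unfold kerL
  exact Complex.measurable_log.comp (measurable_const.sub h1)

/-- The Taylor series is dominated termwise by that of `-log(1-r)`. With `y = 1-r`, the inequality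
`log x ≤ x - 1` at `x = y^{-1/2}` trades the logarithmic singularity for an integrable power while
keeping the factor `r`, hence the decay. -/
theorem norm_log_one_sub_le {q : ℂ} {r : ℝ} (hq : ‖q‖ ≤ r) (hr : r < 1) :
    ‖Complex.log (1 - q)‖ ≤ 2 * r * (1 - r) ^ (-(1 / 2) : ℝ) := by
  have hr0 := (norm_nonneg q).trans hq
  have h1 := Complex.hasSum_taylorSeries_neg_log (hq.trans_lt hr)
  have h2 := Real.hasSum_pow_div_log_of_abs_lt_one (x := r) (by rwa [abs_of_nonneg hr0])
  have h3 : HasSum (fun n : ℕ => r ^ n / (n : ℝ)) (-Real.log (1 - r)) := by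
    rw [← hasSum_nat_add_iff' 1]; simpa using h2
  have h4 : ‖-Complex.log (1 - q)‖ ≤ -Real.log (1 - r) := by
    rw [← h1.tsum_eq, ← h3.tsum_eq]
    refine tsum_of_norm_bounded h3.summable.hasSum fun n => ?_
    rw [norm_div, norm_pow, Complex.norm_natCast]
    gcongr
  rw [norm_neg] at h4
  refine h4.trans ?_
  have hy : 0 < 1 - r := by linarith
  set y := 1 - r with hy'
  have h5 : Real.log (y ^ (-(1 / 2) : ℝ)) = -(1 / 2) * Real.log y := Real.log_rpow hy _
  have h6 := Real.log_le_sub_one_of_pos (Real.rpow_pos_of_pos hy (-(1 / 2) : ℝ))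
  have h7 : y ^ (1 / 2 : ℝ) * y ^ (-(1 / 2) : ℝ) = 1 := by
    rw [← Real.rpow_add hy]; norm_num
  have h8 : y ≤ y ^ (1 / 2 : ℝ) := by
    have := Real.rpow_le_rpow_of_exponent_ge hy (by linarith) (show (1 / 2 : ℝ) ≤ 1 by norm_num)
    simpa using this
  have h9 := Real.rpow_pos_of_pos hy (-(1 / 2) : ℝ)
  have h10 : r = 1 - y := by linarith
  rw [h5] at h6
  rw [h10]; nlinarith

theorem Sym.norm_kerL_le (hp : Sym μ α p) (hμ : 0 < μ) (hθ : 0 < θ) (hm : 0 < m) {u : ℝ}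
    (hu : u ≠ 0) :
    ‖kerL p m θ u‖ ≤
      2 * ((rate μ m * |u|) ^ (-(1 / 2) : ℝ) * Real.exp (-(3 / 2 * (rate μ m * |u|)))) := by
  have hx : 0 < rate μ m * |u| := mul_pos (rate_pos hμ hm) (abs_pos.2 hu)
  set x := rate μ m * |u|
  refine (norm_log_one_sub_le (hp.norm_kerQ_le hθ hm.le u)
    (Real.exp_lt_one_iff.2 (by linarith))).trans ?_
  have h1 : x * Real.exp (-x) ≤ 1 - Real.exp (-(2 * x)) := by
    have := one_sub_exp_ge hx.le; linarith [mul_pos hx (Real.exp_pos (-x))]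
  have h2 := Real.rpow_le_rpow_of_nonpos (by positivity) h1 (show (-(1 / 2) : ℝ) ≤ 0 by norm_num)
  rw [Real.mul_rpow hx.le (Real.exp_pos _).le, ← Real.exp_mul] at h2
  refine (mul_le_mul_of_nonneg_left h2 (by positivity)).trans (le_of_eq ?_)
  have : Real.exp (-(3 / 2 * x)) = Real.exp (-(2 * x)) * Real.exp (-x * -(1 / 2)) := by
    rw [← Real.exp_add]; ring_nf
  rw [this]; ring

theorem Sym.norm_symZ_le (hp : Sym μ α p) (hμ : 0 < μ) (hθ : 0 < θ) (u : ℝ) :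
    ‖symZ p θ u‖ ≤ (1 + 2 * μ) * (1 + θ) * Real.exp |u| := by
  have h1 := hp.norm_le (t := θ * Real.exp u) hμ (by positivity)
  have h2 := _root_.norm_sub_le (Complex.I * ((θ * Real.exp u : ℝ) : ℂ)) (p (θ * Real.exp u))
  rw [norm_mul, Complex.norm_I, one_mul, Complex.norm_real,
    Real.norm_of_nonneg (by positivity)] at h2
  have h3 : 1 ≤ Real.exp |u| := Real.one_le_exp (abs_nonneg u)
  have h4 : Real.exp u ≤ Real.exp |u| := Real.exp_le_exp.2 (le_abs_self u)
  unfold symZ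
  have h5 := mul_le_mul_of_nonneg_left h4 hθ.le
  have h6 : 2 * μ ≤ 2 * μ * Real.exp |u| := le_mul_of_one_le_right (by linarith) h3
  have h7 : 0 ≤ 2 * μ * θ * Real.exp |u| := by positivity
  nlinarith

theorem Sym.symZ_shift (hp : Sym μ α p) (hα0 : 0 < α) (hα1 : α ≤ 1) {θ₁ θ₂ : ℝ}
    (h2 : 0 < θ₂) (h12 : θ₂ < θ₁) (h1 : θ₁ ≤ θ₂ + 1) (u : ℝ) :
    ‖symZ p θ₁ u - symZ p θ₂ u‖ ≤ 2 * (θ₁ - θ₂) ^ α * Real.exp |u| := by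
  have h := Cls.shift hp le_rfl hα0 hα1 h2 h12 h1 u
  simp only [sub_sub_sub_cancel_right, neg_zero, Real.rpow_zero, mul_one, zero_add, one_mul] at h
  have hd : 0 ≤ θ₁ - θ₂ := by linarith
  have e1 : symZ p θ₁ u - symZ p θ₂ u = Complex.I * (((θ₁ - θ₂) * Real.exp u : ℝ) : ℂ) -
      (p (θ₁ * Real.exp u) - p (θ₂ * Real.exp u)) := by
    unfold symZ; push_cast; ring
  rw [e1]
  refine (_root_.norm_sub_le _ _).trans ?_
  rw [norm_mul, Complex.norm_I, one_mul, Complex.norm_real,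
    Real.norm_of_nonneg (by positivity)]
  have b2 : (θ₁ - θ₂) * Real.exp u ≤ (θ₁ - θ₂) ^ α * Real.exp |u| :=
    mul_le_mul (self_le_rpow hα1 hd (by linarith) hα0) (Real.exp_le_exp.2 (le_abs_self u))
      (Real.exp_pos _).le (Real.rpow_nonneg hd _)
  have h3 : 0 ≤ (θ₁ - θ₂) ^ α * Real.exp |u| := by positivity
  nlinarith [(symTol_le μ).2]

theorem Sym.symP_shift (hp : Sym μ α p) (hα0 : 0 < α) (hα1 : α ≤ 1) {θ₁ θ₂ : ℝ}
    (h2 : 0 < θ₂) (h12 : θ₂ < θ₁) (h1 : θ₁ ≤ θ₂ + 1) (u : ℝ) :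
    ‖symP p θ₁ u - symP p θ₂ u‖ ≤ 2 * (θ₁ - θ₂) ^ α * Real.exp |u| * |u| := by
  unfold symP
  rw [← intervalIntegral.integral_sub
    ((hp.continuous_symZ (h2.trans h12)).intervalIntegrable _ _)
    ((hp.continuous_symZ h2).intervalIntegrable _ _)]
  have := intervalIntegral.norm_integral_le_of_norm_le_const (a := (0 : ℝ)) (b := u)
    (C := 2 * (θ₁ - θ₂) ^ α * Real.exp |u|) (f := fun v => symZ p θ₁ v - symZ p θ₂ v) ?_
  · simpa using this
  · intro v hv
    refine (hp.symZ_shift hα0 hα1 h2 h12 h1 v).trans ?_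
    have hvu : |v| ≤ |u| := by
      rcases le_total 0 u with h | h
      · rw [uIoc_of_le h] at hv
        rw [abs_of_nonneg h, abs_of_pos hv.1]; exact hv.2
      · rw [uIoc_of_ge h] at hv
        rw [abs_of_nonpos h, abs_of_nonpos hv.2]; linarith [hv.1]
    have : 0 ≤ θ₁ - θ₂ := by linarith
    gcongr

/-- Mean value inequality on the half-plane of real part at most `R`, which is convex and on which
`|exp| ≤ e^R`. -/
theorem norm_exp_sub_exp_le {a b : ℂ} {R : ℝ} (ha : a.re ≤ R) (hb : b.re ≤ R) :
    ‖Complex.exp a - Complex.exp b‖ ≤ Real.exp R * ‖a - b‖ := by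
  refine (convex_halfSpace_re_le R).norm_image_sub_le_of_norm_hasDerivWithin_le
    (f := Complex.exp) (f' := Complex.exp)
    (fun x _ => (Complex.hasDerivAt_exp x).hasDerivWithinAt) (fun x hx => ?_) hb ha
  rw [Complex.norm_exp]; exact Real.exp_le_exp.2 hx

theorem Sym.kerQ_shift (hp : Sym μ α p) (hα0 : 0 < α) (hα1 : α ≤ 1) (hm : 0 ≤ m) {θ₁ θ₂ : ℝ}
    (h2 : 0 < θ₂) (h12 : θ₂ < θ₁) (h1 : θ₁ ≤ θ₂ + 1) (u : ℝ) :
    ‖kerQ p m θ₁ u - kerQ p m θ₂ u‖ ≤ Real.exp (-(2 * (rate μ m * |u|))) *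
      (2 * (θ₁ - θ₂) ^ α * Real.exp |u| * (m * |u|)) := by
  have hre : ∀ θ, 0 < θ → (((sg u * m : ℝ) : ℂ) * symP p θ u).re ≤ -(2 * (rate μ m * |u|)) := by
    intro θ hθ
    rw [Complex.re_ofReal_mul]
    have := mul_le_mul_of_nonneg_left (hp.sg_symP_re hθ u) hm
    unfold rate; linarith
  refine (norm_exp_sub_exp_le (hre _ (h2.trans h12)) (hre _ h2)).trans ?_
  refine mul_le_mul_of_nonneg_left ?_ (Real.exp_pos _).le
  rw [← mul_sub, norm_mul, Complex.norm_real, Real.norm_eq_abs, abs_mul, abs_sg, one_mul,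
    abs_of_nonneg hm]
  have := mul_le_mul_of_nonneg_left (hp.symP_shift hα0 hα1 h2 h12 h1 u) hm
  linarith

theorem norm_log_one_sub_sub_le {a b : ℂ} {r : ℝ} (ha : ‖a‖ ≤ r) (hb : ‖b‖ ≤ r) (hr : r < 1) :
    ‖Complex.log (1 - a) - Complex.log (1 - b)‖ ≤ 1 / (1 - r) * ‖a - b‖ := by
  refine (convex_closedBall (0 : ℂ) r).norm_image_sub_le_of_norm_hasDerivWithin_le
    (f := fun z => Complex.log (1 - z)) (f' := fun z => (-1) / (1 - z))
    (fun x hx => ?_) (fun x hx => ?_) (by simpa using hb) (by simpa using ha)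
  · have hx : ‖x‖ ≤ r := by simpa using hx
    refine (((hasDerivAt_id x).const_sub 1).clog ?_).hasDerivWithinAt
    left
    have h := (Complex.re_le_norm x).trans_lt (hx.trans_lt hr)
    simp only [Complex.sub_re, Complex.one_re, id]; linarith
  · have hx : ‖x‖ ≤ r := by simpa using hx
    rw [norm_div, norm_neg, norm_one]
    have h := norm_sub_norm_le (1 : ℂ) x
    rw [norm_one] at h
    exact one_div_le_one_div_of_le (by linarith) (by linarith)

/-- The variation of `q` contributes a factor `m|u|` and the derivative of the logarithm a factor of
order `1/(m|u|)`. They cancel, so the variation in `θ` has no singularity at the origin. -/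
theorem Sym.kerL_shift (hp : Sym μ α p) (hμ : 0 < μ) (hα0 : 0 < α) (hα1 : α ≤ 1) (hm : 0 < m)
    {θ₁ θ₂ : ℝ} (h2 : 0 < θ₂) (h12 : θ₂ < θ₁) (h1 : θ₁ ≤ θ₂ + 1) {u : ℝ} (hu : u ≠ 0) :
    ‖kerL p m θ₁ u - kerL p m θ₂ u‖ ≤
      4 / μ * (θ₁ - θ₂) ^ α * Real.exp |u| * Real.exp (-(rate μ m * |u|)) := by
  have hx : 0 < rate μ m * |u| := mul_pos (rate_pos hμ hm) (abs_pos.2 hu)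
  have hxm : rate μ m * |u| = μ / 4 * (m * |u|) := by unfold rate; ring
  have hd : 0 ≤ θ₁ - θ₂ := by linarith
  refine (norm_log_one_sub_sub_le (hp.norm_kerQ_le (h2.trans h12) hm.le u)
    (hp.norm_kerQ_le h2 hm.le u) (Real.exp_lt_one_iff.2 (by linarith))).trans ?_
  have b1 := one_div_le_one_div_of_le (by positivity) (one_sub_exp_ge hx.le)
  refine (mul_le_mul b1 (hp.kerQ_shift hα0 hα1 hm.le h2 h12 h1 u) (norm_nonneg _)
    (by positivity)).trans (le_of_eq ?_)
  have h4 : Real.exp (-(2 * (rate μ m * |u|))) =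
      Real.exp (-(rate μ m * |u|)) * Real.exp (-(rate μ m * |u|)) := by
    rw [← Real.exp_add]; ring_nf
  have hmu : 0 < m * |u| := mul_pos hm (abs_pos.2 hu)
  rw [h4, hxm]; field_simp

end KadenSpiral
end

/-! ### The singular and logarithmic operators, and the first integration by parts. -/

noncomputable section
namespace KadenSpiral

/-- Weighted Hölder bound for the values of the operators. -/
structure EB (α B : ℝ) (J : ℝ → ℂ) : Prop where
  bd : ∀ θ, 0 < θ → ‖J θ‖ ≤ B * (1 + θ) ^ (-(1 + α))
  hol : ∀ θ₂ θ₁, 0 < θ₂ → θ₂ < θ₁ → θ₁ < θ₂ + 1 →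
    ‖J θ₁ - J θ₂‖ ≤ B * (1 + θ₂) ^ (-(1 + α)) * (θ₁ - θ₂) ^ α

namespace EB

variable {α B B' : ℝ} {J J' : ℝ → ℂ}

theorem mono (h : EB α B J) (hB : B ≤ B') : EB α B' J where
  bd θ hθ := (h.bd θ hθ).trans (mul_le_mul_of_nonneg_right hB (weight_pos hθ).le)
  hol θ₂ θ₁ h2 h12 h1 := (h.hol θ₂ θ₁ h2 h12 h1).trans
    (mul_le_mul_of_nonneg_right (mul_le_mul_of_nonneg_right hB (weight_pos h2).le)
      (Real.rpow_nonneg (by linarith) _))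

theorem congr (h : EB α B J) (hJ : ∀ θ, 0 < θ → J' θ = J θ) : EB α B J' where
  bd θ hθ := by rw [hJ θ hθ]; exact h.bd θ hθ
  hol θ₂ θ₁ h2 h12 h1 := by rw [hJ θ₁ (h2.trans h12), hJ θ₂ h2]; exact h.hol θ₂ θ₁ h2 h12 h1

theorem add (h : EB α B J) (h' : EB α B' J') : EB α (B + B') (fun θ => J θ + J' θ) where
  bd θ hθ := by
    rw [add_mul]; exact (norm_add_le _ _).trans (add_le_add (h.bd θ hθ) (h'.bd θ hθ))
  hol θ₂ θ₁ h2 h12 h1 := by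
    rw [add_sub_add_comm, add_mul, add_mul]
    exact (norm_add_le _ _).trans (add_le_add (h.hol θ₂ θ₁ h2 h12 h1) (h'.hol θ₂ θ₁ h2 h12 h1))

theorem const_mul (h : EB α B J) (a : ℂ) : EB α (‖a‖ * B) (fun θ => a * J θ) where
  bd θ hθ := by
    rw [norm_mul, mul_assoc]; exact mul_le_mul_of_nonneg_left (h.bd θ hθ) (norm_nonneg _)
  hol θ₂ θ₁ h2 h12 h1 := by
    rw [← mul_sub, norm_mul, mul_assoc, mul_assoc, ← mul_assoc B]
    exact mul_le_mul_of_nonneg_left (h.hol θ₂ θ₁ h2 h12 h1) (norm_nonneg _)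

theorem sub (h : EB α B J) (h' : EB α B' J') : EB α (B + B') (fun θ => J θ - J' θ) := by
  have := h.add (h'.const_mul (-1))
  simpa [sub_eq_add_neg] using this

theorem nonneg (h : EB α B J) : 0 ≤ B := by
  by_contra hB
  have h1 := h.bd 1 one_pos
  have := mul_neg_of_neg_of_pos (not_le.1 hB) (weight_pos (s := -(1 + α)) one_pos)
  linarith [norm_nonneg (J 1)]

end EB

/-- The rescaled increment of `t ↦ t^{1-2μ} f(t)`. -/
def hat (μ : ℝ) (f : ℝ → ℂ) (θ u : ℝ) : ℂ :=
  (Real.exp ((1 - 2 * μ) * u) : ℂ) * f (θ * Real.exp u) - f θ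

/-- The rescaled singular integral operator. -/
def opJ (μ : ℝ) (p : ℝ → ℂ) (m : ℝ) (f : ℝ → ℂ) (θ : ℝ) : ℂ :=
  ∫ u, hat μ f θ u * (symZ p θ u * ker p m θ u)

/-- The integral operator with logarithmic kernel. -/
def opN (μ : ℝ) (p : ℝ → ℂ) (m : ℝ) (g : ℝ → ℂ) (θ : ℝ) : ℂ :=
  ∫ u, (Real.exp ((1 - 2 * μ) * u) : ℂ) * g (θ * Real.exp u) * kerL p m θ u

/-- Smallness of `1/m`. -/
def Large (μ m : ℝ) : Prop := 4 * μ + 40 ≤ rate μ m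

variable {μ α : ℝ} {p : ℝ → ℂ} {m θ : ℝ}

theorem Large.pos (hm : Large μ m) (hμ : 0 < μ) : 0 < m := by
  by_contra h
  have : rate μ m ≤ 0 := by
    unfold rate; exact mul_nonpos_of_nonneg_of_nonpos (by linarith) (not_lt.1 h)
  unfold Large at hm; linarith

theorem Large.one_le (hm : Large μ m) (hμ : 0 < μ) : 1 ≤ m := by
  unfold Large rate at hm; nlinarith

theorem Large.rate_ge (hm : Large μ m) (hμ : 0 < μ) : 1 ≤ rate μ m := by
  unfold Large at hm; linarith

theorem Large.exp_le (hm : Large μ m) {k : ℝ} (hk : k ≤ 2 * μ + 20) (u : ℝ) :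
    Real.exp (k * |u|) ≤ Real.exp (rate μ m * |u| / 2) := by
  refine Real.exp_le_exp.2 ?_
  unfold Large at hm
  nlinarith [abs_nonneg u]

theorem continuous_expfac (μ : ℝ) :
    Continuous (fun u : ℝ => (Real.exp ((1 - 2 * μ) * u) : ℂ)) := by fun_prop

theorem norm_expfac_le (hμ : 1 / 2 < μ) (u : ℝ) :
    ‖(Real.exp ((1 - 2 * μ) * u) : ℂ)‖ ≤ Real.exp (2 * μ * |u|) := by
  rw [Complex.norm_real, Real.norm_of_nonneg (Real.exp_pos _).le]
  refine Real.exp_le_exp.2 ?_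
  have := neg_abs_le u
  have := le_abs_self u
  nlinarith [abs_nonneg u]

theorem norm_expfac_sub_one_le (hμ : 1 / 2 < μ) (u : ℝ) :
    ‖(Real.exp ((1 - 2 * μ) * u) : ℂ) - 1‖ ≤ 2 * μ * |u| * Real.exp (2 * μ * |u|) := by
  have h := abs_exp_sub_one_le ((1 - 2 * μ) * u)
  rw [← Complex.ofReal_one, ← Complex.ofReal_sub, Complex.norm_real, Real.norm_eq_abs]
  have h1 : |(1 - 2 * μ) * u| ≤ 2 * μ * |u| := by
    rw [abs_mul, abs_of_neg (by linarith)]; nlinarith [abs_nonneg u]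
  exact h.trans (mul_le_mul h1 (Real.exp_le_exp.2 h1) (Real.exp_pos _).le (by positivity))

/-- The increment splits into the variation of `f`, governed by the Hölder weight, and that of
`e^{(1-2μ)u}`, governed by the decay of `f(θ)`. -/
theorem Cls.hat_le {s e A : ℝ} {f : ℝ → ℂ} (h : Cls α s e A f) (he : 0 ≤ e) (hα0 : 0 < α)
    (hα1 : α ≤ 1) (hμ : 1 / 2 < μ) (hθ : 0 < θ) (u : ℝ) :
    ‖hat μ f θ u‖ ≤ A * Real.exp ((2 * μ + e + 1) * |u|) *
      ((1 + θ) ^ (-e) * ((θ * |u|) ^ α + θ * |u|) + 2 * μ * (1 + θ) ^ (-s) * |u|) := by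
  have e1 : hat μ f θ u = (Real.exp ((1 - 2 * μ) * u) : ℂ) * (f (θ * Real.exp u) - f θ) +
      ((Real.exp ((1 - 2 * μ) * u) : ℂ) - 1) * f θ := by unfold hat; ring
  have hA := h.nonneg
  have hw : 0 < (1 + θ) ^ (-s) := weight_pos hθ
  have hw' : 0 < (1 + θ) ^ (-e) := weight_pos hθ
  rw [e1]
  refine (norm_add_le _ _).trans ?_
  rw [norm_mul, norm_mul]
  have b1 := mul_le_mul (norm_expfac_le hμ u) (h.scale he hα0 hα1 hθ u) (norm_nonneg _)
    (Real.exp_pos _).le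
  have b2 := mul_le_mul (norm_expfac_sub_one_le hμ u) (h.bd θ hθ) (norm_nonneg _)
    (by positivity)
  have e2 : Real.exp ((2 * μ + e + 1) * |u|) =
      Real.exp (2 * μ * |u|) * Real.exp ((e + 1) * |u|) := by rw [← Real.exp_add]; ring_nf
  have h3 : 1 ≤ Real.exp ((e + 1) * |u|) := Real.one_le_exp (by positivity)
  have b3 : 2 * μ * |u| * Real.exp (2 * μ * |u|) * (A * (1 + θ) ^ (-s)) ≤
      2 * μ * |u| * Real.exp (2 * μ * |u|) * (A * (1 + θ) ^ (-s)) * Real.exp ((e + 1) * |u|) :=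
    le_mul_of_one_le_right (by positivity) h3
  rw [e2]
  refine (add_le_add b1 (b2.trans b3)).trans (le_of_eq ?_)
  ring

theorem Cls.continuous_hat {s e A : ℝ} {f : ℝ → ℂ} (h : Cls α s e A f) (hθ : 0 < θ) :
    Continuous (hat μ f θ) := by
  unfold hat
  exact ((continuous_expfac μ).mul (h.cont_exp hθ)).sub continuous_const

/-- Majorant of the integrand of `opJ`. -/
theorem Cls.opJ_integrand_le {A : ℝ} {f : ℝ → ℂ} (h : Cls α 0 0 A f) (hα0 : 0 < α)
    (hα1 : α ≤ 1) (hμ : 1 / 2 < μ) (hm : Large μ m) (hp : Sym μ α p) (hθ : 0 < θ) {u : ℝ}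
    (hu : u ≠ 0) :
    ‖hat μ f θ u * (symZ p θ u * ker p m θ u)‖ ≤
      A * (1 + 2 * μ) ^ 2 * (1 + θ) ^ 2 * majorant (1 - α) (rate μ m * u) := by
  have hμ0 : 0 < μ := by linarith
  have hr := hm.rate_ge hμ0
  have hx : 0 < rate μ m * |u| := mul_pos (by linarith) (abs_pos.2 hu)
  have hxa : |rate μ m * u| = rate μ m * |u| := by rw [abs_mul, abs_of_pos (by linarith)]
  have hA := h.nonneg
  have b1 := h.hat_le le_rfl hα0 hα1 hμ hθ u
  have b2 := hp.norm_symZ_le hμ0 hθ u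
  have b3 := hp.norm_ker_le hμ0 hθ (hm.pos hμ0) hu
  have hux : |u| ≤ rate μ m * |u| := le_mul_of_one_le_left (abs_nonneg _) hr
  have hex := hm.exp_le (k := 2 * μ + 2) (by linarith) u
  set x := rate μ m * |u| with hxdef
  have b4 : A * Real.exp ((2 * μ + 0 + 1) * |u|) *
      ((1 + θ) ^ (-(0 : ℝ)) * ((θ * |u|) ^ α + θ * |u|) + 2 * μ * (1 + θ) ^ (-(0 : ℝ)) * |u|) ≤
      A * Real.exp ((2 * μ + 1) * |u|) * ((1 + 2 * μ) * (1 + θ) * (x ^ α + x)) := by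
    rw [neg_zero, Real.rpow_zero, one_mul, mul_one, add_zero]
    refine mul_le_mul_of_nonneg_left ?_ (by positivity)
    have c1 : (θ * |u|) ^ α ≤ (1 + θ) * x ^ α := by
      rw [Real.mul_rpow hθ.le (abs_nonneg u)]
      refine mul_le_mul ?_ (Real.rpow_le_rpow (abs_nonneg u) hux hα0.le) (by positivity)
        (by positivity)
      refine (Real.rpow_le_rpow hθ.le (by linarith : θ ≤ 1 + θ) hα0.le).trans ?_
      have := Real.rpow_le_rpow_of_exponent_le (by linarith : 1 ≤ 1 + θ) hα1
      simpa using this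
    have c2 : 0 ≤ x ^ α := Real.rpow_nonneg hx.le _
    have c3 : 0 ≤ μ * θ * x ^ α := by positivity
    have c4 : 0 ≤ μ * θ * x := by positivity
    have c5 : θ * |u| ≤ θ * x := mul_le_mul_of_nonneg_left hux hθ.le
    have c6 : μ * |u| ≤ μ * x := mul_le_mul_of_nonneg_left hux hμ0.le
    have c7 : 0 ≤ μ * x ^ α := by positivity
    nlinarith
  rw [norm_mul, norm_mul]
  refine (mul_le_mul (b1.trans b4) (mul_le_mul b2 b3 (norm_nonneg _) (by positivity))
    (by positivity) (by positivity)).trans ?_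
  have e1 : x ^ α = x * x ^ (-(1 - α)) := by
    rw [show -(1 - α) = α - 1 by ring, Real.rpow_sub_one hx.ne']; field_simp
  have e2 : majorant (1 - α) (rate μ m * u) = (1 + x ^ (-(1 - α))) * Real.exp (-x / 2) := by
    rw [majorant, hxa]
  have e3 : Real.exp ((2 * μ + 1) * |u|) * Real.exp |u| * Real.exp (-x) ≤ Real.exp (-x / 2) := by
    have : Real.exp (-x / 2) = Real.exp (x / 2) * Real.exp (-x) := by
      rw [← Real.exp_add]; ring_nf
    rw [this, ← Real.exp_add]
    refine mul_le_mul_of_nonneg_right ?_ (Real.exp_pos _).le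
    refine le_trans (le_of_eq ?_) hex
    ring_nf
  rw [e2, e1]
  have e4 : A * Real.exp ((2 * μ + 1) * |u|) *
      ((1 + 2 * μ) * (1 + θ) * (x * x ^ (-(1 - α)) + x)) *
      ((1 + 2 * μ) * (1 + θ) * Real.exp |u| * (Real.exp (-x) / (2 * x))) =
      A * (1 + 2 * μ) ^ 2 * (1 + θ) ^ 2 * ((1 + x ^ (-(1 - α))) / 2) *
        (Real.exp ((2 * μ + 1) * |u|) * Real.exp |u| * Real.exp (-x)) := by
    field_simp; ring
  rw [e4]
  have hpw : 0 ≤ x ^ (-(1 - α)) := Real.rpow_nonneg hx.le _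
  refine (mul_le_mul_of_nonneg_left e3 (by positivity)).trans ?_
  rw [mul_assoc]
  refine mul_le_mul_of_nonneg_left ?_ (by positivity)
  exact mul_le_mul_of_nonneg_right (by linarith) (Real.exp_pos (-x / 2)).le

/-- Hölder continuity turns the `1/|u|` of the kernel into `|u|^{α-1}`. The majorant is crude in
`θ`, which is harmless: it serves integrability and holomorphy at fixed `θ`, not the weighted
bounds. -/
theorem Cls.integrable_opJ {A : ℝ} {f : ℝ → ℂ} (h : Cls α 0 0 A f) (hα0 : 0 < α)
    (hα1 : α ≤ 1) (hμ : 1 / 2 < μ) (hm : Large μ m) (hp : Sym μ α p) (hθ : 0 < θ) :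
    Integrable (fun u => hat μ f θ u * (symZ p θ u * ker p m θ u)) := by
  have hμ0 : 0 < μ := by linarith
  refine integrable_of_le_majorant (β := 1 - α) (by linarith) (rate_pos hμ0 (hm.pos hμ0)) ?_
    (fun u hu => h.opJ_integrand_le hα0 hα1 hμ hm hp hθ hu)
  exact ((h.continuous_hat hθ).measurable.mul ((hp.continuous_symZ hθ).measurable.mul
    (hp.measurable_ker hθ))).aestronglyMeasurable

/-- Version for kernels with the `|u|^{-1/2}` singularity. The exponential factors from dilation are
absorbed by part of the decay of `L`, as `m` is large. -/
theorem opN_integrand_le {K w : ℝ} {G L : ℂ} (hw : 0 ≤ w)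
    (hm : Large μ m) (hμ : 1 / 2 < μ) {u : ℝ} (hu : u ≠ 0)
    (hk : K ≤ 20) (hG : ‖G‖ ≤ w * Real.exp (K * |u|))
    (hL : ‖L‖ ≤ 2 * ((rate μ m * |u|) ^ (-(1 / 2) : ℝ) * Real.exp (-(3 / 2 * (rate μ m * |u|))))) :
    ‖(Real.exp ((1 - 2 * μ) * u) : ℂ) * G * L‖ ≤ 2 * w * majorant (1 / 2) (rate μ m * u) := by
  have hμ0 : 0 < μ := by linarith
  have hx : 0 < rate μ m * |u| := mul_pos (rate_pos hμ0 (hm.pos hμ0)) (abs_pos.2 hu)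
  have hxa : |rate μ m * u| = rate μ m * |u| := by
    rw [abs_mul, abs_of_pos (rate_pos hμ0 (hm.pos hμ0))]
  have hex := hm.exp_le (k := 2 * μ + K) (by linarith) u
  have hmaj := rpow_mul_exp_le_majorant (1 / 2) (rate μ m * u)
  rw [hxa] at hmaj
  set x := rate μ m * |u|
  rw [norm_mul, norm_mul]
  refine (mul_le_mul (mul_le_mul (norm_expfac_le hμ u) hG (norm_nonneg _) (Real.exp_pos _).le) hL
    (norm_nonneg _) (by positivity)).trans ?_
  have e1 : Real.exp (2 * μ * |u|) * (w * Real.exp (K * |u|)) *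
      (2 * (x ^ (-(1 / 2) : ℝ) * Real.exp (-(3 / 2 * x)))) =
      2 * w * (x ^ (-(1 / 2) : ℝ) * (Real.exp ((2 * μ + K) * |u|) * Real.exp (-(3 / 2 * x)))) := by
    rw [add_mul, Real.exp_add]; ring
  rw [e1]
  refine mul_le_mul_of_nonneg_left (le_trans ?_ hmaj) (by positivity)
  refine mul_le_mul_of_nonneg_left ?_ (Real.rpow_nonneg hx.le _)
  refine (mul_le_mul_of_nonneg_right hex (Real.exp_pos _).le).trans ?_
  rw [← Real.exp_add]
  exact Real.exp_le_exp.2 (by linarith)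

/-- Version for the variation of a kernel in `θ`, where no singularity remains and only exponential
decay is used. -/
theorem opN_integrand_le' {K w : ℝ} {G L : ℂ} (hw : 0 ≤ w)
    (hm : Large μ m) (hμ : 1 / 2 < μ) (u : ℝ) (hk : K ≤ 20)
    (hGL : ‖G‖ * ‖L‖ ≤ w * Real.exp (K * |u|) * Real.exp (-(rate μ m * |u|))) :
    ‖(Real.exp ((1 - 2 * μ) * u) : ℂ) * G * L‖ ≤ w * majorant (1 / 2) (rate μ m * u) := by
  have hμ0 : 0 < μ := by linarith
  have hxa : |rate μ m * u| = rate μ m * |u| := by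
    rw [abs_mul, abs_of_pos (rate_pos hμ0 (hm.pos hμ0))]
  have hex := hm.exp_le (k := 2 * μ + K) (by linarith) u
  have hmaj := exp_le_majorant (1 / 2) (rate μ m * u)
  rw [hxa] at hmaj
  set x := rate μ m * |u|
  rw [norm_mul, norm_mul, mul_assoc]
  refine (mul_le_mul (norm_expfac_le hμ u) hGL (by positivity) (Real.exp_pos _).le).trans ?_
  have e1 : Real.exp (2 * μ * |u|) * (w * Real.exp (K * |u|) * Real.exp (-x)) =
      w * (Real.exp ((2 * μ + K) * |u|) * Real.exp (-x)) := by
    rw [add_mul, Real.exp_add]; ring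
  rw [e1]
  refine mul_le_mul_of_nonneg_left (le_trans ?_ hmaj) hw
  refine (mul_le_mul_of_nonneg_right hex (Real.exp_pos _).le).trans ?_
  rw [← Real.exp_add]
  exact Real.exp_le_exp.2 (by linarith)

theorem Cls.integrable_kernel {A s e : ℝ} {g : ℝ → ℂ} (h : Cls α s e A g) (hs : 0 ≤ s)
    (hs' : s ≤ 20) (hμ : 1 / 2 < μ) (hm : Large μ m) (hθ : 0 < θ) {L : ℝ → ℂ}
    (hLm : AEStronglyMeasurable L) (hL : ∀ u, u ≠ 0 → ‖L u‖ ≤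
      2 * ((rate μ m * |u|) ^ (-(1 / 2) : ℝ) * Real.exp (-(3 / 2 * (rate μ m * |u|))))) :
    Integrable (fun u => (Real.exp ((1 - 2 * μ) * u) : ℂ) * g (θ * Real.exp u) * L u) := by
  have hμ0 : 0 < μ := by linarith
  refine integrable_of_le_majorant (β := 1 / 2) (by norm_num) (rate_pos hμ0 (hm.pos hμ0)) ?_
    (fun u hu => opN_integrand_le (w := A * (1 + θ) ^ (-s)) (K := s)
      (mul_nonneg h.nonneg (weight_pos hθ).le) hm hμ hu hs'
      (h.bd_exp hs hθ u) (hL u hu))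
  exact ((continuous_expfac μ).mul (h.cont_exp hθ)).aestronglyMeasurable.mul hLm

theorem Cls.integrable_opN {A s e : ℝ} {g : ℝ → ℂ} (h : Cls α s e A g) (hs : 0 ≤ s) (hs' : s ≤ 20)
    (hμ : 1 / 2 < μ) (hm : Large μ m) (hp : Sym μ α p) (hθ : 0 < θ) :
    Integrable (fun u => (Real.exp ((1 - 2 * μ) * u) : ℂ) * g (θ * Real.exp u) *
      kerL p m θ u) := by
  have hμ0 : 0 < μ := by linarith
  exact h.integrable_kernel hs hs' hμ hm hθ (hp.measurable_kerL hθ).aestronglyMeasurable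
    fun u hu => hp.norm_kerL_le hμ0 hθ (hm.pos hμ0) hu

/-- Constant in the bound of `opN`. -/
def conN (μ : ℝ) : ℝ := (4 + 4 / μ) * majC (1 / 2) * (4 / μ)

theorem conN_nonneg (hμ : 0 < μ) : 0 ≤ conN μ := by
  have := majC_nonneg (1 / 2); unfold conN; positivity

/-- Stated for an abstract kernel so as to serve both the logarithm and the dilogarithm. In the
Hölder bound the variation falls either on the density or on the kernel. -/
theorem Cls.kernel_bound {A : ℝ} {g : ℝ → ℂ} (h : Cls α (1 + α) (1 + α) A g) (hα0 : 0 < α)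
    (hα1 : α ≤ 1) (hμ : 1 / 2 < μ) (hm : Large μ m) {L : ℝ → ℝ → ℂ}
    (hLm : ∀ θ, 0 < θ → AEStronglyMeasurable (L θ))
    (hL : ∀ θ, 0 < θ → ∀ u, u ≠ 0 → ‖L θ u‖ ≤
      2 * ((rate μ m * |u|) ^ (-(1 / 2) : ℝ) * Real.exp (-(3 / 2 * (rate μ m * |u|)))))
    (hLs : ∀ θ₂ θ₁, 0 < θ₂ → θ₂ < θ₁ → θ₁ ≤ θ₂ + 1 → ∀ u, u ≠ 0 → ‖L θ₁ u - L θ₂ u‖ ≤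
      4 / μ * (θ₁ - θ₂) ^ α * Real.exp |u| * Real.exp (-(rate μ m * |u|))) :
    EB α (conN μ * A / m)
      (fun θ => ∫ u, (Real.exp ((1 - 2 * μ) * u) : ℂ) * g (θ * Real.exp u) * L θ u) := by
  have hμ0 : 0 < μ := by linarith
  have hm0 := hm.pos hμ0
  have hr := rate_pos hμ0 hm0
  have hA := h.nonneg
  have hM := majC_nonneg (1 / 2)
  constructor
  · intro θ hθ
    have hw : 0 < (1 + θ) ^ (-(1 + α)) := weight_pos hθ
    refine (norm_integral_le_majorant (β := 1 / 2) (by norm_num) hr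
      (fun u hu => opN_integrand_le (w := A * (1 + θ) ^ (-(1 + α))) (K := 1 + α) (by positivity)
        hm hμ hu (by linarith) (h.bd_exp (by linarith) hθ u)
        (hL θ hθ u hu))).trans ?_
    unfold conN rate
    have e1 : 2 * (A * (1 + θ) ^ (-(1 + α))) * majC (1 / 2) / (μ / 4 * m) =
      2 * majC (1 / 2) * (4 / μ) * A / m * (1 + θ) ^ (-(1 + α)) := by field_simp
    rw [e1]
    gcongr
    linarith [show 0 < 4 / μ by positivity]
  · intro θ₂ θ₁ h2 h12 h1
    have hθ₁ := h2.trans h12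
    have hw : 0 < (1 + θ₂) ^ (-(1 + α)) := weight_pos h2
    have hd : 0 ≤ (θ₁ - θ₂) ^ α := Real.rpow_nonneg (by linarith) _
    rw [← integral_sub
      (h.integrable_kernel (by linarith) (by linarith) hμ hm hθ₁ (hLm θ₁ hθ₁) (hL θ₁ hθ₁))
      (h.integrable_kernel (by linarith) (by linarith) hμ hm h2 (hLm θ₂ h2) (hL θ₂ h2))]
    set W := A * (1 + θ₂) ^ (-(1 + α)) * (θ₁ - θ₂) ^ α with hW
    have hW0 : 0 ≤ W := by positivity
    refine (norm_integral_le_majorant (B := (4 + 4 / μ) * W) (β := 1 / 2) (by norm_num) hr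
      (fun u hu => ?_)).trans ?_
    · have e1 : ∀ E g1 g2 L1 L2 : ℂ, E * g1 * L1 - E * g2 * L2 =
        E * (g1 - g2) * L1 + E * g2 * (L1 - L2) := by intros; ring
      rw [e1, add_mul, add_mul]
      refine (norm_add_le _ _).trans (add_le_add ?_ ?_)
      · refine (opN_integrand_le (w := 2 * W) (K := 1 + α + 1) (by positivity) hm hμ hu
          (by linarith) ?_ (hL θ₁ hθ₁ u hu)).trans (le_of_eq (by ring))
        refine (h.shift (by linarith) hα0 hα1 h2 h12 h1.le u).trans (le_of_eq ?_)
        rw [hW]; ring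
      · refine opN_integrand_le' (K := 1 + α + 1) (by positivity) hm hμ u (by linarith) ?_
        refine (mul_le_mul (h.bd_exp (by linarith) h2 u)
          (hLs θ₂ θ₁ h2 h12 h1.le u hu) (norm_nonneg _)
          (by positivity)).trans (le_of_eq ?_)
        rw [hW, add_mul (1 + α) 1, one_mul, Real.exp_add]; ring
    · rw [hW]; unfold conN rate
      refine le_of_eq ?_
      field_simp

theorem Cls.opN_bound {A : ℝ} {g : ℝ → ℂ} (h : Cls α (1 + α) (1 + α) A g) (hα0 : 0 < α)
    (hα1 : α ≤ 1) (hμ : 1 / 2 < μ) (hm : Large μ m) (hp : Sym μ α p) :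
    EB α (conN μ * A / m) (opN μ p m g) := by
  have hμ0 : 0 < μ := by linarith
  have hm0 := hm.pos hμ0
  exact h.kernel_bound hα0 hα1 hμ hm (fun θ hθ => (hp.measurable_kerL hθ).aestronglyMeasurable)
    (fun θ hθ u hu => hp.norm_kerL_le hμ0 hθ hm0 hu)
    (fun θ₂ θ₁ h2 h12 h1 u hu => hp.kerL_shift hμ0 hα0 hα1 hm0 h2 h12 h1 hu)

theorem tendsto_exp_neg_abs_atTop : Tendsto (fun u : ℝ => Real.exp (-|u|)) atTop (𝓝 0) :=
  Real.tendsto_exp_neg_atTop_nhds_zero.comp tendsto_abs_atTop_atTop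

theorem tendsto_exp_neg_abs_atBot : Tendsto (fun u : ℝ => Real.exp (-|u|)) atBot (𝓝 0) :=
  Real.tendsto_exp_neg_atTop_nhds_zero.comp tendsto_abs_atBot_atTop

theorem hasDerivAt_hat {f f' : ℝ → ℂ} (hf : ∀ t, 0 < t → HasDerivAt f (f' t) t) (hθ : 0 < θ)
    (u : ℝ) : HasDerivAt (hat μ f θ) ((Real.exp ((1 - 2 * μ) * u) : ℂ) *
      ((1 - 2 * μ) * f (θ * Real.exp u) + (θ * Real.exp u : ℝ) * f' (θ * Real.exp u))) u := by
  have h1 : HasDerivAt (fun v : ℝ => θ * Real.exp v) (θ * Real.exp u) u :=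
    (Real.hasDerivAt_exp u).const_mul θ
  have h2 := (hf (θ * Real.exp u) (by positivity)).scomp u h1
  have h3 : HasDerivAt (fun v : ℝ => Real.exp ((1 - 2 * μ) * v))
      (Real.exp ((1 - 2 * μ) * u) * (1 - 2 * μ)) u := by
    have := ((hasDerivAt_id u).const_mul (1 - 2 * μ)).exp
    simpa using this
  have h4 := (h3.ofReal_comp.mul h2).sub_const (f θ)
  refine h4.congr_deriv ?_
  simp only [Function.comp, Complex.real_smul]; push_cast; ring

/-- Integration by parts with antiderivative `-(1/m) log(1-q)` of `∂_u P · ker`. The function `g` is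
what `∂_u(e^{(1-2μ)u} f(θe^u))` leaves after removing the exponential factor. -/
theorem opJ_eq_opN {A A' : ℝ} {f f' g : ℝ → ℂ} (h : Cls α 0 0 A f)
    (hf : ∀ t, 0 < t → HasDerivAt f (f' t) t)
    (hg : Cls α 0 0 A' g) (hgf : ∀ t : ℝ, 0 < t → g t = (1 - 2 * μ) * f t + t * f' t)
    (hα0 : 0 < α) (hα1 : α ≤ 1) (hμ : 1 / 2 < μ) (hm : Large μ m) (hp : Sym μ α p)
    (hθ : 0 < θ) : opJ μ p m f θ = (1 / m : ℝ) * opN μ p m g θ := by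
  have hμ0 : 0 < μ := by linarith
  have hm0 := hm.pos hμ0
  have hr := hm.rate_ge hμ0
  have i1 := h.integrable_opJ hα0 hα1 hμ hm hp hθ
  have i2 := hg.integrable_opN le_rfl (by norm_num) hμ hm hp hθ
  have hhat : ∀ u, HasDerivAt (hat μ f θ)
      ((Real.exp ((1 - 2 * μ) * u) : ℂ) * g (θ * Real.exp u)) u := fun u => by
    rw [hgf _ (by positivity)]; exact hasDerivAt_hat hf hθ u
  have hD : ∀ u, u ≠ 0 → HasDerivAt (fun u => hat μ f θ u * kerL p m θ u)
      ((Real.exp ((1 - 2 * μ) * u) : ℂ) * g (θ * Real.exp u) * kerL p m θ u -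
        m * (hat μ f θ u * (symZ p θ u * ker p m θ u))) u := fun u hu => by
    refine ((hhat u).mul (hp.hasDerivAt_kerL hμ0 hθ hm0 hu)).congr_deriv ?_
    ring
  -- The increment vanishes linearly at the origin, while the logarithmic kernel is at most of order
  -- `|u|^{-1/2}`; so there is no boundary term at `u = 0`.
  have hz : Tendsto (fun u => hat μ f θ u * kerL p m θ u) (𝓝[≠] 0) (𝓝 0) := by
    have hO := (hhat 0).differentiableAt.isBigO_sub
    have h0 : hat μ f θ 0 = 0 := by simp [hat]
    simp only [h0, sub_zero] at hO
    obtain ⟨c, hc0, hc⟩ := hO.exists_pos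
    have hb : ∀ᶠ u in 𝓝[≠] (0 : ℝ), ‖hat μ f θ u * kerL p m θ u‖ ≤ 2 * c * |u| ^ (1 / 2 : ℝ) := by
      filter_upwards [nhdsWithin_le_nhds hc.bound, self_mem_nhdsWithin] with u h1 hu
      have hu' : 0 < |u| := abs_pos.2 hu
      rw [norm_mul]
      have h2 := hp.norm_kerL_le hμ0 hθ hm0 hu
      have h3 : (rate μ m * |u|) ^ (-(1 / 2) : ℝ) ≤ |u| ^ (-(1 / 2) : ℝ) :=
        Real.rpow_le_rpow_of_nonpos hu' (le_mul_of_one_le_left hu'.le hr) (by norm_num)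
      have h4 : Real.exp (-(3 / 2 * (rate μ m * |u|))) ≤ 1 := Real.exp_le_one_iff.2
        (by have := mul_pos (rate_pos hμ0 hm0) hu'; linarith)
      have h5 : ‖kerL p m θ u‖ ≤ 2 * |u| ^ (-(1 / 2) : ℝ) := by
        refine h2.trans (mul_le_mul_of_nonneg_left ?_ zero_le_two)
        exact (mul_le_mul h3 h4 (Real.exp_pos _).le (by positivity)).trans (le_of_eq (mul_one _))
      refine (mul_le_mul h1 h5 (norm_nonneg _) (by positivity)).trans (le_of_eq ?_)
      rw [Real.norm_eq_abs]
      have h6 : |u| * |u| ^ (-(1 / 2) : ℝ) = |u| ^ (1 / 2 : ℝ) := by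
        rw [← Real.rpow_one_add' hu'.le (by norm_num)]; norm_num
      rw [← h6]; ring
    refine squeeze_zero_norm' hb ?_
    have : Tendsto (fun u : ℝ => 2 * c * |u| ^ (1 / 2 : ℝ)) (𝓝 0) (𝓝 (2 * c * |0| ^ (1 / 2 : ℝ))) :=
      ((continuous_abs.rpow_const fun _ => Or.inr (by norm_num)).const_mul (2 * c)).tendsto 0
    simp only [abs_zero] at this
    rw [Real.zero_rpow (by norm_num), mul_zero] at this
    exact this.mono_left nhdsWithin_le_nhds
  have hinf : ∀ u : ℝ, 1 ≤ |u| → ‖hat μ f θ u * kerL p m θ u‖ ≤ 4 * A * Real.exp (-|u|) := by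
    intro u hu
    have hu0 : u ≠ 0 := by rintro rfl; norm_num at hu
    have hA := h.nonneg
    rw [norm_mul]
    have b1 : ‖hat μ f θ u‖ ≤ 2 * A * Real.exp (2 * μ * |u|) := by
      unfold hat
      refine (norm_sub_le _ _).trans ?_
      rw [norm_mul]
      have c1 := mul_le_mul (norm_expfac_le hμ u) (h.bd (θ * Real.exp u) (by positivity))
        (norm_nonneg _) (Real.exp_pos _).le
      have c2 := h.bd θ hθ
      simp only [neg_zero, Real.rpow_zero, mul_one] at c1 c2
      have c3 : 1 ≤ Real.exp (2 * μ * |u|) := Real.one_le_exp (by positivity)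
      nlinarith
    have b2 := hp.norm_kerL_le hμ0 hθ hm0 hu0
    have hx1 : |u| ≤ rate μ m * |u| := le_mul_of_one_le_left (abs_nonneg _) hr
    have b3 : (rate μ m * |u|) ^ (-(1 / 2) : ℝ) ≤ 1 :=
      Real.rpow_le_one_of_one_le_of_nonpos (by linarith) (by norm_num)
    have hex := hm.exp_le (k := 2 * μ) (by linarith) u
    set x := rate μ m * |u|
    refine (mul_le_mul (b1.trans (mul_le_mul_of_nonneg_left hex (by positivity)))
      (b2.trans (mul_le_mul_of_nonneg_left (mul_le_mul_of_nonneg_right b3 (Real.exp_pos _).le)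
        zero_le_two)) (norm_nonneg _) (by positivity)).trans ?_
    have e1 : 2 * A * Real.exp (x / 2) * (2 * (1 * Real.exp (-(3 / 2 * x)))) =
        4 * A * (Real.exp (x / 2) * Real.exp (-(3 / 2 * x))) := by ring
    rw [e1, ← Real.exp_add]
    refine mul_le_mul_of_nonneg_left (Real.exp_le_exp.2 (by linarith)) (by positivity)
  have key := integral_eq_jump hD (i2.sub (i1.const_mul (m : ℂ)))
    (hz.mono_left (nhdsWithin_mono _ fun x hx => ne_of_gt hx))
    (hz.mono_left (nhdsWithin_mono _ fun x hx => ne_of_lt hx))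
    (squeeze_zero_norm' ((eventually_ge_atTop 1).mono fun u hu => hinf u (hu.trans (le_abs_self u)))
      (by simpa using tendsto_exp_neg_abs_atTop.const_mul (4 * A)))
    (squeeze_zero_norm' ((eventually_le_atBot (-1)).mono fun u hu => hinf u
      (by linarith [neg_le_abs u])) (by simpa using tendsto_exp_neg_abs_atBot.const_mul (4 * A)))
  rw [integral_sub i2 (i1.const_mul (m : ℂ)), integral_const_mul, sub_zero] at key
  have key' : opN μ p m g θ = m * opJ μ p m f θ := sub_eq_zero.1 key
  rw [key', ← mul_assoc, ← Complex.ofReal_mul, one_div, inv_mul_cancel₀ hm0.ne',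
    Complex.ofReal_one, one_mul]

end KadenSpiral
end

/-! ### Averaging over unit intervals. -/

noncomputable section
namespace KadenSpiral

/-- Averages over unit intervals. -/
def avg (f : ℝ → ℂ) (t : ℝ) : ℂ := ∫ σ in (0 : ℝ)..1, f (t + σ)

namespace Cls

variable {α s e A : ℝ} {f : ℝ → ℂ}

theorem translate (h : Cls α s e A f) (hs : 0 ≤ s) (he : 0 ≤ e) {σ : ℝ} (hσ : 0 ≤ σ) :
    Cls α s e A (fun t => f (t + σ)) where
  cont := h.cont.comp (by fun_prop) fun t (ht : 0 < t) => by simp only [mem_Ioi]; linarith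
  bd t ht := (h.bd (t + σ) (by linarith)).trans
    (mul_le_mul_of_nonneg_left (weight_anti hs ht (by linarith)) h.nonneg)
  hol t' t ht' hlt := by
    have := h.hol (t' + σ) (t + σ) (by linarith) (by linarith)
    rw [add_sub_add_right_eq_sub] at this
    exact this.trans (mul_le_mul_of_nonneg_right (mul_le_mul_of_nonneg_left
      (weight_anti he ht' (by linarith)) h.nonneg) (modulus_nonneg hlt))

theorem intervalIntegrable_translate (h : Cls α s e A f) {t : ℝ} (ht : 0 < t) :
    IntervalIntegrable (fun σ => f (t + σ)) volume 0 1 := by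
  refine ContinuousOn.intervalIntegrable (h.cont.comp (by fun_prop) fun σ hσ => ?_)
  rw [uIcc_of_le zero_le_one] at hσ
  simp only [mem_Ioi]; linarith [hσ.1]

/-- The derivative of the average is a unit increment of `f`, so its decay is that of the Hölder
weight of `f`, better than the decay of `f` itself. -/
theorem hasDerivAt_avg (h : Cls α s e A f) {t : ℝ} (ht : 0 < t) :
    HasDerivAt (avg f) (f (t + 1) - f t) t := by
  have hii : ∀ a b, 0 < a → 0 < b → IntervalIntegrable f volume a b := fun a b ha hb =>
    ContinuousOn.intervalIntegrable (h.cont.mono fun x hx => by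
      exact lt_of_lt_of_le (lt_min ha hb) hx.1)
  have hca : ∀ a, 0 < a → ContinuousAt f a := fun a ha => h.cont.continuousAt (Ioi_mem_nhds ha)
  have hsm : ∀ a, 0 < a → StronglyMeasurableAtFilter f (𝓝 a) := fun a ha =>
    h.cont.stronglyMeasurableAtFilter isOpen_Ioi a ha
  have h1 := intervalIntegral.integral_hasDerivAt_right (hii (t / 2) (t + 1) (by linarith)
    (by linarith)) (hsm _ (by linarith)) (hca (t + 1) (by linarith))
  have h2 := intervalIntegral.integral_hasDerivAt_right (hii (t / 2) t (by linarith) ht)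
    (hsm _ ht) (hca t ht)
  have h3 := (h1.comp_add_const t 1).sub h2
  refine h3.congr_of_eventuallyEq ?_
  filter_upwards [Ioi_mem_nhds ht] with v (hv : 0 < v)
  rw [avg, intervalIntegral.integral_comp_add_left f v, add_zero]
  simp only [Pi.sub_apply]
  rw [intervalIntegral.integral_interval_sub_left (hii _ _ (by linarith) (by linarith))
    (hii _ _ (by linarith) (by linarith))]

theorem avg_cls (h : Cls α s e A f) (hs : 0 ≤ s) (he : 0 ≤ e) : Cls α s e A (avg f) where
  cont t ht := (h.hasDerivAt_avg ht).continuousAt.continuousWithinAt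
  bd t ht := by
    have := intervalIntegral.norm_integral_le_of_norm_le_const (a := (0 : ℝ)) (b := 1)
      (f := fun σ => f (t + σ)) (C := A * (1 + t) ^ (-s)) fun σ hσ => by
        rw [uIoc_of_le zero_le_one] at hσ
        exact (h.translate hs he hσ.1.le).bd t ht
    simpa [avg] using this
  hol t' t ht' hlt := by
    unfold avg
    rw [← intervalIntegral.integral_sub (h.intervalIntegrable_translate (ht'.trans hlt))
      (h.intervalIntegrable_translate ht')]
    have := intervalIntegral.norm_integral_le_of_norm_le_const (a := (0 : ℝ)) (b := 1)
      (f := fun σ => f (t + σ) - f (t' + σ))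
      (C := A * (1 + t') ^ (-e) * ((t - t') ^ α + (t - t'))) fun σ hσ => by
        rw [uIoc_of_le zero_le_one] at hσ
        exact (h.translate hs he hσ.1.le).hol t' t ht' hlt
    simpa using this

/-- The remainder is an average of increments of length at most one; its decay exponent is thus
raised from `s` to the Hölder exponent `e`. -/
theorem sub_avg_cls (h : Cls α s e A f) (hα0 : 0 < α) (hs : 0 ≤ s) (he : 0 ≤ e) :
    Cls α e e (2 * A) (fun t => f t - avg f t) where
  cont := h.cont.sub (h.avg_cls hs he).cont
  bd t ht := by
    have e1 : f t - avg f t = ∫ σ in (0 : ℝ)..1, (f t - f (t + σ)) := by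
      rw [intervalIntegral.integral_sub (by simp) (h.intervalIntegrable_translate ht)]
      simp [avg]
    rw [e1]
    have := intervalIntegral.norm_integral_le_of_norm_le_const (a := (0 : ℝ)) (b := 1)
      (f := fun σ => f t - f (t + σ)) (C := 2 * A * (1 + t) ^ (-e)) fun σ hσ => by
        rw [uIoc_of_le zero_le_one] at hσ
        rw [norm_sub_rev]
        refine (h.hol t (t + σ) ht (by linarith [hσ.1])).trans ?_
        rw [add_sub_cancel_left]
        have h1 : σ ^ α ≤ 1 := Real.rpow_le_one hσ.1.le hσ.2 hα0.le
        have h2 := mul_nonneg h.nonneg (weight_pos (s := -e) ht).le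
        nlinarith [hσ.2]
    simpa using this
  hol t' t ht' hlt := by
    have h1 := h.hol t' t ht' hlt
    have h2 := (h.avg_cls hs he).hol t' t ht' hlt
    have e1 : f t - avg f t - (f t' - avg f t') = (f t - f t') - (avg f t - avg f t') := by ring
    rw [e1]
    refine (norm_sub_le _ _).trans ?_
    linarith

theorem id_mul (h : Cls α (1 + s) (1 + s) A f) (hs : 0 ≤ s) :
    Cls α s s (2 * A) (fun t => t * f t) where
  cont := (Complex.continuous_ofReal.continuousOn).mul h.cont
  bd t ht := by
    rw [norm_mul, Complex.norm_real, Real.norm_of_nonneg ht.le]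
    have h1 := mul_le_mul_of_nonneg_left (h.bd t ht) ht.le
    rw [neg_add, Real.rpow_add (by linarith), Real.rpow_neg_one] at h1
    refine h1.trans ?_
    have hw : 0 < (1 + t) ^ (-s) := weight_pos ht
    have h2 : t * (1 + t)⁻¹ ≤ 1 := by
      rw [← div_eq_mul_inv, div_le_one (by linarith)]; linarith
    have h3 := mul_le_mul_of_nonneg_right h2 (mul_nonneg h.nonneg hw.le)
    have h4 := mul_nonneg h.nonneg hw.le
    linarith
  hol t' t ht' hlt := by
    have ht := ht'.trans hlt
    have e1 : (t : ℂ) * f t - t' * f t' = ((t - t' : ℝ) : ℂ) * f t + t' * (f t - f t') := by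
      push_cast; ring
    rw [e1]
    refine (norm_add_le _ _).trans ?_
    rw [norm_mul, norm_mul, Complex.norm_real, Complex.norm_real, Real.norm_of_nonneg ht'.le,
      Real.norm_of_nonneg (by linarith)]
    have hM : t - t' ≤ (t - t') ^ α + (t - t') := by
      linarith [Real.rpow_nonneg (show 0 ≤ t - t' by linarith) α]
    have hd : 0 ≤ t - t' := by linarith
    set M := (t - t') ^ α + (t - t')
    have hA := h.nonneg
    have hw : 0 < (1 + t') ^ (-s) := weight_pos ht'
    have b0 : (1 + t') ^ (-(1 + s)) = (1 + t')⁻¹ * (1 + t') ^ (-s) := by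
      rw [neg_add, Real.rpow_add (by linarith), Real.rpow_neg_one]
    have b1 : ‖f t‖ ≤ A * (1 + t') ^ (-s) := (h.bd t ht).trans
      (mul_le_mul_of_nonneg_left ((weight_anti (by linarith) ht' hlt.le).trans
        (weight_mono (by linarith) ht')) hA)
    have b2 : t' * ‖f t - f t'‖ ≤ A * (1 + t') ^ (-s) * M := by
      refine (mul_le_mul_of_nonneg_left (h.hol t' t ht' hlt) ht'.le).trans ?_
      rw [b0]
      have h2 : t' * (1 + t')⁻¹ ≤ 1 := by
        rw [← div_eq_mul_inv, div_le_one (by linarith)]; linarith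
      have h3 := mul_le_mul_of_nonneg_right h2
        (mul_nonneg (mul_nonneg hA hw.le) (hd.trans hM))
      refine le_trans (le_of_eq ?_) (h3.trans (le_of_eq ?_)) <;> ring
    have b3 : (t - t') * ‖f t‖ ≤ M * (A * (1 + t') ^ (-s)) :=
      mul_le_mul hM b1 (norm_nonneg _) (hd.trans hM)
    linarith

end Cls

variable {μ α : ℝ} {p : ℝ → ℂ} {m θ : ℝ}

/-- The density after integration by parts is `(1-2μ) avg f + t(f(t+1) - f(t))`. The unit increment
decays like `t^{-(2+α)}`, so multiplication by `t` still leaves the decay `1+α` required by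
`opN_bound`. The extra power of `1/m` is discarded. -/
theorem Cls.opJ_avg_bound {A : ℝ} {f : ℝ → ℂ} (h : Cls α (1 + α) (2 + α) A f) (hα0 : 0 < α)
    (hα1 : α ≤ 1) (hμ : 1 / 2 < μ) (hm : Large μ m) (hp : Sym μ α p) :
    EB α (conN μ * (2 * μ + 8) * A / m) (opJ μ p m (avg f)) := by
  have hμ0 : 0 < μ := by linarith
  have hA := h.nonneg
  have hav := h.avg_cls (by linarith) (by linarith)
  have hdiff : Cls α (1 + (1 + α)) (1 + (1 + α)) (2 * A) (fun t => f (t + 1) - f t) := by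
    have h1 : Cls α (1 + α) (2 + α) (2 * A) (fun t => f (t + 1) - f t) :=
      ((h.translate (by linarith) (by linarith) zero_le_one).sub h).mono le_rfl le_rfl
        (by linarith)
    refine ⟨h1.cont, fun t ht => ?_, fun t' t ht' hlt => ?_⟩
    · refine (h.hol t (t + 1) ht (by linarith)).trans (le_of_eq ?_)
      rw [add_sub_cancel_left, Real.one_rpow]; ring_nf
    · refine (h1.hol t' t ht' hlt).trans (le_of_eq ?_)
      ring_nf
  have hg := (((hav.mono (le_refl (1 + α)) (by linarith : 1 + α ≤ 2 + α) le_rfl).const_mul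
    ((1 - 2 * μ : ℝ) : ℂ)).add (hdiff.id_mul (by linarith)))
  have hn : ‖((1 - 2 * μ : ℝ) : ℂ)‖ ≤ 2 * μ := by
    rw [Complex.norm_real, Real.norm_eq_abs, abs_of_neg (by linarith)]; linarith
  have hg' : Cls α (1 + α) (1 + α) ((2 * μ + 8) * A)
      (fun t => ((1 - 2 * μ : ℝ) : ℂ) * avg f t + t * (f (t + 1) - f t)) := by
    refine hg.mono le_rfl le_rfl ?_
    nlinarith
  have hb := (hg'.opN_bound hα0 hα1 hμ hm hp).const_mul ((1 / m : ℝ) : ℂ)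
  have h1m := hm.one_le hμ0
  refine (hb.mono ?_).congr fun θ hθ => opJ_eq_opN
    (hav.mono (by linarith) (by linarith) le_rfl) (fun t ht => h.hasDerivAt_avg ht)
    (hg'.mono (by linarith) (by linarith) le_rfl) (fun t ht => by push_cast; rfl) hα0 hα1 hμ hm
    hp hθ
  rw [Complex.norm_real, Real.norm_of_nonneg (by positivity)]
  have hc := conN_nonneg hμ0
  have : 1 / m ≤ 1 := by rw [div_le_one (by linarith)]; exact h1m
  rw [← mul_assoc]
  exact mul_le_of_le_one_left (by positivity) this

theorem hat_add (f g : ℝ → ℂ) (u : ℝ) :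
    hat μ (fun t => f t + g t) θ u = hat μ f θ u + hat μ g θ u := by unfold hat; ring

theorem opJ_add {A A' : ℝ} {f g : ℝ → ℂ} (hf : Cls α 0 0 A f) (hg : Cls α 0 0 A' g)
    (hα0 : 0 < α) (hα1 : α ≤ 1) (hμ : 1 / 2 < μ) (hm : Large μ m) (hp : Sym μ α p)
    (hθ : 0 < θ) :
    opJ μ p m (fun t => f t + g t) θ = opJ μ p m f θ + opJ μ p m g θ := by
  unfold opJ
  rw [← integral_add (hf.integrable_opJ hα0 hα1 hμ hm hp hθ)
    (hg.integrable_opJ hα0 hα1 hμ hm hp hθ)]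
  simp only [hat_add, add_mul]

theorem opJ_const_mul (c : ℂ) (f : ℝ → ℂ) :
    opJ μ p m (fun t => c * f t) θ = c * opJ μ p m f θ := by
  unfold opJ
  rw [← integral_const_mul]
  refine integral_congr_ae (Eventually.of_forall fun u => ?_)
  simp only [hat]; ring

theorem opJ_congr {f g : ℝ → ℂ} (h : ∀ t, 0 < t → f t = g t) (hθ : 0 < θ) :
    opJ μ p m f θ = opJ μ p m g θ := by
  unfold opJ
  refine integral_congr_ae (Eventually.of_forall fun u => ?_)
  simp only [hat]
  rw [h _ hθ, h _ (by positivity)]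

/-! ### Hölder bound for the truncated Hilbert transform. -/

/-- The truncated Hilbert transform preserves Hölder continuity. -/
theorem hilbert_hoelder {f : ℝ → ℂ} (hf : Continuous f) {M l y₁ y₂ : ℝ} (hα0 : 0 < α)
    (hα1 : α < 1) (hM : 0 ≤ M) (h12 : y₂ < y₁) (h1 : y₁ ≤ y₂ + l)
    (hh : ∀ x x', y₂ - l ≤ x → x ≤ y₁ + l → y₂ - l ≤ x' → x' ≤ y₁ + l →
      ‖f x - f x'‖ ≤ M * |x - x'| ^ α) :
    ‖∫ u in (0 : ℝ)..l, ((f (y₁ + u) - f (y₁ - u)) - (f (y₂ + u) - f (y₂ - u))) / u‖ ≤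
      (8 / α + 9 / (1 - α)) * M * (y₁ - y₂) ^ α := by
  set a := y₁ - y₂ with ha
  have ha0 : 0 < a := by linarith
  have hal : a ≤ l := by linarith
  set F : ℝ → ℂ := fun u => ((f (y₁ + u) - f (y₁ - u)) - (f (y₂ + u) - f (y₂ - u))) / u with hF
  have hFb : ∀ u, 0 < u → u ≤ l → ‖F u‖ ≤ 4 * M * u ^ (α - 1) := by
    intro u hu hul
    have b : ∀ y, y₂ ≤ y → y ≤ y₁ → ‖f (y + u) - f (y - u)‖ ≤ 2 * M * u ^ α := by
      intro y hy hy'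
      refine (hh _ _ (by linarith) (by linarith) (by linarith) (by linarith)).trans ?_
      rw [show y + u - (y - u) = 2 * u by ring, abs_of_pos (by linarith),
        Real.mul_rpow zero_le_two hu.le]
      have h2 : (2 : ℝ) ^ α ≤ 2 := by
        have := Real.rpow_le_rpow_of_exponent_le one_le_two hα1.le
        simpa using this
      have h3 : 0 ≤ M * u ^ α := by positivity
      nlinarith
    rw [hF]
    simp only [norm_div, Complex.norm_real, Real.norm_of_nonneg hu.le]
    rw [div_le_iff₀ hu, mul_assoc, Real.rpow_sub_one hu.ne', div_mul_cancel₀ _ hu.ne']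
    refine (norm_sub_le _ _).trans ?_
    linarith [b y₁ h12.le le_rfl, b y₂ le_rfl h12.le]
  have hFc : ∀ c d, 0 < c → 0 < d → IntervalIntegrable F volume c d := by
    intro c d hc hd
    refine ContinuousOn.intervalIntegrable (ContinuousOn.div (by fun_prop) (by fun_prop) ?_)
    intro u hu
    have : 0 < u := lt_of_lt_of_le (lt_min hc hd) hu.1
    exact_mod_cast this.ne'
  have hpow : ∀ b, 0 ≤ b → IntervalIntegrable (fun u : ℝ => 4 * M * u ^ (α - 1)) volume 0 b :=
    fun b hb => (intervalIntegral.intervalIntegrable_rpow' (by linarith)).const_mul _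
  have hFm : Measurable F := by
    have := hf.measurable
    simp only [hF]
    fun_prop
  have hF0 : ∀ b, 0 ≤ b → b ≤ l → IntervalIntegrable F volume 0 b := by
    intro b hb hbl
    refine (hpow b hb).mono_fun' hFm.aestronglyMeasurable ?_
    rw [uIoc_of_le hb]
    exact (ae_restrict_iff' measurableSet_Ioc).2
      (Eventually.of_forall fun u hu => hFb u hu.1 (hu.2.trans hbl))
  -- On scales up to twice the increment `a`, no cancellation between the two base points is used:
  -- the bound by `u^{α-1}` integrates to `a^α`.
  have hnear : ∀ b, 0 ≤ b → b ≤ l → b ≤ 2 * a → ‖∫ u in (0 : ℝ)..b, F u‖ ≤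
      8 / α * M * a ^ α := by
    intro b hb hbl hba
    have h2 := intervalIntegral.norm_integral_le_of_norm_le hb (f := F)
      (Eventually.of_forall fun u hu => hFb u hu.1 (hu.2.trans hbl)) (hpow b hb)
    refine h2.trans ?_
    rw [intervalIntegral.integral_const_mul, integral_rpow (Or.inl (by linarith)),
      sub_add_cancel, Real.zero_rpow hα0.ne', sub_zero]
    have h3 : b ^ α ≤ 2 * a ^ α := by
      refine (Real.rpow_le_rpow hb hba hα0.le).trans ?_
      rw [Real.mul_rpow zero_le_two ha0.le]
      refine mul_le_mul_of_nonneg_right ?_ (Real.rpow_nonneg ha0.le _)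
      simpa using Real.rpow_le_rpow_of_exponent_le one_le_two hα1.le
    have h4 : 4 * M * (b ^ α / α) ≤ 4 * M * (2 * a ^ α / α) := by gcongr
    refine h4.trans (le_of_eq ?_)
    field_simp; ring
  have hconst : 0 ≤ 9 / (1 - α) * M * a ^ α := by
    have : 0 < 1 - α := by linarith
    positivity
  rcases le_total l (2 * a) with hl2 | hl2
  · refine (hnear l (by linarith) le_rfl hl2).trans ?_
    rw [add_mul, add_mul]; linarith
  · rw [← intervalIntegral.integral_add_adjacent_intervals (hF0 (2 * a) (by linarith) hl2)
      (hFc _ _ (by linarith) (by linarith)), add_mul, add_mul]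
    refine (norm_add_le _ _).trans (add_le_add (hnear _ (by linarith) hl2 le_rfl) ?_)
    set Φ : ℝ → ℂ := fun x => ∫ v in (0 : ℝ)..x, f v with hΦ
    have hΦd : ∀ x, HasDerivAt Φ (f x) x := fun x => (hf.integral_hasStrictDerivAt 0 x).hasDerivAt
    -- An antiderivative of the numerator. The constants `a f(y₁)` do not affect the derivative and
    -- make each bracket an integral of `f - f(y₁)` over an interval of length `a`, whence `|D(u)| ≤
    -- 3aM u^α`.
    set D : ℝ → ℂ := fun u => (Φ (y₁ + u) - Φ (y₂ + u) - a * f y₁) +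
      (Φ (y₁ - u) - Φ (y₂ - u) - a * f y₁) with hD
    have hDd : ∀ u, HasDerivAt D ((f (y₁ + u) - f (y₁ - u)) - (f (y₂ + u) - f (y₂ - u))) u := by
      intro u
      have d1 := (((hΦd (y₁ + u)).comp_const_add y₁ u).sub
        ((hΦd (y₂ + u)).comp_const_add y₂ u)).sub_const (a * f y₁)
      have d2 := (((hΦd (y₁ - u)).comp_const_sub y₁ u).sub
        ((hΦd (y₂ - u)).comp_const_sub y₂ u)).sub_const (a * f y₁)
      refine (d1.add d2).congr_deriv ?_
      ring
    have hpiece : ∀ c d R, c ≤ d → (∀ x, c ≤ x → x ≤ d → ‖f x - f y₁‖ ≤ R) →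
        ‖Φ d - Φ c - (d - c : ℝ) * f y₁‖ ≤ R * (d - c) := by
      intro c d R hcd hR
      have e1 : Φ d - Φ c - (d - c : ℝ) * f y₁ = ∫ x in c..d, (f x - f y₁) := by
        rw [intervalIntegral.integral_sub (hf.intervalIntegrable _ _) (by simp), hΦ]
        simp only
        rw [intervalIntegral.integral_interval_sub_left (hf.intervalIntegrable _ _)
          (hf.intervalIntegrable _ _), intervalIntegral.integral_const]
        simp
      rw [e1]
      refine (intervalIntegral.norm_integral_le_of_norm_le_const (C := R) fun x hx => ?_).trans ?_
      · rw [uIoc_of_le hcd] at hx; exact hR x hx.1.le hx.2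
      · rw [abs_of_nonneg (by linarith)]
    have hDb : ∀ u, 2 * a ≤ u → u ≤ l → ‖D u‖ ≤ 3 * a * M * u ^ α := by
      intro u hau hul
      have hu : 0 < u := by linarith
      have p1 := hpiece (y₂ + u) (y₁ + u) (M * u ^ α) (by linarith) (fun x hx hx' => by
        refine (hh x y₁ (by linarith) (by linarith) (by linarith) (by linarith)).trans ?_
        refine mul_le_mul_of_nonneg_left (Real.rpow_le_rpow (abs_nonneg _) ?_ hα0.le) hM
        rw [abs_le]; constructor <;> linarith)
      have p2 := hpiece (y₂ - u) (y₁ - u) (M * (2 * u ^ α)) (by linarith) (fun x hx hx' => by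
        refine (hh x y₁ (by linarith) (by linarith) (by linarith) (by linarith)).trans ?_
        have h2 : |x - y₁| ≤ 2 * u := by rw [abs_le]; constructor <;> linarith
        refine mul_le_mul_of_nonneg_left ((Real.rpow_le_rpow (abs_nonneg _) h2 hα0.le).trans ?_) hM
        rw [Real.mul_rpow zero_le_two hu.le]
        refine mul_le_mul_of_nonneg_right ?_ (Real.rpow_nonneg hu.le _)
        simpa using Real.rpow_le_rpow_of_exponent_le one_le_two hα1.le)
      rw [show y₁ + u - (y₂ + u) = a by rw [ha]; ring] at p1
      rw [show y₁ - u - (y₂ - u) = a by rw [ha]; ring] at p2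
      refine (norm_add_le _ _).trans ((add_le_add p1 p2).trans (le_of_eq ?_))
      ring
    have hinv : ∀ u ∈ uIcc (2 * a) l, HasDerivAt (fun v : ℝ => ((v⁻¹ : ℝ) : ℂ))
        ((-(u ^ 2)⁻¹ : ℝ) : ℂ) u := fun u hu => by
      rw [uIcc_of_le hl2] at hu
      exact (hasDerivAt_inv (by linarith [hu.1] : u ≠ 0)).ofReal_comp
    have hcinv : IntervalIntegrable (fun u : ℝ => ((-(u ^ 2)⁻¹ : ℝ) : ℂ)) volume (2 * a) l := by
      refine ContinuousOn.intervalIntegrable ?_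
      refine Complex.continuous_ofReal.comp_continuousOn ((ContinuousOn.inv₀ (by fun_prop) ?_).neg)
      intro u hu
      rw [uIcc_of_le hl2] at hu
      have : 0 < u := by linarith [hu.1]
      positivity
    -- After integration by parts the integrand is of order `a u^{α-2}`, integrable at infinity
    -- because `α < 1`, with integral over `u ≥ 2a` of order `a^α`.
    have ibp := intervalIntegral.integral_mul_deriv_eq_deriv_mul hinv (fun u _ => hDd u) hcinv
      (Continuous.intervalIntegrable (by fun_prop) _ _)
    have e1 : ∫ u in (2 * a)..l, F u = ∫ u in (2 * a)..l, ((u⁻¹ : ℝ) : ℂ) *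
        ((f (y₁ + u) - f (y₁ - u)) - (f (y₂ + u) - f (y₂ - u))) := by
      refine intervalIntegral.integral_congr fun u _ => ?_
      simp only [hF, Complex.ofReal_inv, div_eq_inv_mul]
    rw [e1, ibp]
    have hpa : a * (2 * a) ^ (α - 1) ≤ a ^ α := by
      have h2 : (2 * a) ^ (α - 1) ≤ a ^ (α - 1) :=
        Real.rpow_le_rpow_of_nonpos ha0 (by linarith) (by linarith)
      have h3 : a * a ^ (α - 1) = a ^ α := by
        rw [Real.rpow_sub_one ha0.ne']; field_simp
      rw [← h3]; exact mul_le_mul_of_nonneg_left h2 ha0.le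
    have hend : ∀ u, 2 * a ≤ u → u ≤ l → ‖((u⁻¹ : ℝ) : ℂ) * D u‖ ≤ 3 * M * a ^ α := by
      intro u hau hul
      have hu : 0 < u := by linarith
      rw [norm_mul, Complex.norm_real, Real.norm_of_nonneg (by positivity)]
      refine (mul_le_mul_of_nonneg_left (hDb u hau hul) (by positivity)).trans ?_
      have h2 : u ^ (α - 1) ≤ (2 * a) ^ (α - 1) :=
        Real.rpow_le_rpow_of_nonpos (by linarith) hau (by linarith)
      have h3 : u⁻¹ * (3 * a * M * u ^ α) = 3 * M * (a * u ^ (α - 1)) := by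
        rw [Real.rpow_sub_one hu.ne']; field_simp
      rw [h3]
      exact mul_le_mul_of_nonneg_left ((mul_le_mul_of_nonneg_left h2 ha0.le).trans hpa)
        (by positivity)
    have hint : ‖∫ u in (2 * a)..l, ((-(u ^ 2)⁻¹ : ℝ) : ℂ) * D u‖ ≤
        3 / (1 - α) * M * a ^ α := by
      have hsub : 0 < 1 - α := by linarith
      have hii : IntervalIntegrable (fun u : ℝ => 3 * a * M * u ^ (α - 2)) volume (2 * a) l :=
        (intervalIntegral.intervalIntegrable_rpow (Or.inr (by
          rw [uIcc_of_le hl2]; intro h; linarith [h.1]))).const_mul _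
      refine (intervalIntegral.norm_integral_le_of_norm_le hl2
        (g := fun u => 3 * a * M * u ^ (α - 2)) (Eventually.of_forall fun u hu => ?_)
        hii).trans ?_
      · have hu0 : 0 < u := by linarith [hu.1]
        rw [norm_mul, Complex.norm_real, norm_neg, Real.norm_of_nonneg (by positivity)]
        refine (mul_le_mul_of_nonneg_left (hDb u hu.1.le hu.2) (by positivity)).trans
          (le_of_eq ?_)
        rw [Real.rpow_sub hu0, Real.rpow_two]; field_simp
      · rw [intervalIntegral.integral_const_mul, integral_rpow (Or.inr ⟨by linarith, by
          rw [uIcc_of_le hl2]; intro h; linarith [h.1]⟩)]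
        have e2 : (l ^ (α - 2 + 1) - (2 * a) ^ (α - 2 + 1)) / (α - 2 + 1) =
            ((2 * a) ^ (α - 1) - l ^ (α - 1)) / (1 - α) := by
          rw [show α - 2 + 1 = -(1 - α) by ring, show α - 1 = -(1 - α) by ring, div_neg,
            ← neg_div, neg_sub]
        rw [e2]
        have h4 : 0 ≤ l ^ (α - 1) := Real.rpow_nonneg (by linarith) _
        have h5 : 3 * a * M * (((2 * a) ^ (α - 1) - l ^ (α - 1)) / (1 - α)) ≤
            3 * a * M * ((2 * a) ^ (α - 1) / (1 - α)) := by
          gcongr; linarith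
        refine h5.trans ?_
        have h6 : 3 * a * M * ((2 * a) ^ (α - 1) / (1 - α)) =
            3 / (1 - α) * M * (a * (2 * a) ^ (α - 1)) := by ring
        rw [h6]
        exact mul_le_mul_of_nonneg_left hpa (by positivity)
    have n1 := norm_sub_le (((l⁻¹ : ℝ) : ℂ) * D l - (((2 * a)⁻¹ : ℝ) : ℂ) * D (2 * a))
      (∫ u in (2 * a)..l, ((-(u ^ 2)⁻¹ : ℝ) : ℂ) * D u)
    have n2 := norm_sub_le (((l⁻¹ : ℝ) : ℂ) * D l) ((((2 * a)⁻¹ : ℝ) : ℂ) * D (2 * a))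
    have n3 := hend l hl2 le_rfl
    have n4 := hend (2 * a) le_rfl hl2
    have n5 : 6 * M * a ^ α ≤ 6 / (1 - α) * M * a ^ α := by
      have : (6 : ℝ) ≤ 6 / (1 - α) := by
        rw [le_div_iff₀ (by linarith)]; linarith
      have h2 : 0 ≤ M * a ^ α := by positivity
      nlinarith
    have n6 : 9 / (1 - α) * M * a ^ α = 6 / (1 - α) * M * a ^ α + 3 / (1 - α) * M * a ^ α := by
      ring
    linarith

end KadenSpiral
end

/-! ### Averages of an inverse square root of the sine along a monotone phase. -/

noncomputable section
namespace KadenSpiral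

/-- The weight `|sin y|^{-1/2}`. -/
def invSin (y : ℝ) : ℝ≥0∞ := ENNReal.ofReal |Real.sin y| ^ (-(1 / 2) : ℝ)

theorem measurable_invSin : Measurable invSin := by unfold invSin; fun_prop

theorem invSin_add_int_mul_pi (y : ℝ) (k : ℤ) : invSin (y + k * Real.pi) = invSin y := by
  unfold invSin
  rw [Real.sin_add_int_mul_pi, abs_mul, abs_zpow, abs_neg, abs_one, one_zpow, one_mul]

/-- Integral of `invSin` over the period centred at the origin. -/
def invSinC : ℝ≥0∞ := ∫⁻ y in Icc (-(Real.pi / 2)) (Real.pi / 2), invSin y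

/-- On the central period `|sin y| ≥ |y|/2`, so the weight is at most an integrable power. The
factor `e²` compensates the exponential in the majorant on this bounded interval. -/
theorem invSinC_lt_top : invSinC < ∞ := by
  have hmaj : ∫⁻ v : ℝ, ENNReal.ofReal (Real.exp 2 * majorant (1 / 2) (1 / 2 * v)) < ∞ :=
    ((integrable_majorant_comp (c := 1 / 2) (by norm_num) (by norm_num)).const_mul
      (Real.exp 2)).lintegral_lt_top
  refine lt_of_le_of_lt ?_ hmaj
  refine (setLIntegral_mono_ae' measurableSet_Icc ?_).trans (setLIntegral_le_lintegral _ _)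
  filter_upwards [ae_ne_zero] with y hy0 hy
  have hpi : Real.pi ≤ 4 := Real.pi_le_four
  have hya : |y| ≤ Real.pi / 2 := abs_le.2 hy
  have hy1 : 0 < |y| := abs_pos.2 hy0
  have h1 : |y| / 2 ≤ |Real.sin y| := by
    have h2 := Real.mul_le_sin (abs_nonneg y) hya
    have h3 : Real.sin |y| ≤ |Real.sin y| := by
      rcases abs_cases y with ⟨h, _⟩ | ⟨h, _⟩ <;> rw [h]
      · exact le_abs_self _
      · rw [Real.sin_neg]; exact neg_le_abs _
    have h4 : 1 / 2 ≤ 2 / Real.pi := by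
      rw [div_le_div_iff₀ two_pos Real.pi_pos]; linarith
    nlinarith
  unfold invSin
  have h5 : ENNReal.ofReal |Real.sin y| ^ (-(1 / 2) : ℝ) ≤
      ENNReal.ofReal (|y| / 2) ^ (-(1 / 2) : ℝ) := by
    rw [ENNReal.rpow_neg, ENNReal.rpow_neg]
    exact ENNReal.inv_le_inv.2 (ENNReal.rpow_le_rpow (ENNReal.ofReal_le_ofReal h1) (by norm_num))
  refine h5.trans ?_
  rw [ENNReal.ofReal_rpow_of_pos (by positivity)]
  refine ENNReal.ofReal_le_ofReal ?_
  have h6 : |1 / 2 * y| = |y| / 2 := by rw [abs_mul, abs_of_pos (by norm_num)]; ring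
  have h7 := rpow_mul_exp_le_majorant (1 / 2) (1 / 2 * y)
  rw [h6] at h7
  have h8 : 1 ≤ Real.exp 2 * Real.exp (-(|y| / 2) / 2) := by
    rw [← Real.exp_add]; exact Real.one_le_exp (by linarith)
  have h9 : 0 ≤ (|y| / 2) ^ (-(1 / 2) : ℝ) := by positivity
  calc (|y| / 2) ^ (-(1 / 2) : ℝ)
      ≤ (|y| / 2) ^ (-(1 / 2) : ℝ) * (Real.exp 2 * Real.exp (-(|y| / 2) / 2)) :=
        le_mul_of_one_le_right h9 h8
    _ = Real.exp 2 * ((|y| / 2) ^ (-(1 / 2) : ℝ) * Real.exp (-(|y| / 2) / 2)) := by ring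
    _ ≤ _ := mul_le_mul_of_nonneg_left h7 (Real.exp_pos _).le

theorem lintegral_invSin_translate (s : Set ℝ) (hs : MeasurableSet s) (k : ℤ) :
    ∫⁻ y in (fun y => y + k * Real.pi) ⁻¹' s, invSin y = ∫⁻ y in s, invSin y := by
  rw [← lintegral_indicator (hs.preimage (by fun_prop)), ← lintegral_indicator hs,
    ← lintegral_add_right_eq_self (s.indicator invSin) (k * Real.pi)]
  refine lintegral_congr fun y => ?_
  simp only [indicator, invSin_add_int_mul_pi]
  rfl

/-- A window of length `π` is covered by two adjacent periods, shifted by a multiple of `π` chosen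
with a floor; each contributes `invSinC`. -/
theorem lintegral_invSin_le (a : ℝ) :
    ∫⁻ y in Icc a (a + Real.pi), invSin y ≤ 2 * invSinC := by
  have hpi := Real.pi_pos
  set k : ℤ := ⌊a / Real.pi + 1 / 2⌋ with hk
  have h1 : (k : ℝ) ≤ a / Real.pi + 1 / 2 := Int.floor_le _
  have h2 : a / Real.pi + 1 / 2 < k + 1 := Int.lt_floor_add_one _
  have h3 : k * Real.pi ≤ a + Real.pi / 2 := by
    have := mul_le_mul_of_nonneg_right h1 hpi.le
    rw [add_mul, div_mul_cancel₀ _ hpi.ne'] at this; linarith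
  have h4 : a + Real.pi / 2 < k * Real.pi + Real.pi := by
    have := mul_lt_mul_of_pos_right h2 hpi
    rw [add_mul, add_mul, div_mul_cancel₀ _ hpi.ne'] at this; linarith
  have hsub : Icc a (a + Real.pi) ⊆
      ((fun y => y + ((-k : ℤ) : ℝ) * Real.pi) ⁻¹' Icc (-(Real.pi / 2)) (Real.pi / 2)) ∪
      ((fun y => y + ((-k - 1 : ℤ) : ℝ) * Real.pi) ⁻¹' Icc (-(Real.pi / 2)) (Real.pi / 2)) := by
    intro y hy
    simp only [mem_union, mem_preimage, mem_Icc] at hy ⊢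
    push_cast
    rcases le_total y (k * Real.pi + Real.pi / 2) with h | h
    · left; constructor <;> nlinarith
    · right; constructor <;> nlinarith
  refine (lintegral_mono_set hsub).trans ((lintegral_union_le _ _ _).trans ?_)
  rw [lintegral_invSin_translate _ measurableSet_Icc, lintegral_invSin_translate _ measurableSet_Icc,
    two_mul]
  rfl

/-- Change of variables to the phase: the image lies in a window of length `π`, and the Jacobian is
at least `β`. -/
theorem lintegral_invSin_comp_le {b b' : ℝ → ℝ} {β v w : ℝ} (hβ : 0 < β) (hvw : v ≤ w)
    (hb : ∀ u ∈ Icc v w, HasDerivAt b (b' u) u) (h1 : ∀ u ∈ Icc v w, β ≤ b' u)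
    (h2 : ∀ u ∈ Icc v w, b' u ≤ 16 * β) (hlen : 16 * β * (w - v) ≤ Real.pi) :
    ∫⁻ u in Icc v w, invSin (b u) ≤ ENNReal.ofReal (1 / β) * (2 * invSinC) := by
  have hcont : ContinuousOn b (Icc v w) := fun u hu => (hb u hu).continuousAt.continuousWithinAt
  have hmono : StrictMonoOn b (Icc v w) := by
    refine strictMonoOn_of_deriv_pos (convex_Icc v w) hcont fun u hu => ?_
    have hu := interior_subset hu
    rw [(hb u hu).deriv]; exact hβ.trans_le (h1 u hu)
  have himg : b '' Icc v w ⊆ Icc (b v) (b v + Real.pi) := by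
    rintro _ ⟨u, hu, rfl⟩
    refine ⟨hmono.monotoneOn (left_mem_Icc.2 hvw) hu hu.1, ?_⟩
    have := (convex_Icc v w).image_sub_le_mul_sub_of_deriv_le hcont
      (fun u hu => (hb u (interior_subset hu)).differentiableAt.differentiableWithinAt)
      (C := 16 * β) (fun u hu => by
        rw [(hb u (interior_subset hu)).deriv]; exact h2 u (interior_subset hu))
      v (left_mem_Icc.2 hvw) u hu hu.1
    have h3 : 16 * β * (u - v) ≤ 16 * β * (w - v) := by
      have := hu.2; gcongr
    linarith
  have hcov := lintegral_image_eq_lintegral_abs_deriv_mul measurableSet_Icc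
    (fun u hu => (hb u hu).hasDerivWithinAt) hmono.injOn invSin
  have hle : ∀ u ∈ Icc v w, invSin (b u) ≤
      ENNReal.ofReal (1 / β) * (ENNReal.ofReal |b' u| * invSin (b u)) := by
    intro u hu
    rw [← mul_assoc, ← ENNReal.ofReal_mul (by positivity)]
    refine le_mul_of_one_le_left zero_le ?_
    rw [ENNReal.one_le_ofReal, one_div_mul_eq_div, le_div_iff₀ hβ, one_mul]
    exact (h1 u hu).trans (le_abs_self _)
  refine (setLIntegral_mono' measurableSet_Icc hle).trans ?_
  rw [lintegral_const_mul' _ _ ENNReal.ofReal_ne_top, ← hcov]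
  gcongr
  exact (lintegral_mono_set himg).trans (lintegral_invSin_le _)

/-- The antitone profile used in the far field. -/
def profile (r u : ℝ) : ℝ≥0∞ := ENNReal.ofReal ((r * |u|) ^ (-(1 / 2) : ℝ) * Real.exp (-(r * |u|) / 2))

theorem measurable_profile (r : ℝ) : Measurable (profile r) := by unfold profile; fun_prop

theorem profile_anti {r u v : ℝ} (hr : 0 < r) (hv : 0 < v) (h : v ≤ u) :
    profile r u ≤ profile r v := by
  unfold profile
  rw [abs_of_pos hv, abs_of_pos (hv.trans_le h)]
  refine ENNReal.ofReal_le_ofReal (mul_le_mul ?_ ?_ (Real.exp_pos _).le (by positivity))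
  · exact Real.rpow_le_rpow_of_nonpos (by positivity) (by gcongr) (by norm_num)
  · exact Real.exp_le_exp.2 (by nlinarith)

theorem lintegral_profile_le {r : ℝ} (hr : 0 < r) :
    ∫⁻ u, profile r u ≤ ENNReal.ofReal (majC (1 / 2) / r) := by
  have hi := integrable_majorant_comp (β := 1 / 2) (c := r) (by norm_num) hr
  have h1 : ∫⁻ u, profile r u ≤ ∫⁻ u, ENNReal.ofReal (majorant (1 / 2) (r * u)) := by
    refine lintegral_mono fun u => ENNReal.ofReal_le_ofReal ?_
    have := rpow_mul_exp_le_majorant (1 / 2) (r * u)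
    rwa [abs_mul, abs_of_pos hr] at this
  refine h1.trans (le_of_eq ?_)
  rw [← ofReal_integral_eq_lintegral_ofReal hi
    (Eventually.of_forall fun u => majorant_nonneg _ _),
    Measure.integral_comp_mul_left (majorant (1 / 2)), abs_of_pos (inv_pos.2 hr), smul_eq_mul,
    majC]
  congr 1; field_simp

/-- Far-field estimate: a monotone phase averages `|sin|^{-1/2}` against the profile. -/
theorem lintegral_profile_mul_invSin_le {b b' : ℝ → ℝ} {β l r : ℝ} (hβ : 0 < β) (hl : 0 < l)
    (hr : 0 < r) (hlen : 16 * β * l ≤ Real.pi) (hbc : Continuous b)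
    (hb : ∀ u ∈ Icc (0 : ℝ) 1, HasDerivAt b (b' u) u) (h1 : ∀ u ∈ Icc (0 : ℝ) 1, β ≤ b' u)
    (h2 : ∀ u ∈ Icc (0 : ℝ) 1, b' u ≤ 16 * β) :
    ∫⁻ u in Ioc l 1, profile r u * invSin (b u) ≤
      ENNReal.ofReal (1 / (l * β) * (2 * invSinC.toReal) * (majC (1 / 2) / r)) := by
  have hmT : Measurable fun u => invSin (b u) := measurable_invSin.comp hbc.measurable
  have hmP := measurable_profile r
  set D : Set (ℝ × ℝ) := {z | z.1 ∈ Ioc l 1 ∧ z.1 - l < z.2 ∧ z.2 ≤ z.1} with hD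
  have hDm : MeasurableSet D := by
    refine (measurable_fst measurableSet_Ioc).inter ?_
    exact (measurableSet_lt (measurable_fst.sub_const l) measurable_snd).inter
      (measurableSet_le measurable_snd measurable_fst)
  set G : ℝ → ℝ → ℝ≥0∞ := fun u v => D.indicator (fun z => profile r z.2 * invSin (b z.1)) (u, v)
    with hG
  have hGm : Measurable (Function.uncurry G) := by
    refine Measurable.indicator ?_ hDm
    exact (hmP.comp measurable_snd).mul (hmT.comp measurable_fst)
  -- An antitone profile is at most its mean over the preceding interval of length `l`. This
  -- decouples it from the oscillating factor.
  have step1 : ∫⁻ u in Ioc l 1, profile r u * invSin (b u) ≤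
      ENNReal.ofReal (1 / l) * ∫⁻ u, ∫⁻ v, G u v := by
    rw [← lintegral_indicator measurableSet_Ioc, ← lintegral_const_mul' _ _ ENNReal.ofReal_ne_top]
    refine lintegral_mono fun u => ?_
    by_cases hu : u ∈ Ioc l 1
    · rw [indicator_of_mem hu]
      have h3 : ∫⁻ v, G u v = (∫⁻ v in Ioc (u - l) u, profile r v) * invSin (b u) := by
        rw [← lintegral_mul_const _ hmP, ← lintegral_indicator measurableSet_Ioc]
        refine lintegral_congr fun v => ?_
        by_cases hz : (u, v) ∈ D
        · simp only [hG]
          rw [indicator_of_mem hz, indicator_of_mem (show v ∈ Ioc (u - l) u from hz.2)]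
        · simp only [hG]
          rw [indicator_of_notMem hz, indicator_of_notMem (show v ∉ Ioc (u - l) u from fun h => hz ⟨hu, h⟩)]
      have h4 : profile r u ≤ ENNReal.ofReal (1 / l) * ∫⁻ v in Ioc (u - l) u, profile r v := by
        have h5 : ∫⁻ _ in Ioc (u - l) u, profile r u ≤ ∫⁻ v in Ioc (u - l) u, profile r v :=
          setLIntegral_mono' measurableSet_Ioc fun v hv =>
            profile_anti hr (by linarith [hv.1, hu.1]) hv.2
        rw [setLIntegral_const, Real.volume_Ioc, sub_sub_cancel] at h5
        calc profile r u = ENNReal.ofReal (1 / l) * (profile r u * ENNReal.ofReal l) := by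
              rw [mul_comm (profile r u), ← mul_assoc, ← ENNReal.ofReal_mul (by positivity),
                one_div_mul_cancel hl.ne', ENNReal.ofReal_one, one_mul]
          _ ≤ _ := by gcongr
      rw [h3, ← mul_assoc]
      gcongr
    · rw [indicator_of_notMem hu]; exact zero_le
  -- By Tonelli, for each fixed `v` only `u ∈ [v, v+l]` contributes, a range on which the phase
  -- advances by at most `π`.
  have step2 : ∫⁻ u, ∫⁻ v, G u v ≤ (∫⁻ v, profile r v) * (ENNReal.ofReal (1 / β) * (2 * invSinC)) := by
    rw [lintegral_lintegral_swap hGm.aemeasurable, ← lintegral_mul_const _ hmP]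
    refine lintegral_mono fun v => ?_
    by_cases hv : v ∈ Icc (0 : ℝ) 1
    · have hmin : v ≤ min (v + l) 1 := le_min (by linarith) hv.2
      have hsub : Icc v (min (v + l) 1) ⊆ Icc (0 : ℝ) 1 := fun u hu =>
        ⟨hv.1.trans hu.1, hu.2.trans (min_le_right _ _)⟩
      have h3 := lintegral_invSin_comp_le hβ hmin (fun u hu => hb u (hsub hu))
        (fun u hu => h1 u (hsub hu)) (fun u hu => h2 u (hsub hu)) (by
          refine le_trans ?_ hlen
          have : min (v + l) 1 - v ≤ l := by linarith [min_le_left (v + l) 1]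
          gcongr)
      refine le_trans ?_ (mul_le_mul_right h3 (profile r v))
      rw [← lintegral_const_mul _ hmT, ← lintegral_indicator measurableSet_Icc]
      refine lintegral_mono fun u => ?_
      simp only [hG]
      by_cases hz : (u, v) ∈ D
      · have hu : u ∈ Icc v (min (v + l) 1) := ⟨hz.2.2, le_min (by linarith [hz.2.1]) hz.1.2⟩
        rw [indicator_of_mem hz, indicator_of_mem hu]
      · rw [indicator_of_notMem hz]; exact zero_le
    · have h3 : ∀ u, G u v = 0 := by
        intro u
        refine indicator_of_notMem (fun hz => hv ?_) _
        exact ⟨by have h4 := hz.2.1; have h5 := hz.1.1; simp only at h4 h5; linarith, hz.2.2.trans hz.1.2⟩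
      simp only [h3, lintegral_zero]; exact zero_le
  refine step1.trans ?_
  refine (mul_le_mul_right (step2.trans (mul_le_mul_left (lintegral_profile_le hr) _)) _).trans
    (le_of_eq ?_)
  rw [← ENNReal.ofReal_toReal invSinC_lt_top.ne, ENNReal.toReal_ofReal ENNReal.toReal_nonneg]
  have h2' : (2 : ℝ≥0∞) = ENNReal.ofReal 2 := by simp
  have hM := majC_nonneg (1 / 2)
  have hS := ENNReal.toReal_nonneg (a := invSinC)
  rw [h2', ← ENNReal.ofReal_mul zero_le_two, ← ENNReal.ofReal_mul (by positivity),
    ← ENNReal.ofReal_mul (by positivity), ← ENNReal.ofReal_mul (by positivity)]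
  congr 1
  field_simp

end KadenSpiral
end

/-! ### Integral bounds for the kernel away from the singularity. -/

noncomputable section
namespace KadenSpiral

variable {μ α : ℝ} {p : ℝ → ℂ} {m θ : ℝ}

/-- Size of the near region in units of `1/(m(1+θ))`. -/
def nearC (μ : ℝ) : ℝ := 1 / (6 * (1 + 2 * μ))

theorem nearC_pos (hμ : 0 < μ) : 0 < nearC μ := by unfold nearC; positivity

theorem nearC_mul (hμ : 0 < μ) : 3 * (1 + 2 * μ) * nearC μ = 1 / 2 := by
  unfold nearC; field_simp; norm_num

theorem nearC_le (hμ : 0 < μ) : nearC μ ≤ 1 / 6 := by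
  have := nearC_mul hμ
  have := nearC_pos hμ
  nlinarith

/-- Majorant of the kernel and its variation in the far region. -/
def farG (μ : ℝ) (p : ℝ → ℂ) (m θ u : ℝ) : ℝ :=
  Real.exp (-(rate μ m * |u|)) / ‖1 - kerQ p m θ u‖ +
    Real.exp (-(rate μ m * |u|)) * (rate μ m * |u|) / ‖1 - kerQ p m θ u‖ ^ 2

theorem farG_nonneg (hr : 0 ≤ rate μ m) (u : ℝ) : 0 ≤ farG μ p m θ u := by
  unfold farG; positivity

theorem exp_neg_mul_sq_le {x : ℝ} (hx : 0 ≤ x) :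
    Real.exp (-x) * (1 + 2 * x) ^ 2 ≤ 64 * Real.exp (-x / 2) := by
  have h1 := Real.add_one_le_exp (x / 4)
  have h2 : 1 + 2 * x ≤ 8 * Real.exp (x / 4) := by linarith
  have h3 : (1 + 2 * x) ^ 2 ≤ (8 * Real.exp (x / 4)) ^ 2 := by gcongr
  have h4 : Real.exp (-x) * (8 * Real.exp (x / 4)) ^ 2 = 64 * Real.exp (-x / 2) := by
    rw [mul_pow, ← Real.exp_nat_mul, mul_left_comm, ← Real.exp_add]
    norm_num; ring_nf
  rw [← h4]; gcongr

theorem Sym.norm_one_sub_kerQ_ge (hp : Sym μ α p) (hμ : 0 < μ) (hθ : 0 < θ) (hm : 0 < m) {u : ℝ}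
    (hu : u ≠ 0) :
    2 * (rate μ m * |u|) / (1 + 2 * (rate μ m * |u|)) ≤ ‖1 - kerQ p m θ u‖ := by
  have hx : 0 < rate μ m * |u| := mul_pos (rate_pos hμ hm) (abs_pos.2 hu)
  refine le_trans ?_ (hp.norm_one_sub_kerQ hθ hm.le u)
  set x := rate μ m * |u|
  have h1 := Real.add_one_le_exp (2 * x)
  have h2 : Real.exp (2 * x) * Real.exp (-(2 * x)) = 1 := by rw [← Real.exp_add]; simp
  rw [div_le_iff₀ (by positivity)]
  nlinarith [Real.exp_pos (-(2 * x))]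

/-- Uses only `|1-q| ≥ 2x/(1+2x)`, `x = rate·|u|`. By itself this would integrate to a logarithm of
`θ`, so it is used only where `x` is bounded below. -/
theorem Sym.farG_le (hp : Sym μ α p) (hμ : 0 < μ) (hθ : 0 < θ) (hm : 0 < m) {u : ℝ}
    (hu : u ≠ 0) :
    farG μ p m θ u ≤ 128 / (rate μ m * |u|) * Real.exp (-(rate μ m * |u|) / 2) := by
  have hx : 0 < rate μ m * |u| := mul_pos (rate_pos hμ hm) (abs_pos.2 hu)
  have hy := hp.norm_one_sub_kerQ_ge hμ hθ hm hu
  unfold farG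
  set x := rate μ m * |u|
  set y := ‖1 - kerQ p m θ u‖
  have hy0 : 0 < y := lt_of_lt_of_le (by positivity) hy
  have h1 : 1 / y ≤ (1 + 2 * x) / (2 * x) := by
    have := one_div_le_one_div_of_le (by positivity) hy
    rwa [one_div_div] at this
  have h2 := exp_neg_mul_sq_le hx.le
  have b1 : Real.exp (-x) / y ≤ Real.exp (-x) * (1 + 2 * x) ^ 2 / x := by
    rw [div_eq_mul_one_div]
    refine (mul_le_mul_of_nonneg_left h1 (Real.exp_pos _).le).trans ?_
    rw [mul_div_assoc]
    refine mul_le_mul_of_nonneg_left ?_ (Real.exp_pos _).le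
    rw [div_le_div_iff₀ (by positivity) hx]
    nlinarith [mul_pos hx hx, mul_pos (mul_pos hx hx) hx]
  have b2 : Real.exp (-x) * x / y ^ 2 ≤ Real.exp (-x) * (1 + 2 * x) ^ 2 / x := by
    have h3 : (1 / y) ^ 2 ≤ ((1 + 2 * x) / (2 * x)) ^ 2 := by gcongr
    have e1 : Real.exp (-x) * x / y ^ 2 = Real.exp (-x) * x * (1 / y) ^ 2 := by ring
    have e2 : Real.exp (-x) * x * ((1 + 2 * x) / (2 * x)) ^ 2 =
        Real.exp (-x) * (1 + 2 * x) ^ 2 / x / 4 := by field_simp; norm_num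
    rw [e1]
    refine (mul_le_mul_of_nonneg_left h3 (by positivity)).trans ?_
    rw [e2]
    have : 0 ≤ Real.exp (-x) * (1 + 2 * x) ^ 2 / x := by positivity
    linarith
  have b3 : Real.exp (-x) * (1 + 2 * x) ^ 2 / x ≤ 64 * Real.exp (-x / 2) / x := by gcongr
  have e3 : 128 / x * Real.exp (-x / 2) = 2 * (64 * Real.exp (-x / 2) / x) := by ring
  rw [e3]; linarith

/-- Multiplication by the unimodular number `e^{-i Im z}` makes the second term real; the imaginary
part of the first is the sine. -/
theorem abs_sin_le_norm_one_sub_exp (z : ℂ) : |Real.sin z.im| ≤ ‖1 - Complex.exp z‖ := by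
  have h1 : ‖1 - Complex.exp z‖ = ‖Complex.exp (-(z.im * Complex.I)) - (Real.exp z.re : ℂ)‖ := by
    have e1 : Complex.exp (-(z.im * Complex.I)) - (Real.exp z.re : ℂ) =
        Complex.exp (-(z.im * Complex.I)) * (1 - Complex.exp z) := by
      rw [mul_sub, mul_one, ← Complex.exp_add, Complex.ofReal_exp]
      congr 2
      apply Complex.ext <;> simp
    have e2 : -(z.im * Complex.I) = ((-z.im : ℝ) : ℂ) * Complex.I := by push_cast; ring
    rw [e1, norm_mul, e2, Complex.norm_exp_ofReal_mul_I, one_mul]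
  rw [h1]
  refine le_trans (le_of_eq ?_) (Complex.abs_im_le_norm _)
  have e2 : -(z.im * Complex.I) = ((-z.im : ℝ) : ℂ) * Complex.I := by push_cast; ring
  rw [Complex.sub_im, Complex.ofReal_im, sub_zero, e2, Complex.exp_ofReal_mul_I_im, Real.sin_neg,
    abs_neg]

/-- Interpolation of the two lower bounds for `y = |1-q|`: a single factor `y^{-1/2}` is estimated
by the sine, all remaining powers by `x`. What is left, `x^{-1/2}`, is integrable at the origin. -/
theorem Sym.farG_le_invSin (hp : Sym μ α p) (hμ : 0 < μ) (hθ : 0 < θ) (hm : 0 < m) {u : ℝ}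
    (hu : u ≠ 0) :
    ENNReal.ofReal (farG μ p m θ u) ≤
      ENNReal.ofReal 128 * (profile (rate μ m) u * invSin (m * (symP p θ u).im)) := by
  have hx : 0 < rate μ m * |u| := mul_pos (rate_pos hμ hm) (abs_pos.2 hu)
  have hy := hp.norm_one_sub_kerQ_ge hμ hθ hm hu
  have hsin : |Real.sin (m * (symP p θ u).im)| ≤ ‖1 - kerQ p m θ u‖ := by
    refine le_trans (le_of_eq ?_) (abs_sin_le_norm_one_sub_exp _)
    rw [Complex.im_ofReal_mul]
    unfold sg
    split_ifs
    · rw [one_mul]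
    · rw [neg_one_mul, neg_mul, Real.sin_neg, abs_neg]
  unfold farG profile
  set x := rate μ m * |u|
  set y := ‖1 - kerQ p m θ u‖
  have hy0 : 0 < y := lt_of_lt_of_le (by positivity) hy
  have key : Real.exp (-x) / y + Real.exp (-x) * x / y ^ 2 ≤
      128 * (x ^ (-(1 / 2) : ℝ) * Real.exp (-x / 2) * y ^ (-(1 / 2) : ℝ)) := by
    set s := y ^ (-(1 / 2) : ℝ)
    set T := x ^ (-(1 / 2) : ℝ)
    have hs : 0 < s := Real.rpow_pos_of_pos hy0 _
    have hT : 0 < T := Real.rpow_pos_of_pos hx _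
    have hs2 : s * s = 1 / y := by
      rw [← Real.rpow_add hy0]; norm_num; rw [Real.rpow_neg_one]
    have hT2 : T * T = 1 / x := by
      rw [← Real.rpow_add hx]; norm_num; rw [Real.rpow_neg_one]
    have hTx : x * (T * T) = 1 := by rw [hT2]; field_simp
    have h1 : s * s ≤ T * T * (1 + 2 * x) := by
      rw [hs2, hT2]
      have := one_div_le_one_div_of_le (by positivity) hy
      rw [one_div_div] at this
      refine this.trans ?_
      rw [one_div_mul_eq_div, div_le_div_iff₀ (by positivity) hx]
      nlinarith [mul_pos hx hx]
    have h2 : s ≤ T * (1 + 2 * x) := by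
      refine le_of_sq_le_sq ?_ (by positivity)
      have h3 : T * T * (1 + 2 * x) ≤ T * T * (1 + 2 * x) ^ 2 := by
        refine mul_le_mul_of_nonneg_left ?_ (by positivity)
        nlinarith
      nlinarith
    have b1 : 1 / y ≤ s * (T * (1 + 2 * x) ^ 2) := by
      rw [← hs2]
      refine mul_le_mul_of_nonneg_left (h2.trans ?_) hs.le
      refine mul_le_mul_of_nonneg_left ?_ hT.le
      nlinarith
    have b2 : x / y ^ 2 ≤ s * (T * (1 + 2 * x) ^ 2) := by
      have e1 : x / y ^ 2 = s * (x * (s * (s * s))) := by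
        have : x / y ^ 2 = x * (1 / y) * (1 / y) := by field_simp
        rw [this, ← hs2]; ring
      rw [e1]
      refine mul_le_mul_of_nonneg_left ?_ hs.le
      have h4 : s * (s * s) ≤ T * (1 + 2 * x) * (T * T * (1 + 2 * x)) :=
        mul_le_mul h2 h1 (by positivity) (by positivity)
      refine (mul_le_mul_of_nonneg_left h4 hx.le).trans (le_of_eq ?_)
      calc x * (T * (1 + 2 * x) * (T * T * (1 + 2 * x)))
          = x * (T * T) * (T * (1 + 2 * x) ^ 2) := by ring
        _ = _ := by rw [hTx, one_mul]
    have b3 := exp_neg_mul_sq_le hx.le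
    have e2 : Real.exp (-x) / y + Real.exp (-x) * x / y ^ 2 =
        Real.exp (-x) * (1 / y + x / y ^ 2) := by ring
    rw [e2]
    refine (mul_le_mul_of_nonneg_left (add_le_add b1 b2) (Real.exp_pos _).le).trans ?_
    have h5 := mul_le_mul_of_nonneg_left b3 (by positivity : 0 ≤ 2 * (s * T))
    linarith
  refine (ENNReal.ofReal_le_ofReal key).trans ?_
  rw [ENNReal.ofReal_mul (by norm_num), ENNReal.ofReal_mul (by positivity)]
  gcongr
  unfold invSin
  rw [← ENNReal.ofReal_rpow_of_pos hy0, ENNReal.rpow_neg, ENNReal.rpow_neg]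
  exact ENNReal.inv_le_inv.2 (ENNReal.rpow_le_rpow (ENNReal.ofReal_le_ofReal hsin) (by norm_num))

theorem exp_one_le_three : Real.exp 1 ≤ 3 := by linarith [Real.exp_one_lt_d9]

theorem exp_bounds_unit {u : ℝ} (hu : |u| ≤ 1) : 1 / 3 ≤ Real.exp u ∧ Real.exp u ≤ 3 := by
  have h := abs_le.1 hu
  have h1 : Real.exp u ≤ Real.exp 1 := Real.exp_le_exp.2 h.2
  have h2 : Real.exp (-u) ≤ Real.exp 1 := Real.exp_le_exp.2 (by linarith)
  have h3 := exp_one_le_three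
  have h4 : Real.exp u * Real.exp (-u) = 1 := by rw [← Real.exp_add]; simp
  refine ⟨?_, h1.trans h3⟩
  nlinarith [Real.exp_pos u]

theorem Sym.symZ_im_bounds (hp : Sym μ α p) (hθ : 0 < θ) {u : ℝ} (hu : |u| ≤ 1) :
    θ / 3 - 1 / 8 ≤ (symZ p θ u).im ∧ (symZ p θ u).im ≤ 3 * θ + 1 / 8 := by
  have h1 := abs_le.1 (hp.abs_im_le (t := θ * Real.exp u) (by positivity))
  have h2 := exp_bounds_unit hu
  have h3 : (symZ p θ u).im = θ * Real.exp u - (p (θ * Real.exp u)).im := by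
    simp only [symZ, Complex.sub_im, Complex.mul_im, Complex.I_re, Complex.I_im,
      Complex.ofReal_re, Complex.ofReal_im]
    ring
  rw [h3]
  constructor <;> nlinarith

theorem Sym.hasDerivAt_symP_im (hp : Sym μ α p) (hθ : 0 < θ) (u : ℝ) :
    HasDerivAt (fun v => m * (symP p θ v).im) (m * (symZ p θ u).im) u :=
  (Complex.imCLM.hasFDerivAt.comp_hasDerivAt u (hp.hasDerivAt_symP hθ u)).const_mul m

theorem lintegral_Ico_neg_eq (F : ℝ → ℝ≥0∞) (l : ℝ) :
    ∫⁻ u in Ico (-1) (-l), F u = ∫⁻ u in Ioc l 1, F (-u) := by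
  rw [← lintegral_indicator measurableSet_Ico, ← lintegral_indicator measurableSet_Ioc,
    ← lintegral_sub_left_eq_self _ (0 : ℝ)]
  refine lintegral_congr fun u => ?_
  by_cases hu : u ∈ Ioc l 1
  · rw [indicator_of_mem hu, indicator_of_mem (by simp only [mem_Ico]; constructor <;> linarith [hu.1, hu.2]),
      zero_sub]
  · rw [indicator_of_notMem hu, indicator_of_notMem]
    intro h; apply hu; constructor <;> linarith [h.1, h.2]

/-- Constant of the far-field bound. -/
def conF (μ : ℝ) : ℝ :=
  4 / μ * majC (1 / 2) * (3072 / (μ * nearC μ) + 128 + 8192 / nearC μ * invSinC.toReal)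

theorem conF_nonneg (hμ : 0 < μ) : 0 ≤ conF μ := by
  have := majC_nonneg (1 / 2)
  have := nearC_pos hμ
  have := ENNReal.toReal_nonneg (a := invSinC)
  unfold conF; positivity

theorem lintegral_exp_le {r K : ℝ} (hr : 0 < r) (hK : 0 ≤ K) :
    ∫⁻ u, ENNReal.ofReal (K * Real.exp (-(r * |u|) / 2)) ≤ ENNReal.ofReal (K * majC (1 / 2) / r) := by
  have hi := (integrable_majorant_comp (β := 1 / 2) (c := r) (by norm_num) hr).const_mul K
  have h1 : ∫⁻ u, ENNReal.ofReal (K * Real.exp (-(r * |u|) / 2)) ≤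
      ∫⁻ u, ENNReal.ofReal (K * majorant (1 / 2) (r * u)) := by
    refine lintegral_mono fun u => ENNReal.ofReal_le_ofReal (mul_le_mul_of_nonneg_left ?_ hK)
    have := exp_le_majorant (1 / 2) (r * u)
    rwa [abs_mul, abs_of_pos hr] at this
  refine h1.trans (le_of_eq ?_)
  rw [← ofReal_integral_eq_lintegral_ofReal hi
    (Eventually.of_forall fun u => mul_nonneg hK (majorant_nonneg _ _)), integral_const_mul,
    Measure.integral_comp_mul_left (majorant (1 / 2)), abs_of_pos (inv_pos.2 hr), smul_eq_mul,
    majC]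
  congr 1; field_simp

/-- The bound `O(1/m)` without a logarithm of `θ`. The cut-off `l` is fixed only up to a factor two,
so that one cut-off serves two nearby points `θ₁`, `θ₂`. -/
theorem Sym.lintegral_farG_le (hp : Sym μ α p) (hμ : 1 / 2 < μ) (hm : Large μ m) (hθ : 0 < θ)
    {l : ℝ} (hl : 0 < l) (hl1 : nearC μ / 2 ≤ l * (m * (1 + θ))) (hl2 : l * (m * (1 + θ)) ≤ nearC μ) :
    ∫⁻ u in (Icc (-l) l)ᶜ, ENNReal.ofReal (farG μ p m θ u) ≤ ENNReal.ofReal (conF μ / m) := by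
  have hμ0 : 0 < μ := by linarith
  have hm0 := hm.pos hμ0
  have hr := rate_pos hμ0 hm0
  have hr1 := hm.rate_ge hμ0
  have hM := majC_nonneg (1 / 2)
  have hn := nearC_pos hμ0
  have hS := ENNReal.toReal_nonneg (a := invSinC)
  have hout : ∀ u, u ∈ (Icc (-l) l)ᶜ → l < |u| := fun u hu => by
    by_contra h; exact hu (abs_le.1 (not_lt.1 h))
  -- For `θ ≤ 2`, outside the cut-off `rate·|u| ≥ (μ/4)(nearC/6) = μ nearC/24`, so the singularity
  -- is out of reach and no oscillation is needed.
  rcases le_total θ 2 with h2 | h2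
  · set x₀ := μ * nearC μ / 24 with hx₀
    have hx₀0 : 0 < x₀ := by positivity
    have hb : ∀ u ∈ (Icc (-l) l)ᶜ, ENNReal.ofReal (farG μ p m θ u) ≤
        ENNReal.ofReal (128 / x₀ * Real.exp (-(rate μ m * |u|) / 2)) := by
      intro u hu
      have hlu := hout u hu
      have hu0 : u ≠ 0 := by rintro rfl; rw [abs_zero] at hlu; linarith
      refine ENNReal.ofReal_le_ofReal ((hp.farG_le hμ0 hθ hm0 hu0).trans ?_)
      refine mul_le_mul_of_nonneg_right ?_ (Real.exp_pos _).le
      refine div_le_div_of_nonneg_left (by norm_num) hx₀0 ?_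
      have h3 : l * (m * (1 + θ)) ≤ l * (m * 3) := by gcongr; linarith
      have h4 : rate μ m * l ≤ rate μ m * |u| := by gcongr
      have h5 : rate μ m * l = μ / 12 * (l * (m * 3)) := by unfold rate; ring
      have h6 : μ / 12 * (nearC μ / 2) ≤ μ / 12 * (l * (m * 3)) := by
        gcongr; linarith
      rw [hx₀]; linarith
    refine (setLIntegral_mono' measurableSet_Icc.compl hb).trans
      ((setLIntegral_le_lintegral _ _).trans
      ((lintegral_exp_le hr (by positivity)).trans (ENNReal.ofReal_le_ofReal ?_)))
    have e1 : 128 / x₀ * majC (1 / 2) / rate μ m =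
        4 / μ * majC (1 / 2) * (3072 / (μ * nearC μ)) / m := by
      rw [hx₀]; unfold rate; field_simp; norm_num; ring
    rw [e1]; unfold conF
    gcongr
    linarith [show 0 ≤ 8192 / nearC μ * invSinC.toReal by positivity]
  -- For `θ ≥ 2` and `|u| ≤ 1` the phase speed `m Im ∂_u P` lies between `m(θ/3 - 1/8) ≥ β` and
  -- `m(3θ + 1/8) ≤ 16β`. Beyond `|u| = 1` the exponential decay suffices.
  · set β := m * θ / 4 with hβ
    have hβ0 : 0 < β := by positivity
    have hlen : 16 * β * l ≤ Real.pi := by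
      have h3 : 16 * β * l = 4 * (l * (m * θ)) := by rw [hβ]; ring
      have h4 : l * (m * θ) ≤ l * (m * (1 + θ)) := by gcongr; linarith
      linarith [Real.pi_gt_three, nearC_le hμ0]
    have hZ : ∀ u : ℝ, |u| ≤ 1 → β ≤ m * (symZ p θ u).im ∧ m * (symZ p θ u).im ≤ 16 * β := by
      intro u hu
      have := hp.symZ_im_bounds hθ hu
      rw [hβ]; constructor <;> nlinarith
    have habs : ∀ u ∈ Icc (0 : ℝ) 1, |u| ≤ 1 := fun u hu => by rw [abs_of_nonneg hu.1]; exact hu.2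
    have hcP : Continuous fun v => m * (symP p θ v).im :=
      continuous_const.mul (Complex.continuous_im.comp (hp.continuous_symP hθ))
    have hfin : 1 / (l * β) * (2 * invSinC.toReal) * (majC (1 / 2) / rate μ m) ≤
        4 / μ * majC (1 / 2) * (32 / nearC μ * invSinC.toReal) / m := by
      have h3 : nearC μ / 16 ≤ l * β := by
        rw [hβ]; nlinarith [mul_pos hl hm0]
      have h4 : 1 / (l * β) ≤ 16 / nearC μ := by
        have := one_div_le_one_div_of_le (by positivity) h3
        rwa [one_div_div] at this
      have h5 : 1 / (l * β) * (2 * invSinC.toReal) * (majC (1 / 2) / rate μ m) ≤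
        16 / nearC μ * (2 * invSinC.toReal) * (majC (1 / 2) / rate μ m) := by gcongr
      refine h5.trans (le_of_eq ?_)
      unfold rate; field_simp; norm_num; ring
    have hpos : ∫⁻ u in Ioc l 1, ENNReal.ofReal (farG μ p m θ u) ≤
        ENNReal.ofReal (128 * (4 / μ * majC (1 / 2) * (32 / nearC μ * invSinC.toReal) / m)) := by
      have h3 := lintegral_profile_mul_invSin_le (b := fun v => m * (symP p θ v).im)
        (b' := fun v => m * (symZ p θ v).im) (r := rate μ m) hβ0 hl hr hlen hcP
        (fun u _ => hp.hasDerivAt_symP_im hθ u) (fun u hu => (hZ u (habs u hu)).1)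
        (fun u hu => (hZ u (habs u hu)).2)
      refine (setLIntegral_mono' measurableSet_Ioc fun u hu =>
        hp.farG_le_invSin hμ0 hθ hm0 (by linarith [hu.1] : (0 : ℝ) < u).ne').trans ?_
      rw [lintegral_const_mul' _ _ ENNReal.ofReal_ne_top, ENNReal.ofReal_mul (by norm_num)]
      gcongr
      exact h3.trans (ENNReal.ofReal_le_ofReal hfin)
    have hneg : ∫⁻ u in Ico (-1) (-l), ENNReal.ofReal (farG μ p m θ u) ≤
        ENNReal.ofReal (128 * (4 / μ * majC (1 / 2) * (32 / nearC μ * invSinC.toReal) / m)) := by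
      rw [lintegral_Ico_neg_eq]
      have h3 := lintegral_profile_mul_invSin_le (b := fun v => -(m * (symP p θ (-v)).im))
        (b' := fun v => m * (symZ p θ (-v)).im) (r := rate μ m) hβ0 hl hr hlen
        (hcP.comp continuous_neg).neg
        (fun u _ => by
          refine ((hp.hasDerivAt_symP_im (m := m) hθ (-u)).scomp u (hasDerivAt_neg u)).neg.congr_deriv ?_
          simp)
        (fun u hu => (hZ (-u) (by rw [abs_neg]; exact habs u hu)).1)
        (fun u hu => (hZ (-u) (by rw [abs_neg]; exact habs u hu)).2)
      refine (setLIntegral_mono' measurableSet_Ioc fun (u : ℝ) hu =>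
        hp.farG_le_invSin hμ0 hθ hm0 (show -u < 0 by linarith [hu.1]).ne).trans ?_
      rw [lintegral_const_mul' _ _ ENNReal.ofReal_ne_top, ENNReal.ofReal_mul (by norm_num)]
      gcongr
      refine le_trans (le_of_eq ?_) (h3.trans (ENNReal.ofReal_le_ofReal hfin))
      refine lintegral_congr fun u => ?_
      simp only [profile, invSin, abs_neg, Real.sin_neg]
    have hbig : ∫⁻ u in {u : ℝ | 1 ≤ |u|}, ENNReal.ofReal (farG μ p m θ u) ≤
        ENNReal.ofReal (128 * majC (1 / 2) / rate μ m) := by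
      have hms : MeasurableSet {u : ℝ | 1 ≤ |u|} := measurableSet_le measurable_const (by fun_prop)
      refine (setLIntegral_mono' hms fun u (hu : 1 ≤ |u|) => ENNReal.ofReal_le_ofReal ?_).trans
        ((setLIntegral_le_lintegral _ _).trans (lintegral_exp_le hr (by norm_num : (0 : ℝ) ≤ 128)))
      have hu0 : u ≠ 0 := by rintro rfl; norm_num at hu
      refine (hp.farG_le hμ0 hθ hm0 hu0).trans ?_
      refine mul_le_mul_of_nonneg_right ?_ (Real.exp_pos _).le
      exact div_le_self (by norm_num) (by nlinarith)
    have hsub : (Icc (-l) l)ᶜ ⊆ {u : ℝ | 1 ≤ |u|} ∪ (Ioc l 1 ∪ Ico (-1) (-l)) := by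
      intro u hu
      have hlu := hout u hu
      by_cases h1 : 1 ≤ |u|
      · exact Or.inl h1
      · right
        have h3 := abs_lt.1 (not_le.1 h1)
        rcases lt_abs.1 hlu with h | h
        · exact Or.inl ⟨h, h3.2.le⟩
        · exact Or.inr ⟨h3.1.le, by linarith⟩
    refine (lintegral_mono_set hsub).trans ((lintegral_union_le _ _ _).trans
      ((add_le_add hbig ((lintegral_union_le _ _ _).trans (add_le_add hpos hneg))).trans ?_))
    rw [← ENNReal.ofReal_add (by positivity) (by positivity),
      ← ENNReal.ofReal_add (by positivity) (by positivity)]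
    refine ENNReal.ofReal_le_ofReal ?_
    have e1 : 128 * majC (1 / 2) / rate μ m = 4 / μ * majC (1 / 2) * 128 / m := by
      unfold rate; field_simp
    rw [e1]
    have e2 : 4 / μ * majC (1 / 2) * 128 / m +
        (128 * (4 / μ * majC (1 / 2) * (32 / nearC μ * invSinC.toReal) / m) +
        128 * (4 / μ * majC (1 / 2) * (32 / nearC μ * invSinC.toReal) / m)) =
        4 / μ * majC (1 / 2) * (128 + 8192 / nearC μ * invSinC.toReal) / m := by ring
    rw [e2]; unfold conF
    gcongr
    linarith [show 0 ≤ 3072 / (μ * nearC μ) by positivity]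

end KadenSpiral
end

/-! ### The kernel near its singularity. -/

noncomputable section
namespace KadenSpiral

variable {μ α : ℝ} {p : ℝ → ℂ} {m θ : ℝ}

/-- Lower bound constant for the phase. -/
def lowC (μ : ℝ) : ℝ := min (μ / 4) (1 / 10)

theorem lowC_pos (hμ : 0 < μ) : 0 < lowC μ := lt_min (by linarith) (by norm_num)

/-- For `θ ≤ 1` the real part of the phase is large enough; for `θ ≥ 1` its imaginary part has slope
at least `θ/3 - 1/8 ≥ (1+θ)/10` on the unit interval. -/
theorem Sym.norm_symP_ge (hp : Sym μ α p) (hμ : 0 < μ) (hθ : 0 < θ) {u : ℝ} (hu : |u| ≤ 1) :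
    lowC μ * (1 + θ) * |u| ≤ ‖symP p θ u‖ := by
  have hκ1 : lowC μ ≤ μ / 4 := min_le_left _ _
  have hκ2 : lowC μ ≤ 1 / 10 := min_le_right _ _
  have hκ := lowC_pos hμ
  have hu0 := abs_nonneg u
  rcases le_total θ 1 with h1 | h1
  · have h2 := hp.sg_symP_re hθ u
    have h3 := Complex.abs_re_le_norm (symP p θ u)
    have h4 : |sg u * (symP p θ u).re| = |(symP p θ u).re| := by rw [abs_mul, abs_sg, one_mul]
    have h5 := neg_abs_le (sg u * (symP p θ u).re)
    have h6 : lowC μ * (1 + θ) * |u| ≤ μ / 4 * 2 * |u| := by gcongr; linarith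
    linarith
  · have hd : ∀ x, HasDerivAt (fun v => 1 * (symP p θ v).im) (1 * (symZ p θ x).im) x :=
      hp.hasDerivAt_symP_im (m := 1) hθ
    have key := Convex.mul_sub_le_image_sub_of_le_deriv (convex_Icc (-1 : ℝ) 1)
      (f := fun v => 1 * (symP p θ v).im) (C := 1 / 10 * (1 + θ))
      (fun x _ => (hd x).continuousAt.continuousWithinAt)
      (fun x _ => (hd x).differentiableAt.differentiableWithinAt) (fun x hx => by
        rw [interior_Icc] at hx
        rw [(hd x).deriv]
        have := (hp.symZ_im_bounds hθ (abs_le.2 ⟨hx.1.le, hx.2.le⟩)).1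
        linarith)
    have h3 := Complex.abs_im_le_norm (symP p θ u)
    have h4 := abs_le.1 hu
    have h7 : lowC μ * (1 + θ) * |u| ≤ 1 / 10 * (1 + θ) * |u| := by gcongr
    rcases le_total 0 u with h | h
    · have := key 0 (by simp) u ⟨h4.1, h4.2⟩ h
      simp only [symP_zero, Complex.zero_im, mul_zero, sub_zero, one_mul] at this
      rw [abs_of_nonneg h] at h7 ⊢
      linarith [le_abs_self (symP p θ u).im]
    · have := key u ⟨h4.1, h4.2⟩ 0 (by simp) h
      simp only [symP_zero, Complex.zero_im, mul_zero, zero_sub, one_mul] at this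
      rw [abs_of_nonpos h] at h7 ⊢
      linarith [neg_abs_le (symP p θ u).im]

theorem exp_abs_le_three {u : ℝ} (hu : |u| ≤ 1) : Real.exp |u| ≤ 3 :=
  (exp_bounds_unit (u := |u|) (by rwa [abs_abs])).2

theorem Sym.norm_symZ_le_unit (hp : Sym μ α p) (hμ : 0 < μ) (hθ : 0 < θ) {u : ℝ} (hu : |u| ≤ 1) :
    ‖symZ p θ u‖ ≤ 3 * (1 + 2 * μ) * (1 + θ) := by
  have h1 := hp.norm_symZ_le hμ hθ u
  have h2 := exp_abs_le_three hu
  have h3 : (1 + 2 * μ) * (1 + θ) * Real.exp |u| ≤ (1 + 2 * μ) * (1 + θ) * 3 := by gcongr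
  linarith

theorem Sym.norm_symP_le (hp : Sym μ α p) (hμ : 0 < μ) (hθ : 0 < θ) {u : ℝ} (hu : |u| ≤ 1) :
    ‖symP p θ u‖ ≤ 3 * (1 + 2 * μ) * (1 + θ) * |u| := by
  have := intervalIntegral.norm_integral_le_of_norm_le_const (a := (0 : ℝ)) (b := u)
    (f := symZ p θ) (C := 3 * (1 + 2 * μ) * (1 + θ)) fun v hv => by
      refine hp.norm_symZ_le_unit hμ hθ (le_trans ?_ hu)
      rcases le_total 0 u with h | h
      · rw [uIoc_of_le h] at hv
        rw [abs_of_pos hv.1, abs_of_nonneg h]; exact hv.2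
      · rw [uIoc_of_ge h] at hv
        rw [abs_of_nonpos hv.2, abs_of_nonpos h]; linarith [hv.1]
  simpa [symP] using this

theorem norm_exp_sub_one_ge {w : ℂ} (hw : ‖w‖ ≤ 1 / 2) : ‖w‖ / 2 ≤ ‖1 - Complex.exp w‖ := by
  have h1 := Complex.norm_exp_sub_one_sub_id_le (hw.trans (by norm_num))
  have h2 := norm_sub_norm_le w (w - (Complex.exp w - 1))
  have e1 : w - (w - (Complex.exp w - 1)) = -(1 - Complex.exp w) := by ring
  have e2 : ‖w - (Complex.exp w - 1)‖ = ‖Complex.exp w - 1 - w‖ := by rw [norm_sub_rev]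
  have h3 := norm_sub_norm_le w (w - (Complex.exp w - 1))
  rw [e1, e2, norm_neg] at h3
  nlinarith [norm_nonneg w]

/-- The function `e^w/(1-e^w)` has a simple pole at the origin with residue `-1`; removing it leaves
a bounded function on `|w| ≤ 1/2`. -/
theorem norm_exp_div_add_inv_le {w : ℂ} (hw : ‖w‖ ≤ 1 / 2) (h0 : w ≠ 0) :
    ‖Complex.exp w / (1 - Complex.exp w) + 1 / w‖ ≤ 6 := by
  have hw0 := norm_pos_iff.2 h0
  have h1 := Complex.norm_exp_sub_one_sub_id_le (hw.trans (by norm_num))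
  have h2 := Complex.norm_exp_sub_one_le (hw.trans (by norm_num))
  have h3 := norm_exp_sub_one_ge hw
  have h4 : 0 < ‖1 - Complex.exp w‖ := by linarith
  have h5 := norm_pos_iff.1 h4
  have e1 : Complex.exp w / (1 - Complex.exp w) + 1 / w =
      (w * (Complex.exp w - 1) - (Complex.exp w - 1 - w)) / (w * (1 - Complex.exp w)) := by
    field_simp; ring
  rw [e1, norm_div, norm_mul, div_le_iff₀ (by positivity)]
  have h6 := norm_sub_le (w * (Complex.exp w - 1)) (Complex.exp w - 1 - w)
  rw [norm_mul] at h6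
  nlinarith

section near

variable {u : ℝ}

theorem Sym.norm_exponent_le (hp : Sym μ α p) (hμ : 0 < μ) (hθ : 0 < θ) (hm : 0 < m)
    (hu : |u| ≤ 1) (hn : m * (1 + θ) * |u| ≤ nearC μ) :
    ‖((sg u * m : ℝ) : ℂ) * symP p θ u‖ ≤ 1 / 2 := by
  rw [norm_mul, Complex.norm_real, Real.norm_eq_abs, abs_mul, abs_sg, one_mul, abs_of_pos hm]
  have h1 := mul_le_mul_of_nonneg_left (hp.norm_symP_le hμ hθ hu) hm.le
  have h2 := nearC_mul hμ
  have h3 : 3 * (1 + 2 * μ) * (m * (1 + θ) * |u|) ≤ 3 * (1 + 2 * μ) * nearC μ := by gcongr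
  linarith

theorem Sym.norm_one_sub_kerQ_ge_near (hp : Sym μ α p) (hμ : 0 < μ) (hθ : 0 < θ) (hm : 0 < m)
    (hu : |u| ≤ 1) (hn : m * (1 + θ) * |u| ≤ nearC μ) :
    m * (lowC μ * (1 + θ) * |u|) / 2 ≤ ‖1 - kerQ p m θ u‖ := by
  have h1 := norm_exp_sub_one_ge (hp.norm_exponent_le hμ hθ hm hu hn)
  have h2 := mul_le_mul_of_nonneg_left (hp.norm_symP_ge hμ hθ hu) hm.le
  rw [norm_mul, Complex.norm_real, Real.norm_eq_abs, abs_mul, abs_sg, one_mul, abs_of_pos hm] at h1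
  unfold kerQ
  linarith

theorem norm_ker : ‖ker p m θ u‖ = ‖kerQ p m θ u‖ / ‖1 - kerQ p m θ u‖ := by
  rw [ker, norm_mul, Complex.norm_real, Real.norm_eq_abs, abs_sg, one_mul, norm_div]

theorem Sym.norm_kerQ_le_one (hp : Sym μ α p) (hμ : 0 < μ) (hθ : 0 < θ) (hm : 0 < m) (u : ℝ) :
    ‖kerQ p m θ u‖ ≤ 1 := by
  refine (hp.norm_kerQ_le hθ hm.le u).trans (Real.exp_le_one_iff.2 ?_)
  have := mul_nonneg (rate_pos hμ hm).le (abs_nonneg u)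
  linarith

theorem Sym.norm_ker_le_near (hp : Sym μ α p) (hμ : 0 < μ) (hθ : 0 < θ) (hm : 0 < m) (hu0 : u ≠ 0)
    (hu : |u| ≤ 1) (hn : m * (1 + θ) * |u| ≤ nearC μ) :
    ‖ker p m θ u‖ ≤ 2 / lowC μ / (m * (1 + θ) * |u|) := by
  have hκ := lowC_pos hμ
  have hua := abs_pos.2 hu0
  rw [norm_ker]
  calc _ ≤ 1 / (m * (lowC μ * (1 + θ) * |u|) / 2) :=
        div_le_div₀ zero_le_one (hp.norm_kerQ_le_one hμ hθ hm u) (by positivity)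
          (hp.norm_one_sub_kerQ_ge_near hμ hθ hm hu hn)
    _ = _ := by field_simp

theorem le_rpow_self_of_le_one {a Y : ℝ} (hα0 : 0 < α) (hα1 : α ≤ 1) (ha : 0 ≤ a) (haY : a ≤ Y)
    (hY : Y ≤ 1) : a ≤ Y ^ α :=
  haY.trans (self_le_rpow hα1 (ha.trans haY) hY hα0)

theorem Sym.norm_symZ_sub_le (hp : Sym μ α p) (hα0 : 0 < α) (hα1 : α ≤ 1) (hθ : 0 < θ)
    {v w Y : ℝ} (hv : |v| ≤ 1) (hw : |w| ≤ 1) (hY : θ * |w - v| ≤ Y) (hY1 : Y ≤ 1) :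
    ‖symZ p θ w - symZ p θ v‖ ≤ 4 * Y ^ α := by
  wlog h : v < w generalizing v w
  · rcases (not_lt.1 h).eq_or_lt with rfl | h'
    · have : 0 ≤ Y := le_trans (by positivity) hY
      simp only [sub_self, norm_zero]; positivity
    · rw [norm_sub_rev]
      exact this hw hv (by rwa [abs_sub_comm]) h'
  have hY0 : 0 ≤ Y := le_trans (by positivity) hY
  rw [abs_of_pos (by linarith)] at hY
  have h1 : Real.exp w - Real.exp v ≤ 3 * (w - v) := by
    have h2 := Real.add_one_le_exp (v - w)
    have h3 : Real.exp v = Real.exp w * Real.exp (v - w) := by rw [← Real.exp_add]; ring_nf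
    have h4 := (exp_bounds_unit hw).2
    rw [h3]
    nlinarith [Real.exp_pos w]
  have hlt : θ * Real.exp v < θ * Real.exp w := by gcongr
  have h5 : θ * Real.exp w - θ * Real.exp v ≤ 3 * Y := by nlinarith
  have h6 := hp.hol (by positivity) hlt
  have h7 : (θ * Real.exp w - θ * Real.exp v) ^ α ≤ 3 * Y ^ α := by
    refine (Real.rpow_le_rpow (by linarith) h5 hα0.le).trans ?_
    rw [Real.mul_rpow (by norm_num) hY0]
    gcongr
    simpa using Real.rpow_le_rpow_of_exponent_le (x := 3) (by norm_num) hα1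
  have h8 := self_le_rpow hα1 hY0 hY1 hα0
  have e1 : symZ p θ w - symZ p θ v = Complex.I * ((θ * Real.exp w - θ * Real.exp v : ℝ) : ℂ) -
      (p (θ * Real.exp w) - p (θ * Real.exp v)) := by unfold symZ; push_cast; ring
  rw [e1]
  refine (_root_.norm_sub_le _ _).trans ?_
  rw [norm_mul, Complex.norm_I, one_mul, Complex.norm_real, Real.norm_of_nonneg (by linarith)]
  linarith

/-- The difference is `∫_0^u (Z(u) - Z(v)) dv`, controlled by the Hölder modulus of `Z = ∂_u P` at
the scale `θ|u|`. -/
theorem Sym.norm_symZ_mul_sub_symP_le (hp : Sym μ α p) (hα0 : 0 < α) (hα1 : α ≤ 1) (hθ : 0 < θ)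
    {Y : ℝ} (hu : |u| ≤ 1) (hY : θ * |u| ≤ Y) (hY1 : Y ≤ 1) :
    ‖symZ p θ u * u - symP p θ u‖ ≤ 4 * Y ^ α * |u| := by
  have e1 : symZ p θ u * u - symP p θ u = ∫ v in (0 : ℝ)..u, (symZ p θ u - symZ p θ v) := by
    rw [intervalIntegral.integral_sub (by simp)
      ((hp.continuous_symZ hθ).intervalIntegrable 0 u), intervalIntegral.integral_const, symP]
    simp [mul_comm]
  rw [e1]
  have := intervalIntegral.norm_integral_le_of_norm_le_const (a := (0 : ℝ)) (b := u)
    (f := fun v => symZ p θ u - symZ p θ v) (C := 4 * Y ^ α) fun v hv => by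
      have h3 : |v| ≤ |u| ∧ |u - v| ≤ |u| := by
        rcases le_total 0 u with h | h
        · rw [uIoc_of_le h] at hv
          rw [abs_of_pos hv.1, abs_of_nonneg h, abs_of_nonneg (by linarith [hv.2])]
          exact ⟨hv.2, by linarith [hv.1]⟩
        · rw [uIoc_of_ge h] at hv
          rw [abs_of_nonpos hv.2, abs_of_nonpos h, abs_of_nonpos (by linarith [hv.1])]
          exact ⟨by linarith [hv.1], by linarith [hv.2]⟩
      exact hp.norm_symZ_sub_le hα0 hα1 hθ (h3.1.trans hu) hu
        ((mul_le_mul_of_nonneg_left h3.2 hθ.le).trans hY) hY1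
  simpa using this

/-- Constant of the kernel expansion at the singularity. -/
def conR (μ : ℝ) : ℝ := 4 / lowC μ + 18 * (1 + 2 * μ)

theorem conR_nonneg (hμ : 0 < μ) : 0 ≤ conR μ := by
  have := lowC_pos hμ; unfold conR; positivity

/-- With `Z = ∂_u P`, removing the pole in the variable `mP` leaves a bounded multiple of `Z`, and
`Z/(mP)` differs from `1/(mu)` by `(Zu - P)/(muP)`. Both errors have the integrable form `Y^α/|u|`,
where `Y = m(1+θ)|u|`. -/
theorem Sym.kernel_expansion (hp : Sym μ α p) (hα0 : 0 < α) (hα1 : α ≤ 1) (hμ : 0 < μ)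
    (hθ : 0 < θ) (hm : 1 ≤ m) (hu0 : u ≠ 0) (hu : |u| ≤ 1) (hn : m * (1 + θ) * |u| ≤ nearC μ) :
    ‖symZ p θ u * ker p m θ u + 1 / (m * u)‖ ≤
      conR μ / m * ((m * (1 + θ) * |u|) ^ α / |u|) := by
  have hm0 : 0 < m := by linarith
  have hκ := lowC_pos hμ
  have hua := abs_pos.2 hu0
  set Y := m * (1 + θ) * |u| with hYdef
  have hY0 : 0 < Y := by positivity
  have hY1 : Y ≤ 1 := hn.trans ((nearC_le hμ).trans (by norm_num))
  have hYa : Y ≤ Y ^ α := self_le_rpow hα1 hY0.le hY1 hα0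
  have hθY : θ * |u| ≤ Y := by
    rw [hYdef]; gcongr; nlinarith
  have hPl := hp.norm_symP_ge hμ hθ hu
  have hP0 : symP p θ u ≠ 0 := norm_pos_iff.1 (lt_of_lt_of_le (by positivity) hPl)
  have hs0 : ((sg u : ℝ) : ℂ) ≠ 0 := by
    intro h
    have := abs_sg u
    rw [Complex.ofReal_eq_zero.1 h] at this; norm_num at this
  have hss : ((sg u : ℝ) : ℂ) * sg u = 1 := by rw [← Complex.ofReal_mul, sg_mul_self]; simp
  have hmc : (m : ℂ) ≠ 0 := Complex.ofReal_ne_zero.2 hm0.ne'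
  have huc : (u : ℂ) ≠ 0 := Complex.ofReal_ne_zero.2 hu0
  have hw0 : ((sg u * m : ℝ) : ℂ) * symP p θ u ≠ 0 := by
    rw [Complex.ofReal_mul]; exact mul_ne_zero (mul_ne_zero hs0 hmc) hP0
  have hb := norm_exp_div_add_inv_le (hp.norm_exponent_le hμ hθ hm0 hu hn) hw0
  have hZ := hp.norm_symZ_le_unit hμ hθ hu
  have hZP := hp.norm_symZ_mul_sub_symP_le hα0 hα1 hθ hu hθY hY1
  set b := Complex.exp (((sg u * m : ℝ) : ℂ) * symP p θ u) /
    (1 - Complex.exp (((sg u * m : ℝ) : ℂ) * symP p θ u)) +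
      1 / (((sg u * m : ℝ) : ℂ) * symP p θ u) with hbdef
  have e0 : ker p m θ u = sg u * b - 1 / (m * symP p θ u) := by
    rw [hbdef, ker, kerQ, mul_add]
    have : (sg u : ℂ) * (1 / (((sg u * m : ℝ) : ℂ) * symP p θ u)) = 1 / (m * symP p θ u) := by
      rw [Complex.ofReal_mul]; field_simp
    rw [this]; ring
  have e1 : symZ p θ u * ker p m θ u + 1 / (m * u) =
      sg u * (b * symZ p θ u) - (symZ p θ u * u - symP p θ u) / (m * u * symP p θ u) := by
    rw [e0]; field_simp; ring
  rw [e1]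
  refine (_root_.norm_sub_le _ _).trans ?_
  have b1 : ‖(sg u : ℂ) * (b * symZ p θ u)‖ ≤ 18 * (1 + 2 * μ) / m * (Y ^ α / |u|) := by
    rw [norm_mul, Complex.norm_real, Real.norm_eq_abs, abs_sg, one_mul, norm_mul]
    calc ‖b‖ * ‖symZ p θ u‖ ≤ 6 * (3 * (1 + 2 * μ) * (1 + θ)) := by gcongr
      _ = 18 * (1 + 2 * μ) / m * (Y / |u|) := by rw [hYdef]; field_simp; norm_num
      _ ≤ _ := by gcongr
  have b2 : ‖(symZ p θ u * u - symP p θ u) / (m * u * symP p θ u)‖ ≤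
      4 / lowC μ / m * (Y ^ α / |u|) := by
    rw [norm_div, norm_mul, norm_mul, Complex.norm_real, Complex.norm_real, Real.norm_eq_abs,
      Real.norm_eq_abs, abs_of_pos hm0]
    have h9 : m * |u| * (lowC μ * |u|) ≤ m * |u| * ‖symP p θ u‖ := by
      gcongr
      refine le_trans ?_ hPl
      gcongr
      exact le_mul_of_one_le_right hκ.le (by linarith)
    calc _ ≤ 4 * Y ^ α * |u| / (m * |u| * (lowC μ * |u|)) := by gcongr
      _ = _ := by field_simp
  have : conR μ / m * (Y ^ α / |u|) =
    18 * (1 + 2 * μ) / m * (Y ^ α / |u|) + 4 / lowC μ / m * (Y ^ α / |u|) := by unfold conR; ring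
  rw [this]; exact add_le_add b1 b2

theorem norm_kernel_le_near (hp : Sym μ α p) (hμ : 0 < μ) (hθ : 0 < θ) (hm : 0 < m) (hu0 : u ≠ 0)
    (hu : |u| ≤ 1) (hn : m * (1 + θ) * |u| ≤ nearC μ) :
    ‖symZ p θ u * ker p m θ u‖ ≤ 6 * (1 + 2 * μ) / lowC μ / m / |u| := by
  have hκ := lowC_pos hμ
  have hua := abs_pos.2 hu0
  rw [norm_mul]
  calc _ ≤ 3 * (1 + 2 * μ) * (1 + θ) * (2 / lowC μ / (m * (1 + θ) * |u|)) := by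
        gcongr
        · exact hp.norm_symZ_le_unit hμ hθ hu
        · exact hp.norm_ker_le_near hμ hθ hm hu0 hu hn
    _ = _ := by field_simp; norm_num

theorem ker_sub_eq (hp : Sym μ α p) (hμ : 0 < μ) {θ₁ θ₂ : ℝ} (h1 : 0 < θ₁) (h2 : 0 < θ₂)
    (hm : 0 < m) (hu : u ≠ 0) : ker p m θ₁ u - ker p m θ₂ u =
      sg u * ((kerQ p m θ₁ u - kerQ p m θ₂ u) /
        ((1 - kerQ p m θ₁ u) * (1 - kerQ p m θ₂ u))) := by
  have := hp.one_sub_kerQ_ne hμ h1 hm hu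
  have := hp.one_sub_kerQ_ne hμ h2 hm hu
  unfold ker; field_simp; ring

/-- Constant of the kernel variation near the singularity. -/
def conK (μ : ℝ) : ℝ := 12 / lowC μ + 72 * (1 + 2 * μ) / lowC μ ^ 2

theorem conK_nonneg (hμ : 0 < μ) : 0 ≤ conK μ := by
  have := lowC_pos hμ; unfold conK; positivity

/-- The variation of `∂_u P` and that of `ker` each cost `(θ₁-θ₂)^α`. In the second, the factor
`1+θ₂` from `∂_u P` is cancelled by one of the two denominators `1-q`. -/
theorem Sym.kernel_shift_near (hp : Sym μ α p) (hα0 : 0 < α) (hα1 : α ≤ 1) (hμ : 0 < μ)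
    {θ₁ θ₂ : ℝ} (h2 : 0 < θ₂) (h12 : θ₂ < θ₁) (h1 : θ₁ ≤ θ₂ + 1) (hm : 0 < m) (hu0 : u ≠ 0)
    (hu : |u| ≤ 1) (hn : m * (1 + θ₁) * |u| ≤ nearC μ) :
    ‖symZ p θ₁ u * ker p m θ₁ u - symZ p θ₂ u * ker p m θ₂ u‖ ≤
      conK μ / m * (θ₁ - θ₂) ^ α / |u| := by
  have hκ := lowC_pos hμ
  have hua := abs_pos.2 hu0
  have hθ1 : 0 < θ₁ := h2.trans h12
  have hδ : 0 ≤ (θ₁ - θ₂) ^ α := Real.rpow_nonneg (by linarith) _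
  have hn2 : m * (1 + θ₂) * |u| ≤ nearC μ := le_trans (by gcongr) hn
  have hE := exp_abs_le_three hu
  have e1 : symZ p θ₁ u * ker p m θ₁ u - symZ p θ₂ u * ker p m θ₂ u =
      (symZ p θ₁ u - symZ p θ₂ u) * ker p m θ₁ u +
        symZ p θ₂ u * (ker p m θ₁ u - ker p m θ₂ u) := by ring
  rw [e1]
  refine (norm_add_le _ _).trans ?_
  have b1 : ‖(symZ p θ₁ u - symZ p θ₂ u) * ker p m θ₁ u‖ ≤
      12 / lowC μ / m * (θ₁ - θ₂) ^ α / |u| := by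
    rw [norm_mul]
    have hz : ‖symZ p θ₁ u - symZ p θ₂ u‖ ≤ 2 * (θ₁ - θ₂) ^ α * 3 :=
      (hp.symZ_shift hα0 hα1 h2 h12 h1 u).trans (by gcongr)
    have hk : ‖ker p m θ₁ u‖ ≤ 2 / lowC μ / (m * |u|) := by
      refine (hp.norm_ker_le_near hμ hθ1 hm hu0 hu hn).trans ?_
      gcongr
      nlinarith
    calc _ ≤ 2 * (θ₁ - θ₂) ^ α * 3 * (2 / lowC μ / (m * |u|)) := by gcongr
      _ = _ := by field_simp; ring
  have b2 : ‖symZ p θ₂ u * (ker p m θ₁ u - ker p m θ₂ u)‖ ≤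
      72 * (1 + 2 * μ) / lowC μ ^ 2 / m * (θ₁ - θ₂) ^ α / |u| := by
    rw [ker_sub_eq hp hμ hθ1 h2 hm hu0, norm_mul, norm_mul, Complex.norm_real, Real.norm_eq_abs,
      abs_sg, one_mul, norm_div, norm_mul]
    have hq : ‖kerQ p m θ₁ u - kerQ p m θ₂ u‖ ≤ 2 * (θ₁ - θ₂) ^ α * 3 * (m * |u|) := by
      refine (hp.kerQ_shift hα0 hα1 hm.le h2 h12 h1 u).trans ?_
      have : Real.exp (-(2 * (rate μ m * |u|))) ≤ 1 := by
        refine Real.exp_le_one_iff.2 ?_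
        have := mul_nonneg (rate_pos hμ hm).le (abs_nonneg u)
        linarith
      refine (mul_le_of_le_one_left (by positivity) this).trans ?_
      gcongr
    have hd1 := hp.norm_one_sub_kerQ_ge_near hμ hθ1 hm hu hn
    have hd2 := hp.norm_one_sub_kerQ_ge_near hμ h2 hm hu hn2
    have hd1' : m * (lowC μ * |u|) / 2 ≤ ‖1 - kerQ p m θ₁ u‖ := by
      refine le_trans ?_ hd1
      gcongr
      exact le_mul_of_one_le_right hκ.le (by linarith)
    have hz := hp.norm_symZ_le_unit hμ h2 hu
    calc _ ≤ 3 * (1 + 2 * μ) * (1 + θ₂) * (2 * (θ₁ - θ₂) ^ α * 3 * (m * |u|) /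
          (m * (lowC μ * |u|) / 2 * (m * (lowC μ * (1 + θ₂) * |u|) / 2))) := by gcongr
      _ = _ := by field_simp; ring
  have : conK μ / m * (θ₁ - θ₂) ^ α / |u| = 12 / lowC μ / m * (θ₁ - θ₂) ^ α / |u| +
      72 * (1 + 2 * μ) / lowC μ ^ 2 / m * (θ₁ - θ₂) ^ α / |u| := by unfold conK; ring
  rw [this]; exact add_le_add b1 b2

end near

/-- The integral of `|u|^{α-1}` over the near region. When `c l` is bounded, as it is at the
cut-off, the result is scale invariant, and the prefactor `B` carries all the smallness. -/
theorem near_integral {f : ℝ → ℂ} {B c l : ℝ} (hα0 : 0 < α) (hl : 0 < l) (hc : 0 ≤ c)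
    (hB : 0 ≤ B) (hf : ∀ u, u ≠ 0 → |u| ≤ l → ‖f u‖ ≤ B * ((c * |u|) ^ α / |u|)) :
    ‖∫ u in Icc (-l) l, f u‖ ≤ 2 / α * B * (c * l) ^ α ∧
      (AEStronglyMeasurable f → IntegrableOn f (Icc (-l) l)) := by
  have hpos : IntegrableOn (fun u : ℝ => u ^ (α - 1)) (Ioc 0 l) := by
    have := intervalIntegral.intervalIntegrable_rpow' (a := 0) (b := l) (r := α - 1) (by linarith)
    rwa [intervalIntegrable_iff_integrableOn_Ioc_of_le hl.le] at this
  have hval : ∫ u in (0 : ℝ)..l, u ^ (α - 1) = l ^ α / α := by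
    rw [integral_rpow (Or.inl (by linarith))]
    rw [sub_add_cancel, Real.zero_rpow hα0.ne', sub_zero]
  set g : ℝ → ℝ := (Ioc 0 l).indicator (fun u => u ^ (α - 1)) with hg
  have hgi : Integrable (fun x => g |x|) := by
    refine integrable_comp_abs_of_integrableOn (Integrable.integrableOn ?_)
    rwa [hg, integrable_indicator_iff measurableSet_Ioc]
  have hgv : ∫ x, g |x| = 2 * (l ^ α / α) := by
    rw [integral_comp_abs, hg, setIntegral_indicator measurableSet_Ioc,
      inter_eq_self_of_subset_right Ioc_subset_Ioi_self, ← hval,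
      intervalIntegral.integral_of_le hl.le]
  have hg0 : ∀ x, 0 ≤ g |x| := fun x => indicator_nonneg (fun u hu => Real.rpow_nonneg hu.1.le _) _
  have hle : ∀ᵐ u ∂volume.restrict (Icc (-l) l), ‖f u‖ ≤ B * c ^ α * g |u| := by
    filter_upwards [ae_restrict_of_ae ae_ne_zero, ae_restrict_mem measurableSet_Icc] with u hu0 hu
    have hul : |u| ≤ l := abs_le.2 hu
    have hua := abs_pos.2 hu0
    rw [hg, indicator_of_mem (show |u| ∈ Ioc 0 l from ⟨hua, hul⟩), Real.rpow_sub hua, Real.rpow_one]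
    refine (hf u hu0 hul).trans (le_of_eq ?_)
    rw [Real.mul_rpow hc hua.le]; ring
  have hB' : 0 ≤ B * c ^ α := by positivity
  constructor
  · refine (norm_integral_le_of_norm_le (hgi.const_mul _).integrableOn hle).trans ?_
    rw [integral_const_mul]
    have h1 : ∫ u in Icc (-l) l, g |u| ≤ 2 * (l ^ α / α) := by
      rw [← hgv]; exact setIntegral_le_integral hgi (Eventually.of_forall hg0)
    refine (mul_le_mul_of_nonneg_left h1 hB').trans (le_of_eq ?_)
    rw [Real.mul_rpow hc hl.le]; ring
  · intro hfm
    exact (hgi.const_mul _).integrableOn.mono' hfm.restrict hle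

end KadenSpiral
end

/-! ### Sup bound of the singular operator for balanced weights. -/

noncomputable section
namespace KadenSpiral

variable {μ α : ℝ} {p : ℝ → ℂ} {m θ : ℝ}

theorem Sym.measurable_farG (hp : Sym μ α p) (hθ : 0 < θ) : Measurable (farG μ p m θ) := by
  have := hp.measurable_kerQ (m := m) hθ
  unfold farG; fun_prop

theorem Sym.far_integral_le (hp : Sym μ α p) (hμ : 1 / 2 < μ) (hm : Large μ m) {θ₁ θ₂ : ℝ}
    (h1 : 0 < θ₁) (h2 : 0 < θ₂) {l K : ℝ} (hK : 0 ≤ K) (hl : 0 < l)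
    (hl1 : l * (m * (1 + θ₁)) ≤ nearC μ) (hl1' : nearC μ / 2 ≤ l * (m * (1 + θ₁)))
    (hl2 : l * (m * (1 + θ₂)) ≤ nearC μ) (hl2' : nearC μ / 2 ≤ l * (m * (1 + θ₂))) {f : ℝ → ℂ}
    (hf : ∀ u, u ≠ 0 → ‖f u‖ ≤ K * (farG μ p m θ₁ u + farG μ p m θ₂ u)) :
    ‖∫ u in (Icc (-l) l)ᶜ, f u‖ ≤ K * (2 * conF μ / m) := by
  have hμ0 : 0 < μ := by linarith
  have hm0 := hm.pos hμ0
  have hr := (rate_pos hμ0 hm0).le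
  have hF := conF_nonneg hμ0
  have hb : ∫⁻ u in (Icc (-l) l)ᶜ, ENNReal.ofReal ‖f u‖ ≤ ENNReal.ofReal (K * (2 * conF μ / m)) := by
    have h3 : ∫⁻ u in (Icc (-l) l)ᶜ, ENNReal.ofReal ‖f u‖ ≤
        ∫⁻ u in (Icc (-l) l)ᶜ, ENNReal.ofReal K *
          (ENNReal.ofReal (farG μ p m θ₁ u) + ENNReal.ofReal (farG μ p m θ₂ u)) := by
      refine lintegral_mono_ae (ae_restrict_of_ae (ae_ne_zero.mono fun u hu => ?_))
      rw [← ENNReal.ofReal_add (farG_nonneg hr u) (farG_nonneg hr u), ← ENNReal.ofReal_mul hK]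
      exact ENNReal.ofReal_le_ofReal (hf u hu)
    refine h3.trans ?_
    rw [lintegral_const_mul' _ _ ENNReal.ofReal_ne_top,
      lintegral_add_left (hp.measurable_farG h1).ennreal_ofReal, ENNReal.ofReal_mul hK]
    gcongr
    refine (add_le_add (hp.lintegral_farG_le hμ hm h1 hl hl1' hl1)
      (hp.lintegral_farG_le hμ hm h2 hl hl2' hl2)).trans ?_
    rw [← ENNReal.ofReal_add (by positivity) (by positivity)]
    exact ENNReal.ofReal_le_ofReal (le_of_eq (by ring))
  refine (norm_integral_le_lintegral_norm _).trans ?_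
  exact ENNReal.toReal_le_of_le_ofReal (by positivity) hb

theorem Sym.exp_mul_ker_le (hp : Sym μ α p) (hμ : 0 < μ) (hm : Large μ m) (hθ : 0 < θ) {a : ℝ}
    (ha : a ≤ 2 * μ + 20) (u : ℝ) : Real.exp (a * |u|) * ‖ker p m θ u‖ ≤ farG μ p m θ u := by
  have hm0 := hm.pos hμ
  have hx : 0 ≤ rate μ m * |u| := mul_nonneg (rate_pos hμ hm0).le (abs_nonneg u)
  have h1 : Real.exp (a * |u|) * ‖kerQ p m θ u‖ ≤ Real.exp (-(rate μ m * |u|)) := by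
    refine (mul_le_mul (hm.exp_le ha u) (hp.norm_kerQ_le hθ hm0.le u) (norm_nonneg _)
      (Real.exp_pos _).le).trans ?_
    rw [← Real.exp_add]
    exact Real.exp_le_exp.2 (by linarith)
  rw [norm_ker, ← mul_div_assoc]
  unfold farG
  have : Real.exp (a * |u|) * ‖kerQ p m θ u‖ / ‖1 - kerQ p m θ u‖ ≤
      Real.exp (-(rate μ m * |u|)) / ‖1 - kerQ p m θ u‖ := by gcongr
  refine this.trans (le_add_of_nonneg_right ?_)
  positivity

/-- The variation of `q` is of order `m|u|`, a multiple of `rate·|u|`, and the product of the two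
denominators is separated by `2ab ≤ a² + b²`. This accounts for the second term of `farG`. -/
theorem Sym.exp_mul_ker_sub_le (hp : Sym μ α p) (hα0 : 0 < α) (hα1 : α ≤ 1) (hμ : 0 < μ)
    (hm : Large μ m) {θ₁ θ₂ : ℝ} (h2 : 0 < θ₂) (h12 : θ₂ < θ₁) (h1 : θ₁ ≤ θ₂ + 1) {a : ℝ}
    (ha : a ≤ 2 * μ + 19) {u : ℝ} (hu : u ≠ 0) :
    Real.exp (a * |u|) * ‖ker p m θ₁ u - ker p m θ₂ u‖ ≤
      8 / μ * (θ₁ - θ₂) ^ α * (farG μ p m θ₁ u + farG μ p m θ₂ u) := by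
  have hm0 := hm.pos hμ
  have hx : 0 ≤ rate μ m * |u| := mul_nonneg (rate_pos hμ hm0).le (abs_nonneg u)
  have hxm : m * |u| = 4 / μ * (rate μ m * |u|) := by unfold rate; field_simp
  have hδ : 0 ≤ (θ₁ - θ₂) ^ α := Real.rpow_nonneg (by linarith) _
  rw [ker_sub_eq hp hμ (h2.trans h12) h2 hm0 hu, norm_mul, Complex.norm_real, Real.norm_eq_abs,
    abs_sg, one_mul, norm_div, norm_mul]
  have hq := hp.kerQ_shift hα0 hα1 hm0.le h2 h12 h1 u
  have hE : Real.exp (a * |u|) * ‖kerQ p m θ₁ u - kerQ p m θ₂ u‖ ≤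
      8 / μ * (θ₁ - θ₂) ^ α * (Real.exp (-(rate μ m * |u|)) * (rate μ m * |u|)) := by
    have h3 : Real.exp (a * |u|) * Real.exp |u| * Real.exp (-(2 * (rate μ m * |u|))) ≤
        Real.exp (-(rate μ m * |u|)) := by
      have h4 := hm.exp_le (k := a + 1) (by linarith) u
      have e1 : Real.exp (a * |u|) * Real.exp |u| = Real.exp ((a + 1) * |u|) := by
        rw [← Real.exp_add]; ring_nf
      rw [e1]
      refine (mul_le_mul_of_nonneg_right h4 (Real.exp_pos _).le).trans ?_
      rw [← Real.exp_add]
      exact Real.exp_le_exp.2 (by linarith)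
    calc _ ≤ Real.exp (a * |u|) * (Real.exp (-(2 * (rate μ m * |u|))) *
          (2 * (θ₁ - θ₂) ^ α * Real.exp |u| * (m * |u|))) := by gcongr
      _ = 8 / μ * (θ₁ - θ₂) ^ α * (Real.exp (a * |u|) * Real.exp |u| *
          Real.exp (-(2 * (rate μ m * |u|))) * (rate μ m * |u|)) := by rw [hxm]; ring
      _ ≤ _ := by gcongr
  have hab : 1 / (‖1 - kerQ p m θ₁ u‖ * ‖1 - kerQ p m θ₂ u‖) ≤
      1 / ‖1 - kerQ p m θ₁ u‖ ^ 2 + 1 / ‖1 - kerQ p m θ₂ u‖ ^ 2 := by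
    rw [one_div, mul_inv, one_div, one_div, ← inv_pow, ← inv_pow]
    nlinarith [sq_nonneg (‖1 - kerQ p m θ₁ u‖⁻¹ - ‖1 - kerQ p m θ₂ u‖⁻¹),
      sq_nonneg (‖1 - kerQ p m θ₁ u‖⁻¹), sq_nonneg (‖1 - kerQ p m θ₂ u‖⁻¹)]
  rw [← mul_div_assoc, div_eq_mul_one_div]
  refine (mul_le_mul hE hab (by positivity) (by positivity)).trans ?_
  rw [mul_assoc]
  refine mul_le_mul_of_nonneg_left ?_ (by positivity)
  unfold farG
  have p1 : 0 ≤ Real.exp (-(rate μ m * |u|)) / ‖1 - kerQ p m θ₁ u‖ := by positivity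
  have p2 : 0 ≤ Real.exp (-(rate μ m * |u|)) / ‖1 - kerQ p m θ₂ u‖ := by positivity
  have e2 : Real.exp (-(rate μ m * |u|)) * (rate μ m * |u|) *
      (1 / ‖1 - kerQ p m θ₁ u‖ ^ 2 + 1 / ‖1 - kerQ p m θ₂ u‖ ^ 2) =
      Real.exp (-(rate μ m * |u|)) * (rate μ m * |u|) / ‖1 - kerQ p m θ₁ u‖ ^ 2 +
      Real.exp (-(rate μ m * |u|)) * (rate μ m * |u|) / ‖1 - kerQ p m θ₂ u‖ ^ 2 := by ring
  rw [e2]; linarith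

variable {A : ℝ} {d : ℝ → ℂ}

/-- Bound without cancellation, for the far region, where the decay `2+α` is kept in full. -/
theorem Cls.hat_le_exp (h : Cls α (2 + α) (2 + α) A d) (hα0 : 0 < α) (hα1 : α ≤ 1)
    (hμ : 1 / 2 < μ) (hθ : 0 < θ) (u : ℝ) :
    ‖hat μ d θ u‖ ≤ 2 * A * (1 + θ) ^ (-(2 + α)) * Real.exp ((2 * μ + 3) * |u|) := by
  have hA := h.nonneg
  have hu := abs_nonneg u
  have h1 := h.bd_exp (by linarith) hθ u
  have h2 := norm_expfac_le hμ u
  have h3 := h.bd θ hθ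
  have hw := (weight_pos (s := -(2 + α)) hθ).le
  unfold hat
  refine (norm_sub_le _ _).trans ?_
  rw [norm_mul]
  have h4 := mul_le_mul h2 h1 (norm_nonneg _) (Real.exp_pos _).le
  have h5 : Real.exp (2 * μ * |u|) * Real.exp ((2 + α) * |u|) ≤ Real.exp ((2 * μ + 3) * |u|) := by
    rw [← Real.exp_add]; exact Real.exp_le_exp.2 (by nlinarith)
  have h6 : 1 ≤ Real.exp ((2 * μ + 3) * |u|) := Real.one_le_exp (by positivity)
  have h7 := mul_le_mul_of_nonneg_left h5 (mul_nonneg hA hw)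
  have h8 := mul_le_mul_of_nonneg_left h6 (mul_nonneg hA hw)
  linarith

/-- Constant of the bound of `hat` near the singularity. -/
def conH (μ : ℝ) : ℝ := Real.exp (2 * μ + 4) * (2 + 2 * μ)

theorem conH_pos (hμ : 0 < μ) : 0 < conH μ := by unfold conH; positivity

/-- Bound with cancellation, expressed in the natural near variable `m(1+θ)|u|`, which dominates
both `θ|u|` and `|u|`. -/
theorem Cls.hat_le_near (h : Cls α (2 + α) (2 + α) A d) (hα0 : 0 < α) (hα1 : α ≤ 1)
    (hμ : 1 / 2 < μ) (hθ : 0 < θ) (hm : 1 ≤ m) {u : ℝ} (hu : |u| ≤ 1)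
    (hn : m * (1 + θ) * |u| ≤ 1) :
    ‖hat μ d θ u‖ ≤ A * conH μ * (1 + θ) ^ (-(2 + α)) * (m * (1 + θ) * |u|) ^ α := by
  have hA := h.nonneg
  have hu0 := abs_nonneg u
  have hw := (weight_pos (s := -(2 + α)) hθ).le
  set Y := m * (1 + θ) * |u| with hY
  have hY0 : 0 ≤ Y := by positivity
  have hYa := self_le_rpow hα1 hY0 hn hα0
  have h1 : θ * |u| ≤ Y := by rw [hY]; gcongr; nlinarith
  have h2 : |u| ≤ Y := by
    rw [hY]; exact le_mul_of_one_le_left hu0 (by nlinarith)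
  have h3 : (θ * |u|) ^ α ≤ Y ^ α := Real.rpow_le_rpow (by positivity) h1 hα0.le
  have h4 : Real.exp ((2 * μ + (2 + α) + 1) * |u|) ≤ Real.exp (2 * μ + 4) :=
    Real.exp_le_exp.2 (by nlinarith)
  refine (h.hat_le (by linarith) hα0 hα1 hμ hθ u).trans ?_
  have h5 : (1 + θ) ^ (-(2 + α)) * ((θ * |u|) ^ α + θ * |u|) + 2 * μ * (1 + θ) ^ (-(2 + α)) * |u| ≤
      (1 + θ) ^ (-(2 + α)) * ((2 + 2 * μ) * Y ^ α) := by
    rw [mul_comm (2 * μ), mul_assoc, ← mul_add]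
    refine mul_le_mul_of_nonneg_left ?_ hw
    nlinarith
  calc _ ≤ A * Real.exp (2 * μ + 4) * ((1 + θ) ^ (-(2 + α)) * ((2 + 2 * μ) * Y ^ α)) := by
        gcongr
    _ = _ := by unfold conH; ring

theorem Cls.hol_unit {s e : ℝ} (h : Cls α s e A d) (hα0 : 0 < α) (hα1 : α ≤ 1) {θ₁ θ₂ : ℝ}
    (h2 : 0 < θ₂) (h12 : θ₂ < θ₁) (h1 : θ₁ ≤ θ₂ + 1) :
    ‖d θ₁ - d θ₂‖ ≤ 2 * A * (1 + θ₂) ^ (-e) * (θ₁ - θ₂) ^ α := by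
  have hA := h.nonneg
  have hw := (weight_pos (s := -e) h2).le
  have := self_le_rpow hα1 (x := θ₁ - θ₂) (by linarith) (by linarith) hα0
  refine (h.hol θ₂ θ₁ h2 h12).trans ?_
  nlinarith [mul_nonneg hA hw]

theorem Cls.hat_shift (h : Cls α (2 + α) (2 + α) A d) (hα0 : 0 < α) (hα1 : α ≤ 1)
    (hμ : 1 / 2 < μ) {θ₁ θ₂ : ℝ} (h2 : 0 < θ₂) (h12 : θ₂ < θ₁) (h1 : θ₁ ≤ θ₂ + 1) (u : ℝ) :
    ‖hat μ d θ₁ u - hat μ d θ₂ u‖ ≤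
      4 * A * (1 + θ₂) ^ (-(2 + α)) * (θ₁ - θ₂) ^ α * Real.exp ((2 * μ + 4) * |u|) := by
  have hA := h.nonneg
  have hu := abs_nonneg u
  have hw := (weight_pos (s := -(2 + α)) h2).le
  have hδ : 0 ≤ (θ₁ - θ₂) ^ α := Real.rpow_nonneg (by linarith) _
  have h3 := h.shift (by linarith) hα0 hα1 h2 h12 h1 u
  have h4 := norm_expfac_le hμ u
  have h5 := h.hol_unit hα0 hα1 h2 h12 h1
  have e1 : hat μ d θ₁ u - hat μ d θ₂ u = (Real.exp ((1 - 2 * μ) * u) : ℂ) *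
      (d (θ₁ * Real.exp u) - d (θ₂ * Real.exp u)) - (d θ₁ - d θ₂) := by unfold hat; ring
  rw [e1]
  refine (norm_sub_le _ _).trans ?_
  rw [norm_mul]
  have h6 := mul_le_mul h4 h3 (norm_nonneg _) (Real.exp_pos _).le
  have h7 : Real.exp (2 * μ * |u|) * Real.exp ((2 + α + 1) * |u|) ≤ Real.exp ((2 * μ + 4) * |u|) := by
    rw [← Real.exp_add]; exact Real.exp_le_exp.2 (by nlinarith)
  have h8 : 1 ≤ Real.exp ((2 * μ + 4) * |u|) := Real.one_le_exp (by positivity)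
  have hB : 0 ≤ 2 * A * (1 + θ₂) ^ (-(2 + α)) * (θ₁ - θ₂) ^ α := by positivity
  have h9 := mul_le_mul_of_nonneg_left h7 hB
  have h10 := mul_le_mul_of_nonneg_left h8 hB
  linarith

/-- Constant of the pointwise bound of `opJ`. -/
def conB (μ α : ℝ) : ℝ :=
  2 / α * (conH μ * (6 * (1 + 2 * μ) / lowC μ)) + 2 * (1 + 2 * μ) * conF μ

theorem conB_nonneg (hμ : 0 < μ) (hα0 : 0 < α) : 0 ≤ conB μ α := by
  have := lowC_pos hμ
  have := conH_pos hμ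
  have := conF_nonneg hμ
  unfold conB; positivity

theorem weight_two_mul {θ : ℝ} (hθ : 0 < θ) :
    (1 + θ) ^ (-(2 + α)) * (1 + θ) = (1 + θ) ^ (-(1 + α)) := by
  nth_rewrite 2 [← Real.rpow_one (1 + θ)]
  rw [← Real.rpow_add (by linarith)]; ring_nf

/-- In the near region `∂_u P · ker` is of order `1/(m|u|)` uniformly in `θ`. In the far region the
growth of `∂_u P` costs a factor `1+θ`, which lowers the weight from `2+α` to `1+α`. -/
theorem Cls.norm_opJ_le (h : Cls α (2 + α) (2 + α) A d) (hα0 : 0 < α) (hα1 : α ≤ 1)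
    (hμ : 1 / 2 < μ) (hm : Large μ m) (hp : Sym μ α p) (hθ : 0 < θ) :
    ‖opJ μ p m d θ‖ ≤ conB μ α * A / m * (1 + θ) ^ (-(1 + α)) := by
  have hμ0 : 0 < μ := by linarith
  have hA := h.nonneg
  have hm1 := hm.one_le hμ0
  have hm0 := hm.pos hμ0
  have hnc := nearC_pos hμ0
  have hnl := nearC_le hμ0
  have hκ := lowC_pos hμ0
  have hH := conH_pos hμ0
  have hF := conF_nonneg hμ0
  have hw := weight_pos (s := -(2 + α)) hθ
  have hN : 1 ≤ m * (1 + θ) := by nlinarith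
  set l := nearC μ / (m * (1 + θ)) with hl
  have hl0 : 0 < l := by positivity
  have hlN : l * (m * (1 + θ)) = nearC μ := by rw [hl]; field_simp
  have hl1 : l ≤ 1 := by nlinarith
  have hd0 : Cls α 0 0 A d := h.mono (by linarith) (by linarith) le_rfl
  have hint := hd0.integrable_opJ hα0 hα1 hμ hm hp hθ
  unfold opJ
  rw [← integral_add_compl measurableSet_Icc hint (s := Icc (-l) l)]
  have hnear := (near_integral (f := fun u => hat μ d θ u * (symZ p θ u * ker p m θ u)) (α := α)
    (B := A * conH μ * (1 + θ) ^ (-(2 + α)) * (6 * (1 + 2 * μ) / lowC μ / m)) (c := m * (1 + θ))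
    hα0 hl0 (by positivity) (by positivity) (fun u hu0 hul => by
      have hn : m * (1 + θ) * |u| ≤ nearC μ := by rw [← hlN, mul_comm l]; gcongr
      have h1 := h.hat_le_near hα0 hα1 hμ hθ hm1 (hul.trans hl1) (by linarith)
      have h2 := norm_kernel_le_near hp hμ0 hθ hm0 hu0 (hul.trans hl1) hn
      rw [norm_mul]
      refine (mul_le_mul h1 h2 (norm_nonneg _) (by positivity)).trans (le_of_eq (by ring)))).1
  have hfar := hp.far_integral_le hμ hm hθ hθ (K := A * (1 + 2 * μ) * (1 + θ) ^ (-(1 + α)))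
    (by have := weight_pos (s := -(1 + α)) hθ; positivity) hl0 hlN.le (by linarith) hlN.le
    (by linarith) (f := fun u => hat μ d θ u * (symZ p θ u * ker p m θ u)) (fun u _ => by
      have h1 := h.hat_le_exp hα0 hα1 hμ hθ u
      have h2 := hp.norm_symZ_le hμ0 hθ u
      have h3 := hp.exp_mul_ker_le hμ0 hm hθ (a := 2 * μ + 4) (by linarith) u
      have e1 : Real.exp ((2 * μ + 4) * |u|) = Real.exp ((2 * μ + 3) * |u|) * Real.exp |u| := by
        rw [← Real.exp_add]; ring_nf
      rw [norm_mul, norm_mul, ← weight_two_mul hθ]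
      calc _ ≤ 2 * A * (1 + θ) ^ (-(2 + α)) * Real.exp ((2 * μ + 3) * |u|) *
            ((1 + 2 * μ) * (1 + θ) * Real.exp |u| * ‖ker p m θ u‖) := by gcongr
        _ = 2 * A * (1 + θ) ^ (-(2 + α)) * ((1 + 2 * μ) * (1 + θ)) *
            (Real.exp ((2 * μ + 4) * |u|) * ‖ker p m θ u‖) := by rw [e1]; ring
        _ ≤ 2 * A * (1 + θ) ^ (-(2 + α)) * ((1 + 2 * μ) * (1 + θ)) * farG μ p m θ u := by gcongr
        _ = _ := by ring)
  have hpow : (m * (1 + θ) * l) ^ α ≤ 1 := by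
    rw [mul_comm, hlN]; exact Real.rpow_le_one hnc.le (by linarith) hα0.le
  have hww : (1 + θ) ^ (-(2 + α)) ≤ (1 + θ) ^ (-(1 + α)) := weight_mono (by linarith) hθ
  refine (norm_add_le _ _).trans ((add_le_add hnear hfar).trans ?_)
  calc _ ≤ 2 / α * (A * conH μ * (1 + θ) ^ (-(1 + α)) * (6 * (1 + 2 * μ) / lowC μ / m)) * 1 +
        A * (1 + 2 * μ) * (1 + θ) ^ (-(1 + α)) * (2 * conF μ / m) := by gcongr
    _ = _ := by unfold conB; ring

end KadenSpiral
end

/-! ### The Hilbert transform part in the logarithmic variable. -/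

noncomputable section
namespace KadenSpiral

variable {μ α : ℝ} {p : ℝ → ℂ} {m θ A : ℝ} {d : ℝ → ℂ}

theorem setIntegral_Icc_symm {f : ℝ → ℂ} {l : ℝ} (hl : 0 ≤ l) (hf : IntegrableOn f (Icc (-l) l)) :
    ∫ u in Icc (-l) l, f u = ∫ u in (0 : ℝ)..l, (f u + f (-u)) := by
  have hii : IntervalIntegrable f volume (-l) l := by
    rw [intervalIntegrable_iff_integrableOn_Ioc_of_le (by linarith)]
    exact hf.mono_set Ioc_subset_Icc_self
  have h1 : IntervalIntegrable f volume (-l) 0 := hii.mono_set (by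
    rw [uIcc_of_le (by linarith), uIcc_of_le (by linarith)]; exact Icc_subset_Icc_right hl)
  have h2 : IntervalIntegrable f volume 0 l := hii.mono_set (by
    rw [uIcc_of_le hl, uIcc_of_le (by linarith)]; exact Icc_subset_Icc_left (by linarith))
  have h3 : IntervalIntegrable (fun u => f (-u)) volume 0 l := by
    have := (IntervalIntegrable.iff_comp_neg (f := f) (a := 0) (b := -l)).1 h1.symm
    simpa using this
  rw [integral_Icc_eq_integral_Ioc, ← intervalIntegral.integral_of_le (by linarith),
    ← intervalIntegral.integral_add_adjacent_intervals h1 h2, intervalIntegral.integral_add h2 h3,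
    intervalIntegral.integral_comp_neg, neg_zero, add_comm]

/-- Constant of the Hilbert transform estimate. -/
def conHil (α : ℝ) : ℝ := 54 * (8 / α + 9 / (1 - α)) + 48 / α

theorem conHil_nonneg (hα0 : 0 < α) (hα1 : α < 1) : 0 ≤ conHil α := by
  have : 0 < 1 - α := by linarith
  unfold conHil; positivity

theorem rpow_const_mul_le {c x : ℝ} (hα1 : α ≤ 1) (hc : 1 ≤ c) (hx : 0 ≤ x) :
    (c * x) ^ α ≤ c * x ^ α := by
  rw [Real.mul_rpow (by linarith) hx]
  gcongr
  simpa using Real.rpow_le_rpow_of_exponent_le hc hα1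

/-- Passing to `x = log t` multiplies the Hölder constant by `θ₁^α`. The conditions on `l` keep all
increments of `t` below one and all weights comparable with the one at `θ₂`. -/
theorem Cls.hoelder_exp (h : Cls α (2 + α) (2 + α) A d) (hα0 : 0 < α) (hα1 : α < 1)
    {θ₁ θ₂ l : ℝ} (h2 : 0 < θ₂) (h12 : θ₂ < θ₁) (hl : 0 < l) (hl1 : 9 * (θ₁ * l) ≤ 1)
    (hl2 : 9 * l ≤ 1) (hy : Real.log θ₁ ≤ Real.log θ₂ + l) {x x' : ℝ}
    (hx1 : Real.log θ₂ - l ≤ x) (hx2 : x ≤ Real.log θ₁ + l)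
    (hx1' : Real.log θ₂ - l ≤ x') (hx2' : x' ≤ Real.log θ₁ + l) :
    ‖d (Real.exp x) - d (Real.exp x')‖ ≤
      18 * A * (1 + θ₂) ^ (-(2 + α)) * θ₁ ^ α * |x - x'| ^ α := by
  wlog hxx : x' < x generalizing x x'
  · rcases (not_lt.1 hxx).eq_or_lt with rfl | h'
    · simp [Real.zero_rpow hα0.ne']
    · rw [norm_sub_rev, abs_sub_comm]
      exact this hx1' hx2' hx1 hx2 h'
  have hA := h.nonneg
  have hθ1 : 0 < θ₁ := h2.trans h12
  have hw := (weight_pos (s := -(2 + α)) h2).le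
  rw [abs_of_pos (by linarith)]
  have e1 : Real.exp x ≤ 3 * θ₁ := by
    have h4 := (exp_bounds_unit (u := l) (by rw [abs_of_pos hl]; linarith)).2
    have h3 : Real.exp x ≤ Real.exp (Real.log θ₁ + l) := Real.exp_le_exp.2 hx2
    rw [Real.exp_add, Real.exp_log hθ1] at h3
    nlinarith
  have e2 : Real.exp x - Real.exp x' ≤ 3 * (θ₁ * (x - x')) := by
    have h2 := Real.add_one_le_exp (x' - x)
    have h3 : Real.exp x' = Real.exp x * Real.exp (x' - x) := by rw [← Real.exp_add]; ring_nf
    rw [h3]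
    nlinarith [Real.exp_pos x]
  have e3 : 3 * (θ₁ * (x - x')) ≤ 1 := by
    have : θ₁ * (x - x') ≤ θ₁ * (3 * l) := by gcongr; linarith
    linarith
  have e4 : 0 ≤ Real.exp x - Real.exp x' := by linarith [Real.exp_lt_exp.2 hxx]
  have e5 : (Real.exp x - Real.exp x') ^ α + (Real.exp x - Real.exp x') ≤
      6 * (θ₁ ^ α * (x - x') ^ α) := by
    have h3 := self_le_rpow hα1.le e4 (e2.trans e3) hα0
    have h4 : (Real.exp x - Real.exp x') ^ α ≤ 3 * (θ₁ ^ α * (x - x') ^ α) := by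
      rw [← Real.mul_rpow hθ1.le (by linarith)]
      exact (Real.rpow_le_rpow e4 e2 hα0.le).trans (rpow_const_mul_le hα1.le (by norm_num)
        (mul_nonneg hθ1.le (by linarith)))
    linarith
  have e6 : (1 + Real.exp x') ^ (-(2 + α)) ≤ 3 * (1 + θ₂) ^ (-(2 + α)) := by
    have h3 : θ₂ * Real.exp (-l) ≤ Real.exp x' := by
      have := Real.exp_le_exp.2 hx1'
      rwa [sub_eq_add_neg, Real.exp_add, Real.exp_log h2] at this
    refine (weight_anti (by linarith) (by positivity) h3).trans
      ((weight_exp (by linarith) h2 (-l)).trans ?_)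
    gcongr
    rw [abs_neg, abs_of_pos hl]
    refine (Real.exp_le_exp.2 ?_).trans exp_one_le_three
    nlinarith
  refine (h.hol _ _ (Real.exp_pos _) (Real.exp_lt_exp.2 hxx)).trans ?_
  have hmod : 0 ≤ (Real.exp x - Real.exp x') ^ α + (Real.exp x - Real.exp x') := by positivity
  calc _ ≤ A * (3 * (1 + θ₂) ^ (-(2 + α))) * (6 * (θ₁ ^ α * (x - x') ^ α)) := by gcongr
    _ = _ := by ring

/-- In the variable `log θ` this is a difference of truncated Hilbert transforms of `d ∘ exp` at two
points; symmetrising in `u` removes the subtracted constants `d θ₁ - d θ₂`. -/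
theorem Cls.hilbert_near (h : Cls α (2 + α) (2 + α) A d) (hα0 : 0 < α) (hα1 : α < 1)
    {θ₁ θ₂ l : ℝ} (h2 : 0 < θ₂) (h12 : θ₂ < θ₁) (hl : 0 < l)
    (hl1 : 9 * (θ₁ * l) ≤ 1) (hl2 : 9 * l ≤ 1) :
    ‖∫ u in Icc (-l) l, ((d (θ₁ * Real.exp u) - d (θ₂ * Real.exp u)) - (d θ₁ - d θ₂)) / (u : ℂ)‖ ≤
      conHil α * A * (1 + θ₂) ^ (-(2 + α)) * (θ₁ - θ₂) ^ α ∧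
    IntegrableOn (fun u : ℝ =>
      ((d (θ₁ * Real.exp u) - d (θ₂ * Real.exp u)) - (d θ₁ - d θ₂)) / (u : ℂ)) (Icc (-l) l) := by
  have hA := h.nonneg
  have hθ1 : 0 < θ₁ := h2.trans h12
  have hw := (weight_pos (s := -(2 + α)) h2).le
  have h1α : 0 < 1 - α := by linarith
  set f : ℝ → ℂ := fun u =>
    ((d (θ₁ * Real.exp u) - d (θ₂ * Real.exp u)) - (d θ₁ - d θ₂)) / (u : ℂ) with hf
  have hb1 : ∀ θ, θ₂ ≤ θ → θ ≤ θ₁ → ∀ u : ℝ, |u| ≤ l → ‖d (θ * Real.exp u) - d θ‖ ≤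
      6 * A * (1 + θ₂) ^ (-(2 + α)) * (θ₁ * |u|) ^ α := by
    intro θ h3 h4 u hu
    have hθ : 0 < θ := h2.trans_le h3
    have hua := abs_nonneg u
    have e1 : θ * |u| ≤ θ₁ * |u| := by gcongr
    have e2 : θ₁ * |u| ≤ θ₁ * l := by gcongr
    have e3 := self_le_rpow hα1.le (x := θ₁ * |u|) (by positivity) (by linarith) hα0
    have e4 : (θ * |u|) ^ α ≤ (θ₁ * |u|) ^ α := Real.rpow_le_rpow (by positivity) e1 hα0.le
    have e5 : Real.exp ((2 + α + 1) * |u|) ≤ 3 :=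
      (Real.exp_le_exp.2 (by nlinarith)).trans exp_one_le_three
    have e6 := weight_anti (s := 2 + α) (by linarith) h2 h3
    refine (h.scale (by linarith) hα0 hα1.le hθ u).trans ?_
    calc _ ≤ A * (1 + θ₂) ^ (-(2 + α)) * (2 * (θ₁ * |u|) ^ α) * 3 := by gcongr; linarith
      _ = _ := by ring
  have hni := near_integral (f := f) (c := θ₁) (B := 12 * A * (1 + θ₂) ^ (-(2 + α))) hα0 hl hθ1.le
    (by positivity) (fun u hu0 hu => by
      have e1 : ((d (θ₁ * Real.exp u) - d (θ₂ * Real.exp u)) - (d θ₁ - d θ₂)) =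
        (d (θ₁ * Real.exp u) - d θ₁) - (d (θ₂ * Real.exp u) - d θ₂) := by ring
      rw [hf]
      simp only
      rw [e1, norm_div, Complex.norm_real, Real.norm_eq_abs, ← mul_div_assoc]
      gcongr
      refine (norm_sub_le _ _).trans ?_
      linarith [hb1 θ₁ h12.le le_rfl u hu, hb1 θ₂ le_rfl h12.le u hu])
  have hcont : ∀ θ, 0 < θ → Continuous fun u => d (θ * Real.exp u) := fun θ hθ => h.cont_exp hθ
  have hfm : AEStronglyMeasurable f := by
    exact ((((hcont θ₁ hθ1).sub (hcont θ₂ h2)).sub continuous_const).measurable.div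
      Complex.measurable_ofReal).aestronglyMeasurable
  have hfi := hni.2 hfm
  refine ⟨?_, hfi⟩
  have hX : 0 ≤ A * (1 + θ₂) ^ (-(2 + α)) * (θ₁ - θ₂) ^ α :=
    mul_nonneg (mul_nonneg hA hw) (Real.rpow_nonneg (by linarith) _)
  have hc1 : 0 ≤ 48 / α := by positivity
  have hc2 : 0 ≤ 54 * (8 / α + 9 / (1 - α)) := by positivity
  -- If `log θ₁ - log θ₂ ≤ l`, the transform bound applies, and the factor `θ₁^α` is compensated by
  -- `θ₁(log θ₁ - log θ₂) ≤ 3(θ₁ - θ₂)`. Otherwise `θ₁ l ≤ 2(θ₁ - θ₂)`, and the absolute bound of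
  -- order `(θ₁ l)^α` is already good enough.
  rcases le_or_gt (Real.log θ₁) (Real.log θ₂ + l) with hy | hy
  · rw [setIntegral_Icc_symm hl.le hfi]
    have hlog : Real.log θ₂ < Real.log θ₁ := Real.log_lt_log h2 h12
    have hH := hilbert_hoelder (f := fun x => d (Real.exp x))
      (h.cont.comp_continuous Real.continuous_exp fun x => Real.exp_pos x)
      (M := 18 * A * (1 + θ₂) ^ (-(2 + α)) * θ₁ ^ α) hα0 hα1 (by positivity) hlog hy
      (fun x x' a b c e => h.hoelder_exp hα0 hα1 h2 h12 hl hl1 hl2 hy a b c e)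
    have e1 : ∀ u : ℝ, f u + f (-u) = ((d (Real.exp (Real.log θ₁ + u)) -
        d (Real.exp (Real.log θ₁ - u))) - (d (Real.exp (Real.log θ₂ + u)) -
        d (Real.exp (Real.log θ₂ - u)))) / u := by
      intro u
      simp only [hf, sub_eq_add_neg (Real.log _) u, Real.exp_add, Real.exp_log hθ1, Real.exp_log h2]
      push_cast
      rw [div_neg]; ring
    simp only [e1]
    refine hH.trans ?_
    have hlog' : Real.log θ₁ - Real.log θ₂ ≤ (θ₁ - θ₂) / θ₂ := by
      rw [← Real.log_div hθ1.ne' h2.ne']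
      refine (Real.log_le_sub_one_of_pos (by positivity)).trans (le_of_eq (by field_simp))
    have hθl : θ₁ ≤ 3 * θ₂ := by
      have h4 := (exp_bounds_unit (u := l) (by rw [abs_of_pos hl]; linarith)).2
      have h3 := Real.exp_le_exp.2 hy
      rw [Real.exp_add, Real.exp_log hθ1, Real.exp_log h2] at h3
      nlinarith
    have h5 : θ₁ * (Real.log θ₁ - Real.log θ₂) ≤ 3 * (θ₁ - θ₂) := by
      calc _ ≤ (3 * θ₂) * ((θ₁ - θ₂) / θ₂) := by gcongr
        _ = _ := by field_simp
    have h6 : θ₁ ^ α * (Real.log θ₁ - Real.log θ₂) ^ α ≤ 3 * (θ₁ - θ₂) ^ α := by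
      rw [← Real.mul_rpow hθ1.le (by linarith)]
      exact (Real.rpow_le_rpow (mul_nonneg hθ1.le (by linarith)) h5 hα0.le).trans
        (rpow_const_mul_le hα1.le (by norm_num) (by linarith))
    calc _ = (8 / α + 9 / (1 - α)) * (18 * A * (1 + θ₂) ^ (-(2 + α))) *
          (θ₁ ^ α * (Real.log θ₁ - Real.log θ₂) ^ α) := by ring
      _ ≤ (8 / α + 9 / (1 - α)) * (18 * A * (1 + θ₂) ^ (-(2 + α))) * (3 * (θ₁ - θ₂) ^ α) := by
        gcongr
      _ = 54 * (8 / α + 9 / (1 - α)) * (A * (1 + θ₂) ^ (-(2 + α)) * (θ₁ - θ₂) ^ α) := by ring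
      _ ≤ _ := by unfold conHil; nlinarith [mul_nonneg hc1 hX]
  · refine hni.1.trans ?_
    have h5 : θ₁ * l ≤ 2 * (θ₁ - θ₂) := by
      have h3 := Real.exp_lt_exp.2 hy
      rw [Real.exp_add, Real.exp_log hθ1, Real.exp_log h2] at h3
      have h4 := Real.add_one_le_exp l
      nlinarith
    have h6 : (θ₁ * l) ^ α ≤ 2 * (θ₁ - θ₂) ^ α :=
      (Real.rpow_le_rpow (by positivity) h5 hα0.le).trans
        (rpow_const_mul_le hα1.le (by norm_num) (by linarith))
    calc _ ≤ 2 / α * (12 * A * (1 + θ₂) ^ (-(2 + α))) * (2 * (θ₁ - θ₂) ^ α) := by gcongr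
      _ = 48 / α * (A * (1 + θ₂) ^ (-(2 + α)) * (θ₁ - θ₂) ^ α) := by ring
      _ ≤ _ := by unfold conHil; nlinarith [mul_nonneg hc2 hX]

end KadenSpiral
end

/-! ### Hölder bound of the singular operator and the main estimate. -/

noncomputable section
namespace KadenSpiral

variable {μ α : ℝ} {p : ℝ → ℂ} {m θ A : ℝ} {d : ℝ → ℂ}

theorem Large.two_le (hm : Large μ m) (hμ : 0 < μ) : 2 ≤ m := by
  unfold Large rate at hm; nlinarith

theorem integral_add_sub_sub {ν : Measure ℝ} {a b c e : ℝ → ℂ} (ha : Integrable a ν)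
    (hb : Integrable b ν) (hc : Integrable c ν) (he : Integrable e ν) :
    ∫ u, (a u + b u - c u - e u) ∂ν = ∫ u, a u ∂ν + ∫ u, b u ∂ν - ∫ u, c u ∂ν - ∫ u, e u ∂ν := by
  have h1 : Integrable (fun u => a u + b u) ν := ha.add hb
  have h2 : Integrable (fun u => a u + b u - c u) ν := h1.sub hc
  rw [integral_sub h2 he, integral_sub h1 hc, integral_add ha hb]

/-- Constant of the near-field Hölder estimate. -/
def conNear (μ α : ℝ) : ℝ :=
  2 / α * (conH μ * conK μ) + 2 / α * (4 * Real.exp (2 * μ + 4) * conR μ) +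
    2 / α * (4 * μ * Real.exp (2 * μ + 4)) + conHil α

theorem conNear_nonneg (hμ : 0 < μ) (hα0 : 0 < α) (hα1 : α < 1) : 0 ≤ conNear μ α := by
  have := conK_nonneg hμ
  have := conH_pos hμ
  have := conR_nonneg hμ
  have := conHil_nonneg hα0 hα1
  unfold conNear; positivity

/-- Write `K` for `∂_u P · ker`. The difference is split into the increment at `θ₂` times the
variation of `K`, the variation of the increment times `K + 1/(mu)`, a term with `e^{(1-2μ)u} - 1`
that cancels `1/u`, and the Hilbert transform part. Only the last needs cancellation between `u` and
`-u`. -/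
theorem Cls.near_shift (h : Cls α (2 + α) (2 + α) A d) (hα0 : 0 < α) (hα1 : α < 1)
    (hμ : 1 / 2 < μ) (hm : Large μ m) (hp : Sym μ α p) {θ₁ θ₂ l : ℝ} (h2 : 0 < θ₂)
    (h12 : θ₂ < θ₁) (h1 : θ₁ ≤ θ₂ + 1) (hl0 : 0 < l) (hlN : l * (m * (1 + θ₁)) = nearC μ) :
    ‖∫ u in Icc (-l) l, (hat μ d θ₁ u * (symZ p θ₁ u * ker p m θ₁ u) -
      hat μ d θ₂ u * (symZ p θ₂ u * ker p m θ₂ u))‖ ≤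
      conNear μ α * A / m * (1 + θ₂) ^ (-(2 + α)) * (θ₁ - θ₂) ^ α := by
  have hμ0 : 0 < μ := by linarith
  have hA := h.nonneg
  have hm2 := hm.two_le hμ0
  have hm0 := hm.pos hμ0
  have hnc := nearC_pos hμ0
  have hnl := nearC_le hμ0
  have hH := conH_pos hμ0
  have hK := conK_nonneg hμ0
  have hR := conR_nonneg hμ0
  have hθ1 : 0 < θ₁ := h2.trans h12
  have hw := (weight_pos (s := -(2 + α)) h2).le
  have hδ : 0 ≤ (θ₁ - θ₂) ^ α := Real.rpow_nonneg (by linarith) _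
  have hl1 : 9 * l ≤ 1 := by nlinarith [mul_pos hl0 hθ1]
  have hl2 : 9 * (θ₁ * l) ≤ 1 := by nlinarith [mul_pos hl0 hθ1]
  have hone : l ≤ 1 := by linarith
  have hpow : (m * (1 + θ₁) * l) ^ α ≤ 1 := by
    rw [mul_comm, hlN]; exact Real.rpow_le_one hnc.le (by linarith) hα0.le
  have hn : ∀ u : ℝ, |u| ≤ l → m * (1 + θ₁) * |u| ≤ nearC μ := fun u hu => by
    rw [← hlN, mul_comm l]; gcongr
  have hexp : ∀ a : ℝ, 0 ≤ a → ∀ u : ℝ, |u| ≤ l → Real.exp (a * |u|) ≤ Real.exp a := fun a ha u hu =>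
    Real.exp_le_exp.2 (mul_le_of_le_one_right ha (hu.trans hone))
  have hZm : ∀ θ, 0 < θ → Measurable fun u => symZ p θ u * ker p m θ u := fun θ hθ =>
    (hp.continuous_symZ hθ).measurable.mul (hp.measurable_ker hθ)
  have hhm : ∀ θ, 0 < θ → Measurable fun u => hat μ d θ u := fun θ hθ =>
    (h.continuous_hat hθ).measurable
  have hdm : ∀ θ, 0 < θ → Measurable fun u => d (θ * Real.exp u) := fun θ hθ =>
    (h.cont_exp hθ).measurable
  have n1 := near_integral (α := α) (c := m * (1 + θ₁)) (l := l)
    (f := fun u => hat μ d θ₂ u * (symZ p θ₁ u * ker p m θ₁ u - symZ p θ₂ u * ker p m θ₂ u))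
    (B := A * conH μ * (1 + θ₂) ^ (-(2 + α)) * (conK μ / m * (θ₁ - θ₂) ^ α)) hα0 hl0
    (by positivity) (by positivity) (fun u hu0 hu => by
      have hn2 : m * (1 + θ₂) * |u| ≤ m * (1 + θ₁) * |u| := by gcongr
      have e1 := h.hat_le_near hα0 hα1.le hμ h2 (by linarith) (hu.trans hone)
        (hn2.trans ((hn u hu).trans (by linarith)))
      have e2 := hp.kernel_shift_near hα0 hα1.le hμ0 h2 h12 h1 hm0 hu0 (hu.trans hone) (hn u hu)
      rw [norm_mul]
      calc _ ≤ A * conH μ * (1 + θ₂) ^ (-(2 + α)) * (m * (1 + θ₁) * |u|) ^ α *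
            (conK μ / m * (θ₁ - θ₂) ^ α / |u|) := by
              refine mul_le_mul (e1.trans ?_) e2 (norm_nonneg _) (by positivity)
              gcongr
        _ = _ := by ring)
  have n2 := near_integral (α := α) (c := m * (1 + θ₁)) (l := l)
    (f := fun u => (hat μ d θ₁ u - hat μ d θ₂ u) * (symZ p θ₁ u * ker p m θ₁ u + 1 / (m * u)))
    (B := 4 * A * (1 + θ₂) ^ (-(2 + α)) * (θ₁ - θ₂) ^ α * Real.exp (2 * μ + 4) * (conR μ / m)) hα0
    hl0 (by positivity) (by positivity) (fun u hu0 hu => by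
      have e1 := h.hat_shift hα0 hα1.le hμ h2 h12 h1 u
      have e2 := hp.kernel_expansion hα0 hα1.le hμ0 hθ1 (by linarith) hu0 (hu.trans hone) (hn u hu)
      have e3 := hexp (2 * μ + 4) (by linarith) u hu
      rw [norm_mul]
      calc _ ≤ 4 * A * (1 + θ₂) ^ (-(2 + α)) * (θ₁ - θ₂) ^ α * Real.exp (2 * μ + 4) *
            (conR μ / m * ((m * (1 + θ₁) * |u|) ^ α / |u|)) := by
              refine mul_le_mul (e1.trans ?_) e2 (norm_nonneg _) (by positivity)
              gcongr
        _ = _ := by ring)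
  have n3 := near_integral (α := α) (c := m * (1 + θ₁)) (l := l)
    (f := fun u => ((Real.exp ((1 - 2 * μ) * u) : ℂ) - 1) *
      (d (θ₁ * Real.exp u) - d (θ₂ * Real.exp u)) * (1 / (m * u)))
    (B := 4 * μ * Real.exp (2 * μ + 4) * A / m * (1 + θ₂) ^ (-(2 + α)) * (θ₁ - θ₂) ^ α) hα0 hl0
    (by positivity) (by positivity) (fun u hu0 hu => by
      have hua := abs_pos.2 hu0
      have e1 := h.shift (by linarith) hα0 hα1.le h2 h12 h1 u
      have e2 := norm_expfac_sub_one_le hμ u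
      have e3 : Real.exp (2 * μ * |u|) * Real.exp ((2 + α + 1) * |u|) ≤ Real.exp (2 * μ + 4) := by
        rw [← Real.exp_add]
        refine Real.exp_le_exp.2 ?_
        nlinarith [hu.trans hone]
      have e4 : |u| ≤ (m * (1 + θ₁) * |u|) ^ α := by
        refine le_rpow_self_of_le_one hα0 hα1.le hua.le ?_ ((hn u hu).trans (by linarith))
        exact le_mul_of_one_le_left hua.le (by nlinarith)
      rw [norm_mul, norm_mul, norm_div, norm_one, norm_mul, Complex.norm_real, Complex.norm_real,
        Real.norm_eq_abs, Real.norm_eq_abs, abs_of_pos hm0]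
      calc _ ≤ 2 * μ * |u| * Real.exp (2 * μ * |u|) * (2 * A * (1 + θ₂) ^ (-(2 + α)) *
            (θ₁ - θ₂) ^ α * Real.exp ((2 + α + 1) * |u|)) * (1 / (m * |u|)) := by gcongr
        _ = 4 * μ * (Real.exp (2 * μ * |u|) * Real.exp ((2 + α + 1) * |u|)) * A / m *
            (1 + θ₂) ^ (-(2 + α)) * (θ₁ - θ₂) ^ α * (|u| / |u|) := by field_simp; ring
        _ ≤ _ := by gcongr)
  have n4 := h.hilbert_near hα0 hα1 h2 h12 hl0 hl2 hl1
  have i1 := n1.2 ((hhm θ₂ h2).mul ((hZm θ₁ hθ1).sub (hZm θ₂ h2))).aestronglyMeasurable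
  have i2 := n2.2 (((hhm θ₁ hθ1).sub (hhm θ₂ h2)).mul
    ((hZm θ₁ hθ1).add (by fun_prop))).aestronglyMeasurable
  have i3 := n3.2 ((((continuous_expfac μ).measurable.sub measurable_const).mul
    ((hdm θ₁ hθ1).sub (hdm θ₂ h2))).mul (by fun_prop)).aestronglyMeasurable
  have i4 := n4.2.const_mul (1 / (m : ℂ))
  have eq : ∀ u : ℝ, hat μ d θ₁ u * (symZ p θ₁ u * ker p m θ₁ u) -
      hat μ d θ₂ u * (symZ p θ₂ u * ker p m θ₂ u) =
      (hat μ d θ₂ u * (symZ p θ₁ u * ker p m θ₁ u - symZ p θ₂ u * ker p m θ₂ u) +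
      (hat μ d θ₁ u - hat μ d θ₂ u) * (symZ p θ₁ u * ker p m θ₁ u + 1 / (m * u)) -
      ((Real.exp ((1 - 2 * μ) * u) : ℂ) - 1) *
        (d (θ₁ * Real.exp u) - d (θ₂ * Real.exp u)) * (1 / (m * u))) -
      1 / (m : ℂ) * (((d (θ₁ * Real.exp u) - d (θ₂ * Real.exp u)) - (d θ₁ - d θ₂)) / (u : ℂ)) := by
    intro u
    have e1 : hat μ d θ₁ u - hat μ d θ₂ u = ((Real.exp ((1 - 2 * μ) * u) : ℂ) - 1) *
        (d (θ₁ * Real.exp u) - d (θ₂ * Real.exp u)) +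
        ((d (θ₁ * Real.exp u) - d (θ₂ * Real.exp u)) - (d θ₁ - d θ₂)) := by unfold hat; ring
    have e2 : hat μ d θ₁ u * (symZ p θ₁ u * ker p m θ₁ u) -
        hat μ d θ₂ u * (symZ p θ₂ u * ker p m θ₂ u) =
        hat μ d θ₂ u * (symZ p θ₁ u * ker p m θ₁ u - symZ p θ₂ u * ker p m θ₂ u) +
        (hat μ d θ₁ u - hat μ d θ₂ u) * (symZ p θ₁ u * ker p m θ₁ u + 1 / (m * u)) -
        (hat μ d θ₁ u - hat μ d θ₂ u) * (1 / (m * u)) := by ring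
    rw [e2]
    nth_rewrite 2 [e1]
    rw [add_mul, one_div_mul_eq_div, div_div, mul_comm (u : ℂ)]; ring
  simp only [eq]
  rw [integral_add_sub_sub i1 i2 i3 i4, integral_const_mul]
  have n5 : ‖1 / (m : ℂ) * ∫ u in Icc (-l) l,
      ((d (θ₁ * Real.exp u) - d (θ₂ * Real.exp u)) - (d θ₁ - d θ₂)) / (u : ℂ)‖ ≤
      1 / m * (conHil α * A * (1 + θ₂) ^ (-(2 + α)) * (θ₁ - θ₂) ^ α) := by
    rw [norm_mul, norm_div, norm_one, Complex.norm_real, Real.norm_of_nonneg hm0.le]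
    gcongr
    exact n4.1
  refine (norm_sub_le _ _).trans ((add_le_add ((norm_sub_le _ _).trans (add_le_add
    ((norm_add_le _ _).trans (add_le_add n1.1 n2.1)) n3.1)) n5).trans ?_)
  calc _ ≤ 2 / α * (A * conH μ * (1 + θ₂) ^ (-(2 + α)) * (conK μ / m * (θ₁ - θ₂) ^ α)) * 1 +
        2 / α * (4 * A * (1 + θ₂) ^ (-(2 + α)) * (θ₁ - θ₂) ^ α * Real.exp (2 * μ + 4) *
            (conR μ / m)) * 1 +
        2 / α * (4 * μ * Real.exp (2 * μ + 4) * A / m * (1 + θ₂) ^ (-(2 + α)) *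
            (θ₁ - θ₂) ^ α) * 1 +
          1 / m * (conHil α * A * (1 + θ₂) ^ (-(2 + α)) * (θ₁ - θ₂) ^ α) := by gcongr
    _ = _ := by unfold conNear; ring

/-- Constant of the far-field Hölder estimate. -/
def conFar (μ : ℝ) : ℝ := (8 * (1 + 2 * μ) + 4 + 16 * (1 + 2 * μ) / μ) * (2 * conF μ)

theorem conFar_nonneg (hμ : 0 < μ) : 0 ≤ conFar μ := by
  have := conF_nonneg hμ
  unfold conFar; positivity

/-- The variation falls on the increment, on `∂_u P`, or on `ker`; all three are dominated by
`farG`. Since `1+θ₁ ≤ 2(1+θ₂)`, the cut-off chosen for `θ₁` is admissible for `θ₂`. -/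
theorem Cls.far_shift (h : Cls α (2 + α) (2 + α) A d) (hα0 : 0 < α) (hα1 : α < 1)
    (hμ : 1 / 2 < μ) (hm : Large μ m) (hp : Sym μ α p) {θ₁ θ₂ l : ℝ} (h2 : 0 < θ₂)
    (h12 : θ₂ < θ₁) (h1 : θ₁ ≤ θ₂ + 1) (hl0 : 0 < l) (hlN : l * (m * (1 + θ₁)) = nearC μ) :
    ‖∫ u in (Icc (-l) l)ᶜ, (hat μ d θ₁ u * (symZ p θ₁ u * ker p m θ₁ u) -
      hat μ d θ₂ u * (symZ p θ₂ u * ker p m θ₂ u))‖ ≤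
      conFar μ * A / m * (1 + θ₂) ^ (-(1 + α)) * (θ₁ - θ₂) ^ α := by
  have hμ0 : 0 < μ := by linarith
  have hA := h.nonneg
  have hm0 := hm.pos hμ0
  have hr := (rate_pos hμ0 hm0).le
  have hnc := nearC_pos hμ0
  have hθ1 : 0 < θ₁ := h2.trans h12
  have hw := (weight_pos (s := -(2 + α)) h2).le
  have hw1 := (weight_pos (s := -(1 + α)) h2).le
  have hww : (1 + θ₂) ^ (-(2 + α)) ≤ (1 + θ₂) ^ (-(1 + α)) := weight_mono (by linarith) h2
  have hδ : 0 ≤ (θ₁ - θ₂) ^ α := Real.rpow_nonneg (by linarith) _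
  have hle : l * (m * (1 + θ₂)) ≤ l * (m * (1 + θ₁)) := by gcongr
  have hge : l * (m * (1 + θ₁)) ≤ 2 * (l * (m * (1 + θ₂))) := by
    have : l * (m * (1 + θ₁)) ≤ l * (m * (2 * (1 + θ₂))) := by gcongr; linarith
    linarith
  refine (hp.far_integral_le hμ hm hθ1 h2 (l := l)
    (K := A * (8 * (1 + 2 * μ) + 4 + 16 * (1 + 2 * μ) / μ) * (1 + θ₂) ^ (-(1 + α)) *
      (θ₁ - θ₂) ^ α) (by positivity) hl0 hlN.le (by linarith) (by linarith) (by linarith)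
    (fun u hu => ?_)).trans (le_of_eq (by unfold conFar; ring))
  have G1 := farG_nonneg (μ := μ) (p := p) (m := m) (θ := θ₁) hr u
  have G2 := farG_nonneg (μ := μ) (p := p) (m := m) (θ := θ₂) hr u
  have eq : hat μ d θ₁ u * (symZ p θ₁ u * ker p m θ₁ u) -
      hat μ d θ₂ u * (symZ p θ₂ u * ker p m θ₂ u) =
      (hat μ d θ₁ u - hat μ d θ₂ u) * (symZ p θ₁ u * ker p m θ₁ u) +
      hat μ d θ₂ u * ((symZ p θ₁ u - symZ p θ₂ u) * ker p m θ₁ u) +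
      hat μ d θ₂ u * (symZ p θ₂ u * (ker p m θ₁ u - ker p m θ₂ u)) := by ring
  have a1 := h.hat_shift hα0 hα1.le hμ h2 h12 h1 u
  have a2 := h.hat_le_exp hα0 hα1.le hμ h2 u
  have z1 := hp.norm_symZ_le hμ0 hθ1 u
  have z2 := hp.norm_symZ_le hμ0 h2 u
  have z3 := hp.symZ_shift hα0 hα1.le h2 h12 h1 u
  have k1 := hp.exp_mul_ker_le hμ0 hm hθ1 (a := 2 * μ + 5) (by linarith) u
  have k2 := hp.exp_mul_ker_le hμ0 hm hθ1 (a := 2 * μ + 4) (by linarith) u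
  have k3 := hp.exp_mul_ker_sub_le hα0 hα1.le hμ0 hm h2 h12 h1 (a := 2 * μ + 4) (by linarith) hu
  have x1 : Real.exp ((2 * μ + 4) * |u|) = Real.exp ((2 * μ + 3) * |u|) * Real.exp |u| := by
    rw [← Real.exp_add]; ring_nf
  have x2 : Real.exp ((2 * μ + 5) * |u|) = Real.exp ((2 * μ + 4) * |u|) * Real.exp |u| := by
    rw [← Real.exp_add]; ring_nf
  have t1 : ‖(hat μ d θ₁ u - hat μ d θ₂ u) * (symZ p θ₁ u * ker p m θ₁ u)‖ ≤
      A * (8 * (1 + 2 * μ)) * (1 + θ₂) ^ (-(1 + α)) * (θ₁ - θ₂) ^ α * farG μ p m θ₁ u := by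
    rw [norm_mul, norm_mul, ← weight_two_mul h2]
    calc _ ≤ 4 * A * (1 + θ₂) ^ (-(2 + α)) * (θ₁ - θ₂) ^ α * Real.exp ((2 * μ + 4) * |u|) *
          ((1 + 2 * μ) * (1 + θ₁) * Real.exp |u| * ‖ker p m θ₁ u‖) := by gcongr
      _ = 4 * A * (1 + θ₂) ^ (-(2 + α)) * (θ₁ - θ₂) ^ α * ((1 + 2 * μ) * (1 + θ₁)) *
          (Real.exp ((2 * μ + 5) * |u|) * ‖ker p m θ₁ u‖) := by rw [x2]; ring
      _ ≤ 4 * A * (1 + θ₂) ^ (-(2 + α)) * (θ₁ - θ₂) ^ α * ((1 + 2 * μ) * (2 * (1 + θ₂))) *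
          farG μ p m θ₁ u := by gcongr; linarith
      _ = _ := by ring
  have t2 : ‖hat μ d θ₂ u * ((symZ p θ₁ u - symZ p θ₂ u) * ker p m θ₁ u)‖ ≤
      A * 4 * (1 + θ₂) ^ (-(1 + α)) * (θ₁ - θ₂) ^ α * farG μ p m θ₁ u := by
    rw [norm_mul, norm_mul]
    calc _ ≤ 2 * A * (1 + θ₂) ^ (-(2 + α)) * Real.exp ((2 * μ + 3) * |u|) *
          (2 * (θ₁ - θ₂) ^ α * Real.exp |u| * ‖ker p m θ₁ u‖) := by gcongr
      _ = A * 4 * (1 + θ₂) ^ (-(2 + α)) * (θ₁ - θ₂) ^ α *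
          (Real.exp ((2 * μ + 4) * |u|) * ‖ker p m θ₁ u‖) := by rw [x1]; ring
      _ ≤ _ := by gcongr
  have t3 : ‖hat μ d θ₂ u * (symZ p θ₂ u * (ker p m θ₁ u - ker p m θ₂ u))‖ ≤
      A * (16 * (1 + 2 * μ) / μ) * (1 + θ₂) ^ (-(1 + α)) * (θ₁ - θ₂) ^ α *
        (farG μ p m θ₁ u + farG μ p m θ₂ u) := by
    rw [norm_mul, norm_mul, ← weight_two_mul h2]
    calc _ ≤ 2 * A * (1 + θ₂) ^ (-(2 + α)) * Real.exp ((2 * μ + 3) * |u|) *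
          ((1 + 2 * μ) * (1 + θ₂) * Real.exp |u| * ‖ker p m θ₁ u - ker p m θ₂ u‖) := by gcongr
      _ = 2 * A * (1 + θ₂) ^ (-(2 + α)) * ((1 + 2 * μ) * (1 + θ₂)) *
          (Real.exp ((2 * μ + 4) * |u|) * ‖ker p m θ₁ u - ker p m θ₂ u‖) := by rw [x1]; ring
      _ ≤ 2 * A * (1 + θ₂) ^ (-(2 + α)) * ((1 + 2 * μ) * (1 + θ₂)) *
          (8 / μ * (θ₁ - θ₂) ^ α * (farG μ p m θ₁ u + farG μ p m θ₂ u)) := by gcongr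
      _ = _ := by ring
  rw [eq]
  refine (norm_add_le _ _).trans ((add_le_add ((norm_add_le _ _).trans
    (add_le_add t1 t2)) t3).trans ?_)
  have pB : 0 ≤ A * (8 * (1 + 2 * μ) + 4) * (1 + θ₂) ^ (-(1 + α)) * (θ₁ - θ₂) ^ α *
    farG μ p m θ₂ u := by positivity
  linarith

/-- The oscillating-kernel estimate for functions with balanced weights. -/
theorem Cls.opJ_balanced (h : Cls α (2 + α) (2 + α) A d) (hα0 : 0 < α) (hα1 : α < 1)
    (hμ : 1 / 2 < μ) (hm : Large μ m) (hp : Sym μ α p) :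
    EB α ((conB μ α + conNear μ α + conFar μ) * A / m) (opJ μ p m d) := by
  have hμ0 : 0 < μ := by linarith
  have hA := h.nonneg
  have hm0 := hm.pos hμ0
  have c1 := conB_nonneg (α := α) hμ0 hα0
  have c2 := conNear_nonneg hμ0 hα0 hα1
  have c3 := conFar_nonneg hμ0
  refine ⟨fun θ hθ => (h.norm_opJ_le hα0 hα1.le hμ hm hp hθ).trans ?_, fun θ₂ θ₁ h2 h12 h1 => ?_⟩
  · have := weight_pos (s := -(1 + α)) hθ
    gcongr; linarith
  · have hθ1 : 0 < θ₁ := h2.trans h12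
    have hnc := nearC_pos hμ0
    have hd0 : Cls α 0 0 A d := h.mono (by linarith) (by linarith) le_rfl
    have j1 := hd0.integrable_opJ hα0 hα1.le hμ hm hp hθ1
    have j2 := hd0.integrable_opJ hα0 hα1.le hμ hm hp h2
    have j12 : Integrable fun u => hat μ d θ₁ u * (symZ p θ₁ u * ker p m θ₁ u) -
      hat μ d θ₂ u * (symZ p θ₂ u * ker p m θ₂ u) := j1.sub j2
    set l := nearC μ / (m * (1 + θ₁)) with hl
    have hl0 : 0 < l := by positivity
    have hlN : l * (m * (1 + θ₁)) = nearC μ := by rw [hl]; field_simp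
    unfold opJ
    rw [← integral_sub j1 j2, ← integral_add_compl measurableSet_Icc j12 (s := Icc (-l) l)]
    refine (norm_add_le _ _).trans ((add_le_add
      (h.near_shift hα0 hα1 hμ hm hp h2 h12 h1.le hl0 hlN)
      (h.far_shift hα0 hα1 hμ hm hp h2 h12 h1.le hl0 hlN)).trans ?_)
    have hww : (1 + θ₂) ^ (-(2 + α)) ≤ (1 + θ₂) ^ (-(1 + α)) := weight_mono (by linarith) h2
    have hδ : 0 ≤ (θ₁ - θ₂) ^ α := Real.rpow_nonneg (by linarith) _
    have hw1 := (weight_pos (s := -(1 + α)) h2).le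
    calc _ ≤ conNear μ α * A / m * (1 + θ₂) ^ (-(1 + α)) * (θ₁ - θ₂) ^ α +
          conFar μ * A / m * (1 + θ₂) ^ (-(1 + α)) * (θ₁ - θ₂) ^ α := by gcongr
      _ = (conNear μ α + conFar μ) * A / m * (1 + θ₂) ^ (-(1 + α)) * (θ₁ - θ₂) ^ α := by ring
      _ ≤ _ := by gcongr; linarith

/-- Constant of the main estimate. -/
def conT (μ α : ℝ) : ℝ :=
  conN μ * (2 * μ + 8) + 2 * (conB μ α + conNear μ α + conFar μ)

theorem conT_nonneg (hμ : 0 < μ) (hα0 : 0 < α) (hα1 : α < 1) : 0 ≤ conT μ α := by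
  have c1 := conB_nonneg (α := α) hμ hα0
  have c2 := conNear_nonneg hμ hα0 hα1
  have c3 := conFar_nonneg hμ
  have c4 := conN_nonneg hμ
  unfold conT; positivity

/-- The oscillating-kernel estimate. -/
theorem Cls.opJ_bound (h : Cls α (1 + α) (2 + α) A d) (hα0 : 0 < α) (hα1 : α < 1)
    (hμ : 1 / 2 < μ) (hm : Large μ m) (hp : Sym μ α p) :
    EB α (conT μ α * A / m) (opJ μ p m d) := by
  -- The average is handled by integration by parts; the remainder has decay and Hölder exponents
  -- both equal to `2+α`, as the balanced estimate requires.
  have hav := h.avg_cls (by linarith) (by linarith)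
  have hd := h.sub_avg_cls hα0 (by linarith) (by linarith)
  have b1 := h.opJ_avg_bound hα0 hα1.le hμ hm hp
  have b2 := hd.opJ_balanced hα0 hα1 hμ hm hp
  refine ((b1.add b2).congr fun θ hθ => ?_).mono (le_of_eq (by unfold conT; ring))
  rw [← opJ_add (hav.mono (s' := 0) (e' := 0) (by linarith) (by linarith) le_rfl)
    (hd.mono (s' := 0) (e' := 0) (by linarith) (by linarith) le_rfl) hα0 hα1.le hμ hm hp hθ]
  exact opJ_congr (fun t _ => by ring) hθ

end KadenSpiral
end

/-! ### The dilogarithmic kernel and the second integration by parts. -/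

noncomputable section
namespace KadenSpiral

variable {μ α : ℝ} {p : ℝ → ℂ} {m θ A : ℝ} {d : ℝ → ℂ}

/-- The dilogarithm on the closed unit disc. -/
def li2 (q : ℂ) : ℂ := ∑' n : ℕ, q ^ (n + 1) / ((n : ℂ) + 1) ^ 2

/-- The derivative of the dilogarithm. -/
def li2' (q : ℂ) : ℂ := ∑' n : ℕ, q ^ n / ((n : ℂ) + 1)

theorem norm_nat_add_one (n : ℕ) : ‖(n : ℂ) + 1‖ = n + 1 := by
  rw [← Nat.cast_succ, Complex.norm_natCast]; push_cast; ring

/-- Termwise differentiation on a slightly smaller disc, where the derivatives are dominated by a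
geometric series. -/
theorem hasDerivAt_li2 {q : ℂ} (hq : ‖q‖ < 1) : HasDerivAt li2 (li2' q) q := by
  obtain ⟨r, hqr, hr⟩ := exists_between hq
  have hr0 : 0 ≤ r := (norm_nonneg q).trans hqr.le
  refine hasDerivAt_tsum_of_isPreconnected (u := fun n => r ^ n) (t := Metric.ball (0 : ℂ) r)
    (y₀ := 0) (g := fun (n : ℕ) (z : ℂ) => z ^ (n + 1) / ((n : ℂ) + 1) ^ 2)
    (g' := fun (n : ℕ) (z : ℂ) => z ^ n / ((n : ℂ) + 1))
    (summable_geometric_of_lt_one hr0 hr) Metric.isOpen_ball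
    (convex_ball 0 r).isPreconnected (fun n y _ => ?_) (fun n y hy => ?_)
    (by simpa using (norm_nonneg q).trans_lt hqr) ?_ (by simpa using hqr)
  · have hn : ((n : ℂ) + 1) ≠ 0 := Nat.cast_add_one_ne_zero n
    refine ((hasDerivAt_pow (n + 1) y).div_const _).congr_deriv ?_
    simp only [Nat.add_sub_cancel]
    push_cast; field_simp
  · have hy : ‖y‖ < r := by simpa using hy
    rw [norm_div, norm_pow, norm_nat_add_one]
    refine (div_le_self (by positivity) (by linarith [Nat.cast_nonneg (α := ℝ) n])).trans ?_
    gcongr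
  · exact summable_zero.congr fun n => by simp

/-- The relation making the dilogarithm of `q` an antiderivative, up to the factor `-m ∂_u P`, of
the logarithmic kernel. -/
theorem mul_li2' {q : ℂ} (hq : ‖q‖ < 1) : q * li2' q = -Complex.log (1 - q) := by
  have h1 := Complex.hasSum_taylorSeries_neg_log hq
  rw [← hasSum_nat_add_iff' 1] at h1
  simp only [Finset.range_one, Finset.sum_singleton, pow_zero, Nat.cast_zero, div_zero,
    sub_zero] at h1
  rw [← h1.tsum_eq, li2', ← tsum_mul_left]
  refine tsum_congr fun n => ?_
  push_cast; ring

theorem norm_li2'_le {q : ℂ} {r : ℝ} (hq : ‖q‖ ≤ r) (hr0 : 0 < r) (hr : r < 1) :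
    ‖li2' q‖ ≤ -Real.log (1 - r) / r := by
  have h2 := (Real.hasSum_pow_div_log_of_abs_lt_one (x := r) (by rwa [abs_of_pos hr0])).div_const r
  refine tsum_of_norm_bounded h2 fun n => ?_
  rw [norm_div, norm_pow, norm_nat_add_one]
  have e1 : r ^ (n + 1) / ((n : ℝ) + 1) / r = r ^ n / ((n : ℝ) + 1) := by
    rw [pow_succ]; field_simp
  rw [e1]; gcongr

theorem norm_li2_le {q : ℂ} {r : ℝ} (hq : ‖q‖ ≤ r) (hr : r < 1) :
    ‖li2 q‖ ≤ -Real.log (1 - r) := by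
  have hr0 : 0 ≤ r := (norm_nonneg q).trans hq
  have h2 := Real.hasSum_pow_div_log_of_abs_lt_one (x := r) (by rwa [abs_of_nonneg hr0])
  refine tsum_of_norm_bounded h2 fun n => ?_
  rw [norm_div, norm_pow, norm_pow, norm_nat_add_one]
  have hn : (0 : ℝ) ≤ n := Nat.cast_nonneg n
  gcongr
  nlinarith

theorem li2_sub_le {a b : ℂ} {r : ℝ} (ha : ‖a‖ ≤ r) (hb : ‖b‖ ≤ r) (hr0 : 0 < r) (hr : r < 1) :
    ‖li2 a - li2 b‖ ≤ -Real.log (1 - r) / r * ‖a - b‖ := by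
  refine (convex_closedBall (0 : ℂ) r).norm_image_sub_le_of_norm_hasDerivWithin_le
    (f := li2) (f' := li2') (fun x hx => ?_) (fun x hx => ?_) (by simpa using hb) (by simpa using ha)
  · have hx : ‖x‖ ≤ r := by simpa using hx
    exact (hasDerivAt_li2 (hx.trans_lt hr)).hasDerivWithinAt
  · exact norm_li2'_le (by simpa using hx) hr0 hr

/-- The series converges uniformly up to the unit circle. This gives one-sided limits of the kernel
at `u = 0`, where `q` tends to `1`. -/
theorem continuousOn_li2 : ContinuousOn li2 (Metric.closedBall 0 1) := by
  have hs : Summable fun n : ℕ => 1 / ((n : ℝ) + 1) ^ 2 := by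
    have := (summable_nat_add_iff 1).2 (Real.summable_one_div_nat_pow.2 one_lt_two)
    simpa using this
  refine continuousOn_tsum (u := fun n : ℕ => 1 / ((n : ℝ) + 1) ^ 2)
    (fun n => by fun_prop) hs fun n q hq => ?_
  have hq : ‖q‖ ≤ 1 := by simpa using hq
  rw [norm_div, norm_pow, norm_pow, norm_nat_add_one]
  gcongr
  exact pow_le_one₀ (norm_nonneg _) hq

theorem neg_log_one_sub_exp_le {x : ℝ} (hx : 0 < x) :
    -Real.log (1 - Real.exp (-(2 * x))) ≤ 2 * (x ^ (-(1 / 2) : ℝ) * Real.exp (-(3 / 2 * x))) := by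
  have hr : Real.exp (-(2 * x)) < 1 := Real.exp_lt_one_iff.2 (by linarith)
  have h0 := norm_log_one_sub_le (q := (Real.exp (-(2 * x)) : ℂ)) (r := Real.exp (-(2 * x)))
    (by rw [Complex.norm_real, Real.norm_of_nonneg (Real.exp_pos _).le]) hr
  rw [← Complex.ofReal_one, ← Complex.ofReal_sub, ← Complex.ofReal_log (by linarith),
    Complex.norm_real, Real.norm_eq_abs] at h0
  refine (neg_le_abs _).trans (h0.trans ?_)
  have h1 : x * Real.exp (-x) ≤ 1 - Real.exp (-(2 * x)) := by
    have := one_sub_exp_ge hx.le; linarith [mul_pos hx (Real.exp_pos (-x))]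
  have h2 := Real.rpow_le_rpow_of_nonpos (by positivity) h1 (show (-(1 / 2) : ℝ) ≤ 0 by norm_num)
  rw [Real.mul_rpow hx.le (Real.exp_pos _).le, ← Real.exp_mul] at h2
  refine (mul_le_mul_of_nonneg_left h2 (by positivity)).trans (le_of_eq ?_)
  have : Real.exp (-(3 / 2 * x)) = Real.exp (-(2 * x)) * Real.exp (-x * -(1 / 2)) := by
    rw [← Real.exp_add]; ring_nf
  rw [this]; ring

/-- The dilogarithmic kernel. -/
def kerLi (p : ℝ → ℂ) (m θ u : ℝ) : ℂ := sg u * li2 (kerQ p m θ u)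

theorem norm_sg_mul (u : ℝ) (z : ℂ) : ‖(sg u : ℂ) * z‖ = ‖z‖ := by
  rw [norm_mul, Complex.norm_real, Real.norm_eq_abs, abs_sg, one_mul]

theorem Sym.norm_kerLi_le (hp : Sym μ α p) (hμ : 0 < μ) (hθ : 0 < θ) (hm : 0 < m) {u : ℝ}
    (hu : u ≠ 0) : ‖kerLi p m θ u‖ ≤
      2 * ((rate μ m * |u|) ^ (-(1 / 2) : ℝ) * Real.exp (-(3 / 2 * (rate μ m * |u|)))) := by
  have hx : 0 < rate μ m * |u| := mul_pos (rate_pos hμ hm) (abs_pos.2 hu)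
  rw [kerLi, norm_sg_mul]
  exact (norm_li2_le (hp.norm_kerQ_le hθ hm.le u) (Real.exp_lt_one_iff.2 (by linarith))).trans
    (neg_log_one_sub_exp_le hx)

/-- The derivative of the dilogarithm is only logarithmically singular at `1`, so the factor `m|u|`
from the variation of `q` more than cancels it. -/
theorem Sym.kerLi_shift (hp : Sym μ α p) (hμ : 0 < μ) (hα0 : 0 < α) (hα1 : α ≤ 1) (hm : 0 < m)
    {θ₁ θ₂ : ℝ} (h2 : 0 < θ₂) (h12 : θ₂ < θ₁) (h1 : θ₁ ≤ θ₂ + 1) {u : ℝ} (hu : u ≠ 0) :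
    ‖kerLi p m θ₁ u - kerLi p m θ₂ u‖ ≤
      4 * (4 / μ * (θ₁ - θ₂) ^ α * Real.exp |u| * Real.exp (-(rate μ m * |u|))) := by
  have hx : 0 < rate μ m * |u| := mul_pos (rate_pos hμ hm) (abs_pos.2 hu)
  have hxm : m * |u| = 4 / μ * (rate μ m * |u|) := by unfold rate; field_simp
  have hd : 0 ≤ (θ₁ - θ₂) ^ α := Real.rpow_nonneg (by linarith) _
  have hr1 : Real.exp (-(2 * (rate μ m * |u|))) < 1 := Real.exp_lt_one_iff.2 (by linarith)
  have h3 := li2_sub_le (hp.norm_kerQ_le (h2.trans h12) hm.le u) (hp.norm_kerQ_le h2 hm.le u)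
    (Real.exp_pos _) hr1
  have h4 := hp.kerQ_shift hα0 hα1 hm.le h2 h12 h1 u
  have h5 := neg_log_one_sub_exp_le hx
  rw [kerLi, kerLi, ← mul_sub, norm_sg_mul]
  rw [hxm] at h4
  set x := rate μ m * |u|
  have hl : 0 ≤ -Real.log (1 - Real.exp (-(2 * x))) := by
    have := Real.log_nonpos (x := 1 - Real.exp (-(2 * x))) (by linarith)
      (by linarith [Real.exp_pos (-(2 * x))])
    linarith
  have hxx : x * (x ^ (-(1 / 2) : ℝ) * Real.exp (-(3 / 2 * x))) ≤ Real.exp (-x) := by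
    have e1 : x * x ^ (-(1 / 2) : ℝ) = x ^ (1 / 2 : ℝ) := by
      rw [← Real.rpow_one_add' hx.le (by norm_num)]; norm_num
    have e2 : x ^ (1 / 2 : ℝ) ≤ Real.exp (x / 2) := by
      have := Real.rpow_le_rpow hx.le (by linarith [Real.add_one_le_exp x] : x ≤ Real.exp x)
        (show (0 : ℝ) ≤ 1 / 2 by norm_num)
      rwa [← Real.exp_mul, mul_one_div] at this
    rw [← mul_assoc, e1]
    refine (mul_le_mul_of_nonneg_right e2 (Real.exp_pos _).le).trans ?_
    rw [← Real.exp_add]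
    exact Real.exp_le_exp.2 (by linarith)
  calc _ ≤ -Real.log (1 - Real.exp (-(2 * x))) / Real.exp (-(2 * x)) *
        (Real.exp (-(2 * x)) * (2 * (θ₁ - θ₂) ^ α * Real.exp |u| * (4 / μ * x))) := by
        refine h3.trans ?_
        gcongr
    _ = -Real.log (1 - Real.exp (-(2 * x))) * (2 * (θ₁ - θ₂) ^ α * Real.exp |u| * (4 / μ * x)) := by
        field_simp
    _ ≤ 2 * (x ^ (-(1 / 2) : ℝ) * Real.exp (-(3 / 2 * x))) *
        (2 * (θ₁ - θ₂) ^ α * Real.exp |u| * (4 / μ * x)) := by gcongr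
    _ = 4 * (4 / μ * (θ₁ - θ₂) ^ α * Real.exp |u| *
        (x * (x ^ (-(1 / 2) : ℝ) * Real.exp (-(3 / 2 * x))))) := by ring
    _ ≤ _ := by gcongr

theorem Sym.hasDerivAt_kerLi (hp : Sym μ α p) (hμ : 0 < μ) (hθ : 0 < θ) (hm : 0 < m) {u : ℝ}
    (hu : u ≠ 0) : HasDerivAt (kerLi p m θ) (-(m * (symZ p θ u * kerL p m θ u))) u := by
  have hq := hp.norm_kerQ_lt hμ hθ hm hu
  have h1 := (hasDerivAt_li2 hq).comp u (hp.hasDerivAt_kerQ (m := m) hθ hu)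
  have h2 : HasDerivAt (fun v => (sg v : ℂ)) 0 u := by
    refine (hasDerivAt_const u (sg u : ℂ)).congr_of_eventuallyEq ?_
    filter_upwards [sg_eventuallyEq hu] with v hv
    rw [hv]
  refine (h2.mul h1).congr_deriv ?_
  have h3 := mul_li2' hq
  have hss : ((sg u : ℝ) : ℂ) * sg u = 1 := by rw [← Complex.ofReal_mul, sg_mul_self]; simp
  rw [zero_mul, zero_add]
  calc (sg u : ℂ) * (li2' (kerQ p m θ u) * (((sg u * m : ℝ) : ℂ) * symZ p θ u * kerQ p m θ u))
      = ((sg u : ℂ) * sg u) * (m * symZ p θ u * (kerQ p m θ u * li2' (kerQ p m θ u))) := by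
        push_cast; ring
    _ = _ := by rw [hss, h3, kerL]; ring

theorem Sym.aestronglyMeasurable_kerLi (hp : Sym μ α p) (hμ : 0 < μ) (hθ : 0 < θ) (hm : 0 < m) :
    AEStronglyMeasurable (kerLi p m θ) := by
  have h1 : ContinuousOn (kerLi p m θ) {0}ᶜ := fun u hu =>
    (hp.hasDerivAt_kerLi hμ hθ hm hu).continuousAt.continuousWithinAt
  have h2 := h1.aestronglyMeasurable (μ := volume) (measurableSet_singleton 0).compl
  rwa [restrict_compl_singleton] at h2

theorem Sym.tendsto_li2_kerQ (hp : Sym μ α p) (hμ : 0 < μ) (hθ : 0 < θ) (hm : 0 < m) :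
    Tendsto (fun u => li2 (kerQ p m θ u)) (𝓝 0) (𝓝 (li2 1)) := by
  have h1 : Tendsto (fun u => ((sg u * m : ℝ) : ℂ) * symP p θ u) (𝓝 0) (𝓝 0) := by
    have h2 : Tendsto (fun u => m * ‖symP p θ u‖) (𝓝 0) (𝓝 (m * ‖symP p θ 0‖)) :=
      ((hp.continuous_symP hθ).norm.const_smul m).tendsto 0
    rw [symP_zero, norm_zero, mul_zero] at h2
    refine squeeze_zero_norm (fun u => ?_) h2
    rw [norm_mul, Complex.norm_real, Real.norm_eq_abs, abs_mul, abs_sg, one_mul, abs_of_pos hm]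
  have h2 : Tendsto (kerQ p m θ) (𝓝 0) (𝓝 1) := by
    have := (Complex.continuous_exp.tendsto 0).comp h1
    rwa [Complex.exp_zero] at this
  refine (continuousOn_li2 1 (by simp)).tendsto.comp
    (tendsto_nhdsWithin_iff.2 ⟨h2, Eventually.of_forall fun u => ?_⟩)
  simpa using hp.norm_kerQ_le_one hμ hθ hm u

/-- Dividing the density by `it - p` makes `∂_u P · kerL` appear, an exact derivative. The
orientation sign makes the dilogarithmic kernel jump at the origin, which yields the boundary term
`2 Li₂(1) k(θ)`. The differentiability of `k` restricts the use to the constant symbol. -/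
theorem opN_eq_kerLi {B B' : ℝ} {k k' g f : ℝ → ℂ} (h : Cls α 0 0 B k)
    (hk : ∀ t, 0 < t → HasDerivAt k (k' t) t) (hg : Cls α 0 0 B' g)
    (hgk : ∀ t : ℝ, 0 < t → g t = (1 - 2 * μ) * k t + t * k' t)
    (hf : Cls α 0 0 A f) (hfk : ∀ t : ℝ, 0 < t → f t = k t * (Complex.I * t - p t))
    (hμ : 1 / 2 < μ) (hm : Large μ m) (hp : Sym μ α p) (hθ : 0 < θ) :
    opN μ p m f θ = (1 / m : ℝ) * (2 * li2 1 * k θ +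
      ∫ u, (Real.exp ((1 - 2 * μ) * u) : ℂ) * g (θ * Real.exp u) * kerLi p m θ u) := by
  have hμ0 : 0 < μ := by linarith
  have hm0 := hm.pos hμ0
  have hr := hm.rate_ge hμ0
  have hB := h.nonneg
  have i1 := hf.integrable_opN le_rfl (by norm_num) hμ hm hp hθ
  have i2 := hg.integrable_kernel le_rfl (by norm_num) hμ hm hθ
    (hp.aestronglyMeasurable_kerLi hμ0 hθ hm0) fun u hu => hp.norm_kerLi_le hμ0 hθ hm0 hu
  set E : ℝ → ℂ := fun u => hat μ k θ u + k θ with hE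
  have hEe : ∀ u, E u = (Real.exp ((1 - 2 * μ) * u) : ℂ) * k (θ * Real.exp u) := fun u => by
    simp only [hE, hat]; ring
  have hEd : ∀ u, HasDerivAt E ((Real.exp ((1 - 2 * μ) * u) : ℂ) * g (θ * Real.exp u)) u := fun u => by
    rw [hgk _ (by positivity)]; exact (hasDerivAt_hat hk hθ u).add_const _
  have hD : ∀ u, u ≠ 0 → HasDerivAt (fun u => E u * kerLi p m θ u)
      ((Real.exp ((1 - 2 * μ) * u) : ℂ) * g (θ * Real.exp u) * kerLi p m θ u -
        m * ((Real.exp ((1 - 2 * μ) * u) : ℂ) * f (θ * Real.exp u) * kerL p m θ u)) u := fun u hu => by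
    refine ((hEd u).mul (hp.hasDerivAt_kerLi hμ0 hθ hm0 hu)).congr_deriv ?_
    rw [hEe, hfk _ (by positivity), symZ]; ring
  have hE0 : E 0 = k θ := by simp [hE, hat]
  have hEc : Tendsto E (𝓝 0) (𝓝 (k θ)) := by
    rw [← hE0]; exact (hEd 0).continuousAt
  have hlim := hEc.mul (hp.tendsto_li2_kerQ hμ0 hθ hm0)
  have ha : Tendsto (fun u => E u * kerLi p m θ u) (𝓝[>] 0) (𝓝 (k θ * li2 1)) := by
    refine (hlim.mono_left nhdsWithin_le_nhds).congr' ?_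
    filter_upwards [self_mem_nhdsWithin] with u hu
    rw [kerLi, sg_of_pos hu]; push_cast; ring
  have hb : Tendsto (fun u => E u * kerLi p m θ u) (𝓝[<] 0) (𝓝 (-(k θ * li2 1))) := by
    refine (hlim.neg.mono_left nhdsWithin_le_nhds).congr' ?_
    filter_upwards [self_mem_nhdsWithin] with u hu
    rw [kerLi, sg_of_neg hu]; push_cast; ring
  have hinf : ∀ u : ℝ, 1 ≤ |u| → ‖E u * kerLi p m θ u‖ ≤ 2 * B * Real.exp (-|u|) := by
    intro u hu
    have hu0 : u ≠ 0 := by rintro rfl; norm_num at hu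
    rw [norm_mul, hEe, norm_mul]
    have c1 := mul_le_mul (norm_expfac_le hμ u) (h.bd (θ * Real.exp u) (by positivity))
      (norm_nonneg _) (Real.exp_pos _).le
    simp only [neg_zero, Real.rpow_zero, mul_one] at c1
    have b2 := hp.norm_kerLi_le hμ0 hθ hm0 hu0
    have hx1 : |u| ≤ rate μ m * |u| := le_mul_of_one_le_left (abs_nonneg _) hr
    have b3 : (rate μ m * |u|) ^ (-(1 / 2) : ℝ) ≤ 1 :=
      Real.rpow_le_one_of_one_le_of_nonpos (by linarith) (by norm_num)
    have hex := hm.exp_le (k := 2 * μ) (by linarith) u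
    set x := rate μ m * |u|
    refine (mul_le_mul (c1.trans (mul_le_mul_of_nonneg_right hex hB))
      (b2.trans (mul_le_mul_of_nonneg_left (mul_le_mul_of_nonneg_right b3 (Real.exp_pos _).le)
        zero_le_two)) (norm_nonneg _) (by positivity)).trans ?_
    have e1 : Real.exp (x / 2) * B * (2 * (1 * Real.exp (-(3 / 2 * x)))) =
        2 * B * (Real.exp (x / 2) * Real.exp (-(3 / 2 * x))) := by ring
    rw [e1, ← Real.exp_add]
    refine mul_le_mul_of_nonneg_left (Real.exp_le_exp.2 (by linarith)) (by positivity)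
  have key := integral_eq_jump hD (i2.sub (i1.const_mul (m : ℂ))) ha hb
    (squeeze_zero_norm' ((eventually_ge_atTop 1).mono fun u hu => hinf u (hu.trans (le_abs_self u)))
      (by simpa using tendsto_exp_neg_abs_atTop.const_mul (2 * B)))
    (squeeze_zero_norm' ((eventually_le_atBot (-1)).mono fun u hu => hinf u
      (by linarith [neg_le_abs u])) (by simpa using tendsto_exp_neg_abs_atBot.const_mul (2 * B)))
  rw [integral_sub i2 (i1.const_mul (m : ℂ)), integral_const_mul] at key
  have hmc : (m : ℂ) ≠ 0 := Complex.ofReal_ne_zero.2 hm0.ne'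
  have key' : m * opN μ p m f θ = 2 * li2 1 * k θ +
      ∫ u, (Real.exp ((1 - 2 * μ) * u) : ℂ) * g (θ * Real.exp u) * kerLi p m θ u := by
    unfold opN; linear_combination -key
  rw [← key']; push_cast; field_simp

theorem Cls.eb (h : Cls α (1 + α) (1 + α) A d) (hα0 : 0 < α) (hα1 : α ≤ 1) : EB α (2 * A) d where
  bd θ hθ := (h.bd θ hθ).trans (mul_le_mul_of_nonneg_right (by linarith [h.nonneg])
    (weight_pos hθ).le)
  hol θ₂ θ₁ h2 h12 h1 := h.hol_unit hα0 hα1 h2 h12 h1.le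

theorem Cls.kerLi_bound (h : Cls α (1 + α) (1 + α) A d) (hα0 : 0 < α) (hα1 : α ≤ 1)
    (hμ : 1 / 2 < μ) (hm : Large μ m) (hp : Sym μ α p) :
    EB α (4 * conN μ * A) (fun θ => ∫ u,
      (Real.exp ((1 - 2 * μ) * u) : ℂ) * d (θ * Real.exp u) * kerLi p m θ u) := by
  have hμ0 : 0 < μ := by linarith
  have hm0 := hm.pos hμ0
  -- The variation bound of the dilogarithmic kernel is four times what the abstract lemma admits,
  -- so the lemma is applied to a quarter of the kernel.
  have h1 := h.kernel_bound hα0 hα1 hμ hm (L := fun θ u => (1 / 4 : ℂ) * kerLi p m θ u)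
    (fun θ hθ => (hp.aestronglyMeasurable_kerLi hμ0 hθ hm0).const_mul _)
    (fun θ hθ u hu => by
      have := hp.norm_kerLi_le hμ0 hθ hm0 hu
      rw [norm_mul]; norm_num
      linarith [norm_nonneg (kerLi p m θ u)])
    (fun θ₂ θ₁ h2 h12 h1 u hu => by
      have := hp.kerLi_shift hμ0 hα0 hα1 hm0 h2 h12 h1 hu
      rw [← mul_sub, norm_mul]; norm_num
      linarith)
  refine ((h1.const_mul 4).congr fun θ _ => ?_).mono ?_
  · rw [← integral_const_mul]
    refine integral_congr_ae (Eventually.of_forall fun u => ?_)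
    simp only; ring
  · have : conN μ * A / m ≤ conN μ * A :=
      div_le_self (mul_nonneg (conN_nonneg hμ0) h.nonneg) (hm.one_le hμ0)
    norm_num; linarith

end KadenSpiral
end

/-! ### The unperturbed spiral. -/

noncomputable section
namespace KadenSpiral

variable {μ α : ℝ} {p : ℝ → ℂ} {m θ A : ℝ} {d : ℝ → ℂ}

/-- The resolvent of the unperturbed symbol. -/
def resMu (μ t : ℝ) : ℂ := (Complex.I * t - μ)⁻¹

theorem resMu_ne (hμ : 0 < μ) (t : ℝ) : Complex.I * t - μ ≠ 0 := by
  intro h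
  have := congrArg Complex.re h
  simp at this; linarith

theorem resMu_mul (hμ : 0 < μ) (t : ℝ) : (t : ℂ) * Complex.I * resMu μ t = 1 + μ * resMu μ t := by
  have := mul_inv_cancel₀ (resMu_ne hμ t)
  unfold resMu; linear_combination this

theorem hasDerivAt_resMu (hμ : 0 < μ) (t : ℝ) :
    HasDerivAt (resMu μ) (-Complex.I * resMu μ t ^ 2) t := by
  have h1 : HasDerivAt (fun s : ℝ => Complex.I * (s : ℂ) - μ) Complex.I t := by
    simpa using ((Complex.ofRealCLM.hasDerivAt (x := t)).const_mul Complex.I).sub_const (μ : ℂ)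
  refine (h1.inv (resMu_ne hμ t)).congr_deriv ?_
  unfold resMu
  have := resMu_ne hμ t
  field_simp

/-- The density produced by integrating `resMu` by parts once. -/
def resK (μ t : ℝ) : ℂ := -2 * μ * resMu μ t - μ * resMu μ t ^ 2

/-- The density dividing `resK` by the symbol. -/
def resK₁ (μ t : ℝ) : ℂ := -2 * μ * resMu μ t ^ 2 - μ * resMu μ t ^ 3

/-- The density produced by integrating `resK` by parts. -/
def resK₂ (μ t : ℝ) : ℂ :=
  (1 - 2 * μ) * resK₁ μ t + (1 + μ * resMu μ t) * (4 * μ * resMu μ t ^ 2 + 3 * μ * resMu μ t ^ 3)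

theorem exists_res_cls (hμ : 0 < μ) (hα1 : α ≤ 1) : ∃ B : ℝ, 0 ≤ B ∧
    Cls α 1 2 B (resMu μ) ∧ Cls α 1 2 B (resK μ) ∧ Cls α (1 + α) (1 + α) B (resK₁ μ) ∧
    Cls α (1 + α) (1 + α) B (resK₂ μ) := by
  have h1 : Cls α 1 2 (2 / ellC μ ^ 2 + 1 / ellC μ) (resMu μ) := (sym_const (α := α) hμ).inv_cls hμ
  set a := 2 / ellC μ ^ 2 + 1 / ellC μ
  obtain ⟨b, h2⟩ : ∃ b, Cls α 2 3 b (fun t => resMu μ t ^ 2) :=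
    ⟨_, ((h1.mul h1 (by norm_num) (e₁ := 3) (by norm_num) (by norm_num)).mono (by norm_num) le_rfl
      le_rfl).congr fun t _ => by ring⟩
  obtain ⟨c, h3⟩ : ∃ c, Cls α 2 3 c (fun t => resMu μ t ^ 3) :=
    ⟨_, ((h2.mul h1 (by norm_num) (e₁ := 3) (by norm_num) (by norm_num)).mono (by norm_num) le_rfl
      le_rfl).congr fun t _ => by ring⟩
  obtain ⟨e, h4⟩ : ∃ e, Cls α 2 3 e (fun t => resMu μ t ^ 4) :=
    ⟨_, ((h3.mul h1 (by norm_num) (e₁ := 3) (by norm_num) (by norm_num)).mono (by norm_num) le_rfl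
      le_rfl).congr fun t _ => by ring⟩
  obtain ⟨x, hx⟩ : ∃ x, Cls α 1 2 x (resK μ) :=
    ⟨_, (h1.const_mul (-2 * μ)).sub ((h2.mono (s' := 1) (e' := 2) (by norm_num) (by norm_num)
      le_rfl).const_mul μ)⟩
  obtain ⟨y, hy⟩ : ∃ y, Cls α 2 3 y (resK₁ μ) :=
    ⟨_, (h2.const_mul (-2 * μ)).sub (h3.const_mul μ)⟩
  obtain ⟨z, hz⟩ : ∃ z, Cls α 2 3 z (resK₂ μ) :=
    ⟨_, ((hy.const_mul (1 - 2 * μ)).add (((h2.const_mul (4 * μ)).add (h3.const_mul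
      (3 * μ + 4 * μ ^ 2))).add (h4.const_mul (3 * μ ^ 2)))).congr fun t _ => by
        unfold resK₂; ring⟩
  refine ⟨max (max a x) (max y z), ?_, h1.mono le_rfl le_rfl ?_, hx.mono le_rfl le_rfl ?_,
    hy.mono (by linarith) (by linarith) ?_, hz.mono (by linarith) (by linarith) ?_⟩
  · exact h1.nonneg.trans ((le_max_left _ _).trans (le_max_left _ _))
  · exact (le_max_left _ _).trans (le_max_left _ _)
  · exact (le_max_right _ _).trans (le_max_left _ _)
  · exact (le_max_left _ _).trans (le_max_right _ _)
  · exact (le_max_right _ _).trans (le_max_right _ _)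

/-- Since `1/(it-μ)` decays only like `1/t`, the main estimate does not apply to it. It is however
smooth for every symbol `p`, so one integration by parts is always possible. -/
theorem opJ_resMu_eq (hα0 : 0 < α) (hα1 : α ≤ 1) (hμ : 1 / 2 < μ) (hm : Large μ m)
    (hp : Sym μ α p) (hθ : 0 < θ) :
    opJ μ p m (resMu μ) θ = (1 / m : ℝ) * opN μ p m (resK μ) θ := by
  have hμ0 : 0 < μ := by linarith
  obtain ⟨B, _, h1, h2, _, _⟩ := exists_res_cls (α := α) hμ0 hα1
  refine opJ_eq_opN (h1.mono (by norm_num) (by norm_num) le_rfl) (fun t _ => hasDerivAt_resMu hμ0 t)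
    (h2.mono (by norm_num) (by norm_num) le_rfl) (fun t _ => ?_) hα0 hα1 hμ hm hp hθ
  have := resMu_mul hμ0 t
  unfold resK; linear_combination resMu μ t * this

/-- The unperturbed operator gains two powers of `m`. -/
theorem exists_opJ_resMu_bound (hα0 : 0 < α) (hα1 : α ≤ 1) (hμ : 1 / 2 < μ) :
    ∃ C : ℝ, 0 ≤ C ∧ ∀ m : ℝ, Large μ m →
      EB α (C / m ^ 2) (opJ μ (fun _ => (μ : ℂ)) m (resMu μ)) := by
  have hμ0 : 0 < μ := by linarith
  obtain ⟨B, hB, h1, h2, h3, h4⟩ := exists_res_cls (α := α) hμ0 hα1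
  have hN := conN_nonneg hμ0
  refine ⟨‖2 * li2 1‖ * (2 * B) + 4 * conN μ * B, by positivity, fun m hm => ?_⟩
  have hp := sym_const (α := α) hμ0
  have hm0 := hm.pos hμ0
  have hd : ∀ t : ℝ, 0 < t → HasDerivAt (resK₁ μ)
      (Complex.I * (4 * μ * resMu μ t ^ 3 + 3 * μ * resMu μ t ^ 4)) t := fun t _ => by
    have e := hasDerivAt_resMu hμ0 t
    refine (((e.pow 2).const_mul (-2 * (μ : ℂ))).sub ((e.pow 3).const_mul (μ : ℂ))).congr_deriv ?_
    push_cast; ring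
  have key := ((((h3.eb hα0 hα1).const_mul (2 * li2 1)).add
    (h4.kerLi_bound hα0 hα1 hμ hm hp)).const_mul (((1 / m : ℝ) : ℂ) * ((1 / m : ℝ) : ℂ)))
  -- Each of the two integrations by parts contributes one factor `1/m`; the boundary term and the
  -- dilogarithmic integral are bounded uniformly in `m`.
  refine (key.congr fun θ hθ => ?_).mono (le_of_eq ?_)
  · rw [opJ_resMu_eq hα0 hα1 hμ hm hp hθ, opN_eq_kerLi
      (h3.mono (s' := 0) (e' := 0) (by linarith) (by linarith) le_rfl) hd
      (h4.mono (s' := 0) (e' := 0) (by linarith) (by linarith) le_rfl) (fun t _ => ?_)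
      (h2.mono (s' := 0) (e' := 0) (by norm_num) (by norm_num) le_rfl) (fun t _ => ?_) hμ hm hp hθ]
    · ring
    · have := resMu_mul hμ0 t
      unfold resK₂
      linear_combination (-(4 * μ * resMu μ t ^ 2 + 3 * μ * resMu μ t ^ 3)) * this
    · have : resMu μ t * (Complex.I * t - μ) = 1 := inv_mul_cancel₀ (resMu_ne hμ0 t)
      unfold resK resK₁
      linear_combination (2 * μ * resMu μ t + μ * resMu μ t ^ 2) * this
  · rw [norm_mul, Complex.norm_real, Real.norm_of_nonneg (by positivity)]
    field_simp

/-! ### Schwarz, mean value and differentiation lemmas for families. -/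

theorem EB.mul_cls {B : ℝ} {J f : ℝ → ℂ} (h : EB α B J) (hf : Cls α 0 0 A f) (hα0 : 0 < α)
    (hα1 : α ≤ 1) : EB α (3 * A * B) (fun θ => f θ * J θ) := by
  have hA := hf.nonneg
  have hB := h.nonneg
  have hb : ∀ θ, 0 < θ → ‖f θ‖ ≤ A := fun θ hθ => by simpa using hf.bd θ hθ
  constructor
  · intro θ hθ
    have hw := (weight_pos (s := -(1 + α)) hθ).le
    rw [norm_mul]
    calc _ ≤ A * (B * (1 + θ) ^ (-(1 + α))) :=
          mul_le_mul (hb θ hθ) (h.bd θ hθ) (norm_nonneg _) hA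
      _ ≤ _ := by nlinarith [mul_nonneg (mul_nonneg hA hB) hw]
  · intro θ₂ θ₁ h2 h12 h1
    have hw := (weight_pos (s := -(1 + α)) h2).le
    have hδ : 0 ≤ (θ₁ - θ₂) ^ α := Real.rpow_nonneg (by linarith) _
    have e1 : f θ₁ * J θ₁ - f θ₂ * J θ₂ = f θ₁ * (J θ₁ - J θ₂) + (f θ₁ - f θ₂) * J θ₂ := by ring
    rw [e1]
    refine (norm_add_le _ _).trans ?_
    rw [norm_mul, norm_mul]
    have a1 := mul_le_mul (hb θ₁ (h2.trans h12)) (h.hol θ₂ θ₁ h2 h12 h1) (norm_nonneg _) hA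
    have a2 := hf.hol_unit hα0 hα1 h2 h12 h1.le
    rw [neg_zero, Real.rpow_zero, mul_one] at a2
    have a3 := mul_le_mul a2 (h.bd θ₂ h2) (norm_nonneg _) (by positivity)
    linarith

/-- Schwarz lemma for families of functions. -/
theorem EB.schwarz {B R : ℝ} {G : ℂ → ℝ → ℂ} (hR : 1 < R) (hB : 0 < B)
    (h : ∀ z ∈ Metric.ball (0 : ℂ) R, EB α B (G z))
    (hd : ∀ θ, 0 < θ → DifferentiableOn ℂ (fun z => G z θ) (Metric.ball 0 R)) :
    EB α (3 * B / R) (fun θ => G 1 θ - G 0 θ) := by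
  have key : ∀ (F : ℂ → ℂ) (M : ℝ), 0 < M → DifferentiableOn ℂ F (Metric.ball 0 R) →
      (∀ z ∈ Metric.ball (0 : ℂ) R, ‖F z‖ ≤ M) → ‖F 1 - F 0‖ ≤ 3 * M / R := by
    intro F M hM hF hb
    have := Complex.dist_le_div_mul_dist_of_mapsTo_ball (R₂ := 3 * M) hF (fun z hz => by
      rw [Metric.mem_closedBall, dist_eq_norm]
      have h1 := hb z hz
      have h2 := hb 0 (by simp; linarith)
      have := norm_sub_le (F z) (F 0)
      linarith) (z := 1) (by simpa using hR)
    simpa [dist_eq_norm] using this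
  constructor
  · intro θ hθ
    have hw := weight_pos (s := -(1 + α)) hθ
    refine (key (fun z => G z θ) (B * (1 + θ) ^ (-(1 + α))) (by positivity) (hd θ hθ)
      fun z hz => (h z hz).bd θ hθ).trans (le_of_eq (by ring))
  · intro θ₂ θ₁ h2 h12 h1
    have hw := weight_pos (s := -(1 + α)) h2
    have hδ : 0 < (θ₁ - θ₂) ^ α := Real.rpow_pos_of_pos (by linarith) _
    have := key (fun z => G z θ₁ - G z θ₂) (B * (1 + θ₂) ^ (-(1 + α)) * (θ₁ - θ₂) ^ α)
      (by positivity) ((hd θ₁ (h2.trans h12)).sub (hd θ₂ h2))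
      fun z hz => (h z hz).hol θ₂ θ₁ h2 h12 h1
    have e1 : G 1 θ₁ - G 0 θ₁ - (G 1 θ₂ - G 0 θ₂) = G 1 θ₁ - G 1 θ₂ - (G 0 θ₁ - G 0 θ₂) := by ring
    rw [e1]
    exact this.trans (le_of_eq (by ring))

/-- Mean value inequality for families of functions. -/
theorem EB.mean_value {B R : ℝ} {G G' : ℂ → ℝ → ℂ} (hR : 1 < R)
    (h : ∀ z ∈ Metric.ball (0 : ℂ) R, EB α B (G' z))
    (hd : ∀ θ, 0 < θ → ∀ z ∈ Metric.ball (0 : ℂ) R, HasDerivAt (fun z => G z θ) (G' z θ) z) :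
    EB α B (fun θ => G 1 θ - G 0 θ) := by
  have key : ∀ (F F' : ℂ → ℂ) (M : ℝ), (∀ z ∈ Metric.ball (0 : ℂ) R, HasDerivAt F (F' z) z) →
      (∀ z ∈ Metric.ball (0 : ℂ) R, ‖F' z‖ ≤ M) → ‖F 1 - F 0‖ ≤ M := by
    intro F F' M hF hb
    have := (convex_ball (0 : ℂ) R).norm_image_sub_le_of_norm_hasDerivWithin_le
      (fun z hz => (hF z hz).hasDerivWithinAt) hb (x := 0) (y := 1) (by simp; linarith)
      (by simpa using hR)
    simpa using this
  constructor
  · intro θ hθ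
    exact key (fun z => G z θ) (fun z => G' z θ) _ (hd θ hθ) fun z hz => (h z hz).bd θ hθ
  · intro θ₂ θ₁ h2 h12 h1
    have := key (fun z => G z θ₁ - G z θ₂) (fun z => G' z θ₁ - G' z θ₂) _
      (fun z hz => (hd θ₁ (h2.trans h12) z hz).sub (hd θ₂ h2 z hz))
      fun z hz => (h z hz).hol θ₂ θ₁ h2 h12 h1
    have e1 : G 1 θ₁ - G 0 θ₁ - (G 1 θ₂ - G 0 θ₂) = G 1 θ₁ - G 1 θ₂ - (G 0 θ₁ - G 0 θ₂) := by ring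
    rw [e1]; exact this

/-- Differentiation under the integral sign for holomorphic families with a uniform majorant. -/
theorem hasDerivAt_integral_of_holomorphic {F : ℂ → ℝ → ℂ} {b : ℝ → ℝ} {z₀ : ℂ} {R : ℝ}
    (hz : z₀ ∈ Metric.ball (0 : ℂ) R)
    (hm : ∀ z ∈ Metric.ball (0 : ℂ) R, AEStronglyMeasurable (F z))
    (hb : ∀ z ∈ Metric.ball (0 : ℂ) R, ∀ u, u ≠ 0 → ‖F z u‖ ≤ b u) (hbi : Integrable b)
    (hd : ∀ u, u ≠ 0 → DifferentiableOn ℂ (fun z => F z u) (Metric.ball 0 R)) :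
    HasDerivAt (fun z => ∫ u, F z u) (∫ u, deriv (fun z => F z u) z₀) z₀ := by
  obtain ⟨r, hr0, hr⟩ := Metric.nhds_basis_closedBall.mem_iff.1
    (Metric.isOpen_ball.mem_nhds hz)
  set r₂ := r / 2 with hr₂
  have hr20 : 0 < r₂ := by positivity
  have hsub : ∀ z ∈ Metric.ball z₀ r₂, Metric.closedBall z r₂ ⊆ Metric.ball (0 : ℂ) R := by
    intro z hz w hw
    apply hr
    rw [Metric.mem_closedBall] at hw ⊢
    rw [Metric.mem_ball] at hz
    linarith [dist_triangle w z z₀]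
  -- Cauchy's estimate on discs of half the available radius turns the majorant of the family into
  -- one of its derivative, so no separate bound on the derivative is needed.
  have hcauchy : ∀ u, u ≠ 0 → ∀ z ∈ Metric.ball z₀ r₂, ‖deriv (fun z => F z u) z‖ ≤ b u / r₂ := by
    intro u hu z hz
    refine Complex.norm_deriv_le_of_forall_mem_sphere_norm_le hr20 ?_ fun w hw =>
      hb w (hsub z hz (Metric.sphere_subset_closedBall hw)) u hu
    exact ((hd u hu).mono (hsub z hz)).diffContOnCl_ball subset_rfl
  have hmem : ∀ z ∈ Metric.ball z₀ r₂, z ∈ Metric.ball (0 : ℂ) R := fun z hz =>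
    hsub z hz (Metric.mem_closedBall_self hr20.le)
  have hderiv : ∀ u, u ≠ 0 → ∀ z ∈ Metric.ball z₀ r₂,
      HasDerivAt (fun z => F z u) (deriv (fun z => F z u) z) z := fun u hu z hz =>
    ((hd u hu).differentiableAt (Metric.isOpen_ball.mem_nhds (hmem z hz))).hasDerivAt
  have hmeas : AEStronglyMeasurable (fun u => deriv (fun z => F z u) z₀) := by
    -- The derivative in `z` is measurable in `u` as an almost everywhere limit of difference
    -- quotients along a sequence of steps.
    set s : ℕ → ℂ := fun n => ((r₂ / (n + 2) : ℝ) : ℂ) with hs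
    have hs0 : ∀ n, s n ≠ 0 := fun n => Complex.ofReal_ne_zero.2 (by positivity)
    have hsn : ∀ n, z₀ + s n ∈ Metric.ball z₀ r₂ := fun n => by
      rw [Metric.mem_ball, dist_eq_norm, add_sub_cancel_left, hs]
      simp only
      rw [Complex.norm_real, Real.norm_of_nonneg (by positivity)]
      exact div_lt_self hr20 (by linarith [Nat.cast_nonneg (α := ℝ) n])
    have hst : Tendsto s atTop (𝓝[≠] 0) := by
      refine tendsto_nhdsWithin_iff.2 ⟨?_, Eventually.of_forall hs0⟩
      have : Tendsto (fun n : ℕ => r₂ / ((n : ℝ) + 2)) atTop (𝓝 0) :=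
        tendsto_const_nhds.div_atTop (tendsto_atTop_add_const_right _ _ tendsto_natCast_atTop_atTop)
      have h2 := (Complex.continuous_ofReal.tendsto 0).comp this
      rwa [Complex.ofReal_zero] at h2
    refine aestronglyMeasurable_of_tendsto_ae atTop
      (f := fun (n : ℕ) (u : ℝ) => (s n)⁻¹ • (F (z₀ + s n) u - F z₀ u)) (fun n => ?_) ?_
    · exact ((hm _ (hmem _ (hsn n))).sub (hm z₀ hz)).const_smul ((s n)⁻¹)
    · filter_upwards [ae_ne_zero] with u hu
      exact (hderiv u hu z₀ (Metric.mem_ball_self hr20)).tendsto_slope_zero.comp hst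
  have hint : Integrable (F z₀) := hbi.mono' (hm z₀ hz) (ae_ne_zero.mono (hb z₀ hz))
  exact (hasDerivAt_integral_of_dominated_loc_of_deriv_le (Metric.ball_mem_nhds z₀ hr20)
    ((Metric.ball_mem_nhds z₀ hr20 |> fun h => Filter.eventually_of_mem h fun z hz' =>
      hm z (hmem z hz'))) hint hmeas
    (ae_ne_zero.mono hcauchy) (hbi.div_const _) (ae_ne_zero.mono hderiv)).2

end KadenSpiral
end

/-! ### Perturbations, their symbols and densities. -/

noncomputable section
namespace KadenSpiral

variable {μ α ε : ℝ} {ρ τ h : ℝ → ℂ} {m θ : ℝ}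

/-- Admissible perturbations in logarithmic variables: `τ = t ρ'`. -/
structure Data (α ε : ℝ) (ρ τ h : ℝ → ℂ) : Prop where
  rho : Cls α α (1 + α) ε ρ
  tau : Cls α α α ε τ
  den : Cls α α (1 + α) ε h
  deriv : ∀ t : ℝ, 0 < t → HasDerivAt ρ (τ t / t) t

/-- The symbol of a perturbation. -/
def symb (μ : ℝ) (ρ τ : ℝ → ℂ) (t : ℝ) : ℂ := μ - τ t / (1 + ρ t)

/-- The constant of the circulation density. -/
def circ (μ : ℝ) : ℝ := 2 * Real.pi * (2 * μ - 1)

/-- The small part of the density of the integral operator. -/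
def dens (μ : ℝ) (ρ τ h : ℝ → ℂ) (t : ℝ) : ℂ :=
  h t * (Complex.I * t - symb μ ρ τ t)⁻¹ +
    circ μ * ((symb μ ρ τ t - μ) * ((Complex.I * t - symb μ ρ τ t)⁻¹ * resMu μ t))

/-- Constant of the resolvent. -/
def conI (μ : ℝ) : ℝ := 2 / ellC μ ^ 2 + 1 / ellC μ

theorem conI_nonneg (hμ : 0 < μ) : 0 ≤ conI μ := by
  have := ellC_pos hμ; unfold conI; positivity

/-- Constant of the density. -/
def conE (μ : ℝ) : ℝ := 2 * conI μ + |circ μ| * (16 * conI μ ^ 2)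

theorem conE_nonneg (hμ : 0 < μ) : 0 ≤ conE μ := by
  have := conI_nonneg hμ; unfold conE; positivity

/-- Admissible size of perturbations. -/
def datTol (μ : ℝ) : ℝ := symTol μ / 4

theorem datTol_pos (hμ : 0 < μ) : 0 < datTol μ := by
  have := symTol_pos hμ; unfold datTol; linarith

theorem datTol_le : datTol μ ≤ 1 / 32 := by
  have := (symTol_le μ).2; unfold datTol; linarith

namespace Data

theorem norm_rho_le (H : Data α ε ρ τ h) (hα0 : 0 < α) (hε : ε ≤ 1 / 2) {t : ℝ} (ht : 0 < t) :
    ‖ρ t‖ ≤ 1 / 2 := by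
  have := (H.rho.mono (s' := 0) (e' := 1 + α) hα0.le le_rfl hε).bd t ht
  simpa using this

theorem norm_one_add_ge (H : Data α ε ρ τ h) (hα0 : 0 < α) (hε : ε ≤ 1 / 2) {t : ℝ} (ht : 0 < t) :
    1 / 2 ≤ ‖1 + ρ t‖ := by
  have h1 := norm_sub_norm_le (1 : ℂ) (-ρ t)
  rw [norm_one, norm_neg, sub_neg_eq_add] at h1
  linarith [H.norm_rho_le hα0 hε ht]

theorem one_add_mem (H : Data α ε ρ τ h) (hα0 : 0 < α) (hε : ε ≤ 1 / 2) {t : ℝ} (ht : 0 < t) :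
    1 + ρ t ∈ Complex.slitPlane := by
  left
  have h1 := Complex.abs_re_le_norm (ρ t)
  have h2 := H.norm_rho_le hα0 hε ht
  have h3 := neg_abs_le (ρ t).re
  simp only [Complex.add_re, Complex.one_re]; linarith

theorem one_add_ne (H : Data α ε ρ τ h) (hα0 : 0 < α) (hε : ε ≤ 1 / 2) {t : ℝ} (ht : 0 < t) :
    1 + ρ t ≠ 0 := Complex.slitPlane_ne_zero (H.one_add_mem hα0 hε ht)

theorem inv_cls (H : Data α ε ρ τ h) (hα0 : 0 < α) (hε : ε ≤ 1 / 2) :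
    Cls α 0 (1 + α) 2 (fun t => (1 + ρ t)⁻¹) where
  cont := (continuousOn_const.add H.rho.cont).inv₀ fun _ ht => H.one_add_ne hα0 hε ht
  bd t ht := by
    have h1 := H.norm_one_add_ge hα0 hε ht
    rw [norm_inv, neg_zero, Real.rpow_zero, mul_one]
    exact inv_le_of_inv_le₀ (by norm_num) (by linarith)
  hol t' t ht' hlt := by
    have ht := ht'.trans hlt
    have h1 := H.norm_one_add_ge hα0 hε ht
    have h2 := H.norm_one_add_ge hα0 hε ht'
    have h3 := (H.rho.mono (s' := α) (e' := 1 + α) le_rfl le_rfl hε).hol t' t ht' hlt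
    rw [inv_sub_inv (H.one_add_ne hα0 hε ht) (H.one_add_ne hα0 hε ht'), norm_div, norm_mul,
      add_sub_add_left_eq_sub, norm_sub_rev]
    rw [div_le_iff₀ (by positivity)]
    have h4 : (1 : ℝ) / 4 ≤ ‖1 + ρ t‖ * ‖1 + ρ t'‖ := by nlinarith
    have h5 : 0 ≤ (1 + t') ^ (-(1 + α)) * ((t - t') ^ α + (t - t')) :=
      mul_nonneg (weight_pos ht').le (modulus_nonneg hlt)
    nlinarith

theorem sub_cls (H : Data α ε ρ τ h) (hα0 : 0 < α) (hε : ε ≤ 1 / 2) :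
    Cls α α α (4 * ε) (fun t => symb μ ρ τ t - μ) := by
  have h1 := (H.tau.mul (H.inv_cls hα0 hε) le_rfl (e₁ := α) (by linarith) (by linarith)).neg
  refine (h1.mono (by linarith) le_rfl (by linarith)).congr fun t _ => ?_
  unfold symb; rw [div_eq_mul_inv]; ring

theorem sym (H : Data α ε ρ τ h) (hα0 : 0 < α) (hε : ε ≤ datTol μ) : Sym μ α (symb μ ρ τ) := by
  have h2 := datTol_le (μ := μ)
  refine (H.sub_cls hα0 (by linarith)).mono hα0.le hα0.le ?_
  unfold datTol at hε; linarith

/-- The term with `h` has Hölder weight `(1+α)+1` and `α+2`; the symbol has only Hölder weight `α`,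
but comes with two inverses of decay `1` each. Both give exponents `1+α` and `2+α`, the class of the
main estimate. -/
theorem dens_cls (H : Data α ε ρ τ h) (hα0 : 0 < α) (hμ : 0 < μ) (hε : ε ≤ datTol μ) :
    Cls α (1 + α) (2 + α) (conE μ * ε) (dens μ ρ τ h) := by
  have h2 := datTol_le (μ := μ)
  have i1 : Cls α 1 2 (conI μ) _ := (H.sym hα0 hε).inv_cls hμ
  have i2 : Cls α 1 2 (conI μ) (resMu μ) := (sym_const (α := α) hμ).inv_cls hμ
  have a1 := H.den.mul i1 zero_le_one (e₁ := 2 + α) (by linarith) (by linarith)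
  have a2 := (i1.mul i2 zero_le_one (e₁ := 3) (by norm_num) (by norm_num))
  have a3 := ((H.sub_cls (μ := μ) hα0 (by linarith)).mul a2 (by norm_num) (e₁ := 2 + α)
    (by linarith) (by linarith)).const_mul (circ μ : ℂ)
  refine ((a1.mono (s' := 1 + α) (e' := 2 + α) (by linarith) le_rfl le_rfl).add
    (a3.mono (s' := 1 + α) (e' := 2 + α) (by linarith) le_rfl le_rfl)).mono le_rfl le_rfl ?_
  rw [Complex.norm_real, Real.norm_eq_abs]
  unfold conE
  exact le_of_eq (by ring)

theorem sub_ne (H : Data α ε ρ τ h) (hα0 : 0 < α) (hμ : 0 < μ) (hε : ε ≤ datTol μ) {t : ℝ}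
    (ht : 0 < t) : Complex.I * t - symb μ ρ τ t ≠ 0 := by
  have hc := ellC_pos hμ
  exact norm_pos_iff.1 (lt_of_lt_of_le (by positivity) ((H.sym hα0 hε).norm_ge hμ ht))

/-- Closed form of the phase. -/
theorem symP_eq (H : Data α ε ρ τ h) (hα0 : 0 < α) (hε : ε ≤ datTol μ) (hθ : 0 < θ) (u : ℝ) :
    symP (symb μ ρ τ) θ u = Complex.I * ((θ * (Real.exp u - 1) : ℝ) : ℂ) - μ * u +
      (Complex.log (1 + ρ (θ * Real.exp u)) - Complex.log (1 + ρ θ)) := by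
  have h2 := datTol_le (μ := μ)
  have hε' : ε ≤ 1 / 2 := by linarith
  have hd : ∀ v : ℝ, HasDerivAt (fun v : ℝ => Complex.I * ((θ * (Real.exp v - 1) : ℝ) : ℂ) - μ * v +
      (Complex.log (1 + ρ (θ * Real.exp v)) - Complex.log (1 + ρ θ))) (symZ (symb μ ρ τ) θ v) v := by
    intro v
    have hv : 0 < θ * Real.exp v := by positivity
    have e1 : HasDerivAt (fun v : ℝ => θ * (Real.exp v - 1)) (θ * Real.exp v) v :=
      ((Real.hasDerivAt_exp v).sub_const 1).const_mul θ
    have e2 : HasDerivAt (fun v : ℝ => θ * Real.exp v) (θ * Real.exp v) v :=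
      (Real.hasDerivAt_exp v).const_mul θ
    have e3 := ((H.deriv _ hv).scomp v e2).const_add 1
    have e4 := e3.clog_real (H.one_add_mem hα0 hε' hv)
    have e5 : HasDerivAt (fun v : ℝ => (μ : ℂ) * v) μ v := by
      simpa using (Complex.ofRealCLM.hasDerivAt (x := v)).const_mul (μ : ℂ)
    refine (((e1.ofReal_comp.const_mul Complex.I).sub e5).add (e4.sub_const _)).congr_deriv ?_
    have h3 := H.one_add_ne hα0 hε' hv
    have h4 : ((θ * Real.exp v : ℝ) : ℂ) ≠ 0 := Complex.ofReal_ne_zero.2 hv.ne'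
    simp only [Function.comp, Complex.real_smul, symZ, symb]
    rw [mul_div_cancel₀ _ h4]
    ring
  unfold symP
  rw [intervalIntegral.integral_eq_sub_of_hasDerivAt (fun v _ => hd v)
    (((H.sym hα0 hε).continuous_symZ hθ).intervalIntegrable 0 u)]
  simp

variable {ε' D R : ℝ} {ρ' τ' h' : ℝ → ℂ}

/-- Admissibility is preserved on a complex disc whose radius is inversely proportional to the size
`D` of the direction. This is what converts holomorphy into a Lipschitz bound. -/
theorem line (H : Data α ε ρ τ h) (H' : Data α D ρ' τ' h') {R : ℝ} {z : ℂ}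
    (hz : z ∈ Metric.ball (0 : ℂ) R) (hR : ε + R * D ≤ ε') :
    Data α ε' (fun t => ρ t + z * ρ' t) (fun t => τ t + z * τ' t) (fun t => h t + z * h' t) := by
  have hz : ‖z‖ < R := by simpa using hz
  have h1 : ε + ‖z‖ * D ≤ ε' := by
    have : ‖z‖ * D ≤ R * D := mul_le_mul_of_nonneg_right hz.le H'.rho.nonneg
    linarith
  refine ⟨(H.rho.add (H'.rho.const_mul z)).mono le_rfl le_rfl h1,
    (H.tau.add (H'.tau.const_mul z)).mono le_rfl le_rfl h1,
    (H.den.add (H'.den.const_mul z)).mono le_rfl le_rfl h1, fun t ht => ?_⟩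
  refine ((H.deriv t ht).add ((H'.deriv t ht).const_mul z)).congr_deriv ?_
  ring

end Data

/-! ### Holomorphic dependence along complex lines. -/

section family

variable {ε' D R : ℝ} {ρ' τ' h' : ℝ → ℂ}

/-- A complex line of admissible perturbations. -/
structure Line (μ α R : ℝ) (ρ τ h ρ' τ' h' : ℝ → ℂ) : Prop where
  data : ∀ z ∈ Metric.ball (0 : ℂ) R, Data α (datTol μ) (fun t => ρ t + z * ρ' t)
    (fun t => τ t + z * τ' t) (fun t => h t + z * h' t)

/-- The symbol along a line. -/
def lineP (μ : ℝ) (ρ τ ρ' τ' : ℝ → ℂ) (z : ℂ) : ℝ → ℂ :=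
  symb μ (fun t => ρ t + z * ρ' t) (fun t => τ t + z * τ' t)

/-- The density along a line. -/
def lineE (μ : ℝ) (ρ τ h ρ' τ' h' : ℝ → ℂ) (z : ℂ) : ℝ → ℂ :=
  dens μ (fun t => ρ t + z * ρ' t) (fun t => τ t + z * τ' t) (fun t => h t + z * h' t)

namespace Line

theorem one_add_ne (L : Line μ α R ρ τ h ρ' τ' h') (hα0 : 0 < α)
    {t : ℝ} (ht : 0 < t) : ∀ z ∈ Metric.ball (0 : ℂ) R,
    1 + (ρ t + z * ρ' t) ≠ 0 := fun z hz =>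
  (L.data z hz).one_add_ne hα0 (by linarith [datTol_le (μ := μ)]) ht

theorem diff_symb (L : Line μ α R ρ τ h ρ' τ' h') (hα0 : 0 < α)
    {t : ℝ} (ht : 0 < t) :
    DifferentiableOn ℂ (fun z => lineP μ ρ τ ρ' τ' z t) (Metric.ball 0 R) := by
  unfold lineP symb
  exact (differentiableOn_const _).sub (DifferentiableOn.div (by fun_prop) (by fun_prop)
    (L.one_add_ne hα0 ht))

theorem diff_dens (L : Line μ α R ρ τ h ρ' τ' h') (hα0 : 0 < α) (hμ : 0 < μ)
    {t : ℝ} (ht : 0 < t) :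
    DifferentiableOn ℂ (fun z => lineE μ ρ τ h ρ' τ' h' z t) (Metric.ball 0 R) := by
  have h1 := L.diff_symb hα0 ht
  have h2 : DifferentiableOn ℂ (fun z => (Complex.I * t - lineP μ ρ τ ρ' τ' z t)⁻¹)
      (Metric.ball 0 R) := ((differentiableOn_const _).sub h1).inv fun z hz =>
    (L.data z hz).sub_ne hα0 hμ le_rfl ht
  exact (DifferentiableOn.mul (by fun_prop) h2).add ((differentiableOn_const _).mul
    ((h1.sub (differentiableOn_const _)).mul (h2.mul (differentiableOn_const _))))

/-- The closed form of the phase makes its derivative an increment of `ρ'/(1+ρ+zρ')` between `θe^u`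
and `θ`. In particular `τ` has disappeared. -/
theorem hasDerivAt_symP (L : Line μ α R ρ τ h ρ' τ' h') (hα0 : 0 < α)
    (hθ : 0 < θ) (u : ℝ) : ∀ z ∈ Metric.ball (0 : ℂ) R,
    HasDerivAt (fun z => symP (lineP μ ρ τ ρ' τ' z) θ u)
      (ρ' (θ * Real.exp u) / (1 + (ρ (θ * Real.exp u) + z * ρ' (θ * Real.exp u))) -
        ρ' θ / (1 + (ρ θ + z * ρ' θ))) z := by
  intro z hz
  have hlog : ∀ t, 0 < t → HasDerivAt (fun z : ℂ => Complex.log (1 + (ρ t + z * ρ' t)))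
      (ρ' t / (1 + (ρ t + z * ρ' t))) z := fun t ht => by
    have e1 : HasDerivAt (fun z : ℂ => 1 + (ρ t + z * ρ' t)) (ρ' t) z := by
      simpa using (((hasDerivAt_id z).mul_const (ρ' t)).const_add (ρ t)).const_add 1
    exact e1.clog ((L.data z hz).one_add_mem hα0 (by linarith [datTol_le (μ := μ)]) ht)
  have e := ((hlog (θ * Real.exp u) (by positivity)).sub (hlog θ hθ)).const_add
    (Complex.I * ((θ * (Real.exp u - 1) : ℝ) : ℂ) - μ * u)
  refine e.congr_of_eventuallyEq ?_
  filter_upwards [Metric.isOpen_ball.mem_nhds hz] with w hw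
  exact (L.data w hw).symP_eq hα0 le_rfl hθ u

theorem hasDerivAt_kerQ (L : Line μ α R ρ τ h ρ' τ' h') (hα0 : 0 < α)
    (hθ : 0 < θ) (u : ℝ) : ∀ z ∈ Metric.ball (0 : ℂ) R,
    HasDerivAt (fun z => kerQ (lineP μ ρ τ ρ' τ' z) m θ u)
      (kerQ (lineP μ ρ τ ρ' τ' z) m θ u * (((sg u * m : ℝ) : ℂ) *
        (ρ' (θ * Real.exp u) / (1 + (ρ (θ * Real.exp u) + z * ρ' (θ * Real.exp u))) -
        ρ' θ / (1 + (ρ θ + z * ρ' θ))))) z := fun z hz =>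
  ((L.hasDerivAt_symP hα0 hθ u z hz).const_mul _).cexp

theorem diff_ker (L : Line μ α R ρ τ h ρ' τ' h') (hα0 : 0 < α) (hμ : 0 < μ)
    (hθ : 0 < θ) (hm : 0 < m) {u : ℝ} (hu : u ≠ 0) :
    DifferentiableOn ℂ (fun z => ker (lineP μ ρ τ ρ' τ' z) m θ u) (Metric.ball 0 R) := by
  have h1 : DifferentiableOn ℂ (fun z => kerQ (lineP μ ρ τ ρ' τ' z) m θ u) (Metric.ball 0 R) :=
    fun z hz => (L.hasDerivAt_kerQ hα0 hθ u z hz).differentiableAt.differentiableWithinAt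
  exact (differentiableOn_const _).mul (h1.div ((differentiableOn_const _).sub h1) fun z hz =>
    ((L.data z hz).sym hα0 le_rfl).one_sub_kerQ_ne hμ hθ hm hu)

theorem hasDerivAt_kerL (L : Line μ α R ρ τ h ρ' τ' h') (hα0 : 0 < α) (hμ : 0 < μ)
    (hθ : 0 < θ) (hm : 0 < m) {u : ℝ} (hu : u ≠ 0) :
    ∀ z ∈ Metric.ball (0 : ℂ) R, HasDerivAt (fun z => kerL (lineP μ ρ τ ρ' τ' z) m θ u)
      (-(m * (ker (lineP μ ρ τ ρ' τ' z) m θ u *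
        (ρ' (θ * Real.exp u) / (1 + (ρ (θ * Real.exp u) + z * ρ' (θ * Real.exp u))) -
        ρ' θ / (1 + (ρ θ + z * ρ' θ)))))) z := fun z hz => by
  refine (((L.hasDerivAt_kerQ hα0 hθ u z hz).const_sub 1).clog
    (((L.data z hz).sym hα0 le_rfl).one_sub_kerQ_mem hμ hθ hm hu)).congr_deriv ?_
  rw [ker]; push_cast; ring

theorem diff_opJ (L : Line μ α R ρ τ h ρ' τ' h') (hα0 : 0 < α)
    (hα1 : α ≤ 1) (hμ' : 1 / 2 < μ) (hm : Large μ m) (hθ : 0 < θ) :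
    DifferentiableOn ℂ (fun z => opJ μ (lineP μ ρ τ ρ' τ' z) m (lineE μ ρ τ h ρ' τ' h' z) θ)
      (Metric.ball 0 R) := by
  have hμ : 0 < μ := by linarith
  have hm0 := hm.pos hμ
  have hcls : ∀ z ∈ Metric.ball (0 : ℂ) R,
      Cls α 0 0 (conE μ * datTol μ) (lineE μ ρ τ h ρ' τ' h' z) := fun z hz =>
    ((L.data z hz).dens_cls hα0 hμ le_rfl).mono (by linarith) (by linarith) le_rfl
  intro z hz
  refine (hasDerivAt_integral_of_holomorphic (R := R)
    (F := fun z u => hat μ (lineE μ ρ τ h ρ' τ' h' z) θ u *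
      (symZ (lineP μ ρ τ ρ' τ' z) θ u * ker (lineP μ ρ τ ρ' τ' z) m θ u)) hz (fun w hw => ?_)
    (fun w hw u hu => (hcls w hw).opJ_integrand_le hα0 hα1 hμ' hm ((L.data w hw).sym hα0 le_rfl) hθ hu)
    ((integrable_majorant_comp (by linarith) (rate_pos hμ hm0)).const_mul _)
    (fun u hu => ?_)).differentiableAt.differentiableWithinAt
  · exact ((hcls w hw).integrable_opJ hα0 hα1 hμ' hm ((L.data w hw).sym hα0 le_rfl) hθ).1
  · have ht : 0 < θ * Real.exp u := by positivity
    have hh : DifferentiableOn ℂ (fun z => hat μ (lineE μ ρ τ h ρ' τ' h' z) θ u)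
        (Metric.ball 0 R) :=
      ((differentiableOn_const _).mul (L.diff_dens hα0 hμ ht)).sub (L.diff_dens hα0 hμ hθ)
    have hZ : DifferentiableOn ℂ (fun z => symZ (lineP μ ρ τ ρ' τ' z) θ u) (Metric.ball 0 R) :=
      (differentiableOn_const _).sub (L.diff_symb hα0 ht)
    exact hh.mul (hZ.mul (L.diff_ker hα0 hμ hθ hm0 hu))

/-- Differentiating the logarithm restores the singular kernel, but multiplied by an increment that
vanishes at `u = 0`. -/
theorem hasDerivAt_opN (L : Line μ α R ρ τ h ρ' τ' h') (hα0 : 0 < α)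
    {A s e : ℝ} {k : ℝ → ℂ} (hk : Cls α s e A k) (hs : 0 ≤ s) (hs' : s ≤ 20)
    (hμ' : 1 / 2 < μ) (hm : Large μ m) (hθ : 0 < θ) : ∀ z ∈ Metric.ball (0 : ℂ) R,
    HasDerivAt (fun z => opN μ (lineP μ ρ τ ρ' τ' z) m k θ)
      (-m * ∫ u, (Real.exp ((1 - 2 * μ) * u) : ℂ) * k (θ * Real.exp u) *
        (ker (lineP μ ρ τ ρ' τ' z) m θ u *
        (ρ' (θ * Real.exp u) / (1 + (ρ (θ * Real.exp u) + z * ρ' (θ * Real.exp u))) -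
        ρ' θ / (1 + (ρ θ + z * ρ' θ))))) z := by
  have hμ : 0 < μ := by linarith
  have hm0 := hm.pos hμ
  intro z hz
  have hd : ∀ u, u ≠ 0 → ∀ w ∈ Metric.ball (0 : ℂ) R, HasDerivAt
      (fun w => (Real.exp ((1 - 2 * μ) * u) : ℂ) * k (θ * Real.exp u) *
        kerL (lineP μ ρ τ ρ' τ' w) m θ u) _ w := fun u hu w hw =>
    (L.hasDerivAt_kerL hα0 hμ hθ hm0 hu w hw).const_mul _
  refine (hasDerivAt_integral_of_holomorphic (R := R)
    (F := fun w u => (Real.exp ((1 - 2 * μ) * u) : ℂ) * k (θ * Real.exp u) *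
      kerL (lineP μ ρ τ ρ' τ' w) m θ u) hz (fun w hw => ?_)
    (fun w hw u hu => opN_integrand_le (w := A * (1 + θ) ^ (-s)) (K := s)
      (mul_nonneg hk.nonneg (weight_pos hθ).le) hm hμ' hu hs' (hk.bd_exp hs hθ u)
      (((L.data w hw).sym hα0 le_rfl).norm_kerL_le hμ hθ hm0 hu))
    ((integrable_majorant_comp (by norm_num) (rate_pos hμ hm0)).const_mul _)
    (fun u hu w hw => (hd u hu w hw).differentiableAt.differentiableWithinAt)).congr_deriv ?_
  · exact (hk.integrable_opN hs hs' hμ' hm ((L.data w hw).sym hα0 le_rfl) hθ).1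
  · rw [← integral_const_mul]
    refine integral_congr_ae (ae_ne_zero.mono fun u hu => ?_)
    simp only
    rw [(hd u hu z hz).deriv]; ring

end Line

end family

end KadenSpiral
end

/-! ### Lipschitz bound for the rescaled operator. -/

noncomputable section
namespace KadenSpiral

variable {μ α ε D R : ℝ} {ρ τ h ρ' τ' h' : ℝ → ℂ} {m θ : ℝ}

/-- The rescaled integral operator of a perturbation. -/
def opT (μ m : ℝ) (ρ τ h : ℝ → ℂ) (θ : ℝ) : ℂ :=
  opJ μ (symb μ ρ τ) m (fun t => (h t + circ μ) * (Complex.I * t - symb μ ρ τ t)⁻¹) θ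

/-- By the resolvent identity, `1/(it-p) = 1/(it-μ) + (p-μ)/((it-p)(it-μ))`; the part without the
small factors `h` or `p-μ` is split off. -/
theorem opT_eq (H : Data α ε ρ τ h) (hε : ε ≤ datTol μ) (hα0 : 0 < α) (hα1 : α ≤ 1)
    (hμ : 1 / 2 < μ) (hm : Large μ m) (hθ : 0 < θ) :
    opT μ m ρ τ h θ = opJ μ (symb μ ρ τ) m (dens μ ρ τ h) θ +
      circ μ * opJ μ (symb μ ρ τ) m (resMu μ) θ := by
  have hμ0 : 0 < μ := by linarith
  have hp := H.sym hα0 hε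
  have h1 := (H.dens_cls hα0 hμ0 hε).mono (s' := 0) (e' := 0) (by linarith) (by linarith) le_rfl
  have h0 : Cls α 1 2 (conI μ) (resMu μ) := (sym_const (α := α) hμ0).inv_cls hμ0
  have h2 := (h0.const_mul (circ μ)).mono (s' := 0) (e' := 0) zero_le_one zero_le_two le_rfl
  rw [← opJ_const_mul, ← opJ_add h1 h2 hα0 hα1 hμ hm hp hθ]
  refine opJ_congr (fun t ht => ?_) hθ
  have e1 : (symb μ ρ τ t - μ) * ((Complex.I * t - symb μ ρ τ t)⁻¹ * resMu μ t) =
      (Complex.I * t - symb μ ρ τ t)⁻¹ - resMu μ t := by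
    have n1 := H.sub_ne hα0 hμ0 hε ht
    have n2 := resMu_ne hμ0 t
    unfold resMu
    rw [inv_sub_inv n1 n2, div_eq_mul_inv, mul_inv]
    ring
  unfold dens
  rw [e1]; unfold resMu; ring

/-- The derivative of the logarithmic part along a line. -/
theorem Line.integral_eq (L : Line μ α R ρ τ h ρ' τ' h') (H' : Data α D ρ' τ' h')
    (hα0 : 0 < α) (hα1 : α < 1) (hμ : 1 / 2 < μ) {B : ℝ} {k : ℝ → ℂ} (hk : Cls α 1 2 B k)
    (hm : Large μ m) {z : ℂ} (hz : z ∈ Metric.ball (0 : ℂ) R) :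
    EB α (40 * B * conI μ * conT μ α * D / m)
      (fun θ => ∫ u, (Real.exp ((1 - 2 * μ) * u) : ℂ) * k (θ * Real.exp u) *
        (ker (lineP μ ρ τ ρ' τ' z) m θ u *
        (ρ' (θ * Real.exp u) / (1 + (ρ (θ * Real.exp u) + z * ρ' (θ * Real.exp u))) -
        ρ' θ / (1 + (ρ θ + z * ρ' θ))))) := by
  have hμ0 : 0 < μ := by linarith
  have H := L.data z hz
  have ht2 := datTol_le (μ := μ)
  have hp : Sym μ α (lineP μ ρ τ ρ' τ' z) := H.sym hα0 le_rfl
  have hI : Cls α 1 2 (conI μ) (fun t : ℝ => (Complex.I * t - lineP μ ρ τ ρ' τ' z t)⁻¹) :=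
    hp.inv_cls hμ0
  -- Division by `it - p` has two purposes: it makes `∂_u P` appear, so that the integrals are of
  -- type `opJ`, and it improves the decay of `k` from `1` to `2`, which brings `κ` into the class
  -- of the main estimate.
  set κ : ℝ → ℂ := fun t => k t * (Complex.I * t - lineP μ ρ τ ρ' τ' z t)⁻¹ with hκdef
  set l : ℝ → ℂ := fun t => ρ' t * (1 + (ρ t + z * ρ' t))⁻¹ with hldef
  have hκ : Cls α 2 3 (2 * (B * conI μ)) κ :=
    (hk.mul hI zero_le_one (e₁ := 3) (by norm_num) (by norm_num)).mono (by norm_num) le_rfl le_rfl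
  have hl : Cls α α (1 + α) (4 * D) l :=
    (H'.rho.mul (H.inv_cls hα0 (by linarith)) le_rfl (e₁ := 1 + α) (by linarith)
      (by linarith)).mono (by linarith) le_rfl (by linarith)
  have hη : Cls α (1 + α) (2 + α) (2 * (2 * (B * conI μ) * (4 * D))) (fun t => κ t * l t) :=
    (hκ.mul hl hα0.le (e₁ := 2 + α) (by linarith) (by linarith)).mono (by linarith) le_rfl le_rfl
  have hκ' : Cls α (1 + α) (2 + α) (2 * (B * conI μ)) κ :=
    hκ.mono (by linarith) (by linarith) le_rfl
  have b1 := hη.opJ_bound hα0 hα1 hμ hm hp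
  have b2 := (hκ'.opJ_bound hα0 hα1 hμ hm hp).mul_cls
    (hl.mono (s' := 0) (e' := 0) (by linarith) (by linarith) le_rfl) hα0 hα1.le
  -- In `opJ (κ l) - l(θ) opJ κ` the subtracted constants `κ(θ)l(θ)` cancel, leaving
  -- `κ(θe^u)(l(θe^u) - l(θ))` under the integral.
  refine ((b1.sub b2).congr fun θ hθ => ?_).mono (le_of_eq (by ring))
  have i1 := (hη.mono (s' := 0) (e' := 0) (by linarith) (by linarith) le_rfl).integrable_opJ
    hα0 hα1.le hμ hm hp hθ
  have i2 := (hκ'.mono (s' := 0) (e' := 0) (by linarith) (by linarith) le_rfl).integrable_opJ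
    hα0 hα1.le hμ hm hp hθ
  unfold opJ
  rw [← integral_const_mul, ← integral_sub i1 (i2.const_mul _)]
  refine integral_congr_ae (Eventually.of_forall fun u => ?_)
  have hu : 0 < θ * Real.exp u := by positivity
  have hZ : κ (θ * Real.exp u) * symZ (lineP μ ρ τ ρ' τ' z) θ u = k (θ * Real.exp u) := by
    rw [hκdef]
    simp only [symZ]
    have hne : Complex.I * ((θ * Real.exp u : ℝ) : ℂ) -
      lineP μ ρ τ ρ' τ' z (θ * Real.exp u) ≠ 0 := H.sub_ne hα0 hμ0 le_rfl hu
    rw [mul_assoc, inv_mul_cancel₀ hne, mul_one]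
  simp only [hat]
  rw [← hZ]
  simp only [hldef, div_eq_mul_inv]
  ring

/-- Lets the case of zero distance be treated as a limit of positive ones, since the Schwarz
argument needs a finite radius. -/
theorem EB.of_forall_pos {B : ℝ} {J : ℝ → ℂ} (h : ∀ η > 0, EB α (B + η) J) : EB α B J where
  bd θ hθ := by
    have hw : 0 < (1 + θ) ^ (-(1 + α)) := weight_pos hθ
    rw [← div_le_iff₀ hw]
    refine le_of_forall_pos_le_add fun η hη => ?_
    rw [div_le_iff₀ hw]; exact (h η hη).bd θ hθ
  hol θ₂ θ₁ h2 h12 h1 := by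
    have hw : 0 < (1 + θ₂) ^ (-(1 + α)) := weight_pos h2
    have hδ : 0 < (θ₁ - θ₂) ^ α := Real.rpow_pos_of_pos (by linarith) _
    rw [← div_le_iff₀ hδ, ← div_le_iff₀ hw]
    refine le_of_forall_pos_le_add fun η hη => ?_
    rw [div_le_iff₀ hw, div_le_iff₀ hδ]; exact (h η hη).hol θ₂ θ₁ h2 h12 h1

/-- Admissible radius for the Lipschitz estimate. -/
def lipTol (μ : ℝ) : ℝ := datTol μ / 5

theorem lipTol_pos (hμ : 0 < μ) : 0 < lipTol μ := by
  have := datTol_pos hμ; unfold lipTol; linarith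

theorem lipTol_le (hμ : 0 < μ) : lipTol μ ≤ datTol μ := by
  have := datTol_pos hμ; unfold lipTol; linarith

theorem Data.mono (H : Data α ε ρ τ h) (hD : ε ≤ D) : Data α D ρ τ h :=
  ⟨H.rho.mono le_rfl le_rfl hD, H.tau.mono le_rfl le_rfl hD, H.den.mono le_rfl le_rfl hD, H.deriv⟩

theorem Data.sub (H : Data α ε ρ τ h) (H' : Data α D ρ' τ' h') :
    Data α (ε + D) (fun t => ρ t - ρ' t) (fun t => τ t - τ' t) (fun t => h t - h' t) :=
  ⟨H.rho.sub H'.rho, H.tau.sub H'.tau, H.den.sub H'.den, fun t ht =>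
    ((H.deriv t ht).sub (H'.deriv t ht)).congr_deriv (by ring)⟩

/-- The Lipschitz estimate for the rescaled operator. -/
theorem exists_opT_lipschitz (hα0 : 0 < α) (hα1 : α < 1) (hμ : 1 / 2 < μ) :
    ∃ C : ℝ, 0 ≤ C ∧ ∀ m : ℝ, Large μ m → ∀ (ρ₁ τ₁ h₁ ρ₂ τ₂ h₂ : ℝ → ℂ) (D : ℝ),
      Data α (lipTol μ) ρ₁ τ₁ h₁ → Data α (lipTol μ) ρ₂ τ₂ h₂ →
      Data α D (fun t => ρ₁ t - ρ₂ t) (fun t => τ₁ t - τ₂ t) (fun t => h₁ t - h₂ t) →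
      EB α (C * D / m) (fun θ => opT μ m ρ₁ τ₁ h₁ θ - opT μ m ρ₂ τ₂ h₂ θ) := by
  have hμ0 : 0 < μ := by linarith
  obtain ⟨B, hB, hres, hresK, _, _⟩ := exists_res_cls (α := α) hμ0 hα1.le
  have hT := conT_nonneg hμ0 hα0 hα1
  have hE := conE_nonneg hμ0
  have hI := conI_nonneg hμ0
  have hε := lipTol_pos hμ0
  have hdt := datTol_pos hμ0
  set C₁ := 3 * (conT μ α * (conE μ * datTol μ) + 1) / (4 * lipTol μ) with hC₁
  set C₂ := |circ μ| * (40 * B * conI μ * conT μ α) with hC₂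
  refine ⟨C₁ + C₂, by positivity, fun m hm ρ₁ τ₁ h₁ ρ₂ τ₂ h₂ D H₁ H₂ H' => ?_⟩
  have hm0 := hm.pos hμ0
  wlog hpos : 0 < D generalizing D
  · have hD0 : D = 0 := le_antisymm (not_lt.1 hpos) H'.rho.nonneg
    have hC : 0 ≤ C₁ + C₂ := by positivity
    refine EB.of_forall_pos fun η hη => ?_
    refine (this (η * m / (C₁ + C₂ + 1)) (H'.mono (by rw [hD0]; positivity))
      (by positivity)).mono ?_
    rw [hD0, mul_zero, zero_div, zero_add]
    have e1 : (C₁ + C₂) * (η * m / (C₁ + C₂ + 1)) / m = η * ((C₁ + C₂) / (C₁ + C₂ + 1)) := by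
      field_simp
    rw [e1]
    refine mul_le_of_le_one_right hη.le ?_
    rw [div_le_one (by positivity)]; linarith
  -- The two data lie in a ball of radius `lipTol`, so their distance is at most `2 lipTol` by the
  -- triangle inequality.
  wlog hD : D ≤ 2 * lipTol μ generalizing D
  · have hD' := (not_le.1 hD).le
    refine (this (2 * lipTol μ) ((H₁.sub H₂).mono (by linarith)) (by positivity) le_rfl).mono ?_
    have hC : 0 ≤ C₁ + C₂ := by positivity
    gcongr
  -- The largest radius with `lipTol + R D ≤ datTol = 5 lipTol`; it is at least `2`, so the disc
  -- contains both endpoints `0` and `1`.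
  set R := 4 * lipTol μ / D with hR
  have hR1 : 1 < R := by rw [hR, lt_div_iff₀ hpos]; linarith
  have hRD : lipTol μ + R * D ≤ datTol μ := by
    rw [hR, div_mul_cancel₀ _ hpos.ne']; unfold lipTol; linarith
  have L : Line μ α R ρ₂ τ₂ h₂ (fun t => ρ₁ t - ρ₂ t) (fun t => τ₁ t - τ₂ t)
      (fun t => h₁ t - h₂ t) := ⟨fun z hz => H₂.line H' hz hRD⟩
  have z0 : lineP μ ρ₂ τ₂ (fun t => ρ₁ t - ρ₂ t) (fun t => τ₁ t - τ₂ t) 0 = symb μ ρ₂ τ₂ := by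
    unfold lineP; simp
  have z1 : lineP μ ρ₂ τ₂ (fun t => ρ₁ t - ρ₂ t) (fun t => τ₁ t - τ₂ t) 1 = symb μ ρ₁ τ₁ := by
    unfold lineP; simp
  have w0 : lineE μ ρ₂ τ₂ h₂ (fun t => ρ₁ t - ρ₂ t) (fun t => τ₁ t - τ₂ t)
      (fun t => h₁ t - h₂ t) 0 = dens μ ρ₂ τ₂ h₂ := by unfold lineE; simp
  have w1 : lineE μ ρ₂ τ₂ h₂ (fun t => ρ₁ t - ρ₂ t) (fun t => τ₁ t - τ₂ t)
      (fun t => h₁ t - h₂ t) 1 = dens μ ρ₁ τ₁ h₁ := by unfold lineE; simp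
  -- The small densities: a uniform bound `O(1/m)` on the disc of radius `R` gives a difference
  -- `O(1/(mR)) = O(D/m)`. The added `1` keeps the bound positive.
  have key1 := EB.schwarz (B := (conT μ α * (conE μ * datTol μ) + 1) / m)
    (G := fun z => opJ μ (lineP μ ρ₂ τ₂ (fun t => ρ₁ t - ρ₂ t) (fun t => τ₁ t - τ₂ t) z) m
      (lineE μ ρ₂ τ₂ h₂ (fun t => ρ₁ t - ρ₂ t) (fun t => τ₁ t - τ₂ t) (fun t => h₁ t - h₂ t) z))
    hR1 (by positivity)
    (fun z hz => (((L.data z hz).dens_cls hα0 hμ0 le_rfl).opJ_bound hα0 hα1 hμ hm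
      ((L.data z hz).sym hα0 le_rfl)).mono (by gcongr; linarith))
    (fun θ hθ => L.diff_opJ hα0 hα1.le hμ hm hθ)
  -- The density `1/(it-μ)`: the factor `1/m` of the integration by parts cancels the factor `m`
  -- from differentiating the logarithm, and the remaining integral is `O(D/m)`.
  have key2 := EB.mean_value (G := fun z θ => (1 / m : ℝ) * opN μ
    (lineP μ ρ₂ τ₂ (fun t => ρ₁ t - ρ₂ t) (fun t => τ₁ t - τ₂ t) z) m (resK μ) θ) hR1
    (fun z hz => (L.integral_eq H' hα0 hα1 hμ hresK hm hz).const_mul (-1))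
    (fun θ hθ z hz => ((L.hasDerivAt_opN hα0 hresK zero_le_one (by norm_num) hμ hm hθ z
      hz).const_mul ((1 / m : ℝ) : ℂ)).congr_deriv (by
        have hmc : (m : ℂ) ≠ 0 := Complex.ofReal_ne_zero.2 hm0.ne'
        rw [← mul_assoc]; congr 1; push_cast; field_simp))
  refine ((key1.add (key2.const_mul (circ μ))).congr fun θ hθ => ?_).mono (le_of_eq ?_)
  · have p1 := H₁.sym hα0 (lipTol_le hμ0)
    have p2 := H₂.sym hα0 (lipTol_le hμ0)
    simp only [z0, z1, w0, w1]
    rw [opT_eq H₁ (lipTol_le hμ0) hα0 hα1.le hμ hm hθ, opT_eq H₂ (lipTol_le hμ0) hα0 hα1.le hμ hm hθ,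
      opJ_resMu_eq hα0 hα1.le hμ hm p1 hθ, opJ_resMu_eq hα0 hα1.le hμ hm p2 hθ]
    ring
  · rw [Complex.norm_real, Real.norm_eq_abs, norm_neg, norm_one, hR, hC₁, hC₂]
    field_simp

/-- The estimate for the unperturbed operator. -/
theorem exists_opT_zero_bound (hα0 : 0 < α) (hα1 : α ≤ 1) (hμ : 1 / 2 < μ) :
    ∃ C : ℝ, 0 ≤ C ∧ ∀ m : ℝ, Large μ m → EB α (C / m ^ 2) (opT μ m 0 0 0) := by
  obtain ⟨C, hC, h⟩ := exists_opJ_resMu_bound hα0 hα1 hμ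
  refine ⟨|circ μ| * C, by positivity, fun m hm => ?_⟩
  refine (((h m hm).const_mul (circ μ)).congr fun θ hθ => ?_).mono (le_of_eq ?_)
  · have hs : symb μ 0 0 = fun _ => (μ : ℂ) := by funext t; simp [symb]
    unfold opT
    rw [hs, ← opJ_const_mul]
    exact opJ_congr (fun t _ => by simp [resMu]) hθ
  · rw [Complex.norm_real, Real.norm_eq_abs]; ring

end KadenSpiral
end

/-! ### Principal values in the logarithmic variable. -/

noncomputable section
namespace KadenSpiral

variable {μ α ε : ℝ} {p ρ τ h : ℝ → ℂ} {m θ : ℝ}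

/-- Two curves through the origin with the same derivative: dividing both by `x > 0` subtracts the
same real logarithm, and the quotients have the same limit in the slit plane. -/
theorem tendsto_log_sub_log {E₁ E₂ : ℝ → ℂ} {b : ℂ} (hb : b ∈ Complex.slitPlane)
    (h₁ : HasDerivAt E₁ b 0) (h₂ : HasDerivAt E₂ b 0) (z₁ : E₁ 0 = 0) (z₂ : E₂ 0 = 0) :
    Tendsto (fun x => Complex.log (E₁ x) - Complex.log (E₂ x)) (𝓝[>] 0) (𝓝 0) := by
  have hs : ∀ E : ℝ → ℂ, HasDerivAt E b 0 → E 0 = 0 →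
      Tendsto (fun x : ℝ => (x⁻¹ : ℝ) * E x) (𝓝[>] 0) (𝓝 b) := fun E hE hz => by
    simpa [hz] using hE.tendsto_slope_zero_right
  have t₁ := hs E₁ h₁ z₁
  have t₂ := hs E₂ h₂ z₂
  have hne : ∀ᶠ z in 𝓝 b, z ≠ 0 :=
    isOpen_ne.mem_nhds (Complex.slitPlane_ne_zero hb)
  have hc := continuousAt_clog hb
  have := (hc.tendsto.comp t₁).sub (hc.tendsto.comp t₂)
  rw [sub_self] at this
  refine this.congr' ?_
  filter_upwards [t₁.eventually hne, t₂.eventually hne, self_mem_nhdsWithin] with x n₁ n₂ hx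
  have hx : 0 < x⁻¹ := inv_pos.2 hx
  simp only [Function.comp]
  rw [Complex.log_ofReal_mul hx (right_ne_zero_of_mul n₁),
    Complex.log_ofReal_mul hx (right_ne_zero_of_mul n₂)]
  ring

/-- The truncated domain in the logarithmic variable. -/
def cut (θ ε : ℝ) : Set ℝ := {u | ε < θ * |Real.exp u - 1|}

theorem measurableSet_cut (θ ε : ℝ) : MeasurableSet (cut θ ε) :=
  (isOpen_lt (by fun_prop) (by fun_prop)).measurableSet

theorem exists_le_abs_of_mem_cut (hε : 0 < ε) : ∃ δ > 0, ∀ u ∈ cut θ ε, δ ≤ |u| := by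
  have hc : Continuous fun u : ℝ => θ * |Real.exp u - 1| := by fun_prop
  have : ∀ᶠ u in 𝓝 (0 : ℝ), θ * |Real.exp u - 1| < ε :=
    hc.continuousAt.eventually_lt continuousAt_const (by simpa using hε)
  obtain ⟨δ, hδ, H⟩ := Metric.eventually_nhds_iff.1 this
  refine ⟨δ, hδ, fun u hu => not_lt.1 fun hlt => ?_⟩
  exact lt_asymm hu (H (by simpa using hlt))

theorem aecover_cut (hθ : 0 < θ) : AECover volume (𝓝[>] (0 : ℝ)) (cut θ) where
  ae_eventually_mem := by
    filter_upwards [ae_ne_zero] with u hu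
    have : 0 < θ * |Real.exp u - 1| :=
      mul_pos hθ (abs_pos.2 (sub_ne_zero.2 (by simpa using hu)))
    exact nhdsWithin_le_nhds (Iio_mem_nhds this)
  measurableSet := measurableSet_cut θ

theorem image_cut (hθ : 0 < θ) :
    (fun u => θ * Real.exp u) '' cut θ ε = {t | 0 < t ∧ ε < |t - θ|} := by
  have key : ∀ u, |θ * Real.exp u - θ| = θ * |Real.exp u - 1| := fun u => by
    rw [← mul_sub_one, abs_mul, abs_of_pos hθ]
  ext t
  constructor
  · rintro ⟨u, hu, rfl⟩
    exact ⟨by positivity, by rw [key]; exact hu⟩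
  · rintro ⟨ht, h⟩
    have e : θ * Real.exp (Real.log (t / θ)) = t := by
      rw [Real.exp_log (by positivity)]; field_simp
    refine ⟨Real.log (t / θ), ?_, e⟩
    rw [cut, mem_ofPred_eq, ← key, e]; exact h

theorem cut_eq (hθ : 0 < θ) (hε : 0 < ε) (hεθ : ε < θ) :
    cut θ ε = Iio (Real.log (1 - ε / θ)) ∪ Ioi (Real.log (1 + ε / θ)) := by
  have h1 : 0 < ε / θ := by positivity
  have h2 : ε / θ < 1 := (div_lt_one hθ).2 hεθ
  ext u
  rw [cut, mem_ofPred_eq, mul_comm, ← div_lt_iff₀ hθ, lt_abs, mem_union, mem_Iio, mem_Ioi,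
    Real.lt_log_iff_exp_lt (by linarith), Real.log_lt_iff_lt_exp (by linarith)]
  constructor
  · rintro (h | h)
    · right; linarith
    · left; linarith
  · rintro (h | h)
    · right; linarith
    · left; linarith

theorem exp_injOn (hθ : 0 < θ) (s : Set ℝ) : InjOn (fun u => θ * Real.exp u) s :=
  fun _ _ _ _ h => Real.exp_injective (mul_left_cancel₀ hθ.ne' h)

theorem hasDerivAt_mul_exp (θ u : ℝ) :
    HasDerivAt (fun u => θ * Real.exp u) (θ * Real.exp u) u := (Real.hasDerivAt_exp u).const_mul θ

theorem integrableOn_trunc_iff (hθ : 0 < θ) (F : ℝ → ℂ) :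
    IntegrableOn F {t | 0 < t ∧ ε < |t - θ|} ↔
      IntegrableOn (fun u => ((θ * Real.exp u : ℝ) : ℂ) * F (θ * Real.exp u)) (cut θ ε) := by
  rw [← image_cut hθ, integrableOn_image_iff_integrableOn_abs_deriv_smul (measurableSet_cut θ ε)
    (fun u _ => (hasDerivAt_mul_exp θ u).hasDerivWithinAt) (exp_injOn hθ _)]
  refine integrableOn_congr_fun (fun u _ => ?_) (measurableSet_cut θ ε)
  rw [abs_of_pos (by positivity), Complex.real_smul]

theorem truncIntegral_eq (hθ : 0 < θ) (F : ℝ → ℂ) :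
    truncIntegral F θ ε =
      ∫ u in cut θ ε, ((θ * Real.exp u : ℝ) : ℂ) * F (θ * Real.exp u) := by
  rw [truncIntegral, ← image_cut hθ, integral_image_eq_integral_abs_deriv_smul
    (measurableSet_cut θ ε) (fun u _ => (hasDerivAt_mul_exp θ u).hasDerivWithinAt) (exp_injOn hθ _)]
  refine setIntegral_congr_fun (measurableSet_cut θ ε) (fun u _ => ?_)
  rw [abs_of_pos (by positivity), Complex.real_smul]

theorem Sym.integrableOn_symZ_ker (hp : Sym μ α p) (hμ : 0 < μ) (hθ : 0 < θ) (hm : Large μ m)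
    (hε : 0 < ε) : IntegrableOn (fun u => symZ p θ u * ker p m θ u) (cut θ ε) := by
  obtain ⟨δ, hδ, hcut⟩ := exists_le_abs_of_mem_cut (θ := θ) hε
  have hm0 := hm.pos hμ
  have hr := rate_pos hμ hm0
  refine Integrable.mono' ((((integrable_majorant_comp zero_lt_one hr).const_mul
    ((1 + 2 * μ) * (1 + θ) / (2 * (rate μ m * δ)))).integrableOn (s := cut θ ε)))
    ((hp.continuous_symZ hθ).measurable.mul (hp.measurable_ker hθ)).aestronglyMeasurable ?_
  refine (ae_restrict_iff' (measurableSet_cut θ ε)).2 (Eventually.of_forall fun u hu => ?_)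
  have hδu := hcut u hu
  have hu0 : u ≠ 0 := fun h => by rw [h, abs_zero] at hδu; linarith
  have b1 := hp.norm_symZ_le hμ hθ u
  have b2 := hp.norm_ker_le hμ hθ hm0 hu0
  have hex := hm.exp_le (k := 1) (by linarith) u
  have hmaj := exp_le_majorant 0 (rate μ m * u)
  rw [abs_mul, abs_of_pos hr] at hmaj
  have hx : rate μ m * δ ≤ rate μ m * |u| := mul_le_mul_of_nonneg_left hδu hr.le
  have hx0 : 0 < rate μ m * δ := by positivity
  rw [one_mul] at hex
  set x := rate μ m * |u|
  rw [norm_mul]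
  have b3 : Real.exp (-x) / (2 * x) ≤ Real.exp (-x) / (2 * (rate μ m * δ)) := by gcongr
  calc _ ≤ (1 + 2 * μ) * (1 + θ) * Real.exp (x / 2) *
        (Real.exp (-x) / (2 * (rate μ m * δ))) :=
        mul_le_mul (b1.trans (by gcongr)) (b2.trans b3) (norm_nonneg _) (by positivity)
    _ = (1 + 2 * μ) * (1 + θ) / (2 * (rate μ m * δ)) * (Real.exp (x / 2) * Real.exp (-x)) := by
        ring
    _ ≤ _ := by
        rw [← Real.exp_add]
        refine mul_le_mul_of_nonneg_left (le_trans (le_of_eq ?_) hmaj) (by positivity)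
        ring_nf

theorem Sym.norm_kerL_le_exp (hp : Sym μ α p) (hμ : 0 < μ) (hθ : 0 < θ) (hm : Large μ m) {u : ℝ}
    (hu : 1 ≤ |u|) : ‖kerL p m θ u‖ ≤ 2 * Real.exp (-|u|) := by
  have hu0 : u ≠ 0 := fun h => by rw [h, abs_zero] at hu; linarith
  refine (hp.norm_kerL_le hμ hθ (hm.pos hμ) hu0).trans ?_
  have hx : |u| ≤ rate μ m * |u| := le_mul_of_one_le_left (abs_nonneg _) (hm.rate_ge hμ)
  refine mul_le_mul_of_nonneg_left ?_ zero_le_two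
  calc _ ≤ 1 * Real.exp (-|u|) := mul_le_mul
        (Real.rpow_le_one_of_one_le_of_nonpos (by linarith) (by norm_num))
        (Real.exp_le_exp.2 (by linarith)) (Real.exp_pos _).le zero_le_one
    _ = _ := one_mul _

theorem Sym.tendsto_kerL_atTop (hp : Sym μ α p) (hμ : 0 < μ) (hθ : 0 < θ) (hm : Large μ m) :
    Tendsto (kerL p m θ) atTop (𝓝 0) :=
  squeeze_zero_norm' ((eventually_ge_atTop 1).mono fun u hu =>
    hp.norm_kerL_le_exp hμ hθ hm (hu.trans (le_abs_self u)))
    (by simpa using tendsto_exp_neg_abs_atTop.const_mul 2)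

theorem Sym.tendsto_kerL_atBot (hp : Sym μ α p) (hμ : 0 < μ) (hθ : 0 < θ) (hm : Large μ m) :
    Tendsto (kerL p m θ) atBot (𝓝 0) :=
  squeeze_zero_norm' ((eventually_le_atBot (-1)).mono fun u hu =>
    hp.norm_kerL_le_exp hμ hθ hm (by linarith [neg_le_abs u]))
    (by simpa using tendsto_exp_neg_abs_atBot.const_mul 2)

/-- The truncated integral is that of an exact derivative over two half-lines; the logarithmic
kernel vanishes at both infinities, so only the two inner endpoints remain. -/
theorem Sym.integral_symZ_ker_eq (hp : Sym μ α p) (hμ : 0 < μ) (hθ : 0 < θ) (hm : Large μ m)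
    (hε : 0 < ε) (hεθ : ε < θ) :
    ∫ u in cut θ ε, symZ p θ u * ker p m θ u =
      (1 / m : ℂ) * (kerL p m θ (Real.log (1 + ε / θ)) - kerL p m θ (Real.log (1 - ε / θ))) := by
  have h1 : 0 < ε / θ := by positivity
  have h2 : ε / θ < 1 := (div_lt_one hθ).2 hεθ
  have hm0 := hm.pos hμ
  have hmc : (m : ℂ) ≠ 0 := Complex.ofReal_ne_zero.2 hm0.ne'
  have hu1 : 0 < Real.log (1 + ε / θ) := Real.log_pos (by linarith)
  have hu2 : Real.log (1 - ε / θ) < 0 := Real.log_neg (by linarith) (by linarith)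
  have hi := hp.integrableOn_symZ_ker hμ hθ hm hε
  have hd : ∀ u, u ≠ 0 → HasDerivAt (fun u => -(1 / m : ℂ) * kerL p m θ u)
      (symZ p θ u * ker p m θ u) u := fun u hu =>
    ((hp.hasDerivAt_kerL hμ hθ hm0 hu).const_mul _).congr_deriv (by field_simp)
  rw [cut_eq hθ hε hεθ] at hi ⊢
  rw [setIntegral_union (Set.disjoint_left.2 fun x hx hx' => by
    simp only [mem_Iio, mem_Ioi] at hx hx'; linarith) measurableSet_Ioi hi.left_of_union
    hi.right_of_union, ← integral_Iic_eq_integral_Iio,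
    integral_Ioi_of_hasDerivAt_of_tendsto' (m := 0)
      (fun x hx => hd x (ne_of_gt (hu1.trans_le hx))) hi.right_of_union
      (by simpa using (hp.tendsto_kerL_atTop hμ hθ hm).const_mul (-(1 / m : ℂ))),
    integral_Iic_of_hasDerivAt_of_tendsto' (m := 0)
      (fun x hx => hd x (ne_of_lt (lt_of_le_of_lt hx hu2)))
      ((integrableOn_Iic_iff_integrableOn_Iio).2 hi.left_of_union)
      (by simpa using (hp.tendsto_kerL_atBot hμ hθ hm).const_mul (-(1 / m : ℂ)))]
  ring

/-- A truncation symmetric in `t` is not symmetric in `u`, but the endpoints `log(1 ± ε/θ)` agree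
with `±ε/θ` to first order. The values of `1-q` there then have the same first order term, and their
logarithms cancel in the limit. -/
theorem Sym.tendsto_integral_symZ_ker (hp : Sym μ α p) (hμ : 0 < μ) (hθ : 0 < θ)
    (hm : Large μ m) :
    Tendsto (fun ε => ∫ u in cut θ ε, symZ p θ u * ker p m θ u) (𝓝[>] 0) (𝓝 0) := by
  have hm0 := hm.pos hμ
  have hE : ∀ s : ℝ, s * s = 1 → HasDerivAt (fun ε : ℝ =>
      1 - Complex.exp (((s * m : ℝ) : ℂ) * symP p θ (Real.log (1 + s * (ε / θ)))))
      (-((m / θ : ℝ) * symZ p θ 0)) 0 := fun s hs => by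
    have e1 : HasDerivAt (fun ε : ℝ => 1 + s * (ε / θ)) (s * (1 / θ)) 0 :=
      (((hasDerivAt_id (0 : ℝ)).div_const θ).const_mul s).const_add 1
    have e2 := e1.log (by simp)
    have e3 : HasDerivAt (symP p θ) (symZ p θ 0) (Real.log (1 + s * (0 / θ))) := by
      simpa using hp.hasDerivAt_symP hθ 0
    have e4 := ((e3.scomp (0 : ℝ) e2).const_mul ((s * m : ℝ) : ℂ)).cexp.const_sub 1
    refine e4.congr_deriv ?_
    have hsc : (s : ℂ) * s = 1 := by exact_mod_cast hs
    simp only [Function.comp, zero_div, mul_zero, add_zero, Real.log_one, symP_zero,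
      Complex.exp_zero, one_mul, div_one, Complex.real_smul]
    push_cast
    linear_combination (-(m : ℂ) / θ * symZ p θ 0) * hsc
  -- The common derivative has positive real part, because `Re ∂_u P ≤ -μ/2`; hence the logarithm is
  -- continuous there.
  have hb : -((m / θ : ℝ) * symZ p θ 0) ∈ Complex.slitPlane := by
    left
    have := hp.symZ_re_le hθ 0
    rw [Complex.neg_re, Complex.re_ofReal_mul]
    have : 0 < m / θ := by positivity
    nlinarith
  have key := (tendsto_log_sub_log hb (hE 1 (by norm_num)) (hE (-1) (by norm_num))
    (by simp [symP_zero]) (by simp [symP_zero])).const_mul (1 / m : ℂ)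
  rw [mul_zero] at key
  refine key.congr' ?_
  filter_upwards [self_mem_nhdsWithin, nhdsWithin_le_nhds (Iio_mem_nhds hθ)] with ε hε hεθ
  have hε : 0 < ε := hε
  have hεθ : ε < θ := hεθ
  have h1 : 0 < ε / θ := by positivity
  have h2 : ε / θ < 1 := (div_lt_one hθ).2 hεθ
  rw [hp.integral_symZ_ker_eq hμ hθ hm hε hεθ]
  have s1 : sg (Real.log (1 + ε / θ)) = 1 := sg_of_pos (Real.log_pos (by linarith))
  have s2 : sg (Real.log (1 - ε / θ)) = -1 := sg_of_neg (Real.log_neg (by linarith) (by linarith))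
  unfold kerL kerQ
  rw [s1, s2, one_mul (ε / θ), neg_one_mul (ε / θ), ← sub_eq_add_neg]

/-- For `u < 0` the exponential is `1/q`, and `1/(1 - 1/q) = -q/(1-q)`; for `u > 0` it is `q`, and
`1/(1-q) = 1 + q/(1-q)`. -/
theorem Sym.one_div_one_sub_exp (hp : Sym μ α p) (hμ : 0 < μ) (hθ : 0 < θ) (hm : 0 < m) {u : ℝ}
    (hu : u ≠ 0) : 1 / (1 - Complex.exp (m * symP p θ u)) =
      ker p m θ u + if 0 < u then 1 else 0 := by
  have hne := hp.one_sub_kerQ_ne hμ hθ hm hu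
  rcases lt_or_gt_of_ne hu with h | h
  · have hq : Complex.exp (m * symP p θ u) = (kerQ p m θ u)⁻¹ := by
      rw [kerQ, sg_of_neg h, ← Complex.exp_neg]; push_cast; ring_nf
    have hQ : kerQ p m θ u ≠ 0 := Complex.exp_ne_zero _
    rw [hq, ker, sg_of_neg h, if_neg (not_lt.2 h.le)]
    have hne' : kerQ p m θ u - 1 ≠ 0 := fun h => hne (by linear_combination -h)
    have : 1 - (kerQ p m θ u)⁻¹ = (kerQ p m θ u - 1) / kerQ p m θ u := by field_simp
    rw [this, one_div_div]
    push_cast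
    rw [add_zero, neg_one_mul, ← div_neg, neg_sub]
  · have hq : Complex.exp (m * symP p θ u) = kerQ p m θ u := by
      rw [kerQ, sg_of_pos h, one_mul]
    rw [hq, ker, sg_of_pos h, if_pos h]
    push_cast
    field_simp
    ring

/-- Truncations of the singular integral. -/
theorem Cls.tendsto_integral_cut {A : ℝ} {f : ℝ → ℂ} (h : Cls α 0 0 A f) (hα0 : 0 < α)
    (hα1 : α ≤ 1) (hμ : 1 / 2 < μ) (hm : Large μ m) (hp : Sym μ α p) (hθ : 0 < θ) :
    (∀ ε > 0, IntegrableOn (fun u => (Real.exp ((1 - 2 * μ) * u) : ℂ) * f (θ * Real.exp u) *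
      (symZ p θ u * ker p m θ u)) (cut θ ε)) ∧
    Tendsto (fun ε => ∫ u in cut θ ε, (Real.exp ((1 - 2 * μ) * u) : ℂ) * f (θ * Real.exp u) *
      (symZ p θ u * ker p m θ u)) (𝓝[>] 0) (𝓝 (opJ μ p m f θ)) := by
  have hμ0 : 0 < μ := by linarith
  have i1 := h.integrable_opJ hα0 hα1 hμ hm hp hθ
  have e1 : (fun u => (Real.exp ((1 - 2 * μ) * u) : ℂ) * f (θ * Real.exp u) *
      (symZ p θ u * ker p m θ u)) = fun u => hat μ f θ u * (symZ p θ u * ker p m θ u) +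
        f θ * (symZ p θ u * ker p m θ u) := by funext u; unfold hat; ring
  have i2 : ∀ ε > 0, IntegrableOn (fun u => f θ * (symZ p θ u * ker p m θ u)) (cut θ ε) :=
    fun ε hε => (hp.integrableOn_symZ_ker hμ0 hθ hm hε).const_mul _
  rw [e1]
  refine ⟨fun ε hε => i1.integrableOn.add (i2 ε hε), ?_⟩
  have t1 := (aecover_cut hθ).integral_tendsto_of_countably_generated i1
  have t2 := (hp.tendsto_integral_symZ_ker hμ0 hθ hm).const_mul (f θ)
  have t3 := t1.add t2
  rw [mul_zero, add_zero] at t3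
  refine t3.congr' ?_
  filter_upwards [self_mem_nhdsWithin] with ε hε
  rw [integral_add i1.integrableOn (i2 ε hε), integral_const_mul]

end KadenSpiral
end

/-! ### Identification of the original operator with the rescaled one. -/

noncomputable section
namespace KadenSpiral

variable {μ α ε θ : ℝ} {τ : ℝ → ℂ} {r γ : ℝ → ℝ} {m : ℕ}

theorem deriv_γ₀ {t : ℝ} (ht : 0 < t) : deriv (γ₀ μ) t = circ μ * t ^ (-(2 * μ)) := by
  have h := (Real.hasDerivAt_rpow_const (p := 1 - 2 * μ) (Or.inl ht.ne')).const_mul (-2 * Real.pi)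
  have h' : HasDerivAt (γ₀ μ) _ t := h
  rw [h'.deriv, circ, show 1 - 2 * μ - 1 = -(2 * μ) by ring]
  ring

theorem deriv_add_deriv_γ₀ {t : ℝ} (ht : 0 < t) : deriv γ t + deriv (γ₀ μ) t =
    t ^ (-(2 * μ)) * (t ^ (2 * μ) * deriv γ t + circ μ) := by
  have h : t ^ (-(2 * μ)) * t ^ (2 * μ) = 1 := by rw [← Real.rpow_add ht]; simp
  rw [deriv_γ₀ ht]
  linear_combination (-deriv γ t) * h

theorem add_r₀ {t : ℝ} (ht : 0 < t) : r t + r₀ μ t = t ^ (-μ) * (1 + t ^ μ * r t) := by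
  have h : t ^ (-μ) * t ^ μ = 1 := by rw [← Real.rpow_add ht]; simp
  rw [r₀]
  linear_combination (-r t) * h

theorem rpow_mul_exp (hθ : 0 < θ) (s u : ℝ) :
    (θ * Real.exp u) ^ s = θ ^ s * Real.exp (s * u) := by
  rw [Real.mul_rpow hθ.le (Real.exp_pos u).le, ← Real.exp_mul, mul_comm u]

variable {h : ℝ → ℂ}

/-- Exponentiating the closed form of the phase: the logarithms give the ratio of `1+ρ`, and
`e^{-μu}` is the ratio of the unperturbed radii. -/
theorem Data.exp_symP (H : Data α ε (fun t => ((t ^ μ * r t : ℝ) : ℂ)) τ h) (hα0 : 0 < α)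
    (hε : ε ≤ datTol μ) (hθ : 0 < θ) (u : ℝ) :
    Complex.exp (m * symP (symb μ (fun t => ((t ^ μ * r t : ℝ) : ℂ)) τ) θ u) =
      (((r (θ * Real.exp u) + r₀ μ (θ * Real.exp u)) / (r θ + r₀ μ θ) : ℝ) : ℂ) ^ m *
      Complex.exp (Complex.I * (m : ℂ) * ((θ * Real.exp u - θ : ℝ) : ℂ)) := by
  have h2 := datTol_le (μ := μ)
  have hu : 0 < θ * Real.exp u := by positivity
  have n1 := H.one_add_ne hα0 (by linarith) hu
  have n2 := H.one_add_ne hα0 (by linarith) hθ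
  have hθμ : (θ ^ (-μ) : ℝ) ≠ 0 := (Real.rpow_pos_of_pos hθ _).ne'
  have e1 : Complex.exp (symP (symb μ (fun t => ((t ^ μ * r t : ℝ) : ℂ)) τ) θ u) =
      (((r (θ * Real.exp u) + r₀ μ (θ * Real.exp u)) / (r θ + r₀ μ θ) : ℝ) : ℂ) *
      Complex.exp (Complex.I * ((θ * Real.exp u - θ : ℝ) : ℂ)) := by
    rw [H.symP_eq hα0 hε hθ, Complex.exp_add, Complex.exp_sub, Complex.exp_sub,
      Complex.exp_log n1, Complex.exp_log n2, add_r₀ hu, add_r₀ hθ, rpow_mul_exp hθ (-μ)]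
    have e2 : ((θ ^ (-μ) * Real.exp (-μ * u) * (1 + (θ * Real.exp u) ^ μ * r (θ * Real.exp u)) /
        (θ ^ (-μ) * (1 + θ ^ μ * r θ)) : ℝ) : ℂ) = Complex.exp (-(μ * u)) *
        ((1 + (((θ * Real.exp u) ^ μ * r (θ * Real.exp u) : ℝ) : ℂ)) /
          (1 + ((θ ^ μ * r θ : ℝ) : ℂ))) := by
      rw [mul_assoc, mul_div_mul_left _ _ hθμ]
      push_cast
      rw [neg_mul]; ring
    rw [e2, Complex.exp_neg, mul_sub_one, div_eq_mul_inv (Complex.exp _) (Complex.exp _)]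
    ring
  rw [Complex.exp_nat_mul, e1, mul_pow, ← Complex.exp_nat_mul]
  ring_nf

/-- The principal value integral in terms of the rescaled operator. -/
theorem iDefinedAt_and_eq (H : Data α ε (fun t => ((t ^ μ * r t : ℝ) : ℂ)) τ
      (fun t => ((t ^ (2 * μ) * deriv γ t : ℝ) : ℂ))) (hα0 : 0 < α) (hα1 : α ≤ 1)
    (hμ : 1 / 2 < μ) (hε : ε ≤ datTol μ) (hm : Large μ m) (hθ : 0 < θ) :
    IDefinedAt μ m r γ θ ∧ I μ m r γ θ = 1 / (2 * (Real.pi : ℂ) * Complex.I) *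
      ((θ ^ (1 - 2 * μ) : ℝ) * opT μ m (fun t => ((t ^ μ * r t : ℝ) : ℂ)) τ
        (fun t => ((t ^ (2 * μ) * deriv γ t : ℝ) : ℂ)) θ) := by
  have hμ0 : 0 < μ := by linarith
  have hm0 := hm.pos hμ0
  have hp := H.sym hα0 hε
  set ρ : ℝ → ℂ := fun t => ((t ^ μ * r t : ℝ) : ℂ) with hρ
  set k : ℝ → ℂ := fun t => ((t ^ (2 * μ) * deriv γ t : ℝ) : ℂ) with hk
  set p := symb μ ρ τ with hpdef
  set w : ℝ → ℝ := fun t => deriv γ t + deriv (γ₀ μ) t with hw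
  have hkc : Cls α 0 0 (ε + ‖(circ μ : ℂ)‖) (fun t => k t + circ μ) :=
    (H.den.mono hα0.le (by linarith) le_rfl).add (Cls.const _)
  have hψ : Cls α 0 0 _ (fun t => (k t + circ μ) * (Complex.I * t - p t)⁻¹) :=
    (hkc.mul (hp.inv_cls hμ0) zero_le_one (e₁ := 0) (by norm_num) (by norm_num)).mono
      (by norm_num) le_rfl le_rfl
  obtain ⟨hint, hlim⟩ := hψ.tendsto_integral_cut hα0 hα1 hμ hm hp hθ
  set N : ℝ → ℂ := fun u => (Real.exp ((1 - 2 * μ) * u) : ℂ) *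
    ((k (θ * Real.exp u) + circ μ) * (Complex.I * (θ * Real.exp u : ℝ) - p (θ * Real.exp u))⁻¹) *
      (symZ p θ u * ker p m θ u) with hN
  have hwI : IntegrableOn w (Ioi θ) := by
    have hc : ContinuousOn (fun t : ℝ => t ^ (2 * μ) * deriv γ t + circ μ) (Ioi θ) := by
      have := (Complex.continuous_re.comp_continuousOn hkc.cont).mono (Ioi_subset_Ioi hθ.le)
      refine this.congr fun t _ => ?_
      simp [hk]
    have hb := (integrableOn_Ioi_rpow_of_lt (a := -(2 * μ)) (by linarith) hθ).const_mul
      (ε + ‖(circ μ : ℂ)‖)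
    refine Integrable.mono' hb ?_ ?_
    · have hc2 : ContinuousOn (fun t : ℝ => t ^ (-(2 * μ)) *
          (t ^ (2 * μ) * deriv γ t + circ μ)) (Ioi θ) := ContinuousOn.mul (fun t ht =>
        (Real.continuousAt_rpow_const _ _ (Or.inl (hθ.trans ht).ne')).continuousWithinAt) hc
      exact (hc2.congr fun t ht => deriv_add_deriv_γ₀ (hθ.trans ht)).aestronglyMeasurable
        measurableSet_Ioi
    · refine (ae_restrict_iff' measurableSet_Ioi).2 (Eventually.of_forall fun t ht => ?_)
      have ht0 : 0 < t := hθ.trans ht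
      have := hkc.bd t ht0
      rw [neg_zero, Real.rpow_zero, mul_one, hk, ← Complex.ofReal_add, Complex.norm_real] at this
      simp only [hw]
      rw [deriv_add_deriv_γ₀ ht0, norm_mul, Real.norm_of_nonneg (Real.rpow_nonneg ht0.le _), mul_comm]
      exact mul_le_mul_of_nonneg_right this (Real.rpow_nonneg ht0.le _)
  -- The integrand on `t > θ` that reproduces `∫_θ^∞`. Its subtraction from the Cauchy integrand
  -- leaves exactly the part carried by `ker`.
  set W : ℝ → ℂ := (Ioi θ).indicator fun t => (w t : ℂ) with hW
  have hWI : Integrable W := (integrable_indicator_iff measurableSet_Ioi).2 hwI.ofReal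
  set F := cauchyIntegrand μ m r γ θ with hF
  have hFN : ∀ u, u ≠ 0 → ((θ * Real.exp u : ℝ) : ℂ) * (F (θ * Real.exp u) - W (θ * Real.exp u)) =
      (θ ^ (1 - 2 * μ) : ℝ) * N u := fun u hu => by
    have ht : 0 < θ * Real.exp u := by positivity
    have hne : Complex.I * ((θ * Real.exp u : ℝ) : ℂ) - p (θ * Real.exp u) ≠ 0 :=
      H.sub_ne hα0 hμ0 hε ht
    have e1 : F (θ * Real.exp u) = (w (θ * Real.exp u) : ℂ) * (ker p m θ u +
        if 0 < u then 1 else 0) := by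
      rw [← hp.one_div_one_sub_exp hμ0 hθ hm0 hu, Complex.ofReal_natCast,
        H.exp_symP hα0 hε hθ, mul_one_div]
      rfl
    have e2 : W (θ * Real.exp u) = (w (θ * Real.exp u) : ℂ) * if 0 < u then 1 else 0 := by
      have : θ * Real.exp u ∈ Ioi θ ↔ 0 < u := by
        rw [mem_Ioi, lt_mul_iff_one_lt_right hθ, Real.one_lt_exp_iff]
      simp only [hW, indicator, this]
      split_ifs <;> simp
    have e3 : (θ * Real.exp u) * w (θ * Real.exp u) = θ ^ (1 - 2 * μ) *
        (Real.exp ((1 - 2 * μ) * u) * ((θ * Real.exp u) ^ (2 * μ) * deriv γ (θ * Real.exp u) +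
          circ μ)) := by
      simp only [hw]
      rw [deriv_add_deriv_γ₀ ht, ← mul_assoc, ← mul_assoc, ← rpow_mul_exp hθ,
        ← Real.rpow_one_add' ht.le (by linarith), ← sub_eq_add_neg]
    have e4 := congrArg (fun x : ℝ => (x : ℂ)) e3
    simp only [Complex.ofReal_mul (θ * Real.exp u) (w _), Complex.ofReal_mul (θ ^ (1 - 2 * μ)),
      Complex.ofReal_mul (Real.exp ((1 - 2 * μ) * u)), Complex.ofReal_add] at e4
    rw [e1, e2, ← mul_sub, add_sub_cancel_right, ← mul_assoc, e4]
    simp only [hN, symZ]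
    have e5 : ∀ a b : ℂ, a * (b * (Complex.I * ((θ * Real.exp u : ℝ) : ℂ) - p (θ * Real.exp u))⁻¹) *
        ((Complex.I * ((θ * Real.exp u : ℝ) : ℂ) - p (θ * Real.exp u)) * ker p m θ u) =
        a * b * ker p m θ u := fun a b => by
      field_simp
    rw [e5]
    ring
  have hcutne : ∀ δ > 0, ∀ u ∈ cut θ δ, u ≠ 0 := fun δ hδ u hu h => by
    rw [h, cut, mem_ofPred_eq] at hu
    simp at hu; linarith
  have hNI : ∀ δ > 0, IntegrableOn (fun t => F t - W t) {t : ℝ | 0 < t ∧ δ < |t - θ|} :=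
    fun δ hδ => by
      rw [integrableOn_trunc_iff hθ]
      have hi : IntegrableOn (fun u => ((θ ^ (1 - 2 * μ) : ℝ) : ℂ) * N u) (cut θ δ) :=
        (hint δ hδ).const_mul _
      exact hi.congr_fun (fun u hu => (hFN u (hcutne δ hδ u hu)).symm) (measurableSet_cut θ δ)
  have hFI : ∀ δ > 0, IntegrableOn F {t : ℝ | 0 < t ∧ δ < |t - θ|} := fun δ hδ =>
    ((hNI δ hδ).add hWI.integrableOn).congr (Eventually.of_forall fun t => by simp)
  -- The truncations are enlarged by the negative half-line, where `W` vanishes, so as to exhaust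
  -- almost all of the real line.
  have hcov : AECover volume (𝓝[>] (0 : ℝ)) (fun δ : ℝ => {t : ℝ | 0 < t → δ < |t - θ|}) := by
    refine ⟨?_, fun δ => ?_⟩
    · have : ∀ᵐ t : ℝ, t ≠ θ := by simp [ae_iff]
      filter_upwards [this] with t ht
      filter_upwards [nhdsWithin_le_nhds (Iio_mem_nhds (abs_pos.2 (sub_ne_zero.2 ht)))] with δ hδ _
      exact hδ
    · have : {t : ℝ | 0 < t → δ < |t - θ|} = Iic 0 ∪ {t | δ < |t - θ|} := by
        ext t; simp only [mem_ofPred_eq, mem_union, mem_Iic, ← not_lt, imp_iff_not_or]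
      rw [this]
      exact measurableSet_Iic.union (isOpen_lt (by fun_prop) (by fun_prop)).measurableSet
  have hlimW : Tendsto (fun δ => truncIntegral W θ δ) (𝓝[>] 0)
      (𝓝 ((∫ t in Ioi θ, w t : ℝ) : ℂ)) := by
    have t1 := hcov.integral_tendsto_of_countably_generated hWI
    rw [hW, integral_indicator measurableSet_Ioi, integral_complex_ofReal] at t1
    refine t1.congr fun δ => ?_
    have hms : MeasurableSet {t : ℝ | 0 < t ∧ δ < |t - θ|} :=
      measurableSet_Ioi.inter (isOpen_lt (f := fun _ : ℝ => δ) (g := fun t : ℝ => |t - θ|)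
        (by fun_prop) (by fun_prop)).measurableSet
    rw [truncIntegral, ← integral_indicator (hcov.measurableSet δ), ← integral_indicator hms]
    refine integral_congr_ae (Eventually.of_forall fun t => ?_)
    by_cases ht : 0 < t
    · simp [indicator, ht, hW]
    · have : t ∉ Ioi θ := fun h => ht (hθ.trans h)
      simp [indicator, ht, this]
  have hlimF : Tendsto (truncIntegral F θ) (𝓝[>] 0)
      (𝓝 ((θ ^ (1 - 2 * μ) : ℝ) * opT μ m ρ τ k θ + ((∫ t in Ioi θ, w t : ℝ) : ℂ))) := by
    refine ((hlim.const_mul ((θ ^ (1 - 2 * μ) : ℝ) : ℂ)).add hlimW).congr' ?_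
    filter_upwards [self_mem_nhdsWithin] with δ hδ
    have e1 : truncIntegral F θ δ = truncIntegral (fun t => F t - W t) θ δ +
        truncIntegral W θ δ := by
      unfold truncIntegral
      rw [← integral_add (hNI δ hδ) hWI.integrableOn]
      simp
    rw [e1, truncIntegral_eq hθ (fun t => F t - W t), ← integral_const_mul]
    congr 1
    exact setIntegral_congr_fun (measurableSet_cut θ δ)
      fun u hu => (hFN u (hcutne δ hδ u hu)).symm
  refine ⟨⟨⟨hFI, _, hlimF⟩, hwI⟩, ?_⟩
  rw [I, pvIntegral, hlimF.limUnder_eq]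
  congr 1
  exact add_sub_cancel_right _ _

end KadenSpiral
end

/-! ### Translation between the norms of `X`, `Y` and the weighted classes. -/

noncomputable section
namespace KadenSpiral

variable {μ α k N B D : ℝ} {f : ℝ → ℝ}

theorem bracket_le {t : ℝ} (ht : 0 < t) : bracket t ≤ 1 + t := by
  unfold bracket
  rw [Real.sqrt_le_left (by linarith)]
  nlinarith

theorem le_bracket {t : ℝ} (ht : 0 < t) : (1 + t) / 2 ≤ bracket t := by
  unfold bracket
  refine Real.le_sqrt_of_sq_le ?_
  nlinarith [sq_nonneg (t - 1)]

theorem bracket_pos (t : ℝ) : 0 < bracket t := Real.sqrt_pos.2 (by positivity)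

theorem two_rpow_le {a : ℝ} (ha : a ≤ 2) : (2 : ℝ) ^ a ≤ 4 := by
  have := Real.rpow_le_rpow_of_exponent_le one_le_two ha
  norm_num at this ⊢
  exact this

/-- Comparability of the bracket with `1+t`, up to a factor two, raised to a power of at most two;
hence the constant `4`. -/
theorem le_of_bracket_mul_le {a t t' x : ℝ} (ha : 0 ≤ a) (ha2 : a ≤ 2) (ht' : 0 < t')
    (htt : t' ≤ t) (hN : 0 ≤ N) (h : bracket t ^ a * x ≤ N) :
    x ≤ 4 * N * (1 + t') ^ (-a) := by
  have ht := ht'.trans_le htt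
  have h1 : 0 < bracket t ^ a := Real.rpow_pos_of_pos (bracket_pos t) _
  have h2 : ((1 + t') / 2) ^ a ≤ bracket t ^ a :=
    Real.rpow_le_rpow (by positivity) (le_trans (by linarith) (le_bracket ht)) ha
  have h3 := two_rpow_le ha2
  rw [Real.div_rpow (by linarith) zero_le_two, div_le_iff₀ (by positivity)] at h2
  have h4 : 0 < (1 + t') ^ a := weight_pos ht'
  have h5 : x ≤ N / bracket t ^ a := (le_div_iff₀ h1).2 (by linarith)
  refine h5.trans ?_
  rw [Real.rpow_neg (by linarith), ← div_eq_mul_inv, div_le_div_iff₀ h1 h4]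
  have h6 : (1 + t') ^ a ≤ bracket t ^ a * 4 :=
    h2.trans (mul_le_mul_of_nonneg_left h3 h1.le)
  nlinarith

theorem abs_le_of_normG_le (hα0 : 0 ≤ α) (hα1 : α ≤ 1) (hN : 0 ≤ N)
    (h : normG α k f ≤ ENNReal.ofReal N) {t : ℝ} (ht : 0 < t) :
    |f t| ≤ 4 * N * (1 + t) ^ (-α) := by
  refine le_of_bracket_mul_le hα0 (by linarith) ht le_rfl hN ?_
  have h1 : ENNReal.ofReal |bracket t ^ α * f t| ≤ ENNReal.ofReal N :=
    (le_iSup₂_of_le (f := fun θ (_ : θ ∈ Ioi (0 : ℝ)) => ENNReal.ofReal |bracket θ ^ α * f θ|)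
      t ht le_rfl).trans (le_self_add.trans h)
  rw [ENNReal.ofReal_le_ofReal_iff hN, abs_mul,
    abs_of_pos (Real.rpow_pos_of_pos (bracket_pos t) _)] at h1
  exact h1

theorem abs_sub_le_of_normG_le (hα0 : 0 ≤ α) (hk0 : 0 ≤ k) (hk : k + α ≤ 2) (hN : 0 ≤ N)
    (h : normG α k f ≤ ENNReal.ofReal N) {t' t : ℝ} (ht' : 0 < t') (hlt : t' < t)
    (h1 : t < t' + 1) : |f t - f t'| ≤ 4 * N * (1 + t') ^ (-(k + α)) * (t - t') ^ α := by
  have hd : 0 < (t - t') ^ α := Real.rpow_pos_of_pos (by linarith) _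
  rw [← div_le_iff₀ hd]
  refine le_of_bracket_mul_le (by linarith) hk ht' hlt.le hN ?_
  have h2 : ENNReal.ofReal (bracket t ^ (k + α) * (|f t - f t'| / |t - t'| ^ α)) ≤
      ENNReal.ofReal N :=
    (le_iSup₂_of_le (f := fun (p : ℝ × ℝ)
      (_ : p ∈ {p : ℝ × ℝ | 0 < p.2 ∧ p.2 < p.1 ∧ p.1 < p.2 + 1}) =>
      ENNReal.ofReal (bracket p.1 ^ (k + α) * (|f p.1 - f p.2| / |p.1 - p.2| ^ α)))
      (t, t') ⟨ht', hlt, h1⟩ le_rfl).trans (le_add_self.trans h)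
  rwa [ENNReal.ofReal_le_ofReal_iff hN, abs_of_pos (by linarith : 0 < t - t')] at h2

/-- Unit scale oscillation bounds propagate linearly. -/
theorem abs_sub_le_nat_mul {t' : ℝ} (hB : ∀ s t, t' ≤ s → s < t → t < s + 1 → |f t - f s| ≤ B)
    (n : ℕ) : ∀ t, t' < t → t - t' < n → |f t - f t'| ≤ n * B := by
  induction n with
  | zero => intro t h1 h2; simp at h2; linarith
  | succ n ih =>
    intro t h1 h2
    have hB0 : 0 ≤ B := (abs_nonneg _).trans
      (hB t' (t' + 1 / 2) le_rfl (by linarith) (by linarith))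
    rcases lt_or_ge (t - t') 1 with h | h
    · refine (hB t' t le_rfl h1 (by linarith)).trans ?_
      push_cast
      nlinarith [(Nat.cast_nonneg n : (0 : ℝ) ≤ n)]
    · have hn : 0 < n := by
        rcases Nat.eq_zero_or_pos n with h0 | h0
        · rw [h0] at h2; norm_num at h2; linarith
        · exact h0
      have hn' : (0 : ℝ) < n := Nat.cast_pos.2 hn
      push_cast at h2
      have hstep : (t - t') / (n + 1) < 1 := (div_lt_one (by linarith)).2 h2
      have hstep0 : 0 < (t - t') / (n + 1) := div_pos (by linarith) (by linarith)
      have e1 : t - t' = (t - t') / (n + 1) * n + (t - t') / (n + 1) := by field_simp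
      have hp : 0 < (t - t') / (n + 1) * n := by positivity
      set s := t - (t - t') / (n + 1) with hs
      have b1 := ih s (by linarith) (by
        have : (t - t') / (n + 1) * n < 1 * n := mul_lt_mul_of_pos_right hstep hn'
        linarith)
      have b2 := hB s t (by linarith) (by linarith) (by linarith)
      have := abs_sub_le (f t) (f s) (f t')
      push_cast
      linarith

/-- The norm controls increments below unit length only. Longer ones are reached by a chain of
`⌊t-t'⌋+1 ≤ 2(t-t')` short steps, which gives the linear part of the modulus and doubles the
constant to `8`. -/
theorem cls_of_normG_le (hα0 : 0 < α) (hα1 : α < 1) (hk0 : 0 ≤ k) (hk1 : k ≤ 1)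
    (hf : ContinuousOn f (Ioi 0)) (hN : 0 ≤ N) (h : normG α k f ≤ ENNReal.ofReal N) :
    Cls α α (k + α) (8 * N) (fun t => (f t : ℂ)) where
  cont := Complex.continuous_ofReal.comp_continuousOn hf
  bd t ht := by
    have hw := weight_pos (s := -α) ht
    rw [Complex.norm_real, Real.norm_eq_abs]
    refine (abs_le_of_normG_le hα0.le hα1.le hN h ht).trans ?_
    have := mul_nonneg hN hw.le
    nlinarith
  hol t' t ht' hlt := by
    rw [← Complex.ofReal_sub, Complex.norm_real, Real.norm_eq_abs]
    have hw := weight_pos (s := -(k + α)) ht'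
    have hNw := mul_nonneg hN hw.le
    have hd : 0 < t - t' := by linarith
    have hda := Real.rpow_nonneg hd.le α
    have hloc : ∀ s t, t' ≤ s → s < t → t < s + 1 →
        |f t - f s| ≤ 4 * N * (1 + t') ^ (-(k + α)) * (t - s) ^ α := fun s t h1 h2 h3 => by
      refine (abs_sub_le_of_normG_le hα0.le hk0 (by linarith) hN h (ht'.trans_le h1) h2 h3).trans ?_
      refine mul_le_mul_of_nonneg_right (mul_le_mul_of_nonneg_left
        (weight_anti (by linarith) ht' h1) (by positivity)) (Real.rpow_nonneg (by linarith) _)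
    rcases lt_or_ge (t - t') 1 with h1 | h1
    · refine (hloc t' t le_rfl hlt (by linarith)).trans ?_
      nlinarith [mul_nonneg hNw hd.le, mul_nonneg hNw hda]
    · have hunit : ∀ s t, t' ≤ s → s < t → t < s + 1 → |f t - f s| ≤
          4 * N * (1 + t') ^ (-(k + α)) := fun s t h1 h2 h3 =>
        (hloc s t h1 h2 h3).trans (mul_le_of_le_one_right (by positivity)
          (Real.rpow_le_one (by linarith) (by linarith) hα0.le))
      have h2 := abs_sub_le_nat_mul hunit (⌊t - t'⌋₊ + 1) t hlt
        (by push_cast; exact Nat.lt_floor_add_one _)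
      refine h2.trans ?_
      have h3 := Nat.floor_le hd.le
      push_cast
      have h4 : (⌊t - t'⌋₊ : ℝ) + 1 ≤ 2 * (t - t') := by linarith
      have := mul_le_mul_of_nonneg_right h4 (by positivity : 0 ≤ 4 * N * (1 + t') ^ (-(k + α)))
      nlinarith [mul_nonneg hNw hda]

/-- The rescaled radius. -/
def rhoOf (μ : ℝ) (r : ℝ → ℝ) (t : ℝ) : ℂ := ((t ^ μ * r t : ℝ) : ℂ)

/-- The logarithmic derivative of the rescaled radius. -/
def tauOf (μ : ℝ) (r : ℝ → ℝ) (t : ℝ) : ℂ :=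
  μ * ((t ^ μ * r t : ℝ) : ℂ) + ((t ^ (μ + 1) * deriv r t : ℝ) : ℂ)

/-- The rescaled circulation density. -/
def denOf (μ : ℝ) (γ : ℝ → ℝ) (t : ℝ) : ℂ := ((t ^ (2 * μ) * deriv γ t : ℝ) : ℂ)

theorem hasDerivAt_rhoOf {r : ℝ → ℝ} {t : ℝ} (ht : 0 < t) (hr : DifferentiableAt ℝ r t) :
    HasDerivAt (rhoOf μ r) (tauOf μ r t / t) t := by
  have h := ((Real.hasDerivAt_rpow_const (p := μ) (Or.inl ht.ne')).mul hr.hasDerivAt).ofReal_comp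
  refine h.congr_deriv ?_
  have htc : (t : ℂ) ≠ 0 := Complex.ofReal_ne_zero.2 ht.ne'
  rw [tauOf, Real.rpow_add_one ht.ne', Real.rpow_sub_one ht.ne']
  push_cast
  field_simp

/-- Here `τ = tρ' = μ θ^μ r + θ^{μ+1} r'`. Since `θ^{μ+1} r'` is only in `𝒢^0`, the Hölder weight of
`τ` is `α`; the two terms together give the factor `1+μ`. -/
theorem data_of_normX_le {r γ : ℝ → ℝ} (hα0 : 0 < α) (hα1 : α < 1) (hμ : 0 < μ) (hD : 0 ≤ D)
    (hr : DifferentiableOn ℝ r (Ioi 0))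
    (hr' : ContinuousOn (fun θ => θ ^ (μ + 1) * deriv r θ) (Ioi 0))
    (hγ' : ContinuousOn (fun θ => θ ^ (2 * μ) * deriv γ θ) (Ioi 0))
    (h : normX μ α r γ ≤ ENNReal.ofReal D) :
    Data α (8 * (1 + μ) * D) (rhoOf μ r) (tauOf μ r) (denOf μ γ) := by
  have hc : ContinuousOn (fun θ => θ ^ μ * r θ) (Ioi 0) := ContinuousOn.mul (fun t ht =>
    (Real.continuousAt_rpow_const _ _ (Or.inl (ne_of_gt ht))).continuousWithinAt) hr.continuousOn
  have c1 := cls_of_normG_le hα0 hα1 zero_le_one le_rfl hc hD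
    ((le_self_add.trans le_self_add).trans h)
  have c2 := cls_of_normG_le hα0 hα1 le_rfl zero_le_one hr' hD
    ((le_add_self.trans le_self_add).trans h)
  have c3 := cls_of_normG_le hα0 hα1 zero_le_one le_rfl hγ' hD
    ((le_add_self.trans le_add_self).trans h)
  have hle : 8 * D ≤ 8 * (1 + μ) * D := by nlinarith [mul_nonneg hμ.le hD]
  refine ⟨c1.mono le_rfl le_rfl hle, ?_, c3.mono le_rfl le_rfl hle, fun t ht =>
    hasDerivAt_rhoOf ht (hr.differentiableAt (Ioi_mem_nhds ht))⟩
  refine (((c1.const_mul (μ : ℂ)).mono (s' := α) (e' := α) le_rfl (by linarith) le_rfl).add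
    (c2.mono le_rfl (by linarith) le_rfl)).mono le_rfl le_rfl ?_
  rw [Complex.norm_real, Real.norm_of_nonneg hμ.le]
  exact le_of_eq (by ring)

theorem MemX.data {r γ : ℝ → ℝ} (H : MemX μ α r γ) (hα0 : 0 < α) (hα1 : α < 1) (hμ : 0 < μ)
    (hD : 0 ≤ D) (h : normX μ α r γ ≤ ENNReal.ofReal D) :
    Data α (8 * (1 + μ) * D) (rhoOf μ r) (tauOf μ r) (denOf μ γ) :=
  data_of_normX_le hα0 hα1 hμ hD H.diff_r H.mem_deriv_r.1 H.mem_deriv_γ.1 h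

theorem Data.congr {ε : ℝ} {ρ τ h ρ' τ' h' : ℝ → ℂ} (H : Data α ε ρ τ h)
    (e₁ : ∀ t, 0 < t → ρ' t = ρ t) (e₂ : ∀ t, 0 < t → τ' t = τ t) (e₃ : ∀ t, 0 < t → h' t = h t) :
    Data α ε ρ' τ' h' :=
  ⟨H.rho.congr e₁, H.tau.congr e₂, H.den.congr e₃, fun t ht => by
    rw [e₂ t ht]
    exact (H.deriv t ht).congr_of_eventuallyEq (Filter.eventually_of_mem (Ioi_mem_nhds ht) e₁)⟩

theorem MemX.data_sub {r₁ γ₁ r₂ γ₂ : ℝ → ℝ} (H₁ : MemX μ α r₁ γ₁) (H₂ : MemX μ α r₂ γ₂)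
    (hα0 : 0 < α) (hα1 : α < 1) (hμ : 0 < μ) (hD : 0 ≤ D)
    (h : normX μ α (r₁ - r₂) (γ₁ - γ₂) ≤ ENNReal.ofReal D) :
    Data α (8 * (1 + μ) * D) (fun t => rhoOf μ r₁ t - rhoOf μ r₂ t)
      (fun t => tauOf μ r₁ t - tauOf μ r₂ t) (fun t => denOf μ γ₁ t - denOf μ γ₂ t) := by
  have hd : ∀ {f g : ℝ → ℝ}, DifferentiableOn ℝ f (Ioi 0) → DifferentiableOn ℝ g (Ioi 0) →
      ∀ t, 0 < t → deriv (f - g) t = deriv f t - deriv g t := fun hf hg t ht =>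
    deriv_sub (hf.differentiableAt (Ioi_mem_nhds ht)) (hg.differentiableAt (Ioi_mem_nhds ht))
  have dr := hd H₁.diff_r H₂.diff_r
  have dγ := hd H₁.diff_γ H₂.diff_γ
  refine (data_of_normX_le hα0 hα1 hμ hD (H₁.diff_r.sub H₂.diff_r)
    ((H₁.mem_deriv_r.1.sub H₂.mem_deriv_r.1).congr fun t ht => ?_)
    ((H₁.mem_deriv_γ.1.sub H₂.mem_deriv_γ.1).congr fun t ht => ?_) h).congr
    (fun t ht => ?_) (fun t ht => ?_) (fun t ht => ?_)
  · simp only [dr t ht, Pi.sub_apply]; ring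
  · simp only [dγ t ht, Pi.sub_apply]; ring
  · simp only [rhoOf, Pi.sub_apply]; push_cast; ring
  · simp only [tauOf, dr t ht, Pi.sub_apply]; push_cast; ring
  · simp only [denOf, dγ t ht]; push_cast; ring

theorem normG_le {A A' : ℝ} (hA : 0 ≤ A) (hA' : 0 ≤ A')
    (h1 : ∀ t, 0 < t → |bracket t ^ α * f t| ≤ A)
    (h2 : ∀ t' t, 0 < t' → t' < t → t < t' + 1 →
      bracket t ^ (k + α) * (|f t - f t'| / (t - t') ^ α) ≤ A') :
    normG α k f ≤ ENNReal.ofReal (A + A') := by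
  rw [ENNReal.ofReal_add hA hA']
  refine add_le_add (iSup₂_le fun t ht => ENNReal.ofReal_le_ofReal (h1 t ht))
    (iSup₂_le fun p hp => ENNReal.ofReal_le_ofReal ?_)
  rw [abs_of_pos (sub_pos.2 hp.2.1)]
  exact h2 p.2 p.1 hp.1 hp.2.1 hp.2.2

theorem bracket_rpow_mul_le {a t t' : ℝ} (ha : 0 ≤ a) (ha2 : a ≤ 2) (ht' : 0 < t') (hlt : t' < t)
    (h1 : t < t' + 1) : bracket t ^ a ≤ 4 * (1 + t') ^ a := by
  have h := Real.rpow_le_rpow (bracket_pos t).le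
    ((bracket_le (ht'.trans hlt)).trans (by linarith : 1 + t ≤ 2 * (1 + t'))) ha
  rw [Real.mul_rpow zero_le_two (by linarith)] at h
  exact h.trans (mul_le_mul_of_nonneg_right (two_rpow_le ha2) (weight_pos ht').le)

theorem weight_mul_neg {a t : ℝ} (ht : 0 < t) : (1 + t) ^ a * (1 + t) ^ (-a) = 1 := by
  rw [← Real.rpow_add (by linarith)]; simp

variable {J F : ℝ → ℂ}

theorem EB.continuousOn (h : EB α B J) (hα0 : 0 < α) : ContinuousOn J (Ioi 0) := by
  have hB := h.nonneg
  have key : ∀ s t, 0 < s → 0 < t → |t - s| < 1 → ‖J t - J s‖ ≤ B * |t - s| ^ α := by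
    have aux : ∀ s t, 0 < s → s < t → t < s + 1 → ‖J t - J s‖ ≤ B * |t - s| ^ α :=
      fun s t hs hst h1 => by
        rw [abs_of_pos (sub_pos.2 hst)]
        refine (h.hol s t hs hst h1).trans (mul_le_mul_of_nonneg_right ?_
          (Real.rpow_nonneg (by linarith) _))
        exact mul_le_of_le_one_right hB
          (Real.rpow_le_one_of_one_le_of_nonpos (by linarith) (by linarith))
    intro s t hs ht hst
    rcases lt_trichotomy s t with h1 | h1 | h1
    · exact aux s t hs h1 (by linarith [le_abs_self (t - s)])
    · rw [h1]; simp [hα0.ne']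
    · rw [norm_sub_rev, abs_sub_comm]
      exact aux t s ht h1 (by linarith [neg_le_abs (t - s)])
  intro s hs
  refine (tendsto_iff_norm_sub_tendsto_zero.2 ?_)
  have hc : Continuous fun t : ℝ => B * |t - s| ^ α :=
    (Continuous.rpow_const (by fun_prop) fun _ => Or.inr hα0.le).const_mul B
  have ht : Tendsto (fun t : ℝ => B * |t - s| ^ α) (𝓝[Ioi 0] s) (𝓝 0) := by
    have := (hc.tendsto s).mono_left (nhdsWithin_le_nhds (s := Ioi 0))
    simpa [Real.zero_rpow hα0.ne'] using this
  refine squeeze_zero' (Eventually.of_forall fun _ => norm_nonneg _) ?_ ht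
  filter_upwards [self_mem_nhdsWithin, nhdsWithin_le_nhds (Metric.ball_mem_nhds s one_pos)]
    with t ht h1
  exact key s t hs ht (by simpa [Real.dist_eq] using h1)

theorem EB.normG_im (h : EB α B J) (hα0 : 0 < α) (hα1 : α < 1)
    (hf : ∀ t, 0 < t → f t = (J t).im) : normG α 1 f ≤ ENNReal.ofReal (5 * B) := by
  have hB := h.nonneg
  rw [show 5 * B = B + 4 * B by ring]
  refine normG_le hB (by positivity) (fun t ht => ?_) (fun t' t ht' hlt h1 => ?_)
  · rw [hf t ht, abs_mul, abs_of_pos (Real.rpow_pos_of_pos (bracket_pos t) _)]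
    have b1 := (Complex.abs_im_le_norm _).trans (h.bd t ht)
    have b2 : bracket t ^ α ≤ (1 + t) ^ α :=
      Real.rpow_le_rpow (bracket_pos t).le (bracket_le ht) hα0.le
    have b3 : (1 + t) ^ α ≤ (1 + t) ^ (1 + α) :=
      Real.rpow_le_rpow_of_exponent_le (by linarith) (by linarith)
    refine (mul_le_mul (b2.trans b3) b1 (abs_nonneg _) (weight_pos ht).le).trans (le_of_eq ?_)
    linear_combination B * weight_mul_neg (a := 1 + α) ht
  · have hd : 0 < (t - t') ^ α := Real.rpow_pos_of_pos (by linarith) _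
    rw [hf t (ht'.trans hlt), hf t' ht', ← Complex.sub_im]
    have b1 := (div_le_iff₀ hd).2 ((Complex.abs_im_le_norm _).trans (h.hol t' t ht' hlt h1))
    refine (mul_le_mul (bracket_rpow_mul_le (by linarith) (by linarith) ht' hlt h1) b1
      (by positivity) (mul_nonneg (by norm_num) (weight_pos ht').le)).trans (le_of_eq ?_)
    linear_combination 4 * B * weight_mul_neg (a := 1 + α) ht'

/-- The factor `t` uses up one power of the weight `1+α`, which leaves precisely the weights of
`𝒢^0`. -/
theorem EB.normG_re (h : EB α B J) (hα0 : 0 < α) (hα1 : α < 1)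
    (hf : ∀ t, 0 < t → f t = t * (J t).re) : normG α 0 f ≤ ENNReal.ofReal (13 * B) := by
  have hB := h.nonneg
  rw [show 13 * B = B + 12 * B by ring]
  refine normG_le hB (by positivity) (fun t ht => ?_) (fun t' t ht' hlt h1 => ?_)
  · rw [hf t ht, abs_mul, abs_mul, abs_of_pos (Real.rpow_pos_of_pos (bracket_pos t) _),
      abs_of_pos ht, ← mul_assoc]
    have b1 := (Complex.abs_re_le_norm _).trans (h.bd t ht)
    have b2 : bracket t ^ α ≤ (1 + t) ^ α :=
      Real.rpow_le_rpow (bracket_pos t).le (bracket_le ht) hα0.le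
    have b3 : bracket t ^ α * t ≤ (1 + t) ^ (1 + α) := by
      rw [add_comm 1 α, Real.rpow_add_one (by linarith)]
      exact mul_le_mul b2 (by linarith) ht.le (weight_pos ht).le
    refine (mul_le_mul b3 b1 (abs_nonneg _) (weight_pos ht).le).trans (le_of_eq ?_)
    linear_combination B * weight_mul_neg (a := 1 + α) ht
  · have hδ : 0 < t - t' := by linarith
    have hd : 0 < (t - t') ^ α := Real.rpow_pos_of_pos hδ _
    have ht := ht'.trans hlt
    rw [hf t ht, hf t' ht']
    have e1 : t * (J t).re - t' * (J t').re = t * (J t - J t').re + (t - t') * (J t').re := by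
      rw [Complex.sub_re]; ring
    have hw : 0 < (1 + t') ^ (-(1 + α)) := weight_pos ht'
    have hdα : t - t' ≤ (t - t') ^ α := by
      have := Real.rpow_le_rpow_of_exponent_ge hδ (by linarith) hα1.le
      simpa using this
    have b1 := (Complex.abs_re_le_norm _).trans (h.hol t' t ht' hlt h1)
    have b2 := (Complex.abs_re_le_norm _).trans (h.bd t' ht')
    have b3 : |t * (J t).re - t' * (J t').re| / (t - t') ^ α ≤
        3 * B * ((1 + t') * (1 + t') ^ (-(1 + α))) := by
      rw [div_le_iff₀ hd, e1]
      refine (abs_add_le _ _).trans ?_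
      rw [abs_mul, abs_mul, abs_of_pos ht, abs_of_pos hδ]
      have c1 : t * |(J t - J t').re| ≤ 2 * (1 + t') * (B * (1 + t') ^ (-(1 + α)) * (t - t') ^ α) :=
        mul_le_mul (by linarith) b1 (abs_nonneg _) (by linarith)
      have c2 : (t - t') * |(J t').re| ≤ (t - t') ^ α * (B * (1 + t') ^ (-(1 + α))) :=
        mul_le_mul hdα b2 (abs_nonneg _) hd.le
      have c3 : 0 ≤ t' * ((t - t') ^ α * (B * (1 + t') ^ (-(1 + α)))) := by positivity
      nlinarith
    rw [zero_add]
    refine (mul_le_mul (bracket_rpow_mul_le hα0.le (by linarith) ht' hlt h1) b3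
      (by positivity) (mul_nonneg (by norm_num) (weight_pos ht').le)).trans (le_of_eq ?_)
    have e2 := weight_mul_neg (a := 1 + α) ht'
    rw [add_comm 1 α, Real.rpow_add_one (by linarith)] at e2
    rw [add_comm 1 α]
    linear_combination 12 * B * e2

theorem re_rescale {t : ℝ} (ht : 0 < t) (hF : F t = ((t ^ (1 - 2 * μ) : ℝ) : ℂ) * J t) :
    t ^ (2 * μ) * (F t).re = t * (J t).re := by
  rw [hF, Complex.re_ofReal_mul, ← mul_assoc, ← Real.rpow_add ht]
  simp

theorem im_rescale {t : ℝ} (ht : 0 < t) (hF : F t = ((t ^ (1 - 2 * μ) : ℝ) : ℂ) * J t) :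
    t ^ (2 * μ - 1) * (F t).im = (J t).im := by
  rw [hF, Complex.im_ofReal_mul, ← mul_assoc, ← Real.rpow_add ht]
  simp

theorem EB.normY_le (h : EB α B J) (hα0 : 0 < α) (hα1 : α < 1)
    (hF : ∀ t, 0 < t → F t = ((t ^ (1 - 2 * μ) : ℝ) : ℂ) * J t) :
    normY μ α F ≤ ENNReal.ofReal (18 * B) := by
  have hB := h.nonneg
  rw [show 18 * B = 13 * B + 5 * B by ring, ENNReal.ofReal_add (by positivity) (by positivity)]
  exact add_le_add (h.normG_re hα0 hα1 fun t ht => re_rescale ht (hF t ht))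
    (h.normG_im hα0 hα1 fun t ht => im_rescale ht (hF t ht))

/-- The vanishing at the origin of the real part is automatic: `t^{2μ} Re F = t Re J` with `J`
bounded. -/
theorem EB.memY (h : EB α B J) (hα0 : 0 < α) (hα1 : α < 1)
    (hF : ∀ t, 0 < t → F t = ((t ^ (1 - 2 * μ) : ℝ) : ℂ) * J t) : MemY μ α F := by
  have hc := h.continuousOn hα0
  have hre : ∀ t, 0 < t → t ^ (2 * μ) * (F t).re = t * (J t).re :=
    fun t ht => re_rescale ht (hF t ht)
  have him : ∀ t, 0 < t → t ^ (2 * μ - 1) * (F t).im = (J t).im :=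
    fun t ht => im_rescale ht (hF t ht)
  refine ⟨⟨⟨?_, (h.normG_re hα0 hα1 hre).trans_lt ENNReal.ofReal_lt_top⟩, ?_⟩, ?_,
    (h.normG_im hα0 hα1 him).trans_lt ENNReal.ofReal_lt_top⟩
  · exact (continuousOn_id.mul (Complex.continuous_re.comp_continuousOn hc)).congr hre
  · have ht : Tendsto (fun t : ℝ => t * B) (𝓝[>] 0) (𝓝 0) := by
      have : Continuous fun t : ℝ => t * B := by fun_prop
      simpa using (this.tendsto 0).mono_left (nhdsWithin_le_nhds (s := Ioi 0))
    refine squeeze_zero_norm' ?_ ht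
    filter_upwards [self_mem_nhdsWithin] with t ht
    have ht0 : 0 < t := ht
    rw [hre t ht, norm_mul, Real.norm_of_nonneg ht0.le]
    refine mul_le_mul_of_nonneg_left ?_ ht0.le
    refine ((Complex.abs_re_le_norm _).trans (h.bd t ht)).trans ?_
    exact mul_le_of_le_one_right h.nonneg
      (Real.rpow_le_one_of_one_le_of_nonpos (by linarith) (by linarith))
  · exact (Complex.continuous_im.comp_continuousOn hc).congr him

theorem norm_cauchy_const_le : ‖1 / (2 * (Real.pi : ℂ) * Complex.I)‖ ≤ 1 := by
  have := Real.pi_gt_three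
  rw [norm_div, norm_mul, norm_mul, Complex.norm_I, Complex.norm_real,
    Real.norm_of_nonneg Real.pi_pos.le, norm_one, Complex.norm_ofNat, mul_one,
    div_le_one (by positivity)]
  linarith

theorem data_zero {ε : ℝ} (hε : 0 ≤ ε) : Data α ε 0 0 0 := by
  have h : ∀ s e : ℝ, Cls α s e ε (0 : ℝ → ℂ) := fun s e =>
    { cont := continuousOn_const
      bd := fun t ht => by simpa using mul_nonneg hε (weight_pos ht).le
      hol := fun t' t ht' hlt => by
        simpa using mul_nonneg (mul_nonneg hε (weight_pos ht').le) (modulus_nonneg hlt) }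
  exact ⟨h _ _, h _ _, h _ _, fun t _ => by simp⟩

theorem rhoOf_zero : rhoOf μ 0 = 0 := by funext t; simp [rhoOf]

theorem tauOf_zero : tauOf μ 0 = 0 := by funext t; simp [tauOf]

theorem denOf_zero : denOf μ 0 = 0 := by funext t; simp [denOf]

end KadenSpiral
end

/-! ### Assembly of the final statement. -/

theorem proposition2p3 (μ α : ℝ) (hμ : 1 / 2 < μ) (hα0 : 0 < α) (hα1 : α < 1) :
    ∃ ε₁ : ℝ, 0 < ε₁ ∧ ε₁ < 1 ∧ ∃ m₁ : ℕ, 0 < m₁ ∧ ∃ C : ℝ, 1 < C ∧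
      ∀ m : ℕ, m₁ < m →
        (∀ r γ : ℝ → ℝ, KadenSpiral.MemBallX μ α ε₁ r γ →
          (∀ θ : ℝ, 0 < θ → KadenSpiral.IDefinedAt μ m r γ θ) ∧
          KadenSpiral.MemY μ α (KadenSpiral.I μ m r γ)) ∧
        KadenSpiral.normY μ α (KadenSpiral.I μ m 0 0) ≤ ENNReal.ofReal (C / (m : ℝ) ^ 2) ∧
        ∀ r₁ γ₁ r₂ γ₂ : ℝ → ℝ,
          KadenSpiral.MemBallX μ α ε₁ r₁ γ₁ → KadenSpiral.MemBallX μ α ε₁ r₂ γ₂ →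
          KadenSpiral.normY μ α (KadenSpiral.I μ m r₁ γ₁ - KadenSpiral.I μ m r₂ γ₂) ≤
            ENNReal.ofReal (C / (m : ℝ)) *
              KadenSpiral.normX μ α (r₁ - r₂) (γ₁ - γ₂) := by
  have hμ0 : 0 < μ := by linarith
  obtain ⟨CL, hCL, hL⟩ := KadenSpiral.exists_opT_lipschitz hα0 hα1 hμ
  obtain ⟨C0, hC0, hZ⟩ := KadenSpiral.exists_opT_zero_bound hα0 hα1.le hμ
  have hl := KadenSpiral.lipTol_pos hμ0
  have hl' : KadenSpiral.lipTol μ < 1 := by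
    have := KadenSpiral.lipTol_le hμ0
    have := KadenSpiral.datTol_le (μ := μ)
    linarith
  -- The passage from the `X`-norm to admissible data costs the factor `8(1+μ)`.
  set ε₁ := KadenSpiral.lipTol μ / (8 * (1 + μ)) with hε₁
  have hε₁0 : 0 < ε₁ := by positivity
  have hε₁e : 8 * (1 + μ) * ε₁ = KadenSpiral.lipTol μ := by rw [hε₁]; field_simp
  -- The threshold for `m` is the solution of `4μ + 40 ≤ (μ/4) m`. In the constant, `18` comes from
  -- the `Y`-norm, `8(1+μ)` from the data, and `2` makes it exceed one.
  refine ⟨ε₁, hε₁0, (div_lt_one (by positivity)).2 (by linarith), ⌈(4 * μ + 40) * 4 / μ⌉₊ + 1,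
    Nat.succ_pos _, 18 * (CL * (8 * (1 + μ))) + 18 * C0 + 2, by
    have : 0 ≤ CL * (8 * (1 + μ)) := by positivity
    linarith, fun m hm₁ => ?_⟩
  have hm : KadenSpiral.Large μ m := by
    have h1 : (4 * μ + 40) * 4 / μ ≤ m := (Nat.le_ceil _).trans (Nat.cast_le.2 (by omega))
    rw [div_le_iff₀ hμ0] at h1
    unfold KadenSpiral.Large KadenSpiral.rate
    linarith
  have hm0 : (0 : ℝ) < m := hm.pos hμ0
  set c : ℂ := 1 / (2 * (Real.pi : ℂ) * Complex.I) with hc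
  have hcn : ‖c‖ ≤ 1 := KadenSpiral.norm_cauchy_const_le
  have hball : ∀ r γ, KadenSpiral.MemBallX μ α ε₁ r γ → KadenSpiral.Data α (KadenSpiral.lipTol μ)
      (KadenSpiral.rhoOf μ r) (KadenSpiral.tauOf μ r) (KadenSpiral.denOf μ γ) := fun r γ h =>
    hε₁e ▸ h.1.data hα0 hα1 hμ0 hε₁0.le h.2.le
  have h0 : KadenSpiral.Data α (KadenSpiral.lipTol μ)
      (KadenSpiral.rhoOf μ 0) (KadenSpiral.tauOf μ 0) (KadenSpiral.denOf μ 0) := by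
    rw [KadenSpiral.rhoOf_zero, KadenSpiral.tauOf_zero, KadenSpiral.denOf_zero]
    exact KadenSpiral.data_zero hl.le
  have hI : ∀ r γ, KadenSpiral.Data α (KadenSpiral.lipTol μ)
      (KadenSpiral.rhoOf μ r) (KadenSpiral.tauOf μ r) (KadenSpiral.denOf μ γ) → ∀ θ : ℝ, 0 < θ →
      KadenSpiral.IDefinedAt μ m r γ θ ∧ KadenSpiral.I μ m r γ θ =
        ((θ ^ (1 - 2 * μ) : ℝ) : ℂ) * (c * KadenSpiral.opT μ m (KadenSpiral.rhoOf μ r)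
          (KadenSpiral.tauOf μ r) (KadenSpiral.denOf μ γ) θ) := fun r γ H θ hθ => by
    obtain ⟨h1, h2⟩ := KadenSpiral.iDefinedAt_and_eq H hα0 hα1.le hμ
      (KadenSpiral.lipTol_le hμ0) hm hθ
    refine ⟨h1, h2.trans ?_⟩
    rw [← hc, mul_left_comm]
    rfl
  have hZ' := hZ m hm
  refine ⟨fun r γ h => ⟨fun θ hθ => (hI r γ (hball r γ h) θ hθ).1, ?_⟩, ?_, ?_⟩
  · have H := hball r γ h
    -- Membership in `Y` follows by writing the operator as its difference from the unperturbed one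
    -- plus the unperturbed one, both already bounded.
    have b1 := hL m hm _ _ _ _ _ _ _ H (KadenSpiral.data_zero hl.le)
      (H.sub (KadenSpiral.data_zero le_rfl))
    have b2 := ((b1.add hZ').const_mul c)
    refine b2.memY hα0 hα1 fun θ hθ => ?_
    rw [(hI r γ H θ hθ).2, sub_add_cancel]
  · have b1 := (hZ'.const_mul c).mono (mul_le_of_le_one_left (by positivity) hcn)
    refine (b1.normY_le (μ := μ) hα0 hα1 fun θ hθ => ?_).trans (ENNReal.ofReal_le_ofReal ?_)
    · rw [(hI 0 0 h0 θ hθ).2, KadenSpiral.rhoOf_zero, KadenSpiral.tauOf_zero,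
        KadenSpiral.denOf_zero]
    · rw [← mul_div_assoc]
      have : 0 ≤ CL * (8 * (1 + μ)) := by positivity
      gcongr
      linarith
  · intro r₁ γ₁ r₂ γ₂ h₁ h₂
    have hCm : 0 < (18 * (CL * (8 * (1 + μ))) + 18 * C0 + 2) / (m : ℝ) := by positivity
    -- Norms are extended-valued; an infinite distance makes the right-hand side infinite, because
    -- its coefficient is positive.
    by_cases htop : KadenSpiral.normX μ α (r₁ - r₂) (γ₁ - γ₂) = ⊤
    · rw [htop, ENNReal.mul_top (ENNReal.ofReal_pos.2 hCm).ne']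
      exact le_top
    set D := (KadenSpiral.normX μ α (r₁ - r₂) (γ₁ - γ₂)).toReal with hD
    have hD0 : 0 ≤ D := ENNReal.toReal_nonneg
    have hDe : KadenSpiral.normX μ α (r₁ - r₂) (γ₁ - γ₂) = ENNReal.ofReal D :=
      (ENNReal.ofReal_toReal htop).symm
    have H₁ := hball r₁ γ₁ h₁
    have H₂ := hball r₂ γ₂ h₂
    have H := h₁.1.data_sub h₂.1 hα0 hα1 hμ0 hD0 hDe.le
    have b1 := ((hL m hm _ _ _ _ _ _ _ H₁ H₂ H).const_mul c).mono
      (mul_le_of_le_one_left (by positivity) hcn)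
    refine (b1.normY_le (μ := μ) hα0 hα1 fun θ hθ => ?_).trans ?_
    · rw [Pi.sub_apply, (hI r₁ γ₁ H₁ θ hθ).2, (hI r₂ γ₂ H₂ θ hθ).2]
      ring
    · rw [hDe, ← ENNReal.ofReal_mul hCm.le]
      refine ENNReal.ofReal_le_ofReal ?_
      rw [← mul_div_assoc, div_mul_eq_mul_div]
      refine div_le_div_of_nonneg_right ?_ hm0.le
      nlinarith [mul_nonneg hC0 hD0]
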